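/- All graphs are finite and simple. A \emph{canvas} is a plane graph whose outer face is bounded by a cycle of length at least four and all of whose other faces have length three. A vertex is \emph{external} if it is incident with the outer face and \emph{internal} otherwise. For an integer $\ell$, an \emph{$\ell$-candidate} is a canvas with outer face of length $\ell$ such that every triangle bounds a face and every internal vertex has degree at least five. A \emph{$\star$-contraction} of a canvas is any of the following operations (after contracting an edge, the resulting $2$-faces are always suppressed; the result is required to be a simple graph): \begin{itemize} \item \emph{$1$-contraction}: contract an edge $v_1v_2$, where $v_2$ is internal. \item \emph{$2$-contraction}: contract the edges $v_1v_2$ and $v_3v_4$, where $v_1v_2v_3v_4$ is a $4$-cycle whose interior consists of two $3$-faces and $v_1,\dots,v_4$ are internal vertices of degree five. \item \emph{$5$-contraction}: contract the five edges incident with an internal vertex $v$ of degree five, all of whose neighbors $v_1,\dots,v_5$ are internal vertices of degree five. \item \emph{Extended $5$-contraction}: in the same situation, let $v_1,v_2$ be consecutive neighbors of $v$ and let $x\ne v$ be a common neighbor of $v_1$ and $v_2$; perform the $5$-contraction and then the $1$-contraction of the edge between the resulting vertex and $x$. \item \emph{$8$-contraction}: an \emph{$8$-diamond} is the subgraph drawn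 in the closed disk bounded by a $4$-cycle $x_1x_2x_3z$ when it has exactly the eight interior vertices $v,v_1,\dots,v_5,x_4,x_5$ and its faces inside the disk are the triangles $vv_iv_{i+1}$, $v_iv_{i+1}x_i$, $v_{i+1}x_ix_{i+1}$ for $i=1,\dots,5$ (indices modulo $5$), and $zx_3x_4$, $zx_4x_5$, $zx_5x_1$ (so all eight interior vertices are internal and have degree five). Delete these eight vertices and add either the edge $x_1x_3$ or the edge $x_2z$ inside the disk. \item \emph{$10$-contraction}: a \emph{$10$-diamond} is the subgraph drawn in the closed disk bounded by a $5$-cycle $zy_1y_2y_3x_3$ when it consists of an $8$-diamond inside the $4$-cycle $zx_1x_2x_3$ as above together with the edges of the path $y_1x_1y_2x_2y_3x_3$ (so $x_1$, $x_2$ are internal of degrees $7$ and $6$). Delete the ten vertices in the interior of the disk and replace them by a $5$-wheel of six internal vertices of degree five; that is, a new vertex $w$ adjacent to a new $5$-cycle $b_1\dots b_5$, where $b_i$ is adjacent to the $i$-th and $(i+1)$-st vertex of the bounding $5$-cycle. \end{itemize} \textbf{Claim.} For every $\ell$-candidate $G$ there exist an $\ell$-candidate $G'$ with no internal vertices and a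 finite sequence $G'=G_0,G_1,\dots,G_m=G$ ($m\ge 0$) of $\ell$-candidates such that for every $i\in\{1,\dots,m\}$, the canvas $G_{i-1}$ is obtained from $G_i$ by a $\star$-contraction. (That is, $G$ is obtained from $G'$ by a sequence of inverses of $\star$-contractions in which all intermediate canvases are $\ell$-candidates.) -/

import Mathlib

universe u

/-! # Plane graphs, canvases, candidates and the star-contractions

Connected finite plane graphs are given combinatorially: a simple graph with a rotation system (the
cyclic order of the edges around each vertex) satisfying Euler's formula, and a choice of the outer
face. -/

/-- A rotation system on a simple graph: `rot` sends each dart (directed edge) to the dart that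
follows it in the clockwise order around its origin. -/
structure RotationSystem {V : Type*} (G : SimpleGraph V) where
  rot : Equiv.Perm G.Dart
  rot_fst : ∀ d, (rot d).fst = d.fst
  rot_cyclic : ∀ d e : G.Dart, d.fst = e.fst → rot.SameCycle d e

namespace RotationSystem

variable {V : Type*} {G : SimpleGraph V} (R : RotationSystem G)

/-- Face tracing: the dart that follows `d` on the boundary of the face to the left of `d`. -/
def next : Equiv.Perm G.Dart :=
  (Function.Involutive.toPerm SimpleGraph.Dart.symm SimpleGraph.Dart.symm_involutive).trans R.rot

/-- The faces are the orbits of face tracing. -/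
def Face : Type _ := Quotient (Equiv.Perm.SameCycle.setoid R.next)

/-- The face to the left of a dart. -/
def leftFace (d : G.Dart) : R.Face := Quotient.mk (Equiv.Perm.SameCycle.setoid R.next) d

/-- The length of a face. -/
noncomputable def faceLength (F : R.Face) : ℕ := {d : G.Dart | R.leftFace d = F}.ncard

end RotationSystem

/-- A finite connected plane graph (with at least one edge): a rotation system of genus zero,
together with the choice of the outer face. -/
structure PlaneGraph where
  V : Type u
  finite : Finite V
  graph : SimpleGraph V
  connected : graph.Connected
  sys : RotationSystem graph
  euler : Nat.card V + Nat.card sys.Face = graph.edgeSet.ncard + 2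
  outer : sys.Face

namespace PlaneGraph

variable (G : PlaneGraph.{u})

/-- `(a, b)` is a directed edge with the outer face on its left. -/
def IsOuter (a b : G.V) : Prop :=
  ∃ d : G.graph.Dart, G.sys.leftFace d = G.outer ∧ d.fst = a ∧ d.snd = b

/-- The non-outer face to the left of the directed edge `(a, b)` is traversed as `a, b, c, ...`.
When all the non-outer faces have length three, this says that `abc` bounds a non-outer face and
`a, b, c` is its cyclic order. -/
def IsFace (a b c : G.V) : Prop :=
  ∃ d : G.graph.Dart, G.sys.leftFace d ≠ G.outer ∧
    d.fst = a ∧ d.snd = b ∧ (G.sys.next d).snd = c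

/-- The vertex sets `{a, b, c}` of the triangles that bound non-outer faces. -/
def facial : Set (Set G.V) := {T | ∃ a b c, G.IsFace a b c ∧ T = {a, b, c}}

/-- A vertex is external if it is incident with the outer face. -/
def External (v : G.V) : Prop := ∃ w, G.IsOuter v w

/-- A vertex is internal if it is not incident with the outer face. -/
def Internal (v : G.V) : Prop := ¬ G.External v

noncomputable def deg (v : G.V) : ℕ := (G.graph.neighborSet v).ncard

end PlaneGraph

/-- A canvas: the outer face is bounded by a cycle of length at least four, and all other faces
have length three. -/
structure Canvas extends PlaneGraph.{u} where
  outer_length : 4 ≤ sys.faceLength outer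
  outer_cycle : Set.InjOn (fun d : graph.Dart => d.fst) {d | sys.leftFace d = outer}
  face_length : ∀ F, F ≠ outer → sys.faceLength F = 3

namespace Canvas

/-- An `ℓ`-candidate: a canvas with outer face of length `ℓ` in which every triangle bounds a face
and all internal vertices have degree at least five. -/
structure IsCandidate (G : Canvas.{u}) (ℓ : ℕ) : Prop where
  outer_length_eq : G.sys.faceLength G.outer = ℓ
  triangle_facial : ∀ a b c : G.V, G.graph.Adj a b → G.graph.Adj b c → G.graph.Adj c a →
    {a, b, c} ∈ G.facial
  five_le_deg : ∀ v, G.Internal v → 5 ≤ G.deg v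

/-- `v` is an internal vertex of degree five. -/
def InternalFive (G : Canvas.{u}) (v : G.V) : Prop := G.Internal v ∧ G.deg v = 5

/-- `H` is obtained from `G` by contracting the edges in `E` and suppressing the resulting
2-faces; `f` maps each vertex to the vertex it becomes.  The triangular faces two of whose vertices
are merged collapse and disappear; all other faces survive, no two of them being identified. -/
structure IsContraction (G H : Canvas.{u}) (E : Set (Sym2 G.V)) (f : G.V → H.V) : Prop where
  edges : E ⊆ G.graph.edgeSet
  surjective : Function.Surjective f
  fibers : ∀ a b, f a = f b ↔ (SimpleGraph.fromEdgeSet E).Reachable a b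
  adj : ∀ p q, H.graph.Adj p q ↔ p ≠ q ∧ ∃ a b, G.graph.Adj a b ∧ f a = p ∧ f b = q
  face : ∀ p q r, H.IsFace p q r ↔
    (p ≠ q ∧ q ≠ r ∧ r ≠ p) ∧ ∃ a b c, G.IsFace a b c ∧ f a = p ∧ f b = q ∧ f c = r
  face_inj : ∀ a b c a' b' c', G.IsFace a b c → G.IsFace a' b' c' →
    f a ≠ f b → f b ≠ f c → f c ≠ f a →
    f a = f a' → f b = f b' → f c = f c' → a = a' ∧ b = b' ∧ c = c'
  outer : ∀ p q, H.IsOuter p q ↔ ∃ a b, G.IsOuter a b ∧ f a = p ∧ f b = q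

/-- `H` is obtained from `G` by deleting the set `D` of internal vertices and filling the hole by
the set `W` of new vertices so that `N` is the set of the new facial triangles; `g` maps each vertex
outside of `D` to its copy in `H` (its values on `D` are irrelevant). In a canvas every edge lies on
a facial triangle, hence `H` is determined by its facial triangles. -/
structure IsReplacement (G H : Canvas.{u}) (D : Set G.V) (W : Set H.V) (N : Set (Set H.V))
    (g : G.V → H.V) : Prop where
  injOn : Set.InjOn g Dᶜ
  image : g '' Dᶜ = Wᶜ
  orient : ∀ a b c, a ∉ D → b ∉ D → c ∉ D → G.IsFace a b c → H.IsFace (g a) (g b) (g c)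
  facial : H.facial = (fun T => g '' T) '' {T | T ∈ G.facial ∧ Disjoint T D} ∪ N
  outer : ∀ p q, H.IsOuter p q ↔ ∃ a b, G.IsOuter a b ∧ g a = p ∧ g b = q

/-- The 1-contraction of the edge `v₁v₂`, where `v₂` is internal. -/
def IsOneContraction (G H : Canvas.{u}) (v₁ v₂ : G.V) : Prop :=
  G.graph.Adj v₁ v₂ ∧ G.Internal v₂ ∧ ∃ f, IsContraction G H {s(v₁, v₂)} f

/-- The 2-contraction of the edges `v₁v₂` and `v₃v₄`, where `v₁v₂v₃v₄` is a 4-cycle of internal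
vertices of degree five whose interior consists of two triangular faces. -/
def IsTwoContraction (G H : Canvas.{u}) (v₁ v₂ v₃ v₄ : G.V) : Prop :=
  [v₁, v₂, v₃, v₄].Nodup ∧
  (({v₁, v₂, v₃} ∈ G.facial ∧ {v₁, v₃, v₄} ∈ G.facial) ∨
    ({v₁, v₂, v₄} ∈ G.facial ∧ {v₂, v₃, v₄} ∈ G.facial)) ∧
  (G.InternalFive v₁ ∧ G.InternalFive v₂ ∧ G.InternalFive v₃ ∧ G.InternalFive v₄) ∧
  ∃ f, IsContraction G H {s(v₁, v₂), s(v₃, v₄)} f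

/-- The 5-contraction of the five edges incident with `v`, where `v` and all its neighbors are
internal vertices of degree five; `f` is the contraction map. -/
def IsFiveContraction (G H : Canvas.{u}) (v : G.V) (f : G.V → H.V) : Prop :=
  G.InternalFive v ∧ (∀ w, G.graph.Adj v w → G.InternalFive w) ∧
  IsContraction G H (G.graph.incidenceSet v) f

/-- The extended 5-contraction: the 5-contraction of the edges incident with `v`, followed by the
1-contraction of the edge between the resulting vertex and `x`, where `x ≠ v` is a common neighbor
of two consecutive neighbors `v₁`, `v₂` of `v`. -/
def IsExtendedFiveContraction (G H : Canvas.{u}) (v v₁ v₂ x : G.V) : Prop :=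
  G.graph.Adj v v₁ ∧ G.graph.Adj v v₂ ∧ G.graph.Adj v₁ v₂ ∧
  x ≠ v ∧ G.graph.Adj x v₁ ∧ G.graph.Adj x v₂ ∧
  ∃ (G₁ : Canvas.{u}) (f : G.V → G₁.V),
    IsFiveContraction G G₁ v f ∧ IsOneContraction G₁ H (f x) (f v)

/-- The 8-diamond with outer 4-cycle `x₀x₁x₂z`: the vertex `v` has the neighbors `a₀, ..., a₄` in
cyclic order, `xᵢ` is the second common neighbor of `aᵢ` and `aᵢ₊₁`, the vertices `x₀, ..., x₄`
form a 5-cycle, and `z` is adjacent to `x₂, x₃, x₄, x₀`.  The listed triangles are all the faces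
inside the 4-cycle. -/
structure IsEightDiamond (G : Canvas.{u}) (v : G.V) (a x : Fin 5 → G.V) (z : G.V) : Prop where
  nodup : [v, a 0, a 1, a 2, a 3, a 4, x 0, x 1, x 2, x 3, x 4, z].Nodup
  hub : ∀ i, {v, a i, a (i + 1)} ∈ G.facial
  middle : ∀ i, {a i, a (i + 1), x i} ∈ G.facial
  rim : ∀ i, {a (i + 1), x i, x (i + 1)} ∈ G.facial
  top₁ : {z, x 2, x 3} ∈ G.facial
  top₂ : {z, x 3, x 4} ∈ G.facial
  top₃ : {z, x 4, x 0} ∈ G.facial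
  internalFive : ∀ u ∈ [v, a 0, a 1, a 2, a 3, a 4, x 3, x 4], G.InternalFive u

/-- The eight interior vertices of an 8-diamond. -/
def eightInterior {V : Type u} (v : V) (a x : Fin 5 → V) : Set V :=
  {v, a 0, a 1, a 2, a 3, a 4, x 3, x 4}

/-- The 8-contraction: the interior of an 8-diamond with outer 4-cycle `x₀x₁x₂z` is replaced by
one of the edges `x₀x₂` and `x₁z`. -/
def IsEightContraction (G H : Canvas.{u}) (v : G.V) (a x : Fin 5 → G.V) (z : G.V) : Prop :=
  IsEightDiamond G v a x z ∧
  ∃ g : G.V → H.V,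
    (¬ G.graph.Adj (x 0) (x 2) ∧
      IsReplacement G H (eightInterior v a x) ∅
        {{g (x 0), g (x 1), g (x 2)}, {g (x 0), g (x 2), g z}} g) ∨
    (¬ G.graph.Adj (x 1) z ∧
      IsReplacement G H (eightInterior v a x) ∅
        {{g (x 1), g z, g (x 0)}, {g (x 1), g z, g (x 2)}} g)

/-- The 10-diamond with outer 5-cycle `z y₀ y₁ y₂ x₂`: an 8-diamond inside the 4-cycle
`z x₀ x₁ x₂` together with the path `y₀ x₀ y₁ x₁ y₂ x₂`. -/
structure IsTenDiamond (G : Canvas.{u}) (v : G.V) (a x : Fin 5 → G.V) (z : G.V)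
    (y : Fin 3 → G.V) : Prop extends IsEightDiamond G v a x z where
  nodup_ten : [v, a 0, a 1, a 2, a 3, a 4, x 0, x 1, x 2, x 3, x 4, z, y 0, y 1, y 2].Nodup
  side₁ : {z, x 0, y 0} ∈ G.facial
  side₂ : {y 0, x 0, y 1} ∈ G.facial
  side₃ : {x 0, y 1, x 1} ∈ G.facial
  side₄ : {y 1, x 1, y 2} ∈ G.facial
  side₅ : {x 1, y 2, x 2} ∈ G.facial
  internal₀ : G.Internal (x 0)
  deg₀ : G.deg (x 0) = 7
  internal₁ : G.Internal (x 1)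
  deg₁ : G.deg (x 1) = 6

/-- The facial triangles inside the 5-cycle `k₀k₁k₂k₃k₄` filled by the 5-wheel with hub `w` and rim
`b₀b₁b₂b₃b₄`, all of whose vertices have degree five: `bᵢ` is adjacent to `kᵢ` and `kᵢ₊₁`. -/
def wheelTriangles {V : Type u} (w : V) (b k : Fin 5 → V) : Set (Set V) :=
  {T | ∃ i, T = {w, b i, b (i + 1)} ∨ T = {b i, b (i + 1), k (i + 1)} ∨
    T = {b i, k i, k (i + 1)}}

/-- The 10-contraction: the interior of a 10-diamond is replaced by a 5-wheel of six internal
vertices of degree five. -/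
def IsTenContraction (G H : Canvas.{u}) (v : G.V) (a x : Fin 5 → G.V) (z : G.V)
    (y : Fin 3 → G.V) : Prop :=
  IsTenDiamond G v a x z y ∧
  ∃ (g : G.V → H.V) (w : H.V) (b : Fin 5 → H.V),
    [w, b 0, b 1, b 2, b 3, b 4].Nodup ∧
    IsReplacement G H (eightInterior v a x ∪ {x 0, x 1}) {w, b 0, b 1, b 2, b 3, b 4}
      (wheelTriangles w b ![g z, g (y 0), g (y 1), g (y 2), g (x 2)]) g

/-- `H` is obtained from `G` by a `⋆`-contraction. -/
def IsStarContraction (G H : Canvas.{u}) : Prop :=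
  (∃ v₁ v₂, IsOneContraction G H v₁ v₂) ∨
  (∃ v₁ v₂ v₃ v₄, IsTwoContraction G H v₁ v₂ v₃ v₄) ∨
  (∃ v f, IsFiveContraction G H v f) ∨
  (∃ v v₁ v₂ x, IsExtendedFiveContraction G H v v₁ v₂ x) ∨
  (∃ v a x z, IsEightContraction G H v a x z) ∨
  (∃ v a x z y, IsTenContraction G H v a x z y)

end Canvas

/-! ## Faces and rotations of canvases -/

namespace Equiv.Perm

/-! The proof is by induction on the number of vertices. It suffices that a candidate with an
internal vertex has a ⋆-contraction to a smaller candidate (`IsCandidate.reducible`). Call a vertex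
small if it is internal of degree five, and big otherwise; suppose that no contraction works.

Contracting an edge `uv` with `v` internal fails for one of two reasons. Either `uv` lies on a
chordless 4-cycle, which would become a nonfacial triangle, or a common neighbor of `u` and `v` is
small and its degree would drop to four. The first reason is removed by localizing: if there is no
chordless 4-cycle, take all internal vertices; otherwise take the interior of a chordless 4-cycle
that encloses as few faces as possible. Every 4-cycle through a vertex of this region `I` has a
chord (`exists_region`). The sides of a 4-cycle come from mod 2 homology: by Euler's formula and
linear algebra, every even set of edges bounds a set of faces (`exists_side_of_even`).

Hence every edge with an end in `I` has a small common neighbor (`Region.exists_small_common`).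
Together with the 2-contraction this yields a full hub, that is, a small vertex of `I` all of whose
neighbors are small and in `I` (`Region.exists_fullHub`). Without one, each small vertex of `I`
would have exactly one big neighbor, all neighbors of that big vertex would again be small vertices
of `I`, and these vertices would exhaust the graph without reaching the outer face.

The second layer around a full hub is an induced 5-cycle. If all of it is big, the 5-contraction
works. If some of its vertices are small but none of these is in `I`, the extended 5-contraction
works. If one in `I` is small, then so is a neighbor of it on this cycle, and the 8-diamond appears
(`Region.exists_diamond`).

An 8-diamond is excluded in the whole graph (`Config.not_diamond`). No outside vertex sees three
consecutive corners, for otherwise a 1-contraction applies; so internal corners have degrees at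
least 7, 6, 7, 6. Counting degrees then makes one of the two 8-contractions work, except when an
internal corner of degree 7 is next to an internal corner of degree 6; this is the 10-diamond, and
there the 10-contraction works.

New canvases are built from their oriented triangles and outer cycle by `DiskData.toCanvas`. Only
two constructions are needed: the contraction of one edge (`EdgeContr`) and the replacement of a
vertex of degree five by a wheel (`Hub`). The 8-contraction is the contraction of the interior of
the diamond into one of its corners. The 10-contraction is the contraction of the interior to a
vertex followed by its replacement by a wheel. -/

theorem SameCycle.induction_on_set {α : Type*} [Finite α] {f : Equiv.Perm α} {x y : α}
    (h : f.SameCycle x y) (S : α → Prop) (hx : S x) (hS : ∀ z, S z → S (f z)) : S y := by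
  obtain ⟨n, rfl⟩ := h.exists_nat_pow_eq
  clear h
  induction n with
  | zero => simpa
  | succ n ih => rw [pow_succ', Equiv.Perm.mul_apply]; exact hS _ ih

end Equiv.Perm

namespace RotationSystem

variable {V : Type*} {G : SimpleGraph V} (R : RotationSystem G)

theorem next_eq (d : G.Dart) : R.next d = R.rot d.symm := rfl

theorem next_fst (d : G.Dart) : (R.next d).fst = d.snd := R.rot_fst d.symm

theorem rot_eq_next_symm (d : G.Dart) : R.rot d = R.next d.symm := by
  rw [next_eq, SimpleGraph.Dart.symm_symm]

theorem leftFace_eq_iff (d e : G.Dart) : R.leftFace d = R.leftFace e ↔ R.next.SameCycle d e :=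
  Quotient.eq (r := Equiv.Perm.SameCycle.setoid R.next)

theorem leftFace_next (d : G.Dart) : R.leftFace (R.next d) = R.leftFace d := by
  rw [leftFace_eq_iff]
  exact Equiv.Perm.sameCycle_apply_left.2 (Equiv.Perm.SameCycle.refl _ _)

theorem leftFace_rot (d : G.Dart) : R.leftFace (R.rot d) = R.leftFace d.symm := by
  rw [rot_eq_next_symm, leftFace_next]

theorem leftFace_surjective : Function.Surjective R.leftFace := Quotient.mk_surjective

theorem next_ne (d : G.Dart) : R.next d ≠ d := fun h =>
  d.snd_ne_fst (by rw [← R.next_fst d, h])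

theorem next_next_next [Finite V] (d : G.Dart) (h : R.faceLength (R.leftFace d) = 3) :
    R.next (R.next (R.next d)) = d := by
  classical
  have : Finite G.Dart := Finite.of_injective _ SimpleGraph.Dart.toProd_injective
  have := Fintype.ofFinite G.Dart
  have hs : {e : G.Dart | R.leftFace e = R.leftFace d} = ((R.next.cycleOf d).support : Set _) := by
    ext e
    rw [Finset.mem_coe, Equiv.Perm.mem_support_cycleOf_iff' (R.next_ne d), Set.mem_ofPred_eq,
      R.leftFace_eq_iff, Equiv.Perm.sameCycle_comm]
  have := Equiv.Perm.pow_mod_card_support_cycleOf_self_apply R.next 3 d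
  rw [faceLength, hs, Set.ncard_coe_finset] at h
  rw [h] at this
  simpa [pow_succ] using this.symm

end RotationSystem

namespace Canvas

variable {G : Canvas.{u}}

instance : Finite G.V := G.finite

instance : Finite G.graph.Dart := Finite.of_injective _ SimpleGraph.Dart.toProd_injective

instance : Finite G.sys.Face := Finite.of_surjective _ G.sys.leftFace_surjective

theorem dart_ext {d e : G.graph.Dart} (h₁ : d.fst = e.fst) (h₂ : d.snd = e.snd) : d = e :=
  SimpleGraph.Dart.ext _ _ (Prod.ext h₁ h₂)

theorem isOuter_dart (d : G.graph.Dart) : G.IsOuter d.fst d.snd ↔ G.sys.leftFace d = G.outer :=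
  ⟨fun ⟨e, he, h₁, h₂⟩ => by rwa [← dart_ext h₁ h₂], fun h => ⟨d, h, rfl, rfl⟩⟩

theorem isFace_dart (d : G.graph.Dart) (c : G.V) :
    G.IsFace d.fst d.snd c ↔ G.sys.leftFace d ≠ G.outer ∧ (G.sys.next d).snd = c :=
  ⟨fun ⟨e, he, h₁, h₂, h₃⟩ => by rw [← dart_ext h₁ h₂]; exact ⟨he, h₃⟩,
    fun h => ⟨d, h.1, rfl, rfl, h.2⟩⟩

theorem adj_of_isOuter {a b : G.V} (h : G.IsOuter a b) : G.graph.Adj a b := by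
  obtain ⟨d, -, rfl, rfl⟩ := h
  exact d.adj

theorem adj_of_isFace {a b c : G.V} (h : G.IsFace a b c) : G.graph.Adj a b := by
  obtain ⟨d, -, rfl, rfl, -⟩ := h
  exact d.adj

theorem isFace_rot {a b c : G.V} (h : G.IsFace a b c) : G.IsFace b c a := by
  obtain ⟨d, hd, rfl, rfl, rfl⟩ := h
  refine ⟨G.sys.next d, by rwa [G.sys.leftFace_next], G.sys.next_fst d, rfl, ?_⟩
  have := G.sys.next_next_next d (G.face_length _ hd)
  rw [← G.sys.next_fst, this]

theorem isFace_ne {a b c : G.V} (h : G.IsFace a b c) : a ≠ b ∧ b ≠ c ∧ c ≠ a :=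
  ⟨(adj_of_isFace h).ne, (adj_of_isFace (isFace_rot h)).ne,
    (adj_of_isFace (isFace_rot (isFace_rot h))).ne⟩

theorem not_isOuter_of_isFace {a b c : G.V} (h : G.IsFace a b c) : ¬ G.IsOuter a b := by
  obtain ⟨d, hd, rfl, rfl, -⟩ := h
  rwa [isOuter_dart]

theorem isFace_unique {a b c c' : G.V} (h : G.IsFace a b c) (h' : G.IsFace a b c') : c = c' := by
  obtain ⟨d, hd, rfl, rfl, rfl⟩ := h
  exact ((isFace_dart d c').1 h').2

theorem isOuter_or_isFace {a b : G.V} (h : G.graph.Adj a b) :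
    G.IsOuter a b ∨ ∃ c, G.IsFace a b c := by
  let d : G.graph.Dart := ⟨(a, b), h⟩
  by_cases hd : G.sys.leftFace d = G.outer
  · exact Or.inl ((isOuter_dart d).2 hd)
  · exact Or.inr ⟨_, (isFace_dart d _).2 ⟨hd, rfl⟩⟩

theorem isOuter_succ {a b : G.V} (h : G.IsOuter a b) : ∃ c, G.IsOuter b c := by
  obtain ⟨d, hd, rfl, rfl⟩ := h
  exact ⟨(G.sys.next d).snd, G.sys.next d, by rwa [G.sys.leftFace_next], G.sys.next_fst d, rfl⟩

theorem isOuter_right_unique {a b b' : G.V} (h : G.IsOuter a b) (h' : G.IsOuter a b') :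
    b = b' := by
  obtain ⟨d, hd, rfl, rfl⟩ := h
  obtain ⟨e, he, h₁, rfl⟩ := h'
  rw [G.outer_cycle hd he h₁.symm]

theorem isOuter_left_unique {a a' b : G.V} (h : G.IsOuter a b) (h' : G.IsOuter a' b) :
    a = a' := by
  obtain ⟨d, hd, rfl, rfl⟩ := h
  obtain ⟨e, he, rfl, h₁⟩ := h'
  have := @G.outer_cycle (G.sys.next d) (by simpa [G.sys.leftFace_next] using hd) (G.sys.next e)
    (by simpa [G.sys.leftFace_next] using he) (by simp [G.sys.next_fst, h₁])
  rw [G.sys.next.injective this]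

/-- The outer face is a single orbit of face tracing, so its boundary can be followed all the way
round from any starting point. -/
theorem isOuter_induction (S : G.V → Prop) {a b : G.V} (hab : G.IsOuter a b) (ha : S a)
    (hS : ∀ x y, G.IsOuter x y → S x → S y) {x y : G.V} (hxy : G.IsOuter x y) : S x := by
  obtain ⟨d, hd, rfl, rfl⟩ := hab
  obtain ⟨e, he, rfl, rfl⟩ := hxy
  have h := (G.sys.leftFace_eq_iff d e).1 (hd.trans he.symm)
  refine (h.induction_on_set (fun e => G.sys.leftFace e = G.outer ∧ S e.fst) ⟨hd, ha⟩ ?_).2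
  rintro z ⟨hz, hz'⟩
  exact ⟨by rwa [G.sys.leftFace_next], by
    rw [G.sys.next_fst]; exact hS _ _ ((isOuter_dart z).2 hz) hz'⟩

/-- The edge from `v` to `t` follows the edge from `v` to `s` around `v`. -/
def Step (G : Canvas.{u}) (v s t : G.V) : Prop :=
  G.IsFace s v t ∨ (G.IsOuter s v ∧ G.IsOuter v t)

theorem step_rot (d : G.graph.Dart) : G.Step d.fst d.snd (G.sys.rot d).snd := by
  have h₁ : d.symm.fst = d.snd := rfl
  have h₂ : d.symm.snd = d.fst := rfl
  by_cases hd : G.sys.leftFace d.symm = G.outer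
  · right
    refine ⟨⟨d.symm, hd, h₁, h₂⟩, G.sys.rot d, ?_, G.sys.rot_fst d, rfl⟩
    rw [G.sys.leftFace_rot, hd]
  · left
    exact ⟨d.symm, hd, h₁, h₂, by rw [G.sys.rot_eq_next_symm]⟩

theorem exists_step {v s : G.V} (h : G.graph.Adj v s) : ∃ t, G.Step v s t :=
  ⟨_, step_rot ⟨(v, s), h⟩⟩

theorem step_unique {v s t t' : G.V} (h : G.Step v s t) (h' : G.Step v s t') : t = t' := by
  rcases h with h | h <;> rcases h' with h' | h'
  · exact isFace_unique h h'
  · exact absurd h'.1 (not_isOuter_of_isFace h)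
  · exact absurd h.1 (not_isOuter_of_isFace h')
  · exact isOuter_right_unique h.2 h'.2

theorem step_adj {v s t : G.V} (h : G.Step v s t) : G.graph.Adj v s ∧ G.graph.Adj v t := by
  rcases h with h | h
  · exact ⟨(adj_of_isFace h).symm, adj_of_isFace (isFace_rot h)⟩
  · exact ⟨(adj_of_isOuter h.1).symm, adj_of_isOuter h.2⟩

/-- The darts at `v` form one cycle of the rotation, and `Step` is the rotation read off at the far
ends. In all local arguments this lemma takes the place of the rotation system. -/
theorem nbr_induction {v : G.V} (S : G.V → Prop) {s : G.V} (hs : G.graph.Adj v s) (hs' : S s)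
    (hS : ∀ x y, G.Step v x y → S x → S y) {t : G.V} (ht : G.graph.Adj v t) : S t := by
  let d : G.graph.Dart := ⟨(v, s), hs⟩
  let e : G.graph.Dart := ⟨(v, t), ht⟩
  have h := G.sys.rot_cyclic d e rfl
  refine (h.induction_on_set (fun e => e.fst = v ∧ S e.snd) ⟨rfl, hs'⟩ ?_).2
  rintro z ⟨rfl, hz'⟩
  exact ⟨G.sys.rot_fst z, hS _ _ (step_rot z) hz'⟩

theorem step_right_unique {v s s' t : G.V} (h : G.Step v s t) (h' : G.Step v s' t) : s = s' := by
  rcases h with h | h <;> rcases h' with h' | h'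
  · exact isFace_unique (isFace_rot h) (isFace_rot h')
  · exact absurd h'.2 (not_isOuter_of_isFace (isFace_rot h))
  · exact absurd h.2 (not_isOuter_of_isFace (isFace_rot h'))
  · exact isOuter_left_unique h.1 h'.1

/-- The principle of induction around a vertex `v`, with the neighbor `e` left out. -/
theorem nbr_induction_punctured {v e : G.V} (S : G.V → Prop) (hv : G.graph.Adj v e)
    (hS : ∀ x y, x ≠ e → y ≠ e → G.Step v x y → (S x ↔ S y)) {s t : G.V}
    (hs : G.graph.Adj v s) (ht : G.graph.Adj v t) (hse : s ≠ e) (hte : t ≠ e) : S s ↔ S t := by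
  obtain ⟨e', he'⟩ := exists_step hv
  -- One turn around `v` that starts at the successor `e'` of `e` meets all other neighbors before
  -- it returns to `e`. Admitting `x = e` in the invariant closes the turn.
  have key : ∀ S : G.V → Prop, (∀ x y, x ≠ e → y ≠ e → G.Step v x y → (S x ↔ S y)) → S e' →
      ∀ t, G.graph.Adj v t → t ≠ e → S t := by
    intro S hS h t ht hte
    have := nbr_induction (fun x => x = e ∨ S x) hv (Or.inl rfl) ?_ ht
    · exact this.resolve_left hte
    intro x y hxy hx
    by_cases hy : y = e
    · exact Or.inl hy
    by_cases hx' : x = e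
    · subst hx'
      rw [step_unique hxy he']; exact Or.inr h
    · exact Or.inr ((hS x y hx' hy hxy).1 (hx.resolve_left hx'))
  -- The hypothesis is an equivalence, so the one-directional `key` applies to `S` or to its
  -- negation, according to the value at `e'`.
  by_cases h : S e'
  · exact iff_of_true (key S hS h s hs hse) (key S hS h t ht hte)
  · have := key (fun x => ¬ S x) (fun x y h1 h2 h3 => not_congr (hS x y h1 h2 h3)) h
    exact iff_of_false (this s hs hse) (this t ht hte)

/-! ### Counting -/

theorem faceLength_outer_eq : G.sys.faceLength G.outer =
    {p : G.V × G.V | G.IsOuter p.1 p.2}.ncard := by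
  have : {p : G.V × G.V | G.IsOuter p.1 p.2} =
      SimpleGraph.Dart.toProd '' {d : G.graph.Dart | G.sys.leftFace d = G.outer} := by
    ext ⟨a, b⟩
    constructor
    · rintro ⟨d, hd, h1, h2⟩
      exact ⟨d, hd, Prod.ext h1 h2⟩
    · rintro ⟨d, hd, h⟩
      exact ⟨d, hd, congrArg Prod.fst h, congrArg Prod.snd h⟩
  rw [this, Set.ncard_image_of_injective _ SimpleGraph.Dart.toProd_injective]
  rfl

end Canvas

theorem SimpleGraph.ncard_adj_eq {V : Type*} [Finite V] (G : SimpleGraph V) :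
    {p : V × V | G.Adj p.1 p.2}.ncard = Nat.card G.Dart := by
  have : {p : V × V | G.Adj p.1 p.2} = Set.range (SimpleGraph.Dart.toProd (G := G)) := by
    ext p
    exact ⟨fun h => ⟨⟨p, h⟩, rfl⟩, fun ⟨d, hd⟩ => hd ▸ d.adj⟩
  rw [this, ← Set.image_univ, Set.ncard_image_of_injective _ SimpleGraph.Dart.toProd_injective,
    Set.ncard_univ]

theorem SimpleGraph.card_dart_eq {V : Type*} [Finite V] (G : SimpleGraph V) :
    Nat.card G.Dart = 2 * G.edgeSet.ncard := by
  classical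
  have := Fintype.ofFinite V
  rw [Nat.card_eq_fintype_card, G.dart_card_eq_twice_card_edges, ← Set.ncard_coe_finset]
  simp

theorem RotationSystem.card_dart_eq_sum {V : Type*} [Finite V] {G : SimpleGraph V}
    (R : RotationSystem G) (F₀ : R.Face) (h : ∀ F, F ≠ F₀ → R.faceLength F = 3) :
    Nat.card G.Dart + 3 = R.faceLength F₀ + 3 * Nat.card R.Face := by
  classical
  have : Finite G.Dart := Finite.of_injective _ SimpleGraph.Dart.toProd_injective
  have : Finite R.Face := Finite.of_surjective _ R.leftFace_surjective
  have := Fintype.ofFinite R.Face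
  have h1 : Nat.card G.Dart = ∑ F, R.faceLength F := by
    rw [← Nat.card_congr (Equiv.sigmaFiberEquiv R.leftFace), Nat.card_sigma]
    rfl
  have h2 : ∑ F ∈ Finset.univ.erase F₀, R.faceLength F = 3 * (Fintype.card R.Face - 1) := by
    rw [Finset.sum_congr rfl (fun F hF => h F (Finset.ne_of_mem_erase hF))]
    simp [Finset.card_erase_of_mem, mul_comm]
  have h3 : 0 < Fintype.card R.Face := Fintype.card_pos_iff.2 ⟨F₀⟩
  rw [h1, ← Finset.add_sum_erase _ _ (Finset.mem_univ F₀), h2, Nat.card_eq_fintype_card]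
  omega

namespace Canvas

variable {G : Canvas.{u}}

/-- Euler's formula with the number of faces eliminated: counting darts by faces gives `2E + 3 = ℓ +
3F` for the outer length `ℓ`. In this form only darts, outer darts and vertices have to be counted
when a new canvas is built. -/
theorem count : {p : G.V × G.V | G.graph.Adj p.1 p.2}.ncard + 2 * G.sys.faceLength G.outer + 6 =
    6 * Nat.card G.V := by
  have h1 := G.graph.ncard_adj_eq
  have h2 := G.graph.card_dart_eq
  have h3 := G.sys.card_dart_eq_sum G.outer G.face_length
  have h4 := G.euler
  omega

theorem exists_external (G : Canvas.{u}) : ∃ v w, G.IsOuter v w := by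
  have h : 0 < {d : G.graph.Dart | G.sys.leftFace d = G.outer}.ncard :=
    lt_of_lt_of_le (by norm_num) G.outer_length
  obtain ⟨d, hd⟩ := (Set.ncard_pos (Set.toFinite _)).1 h
  exact ⟨_, _, d, hd, rfl, rfl⟩

/-- Connectedness as an induction principle. Its typical use is to refute a set of internal vertices
closed under adjacency, since `exists_external` gives a vertex outside of it. -/
theorem closed_eq_univ (S : G.V → Prop) {s : G.V} (hs : S s)
    (hS : ∀ x y, S x → G.graph.Adj x y → S y) (t : G.V) : S t := by
  obtain ⟨p⟩ := G.connected.preconnected s t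
  induction p with
  | nil => exact hs
  | cons h _ ih => exact ih (hS _ _ hs h)

theorem external_of_isOuter_right {a b : G.V} (h : G.IsOuter a b) : G.External b := isOuter_succ h

end Canvas

/-! ## Building canvases from their oriented faces -/

/-- The oriented triangular faces and the outer cycle of a canvas. -/
structure DiskData (V : Type u) where
  finite : Finite V
  face : V → V → V → Prop
  outer : V → V → Prop
  face_rot : ∀ {a b c}, face a b c → face b c a
  face_unique : ∀ {a b c d}, face a b c → face a b d → c = d
  face_ne : ∀ {a b c}, face a b c → a ≠ b
  outer_ne : ∀ {a b}, outer a b → a ≠ b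
  outer_right_unique : ∀ {a b c}, outer a b → outer a c → b = c
  outer_left_unique : ∀ {a b c}, outer a c → outer b c → a = b
  outer_succ : ∀ {a b}, outer a b → ∃ c, outer b c
  not_outer : ∀ {a b c}, face a b c → ¬ outer a b
  symm : ∀ {a b}, (outer a b ∨ ∃ c, face a b c) → (outer b a ∨ ∃ c, face b a c)
  outer_induction : ∀ (S : V → Prop) {a b}, outer a b → S a → (∀ x y, outer x y → S x → S y) →
    ∀ {x y}, outer x y → S x
  link : ∀ (v : V) (S : V → Prop),
    (∀ s t, face s v t ∨ (outer s v ∧ outer v t) → (S s ↔ S t)) →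
    ∀ s t, (outer v s ∨ ∃ c, face v s c) → (outer v t ∨ ∃ c, face v t c) → S s → S t
  nonempty : Nonempty V
  connected : ∀ (S : V → Prop), (∀ x y, (outer x y ∨ ∃ c, face x y c) → (S x ↔ S y)) →
    ∀ x y, S x → S y
  outer_length : 4 ≤ {p : V × V | outer p.1 p.2}.ncard
  count : {p : V × V | outer p.1 p.2 ∨ ∃ c, face p.1 p.2 c}.ncard +
    2 * {p : V × V | outer p.1 p.2}.ncard + 6 = 6 * Nat.card V

namespace DiskData

variable {V : Type u} (D : DiskData V)

def graph : SimpleGraph V where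
  Adj a b := D.outer a b ∨ ∃ c, D.face a b c
  symm := ⟨fun _ _ h => D.symm h⟩
  loopless := ⟨fun a h => by
    rcases h with h | ⟨c, h⟩
    · exact D.outer_ne h rfl
    · exact D.face_ne h rfl⟩

/-- One step of face tracing, along a triangle or along the outer cycle. These two cases exclude
each other by `not_outer`. -/
def Nx (a b c : V) : Prop := D.face a b c ∨ (D.outer a b ∧ D.outer b c)

theorem exists_nx {a b : V} (h : D.graph.Adj a b) : ∃ c, D.Nx a b c := by
  rcases h with h | ⟨c, h⟩
  · obtain ⟨c, hc⟩ := D.outer_succ h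
    exact ⟨c, Or.inr ⟨h, hc⟩⟩
  · exact ⟨c, Or.inl h⟩

variable {D} in
theorem Nx.unique {a b c c' : V} (h : D.Nx a b c) (h' : D.Nx a b c') : c = c' := by
  rcases h with h | h <;> rcases h' with h' | h'
  · exact D.face_unique h h'
  · exact absurd h'.1 (D.not_outer h)
  · exact absurd h.1 (D.not_outer h')
  · exact D.outer_right_unique h.2 h'.2

variable {D} in
theorem Nx.left_unique {a a' b c : V} (h : D.Nx a b c) (h' : D.Nx a' b c) : a = a' := by
  rcases h with h | h <;> rcases h' with h' | h'
  · exact D.face_unique (D.face_rot h) (D.face_rot h')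
  · exact absurd h'.2 (D.not_outer (D.face_rot h))
  · exact absurd h.2 (D.not_outer (D.face_rot h'))
  · exact D.outer_left_unique h.1 h'.1

variable {D} in
theorem Nx.adj_right {a b c : V} (h : D.Nx a b c) : D.graph.Adj b c := by
  rcases h with h | h
  · exact Or.inr ⟨_, D.face_rot h⟩
  · exact Or.inl h.2

noncomputable def nextFun (d : D.graph.Dart) : D.graph.Dart :=
  ⟨(d.snd, (D.exists_nx d.adj).choose), (D.exists_nx d.adj).choose_spec.adj_right⟩

theorem nextFun_spec (d : D.graph.Dart) : D.Nx d.fst d.snd (D.nextFun d).snd :=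
  (D.exists_nx d.adj).choose_spec

theorem nextFun_fst (d : D.graph.Dart) : (D.nextFun d).fst = d.snd := rfl

theorem nextFun_injective : Function.Injective D.nextFun := by
  intro d e h
  have h1 : d.snd = e.snd := by rw [← nextFun_fst, h, nextFun_fst]
  have h2 := D.nextFun_spec d
  have h3 := D.nextFun_spec e
  rw [← h, ← h1] at h3
  exact SimpleGraph.Dart.ext _ _ (Prod.ext (h2.left_unique h3) h1)

noncomputable def rotPerm : Equiv.Perm D.graph.Dart :=
  Equiv.ofBijective (fun d => D.nextFun d.symm) (by
    have := D.finite
    have : Finite D.graph.Dart := Finite.of_injective _ SimpleGraph.Dart.toProd_injective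
    exact Finite.injective_iff_bijective.1
      (D.nextFun_injective.comp SimpleGraph.Dart.symm_involutive.injective))

theorem rotPerm_apply (d : D.graph.Dart) : D.rotPerm d = D.nextFun d.symm := rfl

/-- The field `link` is exactly what makes the darts at a vertex a single cycle: it is applied to
membership in the cycle of a given dart. -/
noncomputable def sys : RotationSystem D.graph where
  rot := D.rotPerm
  rot_fst d := rfl
  rot_cyclic := by
    rintro ⟨⟨v, s⟩, hs⟩ ⟨⟨v', t⟩, ht⟩ (rfl : v = v')
    let d : D.graph.Dart := ⟨(v, s), hs⟩
    let S : V → Prop := fun x => ∃ h : D.graph.Adj v x, D.rotPerm.SameCycle d ⟨(v, x), h⟩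
    suffices hS : ∀ x y, D.face x v y ∨ (D.outer x v ∧ D.outer v y) → (S x ↔ S y) by
      obtain ⟨_, h⟩ := D.link v S hS s t hs ht ⟨hs, Equiv.Perm.SameCycle.refl _ _⟩
      exact h
    intro x y hxy
    have h1 : D.graph.Adj v x := by
      rcases hxy with h | h
      · exact D.symm (Or.inr ⟨_, h⟩)
      · exact D.symm (Or.inl h.1)
    have h2 : D.graph.Adj v y := Nx.adj_right hxy
    have h3 : D.rotPerm ⟨(v, x), h1⟩ = ⟨(v, y), h2⟩ := by
      apply SimpleGraph.Dart.ext
      exact Prod.ext rfl ((D.nextFun_spec (SimpleGraph.Dart.symm ⟨(v, x), h1⟩)).unique hxy)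
    constructor
    · rintro ⟨_, h⟩
      exact ⟨h2, by rw [← h3]; exact h.apply_right⟩
    · rintro ⟨_, h⟩
      exact ⟨h1, by rw [← h3] at h; exact Equiv.Perm.sameCycle_apply_right.1 h⟩

theorem sys_next (d : D.graph.Dart) : D.sys.next d = D.nextFun d := by
  rw [RotationSystem.next_eq]
  change D.nextFun d.symm.symm = _
  rw [SimpleGraph.Dart.symm_symm]

theorem exists_outer : ∃ d : D.graph.Dart, D.outer d.fst d.snd := by
  have := D.finite
  obtain ⟨⟨a, b⟩, h⟩ := (Set.ncard_pos (Set.toFinite _)).1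
    (lt_of_lt_of_le (by norm_num) D.outer_length)
  exact ⟨⟨(a, b), Or.inl h⟩, h⟩

noncomputable def outerDart : D.graph.Dart := D.exists_outer.choose

noncomputable def outerFace : D.sys.Face := D.sys.leftFace D.outerDart

/-- Face tracing keeps outer darts outer, so the chosen face contains only outer darts. It contains
all of them because `outer_induction` says that the outer darts form one orbit. -/
theorem leftFace_eq_outerFace (d : D.graph.Dart) :
    D.sys.leftFace d = D.outerFace ↔ D.outer d.fst d.snd := by
  have := D.finite
  have : Finite D.graph.Dart := Finite.of_injective _ SimpleGraph.Dart.toProd_injective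
  have h0 : D.outer D.outerDart.fst D.outerDart.snd := D.exists_outer.choose_spec
  constructor
  · intro h
    have h := (D.sys.leftFace_eq_iff _ _).1 h.symm
    refine h.induction_on_set (fun d => D.outer d.fst d.snd) h0 ?_
    intro z hz
    rw [sys_next]
    rcases D.nextFun_spec z with h | h
    · exact absurd hz (D.not_outer h)
    · exact h.2
  · intro hd
    refine D.outer_induction (fun x => ∀ d : D.graph.Dart, d.fst = x → D.outer d.fst d.snd →
      D.sys.leftFace d = D.outerFace) h0 ?_ ?_ hd d rfl hd
    · intro e he he'
      rw [he] at he'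
      have : e = D.outerDart :=
        SimpleGraph.Dart.ext _ _ (Prod.ext he (D.outer_right_unique he' h0))
      rw [this]; rfl
    · intro x y hxy hx e he he'
      have h1 := hx ⟨(x, y), Or.inl hxy⟩ rfl hxy
      rw [← h1, ← D.sys.leftFace_next ⟨(x, y), Or.inl hxy⟩, sys_next]
      congr 1
      refine SimpleGraph.Dart.ext _ _ (Prod.ext he ?_)
      have h2 := D.nextFun_spec ⟨(x, y), Or.inl hxy⟩
      refine Nx.unique (b := y) (a := x) (Or.inr ⟨hxy, ?_⟩) h2
      rw [← he]; exact he'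

theorem nextFun_snd_of_face {d : D.graph.Dart} {c : V} (h : D.face d.fst d.snd c) :
    (D.nextFun d).snd = c := (D.nextFun_spec d).unique (Or.inl h)

theorem faceLength_eq_three (F : D.sys.Face) (hF : F ≠ D.outerFace) : D.sys.faceLength F = 3 := by
  have := D.finite
  have : Finite D.graph.Dart := Finite.of_injective _ SimpleGraph.Dart.toProd_injective
  obtain ⟨d, rfl⟩ := D.sys.leftFace_surjective F
  have hd : ¬ D.outer d.fst d.snd := fun h => hF ((D.leftFace_eq_outerFace d).2 h)
  obtain ⟨⟨a, b⟩, hab⟩ := d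
  obtain ⟨c, hc⟩ : ∃ c, D.face a b c := hab.resolve_left hd
  have hbc := D.face_rot hc
  have hca := D.face_rot hbc
  let d : D.graph.Dart := ⟨(a, b), hab⟩
  let e : D.graph.Dart := ⟨(b, c), Or.inr ⟨_, hbc⟩⟩
  let f : D.graph.Dart := ⟨(c, a), Or.inr ⟨_, hca⟩⟩
  have h1 : D.sys.next d = e := by
    rw [sys_next]
    exact SimpleGraph.Dart.ext _ _ (Prod.ext rfl (D.nextFun_snd_of_face hc))
  have h2 : D.sys.next e = f := by
    rw [sys_next]
    exact SimpleGraph.Dart.ext _ _ (Prod.ext rfl (D.nextFun_snd_of_face hbc))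
  have h3 : D.sys.next f = d := by
    rw [sys_next]
    exact SimpleGraph.Dart.ext _ _ (Prod.ext rfl (D.nextFun_snd_of_face hca))
  have h4 : {x : D.graph.Dart | D.sys.leftFace x = D.sys.leftFace d} = {d, e, f} := by
    ext x
    constructor
    · intro hx
      have hx := (D.sys.leftFace_eq_iff _ _).1 (Eq.symm hx)
      refine hx.induction_on_set (fun x => x ∈ ({d, e, f} : Set _)) (by simp) ?_
      rintro z (rfl | rfl | rfl)
      · rw [h1]; simp
      · rw [h2]; simp
      · rw [h3]; simp
    · rintro (rfl | rfl | rfl)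
      · rfl
      · rw [← h1]; exact D.sys.leftFace_next _
      · rw [← h2, ← h1]; exact (D.sys.leftFace_next _).trans (D.sys.leftFace_next _)
  have hde : d ≠ e := fun h => D.face_ne hc (congrArg (fun d : D.graph.Dart => d.fst) h)
  have hef : e ≠ f := fun h => D.face_ne hbc (congrArg (fun d : D.graph.Dart => d.fst) h)
  have hfd : f ≠ d := fun h => D.face_ne hca (congrArg (fun d : D.graph.Dart => d.fst) h)
  change {x : D.graph.Dart | D.sys.leftFace x = D.sys.leftFace d}.ncard = 3
  rw [h4, Set.ncard_eq_three]
  exact ⟨d, e, f, hde, hfd.symm, hef, rfl⟩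

theorem faceLength_outerFace :
    D.sys.faceLength D.outerFace = {p : V × V | D.outer p.1 p.2}.ncard := by
  have : {p : V × V | D.outer p.1 p.2} =
      SimpleGraph.Dart.toProd '' {d : D.graph.Dart | D.sys.leftFace d = D.outerFace} := by
    ext ⟨a, b⟩
    constructor
    · intro h
      exact ⟨⟨(a, b), Or.inl h⟩, (D.leftFace_eq_outerFace _).2 h, rfl⟩
    · rintro ⟨d, hd, h⟩
      have hd := (D.leftFace_eq_outerFace _).1 hd
      change D.outer d.toProd.1 d.toProd.2 at hd
      rwa [h] at hd
  rw [this, Set.ncard_image_of_injective _ SimpleGraph.Dart.toProd_injective]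
  rfl

/-- The canvas with the given faces. -/
noncomputable def toCanvas : Canvas.{u} where
  V := V
  finite := D.finite
  graph := D.graph
  connected := by
    have := D.nonempty
    refine ⟨fun x y => ?_⟩
    refine D.connected (fun z => D.graph.Reachable x z) ?_ x y (SimpleGraph.Reachable.refl _)
    intro a b hab
    have hab : D.graph.Adj a b := hab
    exact ⟨fun h => h.trans hab.reachable, fun h => h.trans hab.symm.reachable⟩
  sys := D.sys
  -- The field `count` is Euler's formula in terms of darts; counting darts by faces of length three
  -- brings the number of faces back.
  euler := by
    have := D.finite
    have h1 := D.graph.ncard_adj_eq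
    have h2 := D.graph.card_dart_eq
    have h3 := D.sys.card_dart_eq_sum D.outerFace D.faceLength_eq_three
    have h4 := D.count
    have h5 := D.faceLength_outerFace
    change {p : V × V | D.outer p.1 p.2 ∨ ∃ c, D.face p.1 p.2 c}.ncard = _ at h1
    omega
  outer := D.outerFace
  outer_length := by rw [faceLength_outerFace]; exact D.outer_length
  outer_cycle := by
    intro d hd e he h
    have hd := (D.leftFace_eq_outerFace _).1 hd
    have he := (D.leftFace_eq_outerFace _).1 he
    refine SimpleGraph.Dart.ext _ _ (Prod.ext h ?_)
    change d.fst = e.fst at h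
    rw [← h] at he
    exact D.outer_right_unique hd he
  face_length := D.faceLength_eq_three

theorem toCanvas_adj (a b : V) : D.toCanvas.graph.Adj a b ↔ D.outer a b ∨ ∃ c, D.face a b c :=
  Iff.rfl

theorem toCanvas_isOuter (a b : V) : D.toCanvas.IsOuter a b ↔ D.outer a b := by
  constructor
  · rintro ⟨d, hd, rfl, rfl⟩
    exact (D.leftFace_eq_outerFace d).1 hd
  · intro h
    exact ⟨⟨(a, b), Or.inl h⟩, (D.leftFace_eq_outerFace _).2 h, rfl, rfl⟩

theorem toCanvas_isFace (a b c : V) : D.toCanvas.IsFace a b c ↔ D.face a b c := by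
  constructor
  · rintro ⟨d, hd, rfl, rfl, rfl⟩
    have hd' : ¬ D.outer d.fst d.snd := fun h => hd ((D.leftFace_eq_outerFace d).2 h)
    have h : D.toCanvas.sys.next d = D.nextFun d := D.sys_next d
    rw [h]
    exact (D.nextFun_spec d).resolve_right fun h => hd' h.1
  · intro h
    refine ⟨⟨(a, b), Or.inr ⟨c, h⟩⟩, fun h' => D.not_outer h ((D.leftFace_eq_outerFace _).1 h'),
      rfl, rfl, ?_⟩
    have h' : D.toCanvas.sys.next ⟨(a, b), Or.inr ⟨c, h⟩⟩ = D.nextFun ⟨(a, b), Or.inr ⟨c, h⟩⟩ :=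
      D.sys_next _
    rw [h']
    exact D.nextFun_snd_of_face h

end DiskData

/-! ## Contractions -/

namespace Canvas

variable {G : Canvas.{u}}

theorem facial_iff {a b c : G.V} : {a, b, c} ∈ G.facial ↔ G.IsFace a b c ∨ G.IsFace b a c := by
  constructor
  · rintro ⟨x, y, z, h, he⟩
    have h1 := isFace_rot h
    have h2 := isFace_rot h1
    obtain ⟨d1, d2, d3⟩ := isFace_ne h
    have ha : a ∈ ({x, y, z} : Set G.V) := he ▸ (by simp)
    have hb : b ∈ ({x, y, z} : Set G.V) := he ▸ (by simp)
    have hc : c ∈ ({x, y, z} : Set G.V) := he ▸ (by simp)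
    have hx : x ∈ ({a, b, c} : Set G.V) := he.symm ▸ (by simp)
    have hy : y ∈ ({a, b, c} : Set G.V) := he.symm ▸ (by simp)
    have hz : z ∈ ({a, b, c} : Set G.V) := he.symm ▸ (by simp)
    simp only [Set.mem_insert_iff, Set.mem_singleton_iff] at ha hb hc hx hy hz
    clear he
    grind
  · rintro (h | h)
    · exact ⟨a, b, c, h, rfl⟩
    · exact ⟨b, a, c, h, Set.insert_comm _ _ _⟩

theorem facial_adj {a b c : G.V} (h : {a, b, c} ∈ G.facial) :
    G.graph.Adj a b ∧ G.graph.Adj b c ∧ G.graph.Adj c a := by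
  rcases facial_iff.1 h with h | h
  · exact ⟨adj_of_isFace h, adj_of_isFace (isFace_rot h), adj_of_isFace (isFace_rot (isFace_rot h))⟩
  · exact ⟨(adj_of_isFace h).symm, (adj_of_isFace (isFace_rot (isFace_rot h))).symm,
      (adj_of_isFace (isFace_rot h)).symm⟩

theorem isFace_of_internal {a b : G.V} (h : G.graph.Adj a b) (hi : G.Internal a ∨ G.Internal b) :
    ∃ c, G.IsFace a b c := by
  refine (isOuter_or_isFace h).resolve_left fun ho => ?_
  rcases hi with hi | hi
  · exact hi ⟨_, ho⟩
  · exact hi (external_of_isOuter_right ho)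

/-- If the two faces at `uv` had the same third vertex, the rotation at each of `u`, `v`, `p` would
close up inside `{u, v, p}`. By connectedness this would be the whole graph, and all six darts would
lie on triangles, which leaves no outer face. -/
theorem opposite_ne {u v p q : G.V} (hp : G.IsFace u v p) (hq : G.IsFace v u q) : p ≠ q := by
  rintro rfl
  have hp' := isFace_rot hp
  have hp'' := isFace_rot hp'
  have hq' := isFace_rot hq
  have hq'' := isFace_rot hq'
  let S : G.V → Prop := fun x => x = u ∨ x = v ∨ x = p
  have key : ∀ x y, S x → G.graph.Adj x y → S y := by
    rintro x y hx hxy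
    have hs : ∀ s t, G.Step x s t → S s → S t := by
      intro s t hst hs
      have hne := (step_adj hst).1.ne
      have := fun t' (h : G.Step x s t') => step_unique hst h
      rcases hx with rfl | rfl | rfl <;> rcases hs with rfl | rfl | rfl <;>
        first
        | exact absurd rfl hne
        | (right; right; exact this _ (Or.inl (by assumption)))
        | (right; left; exact this _ (Or.inl (by assumption)))
        | (left; exact this _ (Or.inl (by assumption)))
    rcases hx with rfl | rfl | rfl
    · exact nbr_induction S (adj_of_isFace hp) (Or.inr (Or.inl rfl)) hs hxy
    · exact nbr_induction S (adj_of_isFace hq) (Or.inl rfl) hs hxy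
    · exact nbr_induction S (adj_of_isFace hp'') (Or.inl rfl) hs hxy
  obtain ⟨a, b, hab⟩ := G.exists_external
  have ha : S a := closed_eq_univ S (s := u) (Or.inl rfl) key a
  have hb : S b := closed_eq_univ S (s := u) (Or.inl rfl) key b
  have hne := (adj_of_isOuter hab).ne
  rcases ha with rfl | rfl | rfl <;> rcases hb with rfl | rfl | rfl <;>
    first
    | exact hne rfl
    | exact not_isOuter_of_isFace (by assumption) hab

/-- `f : G → H` contracts some connected subgraphs of `G` to vertices. -/
structure Contr (G H : Canvas.{u}) (f : G.V → H.V) : Prop where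
  surjective : Function.Surjective f
  adj : ∀ p q, H.graph.Adj p q ↔ p ≠ q ∧ ∃ a b, G.graph.Adj a b ∧ f a = p ∧ f b = q
  face : ∀ p q r, H.IsFace p q r ↔
    (p ≠ q ∧ q ≠ r ∧ r ≠ p) ∧ ∃ a b c, G.IsFace a b c ∧ f a = p ∧ f b = q ∧ f c = r
  face_inj : ∀ a b c a' b' c', G.IsFace a b c → G.IsFace a' b' c' →
    f a ≠ f b → f b ≠ f c → f c ≠ f a →
    f a = f a' → f b = f b' → f c = f c' → a = a' ∧ b = b' ∧ c = c'
  outer : ∀ p q, H.IsOuter p q ↔ ∃ a b, G.IsOuter a b ∧ f a = p ∧ f b = q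
  ext_inj : ∀ a b, G.External a → G.External b → f a = f b → a = b

namespace Contr

variable {H K : Canvas.{u}} {f : G.V → H.V} {g : H.V → K.V}

theorem id (G : Canvas.{u}) : Contr G G (fun x => x) where
  surjective := fun x => ⟨x, rfl⟩
  adj p q := ⟨fun h => ⟨h.ne, p, q, h, rfl, rfl⟩, by rintro ⟨-, a, b, h, rfl, rfl⟩; exact h⟩
  face p q r := ⟨fun h => ⟨isFace_ne h, p, q, r, h, rfl, rfl, rfl⟩, by
    rintro ⟨-, a, b, c, h, rfl, rfl, rfl⟩; exact h⟩
  face_inj := by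
    intro a b c a' b' c' _ _ _ _ _ h1 h2 h3
    exact ⟨h1, h2, h3⟩
  outer p q := ⟨fun h => ⟨p, q, h, rfl, rfl⟩, by rintro ⟨a, b, h, rfl, rfl⟩; exact h⟩
  ext_inj a b _ _ h := h

theorem external_iff (hf : Contr G H f) (p : H.V) :
    H.External p ↔ ∃ a, G.External a ∧ f a = p := by
  constructor
  · rintro ⟨q, h⟩
    obtain ⟨a, b, hab, rfl, rfl⟩ := (hf.outer _ _).1 h
    exact ⟨a, ⟨b, hab⟩, rfl⟩
  · rintro ⟨a, ⟨b, hab⟩, rfl⟩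
    exact ⟨f b, (hf.outer _ _).2 ⟨a, b, hab, rfl, rfl⟩⟩

theorem external (hf : Contr G H f) {a : G.V} (h : G.External a) : H.External (f a) :=
  (hf.external_iff _).2 ⟨a, h, rfl⟩

theorem adj_of (hf : Contr G H f) {a b : G.V} (h : G.graph.Adj a b) (hne : f a ≠ f b) :
    H.graph.Adj (f a) (f b) := (hf.adj _ _).2 ⟨hne, a, b, h, rfl, rfl⟩

theorem facial_of (hf : Contr G H f) {a b c : G.V} (h : {a, b, c} ∈ G.facial) (h1 : f a ≠ f b)
    (h2 : f b ≠ f c) (h3 : f c ≠ f a) : {f a, f b, f c} ∈ H.facial := by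
  rw [facial_iff] at h ⊢
  rcases h with h | h
  · exact Or.inl ((hf.face _ _ _).2 ⟨⟨h1, h2, h3⟩, a, b, c, h, rfl, rfl, rfl⟩)
  · exact Or.inr ((hf.face _ _ _).2 ⟨⟨h1.symm, h3.symm, h2.symm⟩, b, a, c, h, rfl, rfl, rfl⟩)

theorem comp (hf : Contr G H f) (hg : Contr H K g) : Contr G K (g ∘ f) where
  surjective := hg.surjective.comp hf.surjective
  adj p q := by
    rw [hg.adj]
    constructor
    · rintro ⟨hne, a, b, hab, rfl, rfl⟩
      obtain ⟨-, a, b, hab', rfl, rfl⟩ := (hf.adj _ _).1 hab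
      exact ⟨hne, a, b, hab', rfl, rfl⟩
    · rintro ⟨hne, a, b, hab, rfl, rfl⟩
      exact ⟨hne, f a, f b, hf.adj_of hab fun h => hne (congrArg g h), rfl, rfl⟩
  face p q r := by
    rw [hg.face]
    constructor
    · rintro ⟨hne, a, b, c, h, rfl, rfl, rfl⟩
      obtain ⟨-, a, b, c, h', rfl, rfl, rfl⟩ := (hf.face _ _ _).1 h
      exact ⟨hne, a, b, c, h', rfl, rfl, rfl⟩
    · rintro ⟨⟨h1, h2, h3⟩, a, b, c, h, rfl, rfl, rfl⟩
      exact ⟨⟨h1, h2, h3⟩, f a, f b, f c, (hf.face _ _ _).2 ⟨⟨fun h => h1 (congrArg g h),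
        fun h => h2 (congrArg g h), fun h => h3 (congrArg g h)⟩, a, b, c, h, rfl, rfl, rfl⟩,
        rfl, rfl, rfl⟩
  face_inj := by
    intro a b c a' b' c' h h' h1 h2 h3 e1 e2 e3
    have n1 : f a ≠ f b := fun h => h1 (congrArg g h)
    have n2 : f b ≠ f c := fun h => h2 (congrArg g h)
    have n3 : f c ≠ f a := fun h => h3 (congrArg g h)
    simp only [Function.comp_apply] at *
    have n1' : f a' ≠ f b' := fun h => h1 (by rw [e1, e2, h])
    have n2' : f b' ≠ f c' := fun h => h2 (by rw [e2, e3, h])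
    have n3' : f c' ≠ f a' := fun h => h3 (by rw [e3, e1, h])
    obtain ⟨m1, m2, m3⟩ := hg.face_inj _ _ _ _ _ _
      ((hf.face _ _ _).2 ⟨⟨n1, n2, n3⟩, a, b, c, h, rfl, rfl, rfl⟩)
      ((hf.face _ _ _).2 ⟨⟨n1', n2', n3'⟩, a', b', c', h', rfl, rfl, rfl⟩) h1 h2 h3 e1 e2 e3
    exact hf.face_inj _ _ _ _ _ _ h h' n1 n2 n3 m1 m2 m3
  outer p q := by
    rw [hg.outer]
    constructor
    · rintro ⟨a, b, h, rfl, rfl⟩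
      obtain ⟨a, b, h', rfl, rfl⟩ := (hf.outer _ _).1 h
      exact ⟨a, b, h', rfl, rfl⟩
    · rintro ⟨a, b, h, rfl, rfl⟩
      exact ⟨f a, f b, (hf.outer _ _).2 ⟨a, b, h, rfl, rfl⟩, rfl, rfl⟩
  ext_inj a b ha hb h := hf.ext_inj a b ha hb
    (hg.ext_inj _ _ (hf.external ha) (hf.external hb) h)

theorem outer_ncard (hf : Contr G H f) :
    {p : H.V × H.V | H.IsOuter p.1 p.2}.ncard = {p : G.V × G.V | G.IsOuter p.1 p.2}.ncard := by
  have : {p : H.V × H.V | H.IsOuter p.1 p.2} =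
      Prod.map f f '' {p : G.V × G.V | G.IsOuter p.1 p.2} := by
    ext ⟨p, q⟩
    constructor
    · intro h
      obtain ⟨a, b, h', rfl, rfl⟩ := (hf.outer _ _).1 h
      exact ⟨(a, b), h', rfl⟩
    · rintro ⟨⟨a, b⟩, h, he⟩
      obtain ⟨rfl, rfl⟩ := Prod.mk.inj he
      exact (hf.outer _ _).2 ⟨a, b, h, rfl, rfl⟩
  rw [this, Set.InjOn.ncard_image]
  rintro ⟨a, b⟩ h ⟨a', b'⟩ h' he
  obtain ⟨h1, h2⟩ := Prod.mk.inj he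
  exact Prod.ext (hf.ext_inj _ _ ⟨_, h⟩ ⟨_, h'⟩ h1)
    (hf.ext_inj _ _ (external_of_isOuter_right h) (external_of_isOuter_right h') h2)

theorem faceLength_outer (hf : Contr G H f) :
    H.sys.faceLength H.outer = G.sys.faceLength G.outer := by
  rw [faceLength_outer_eq, faceLength_outer_eq, hf.outer_ncard]

end Contr

/-- The data of the contraction of an edge `uv`: the faces `uvp` and `vuq` are the only triangles
through it, and the map `f` identifies `u` and `v`. -/
structure EdgeContr (G : Canvas.{u}) (W : Type u) (f : G.V → W) (u v p q : G.V) : Prop where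
  internal : G.Internal v
  face_left : G.IsFace u v p
  face_right : G.IsFace v u q
  common : ∀ t, G.graph.Adj t u → G.graph.Adj t v → t = p ∨ t = q
  surjective : Function.Surjective f
  eq_iff : ∀ a b, f a = f b ↔ a = b ∨ (a = u ∧ b = v) ∨ (a = v ∧ b = u)

namespace EdgeContr

variable {W : Type u} {f : G.V → W} {u v p q : G.V}

def Face (G : Canvas.{u}) (f : G.V → W) (x y z : W) : Prop :=
  (x ≠ y ∧ y ≠ z ∧ z ≠ x) ∧ ∃ a b c, G.IsFace a b c ∧ f a = x ∧ f b = y ∧ f c = z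

def Outer (G : Canvas.{u}) (f : G.V → W) (x y : W) : Prop :=
  ∃ a b, G.IsOuter a b ∧ f a = x ∧ f b = y

/-- The directed edges that survive the contraction, with one representative for each pair of
identified ones. -/
def Survives (G : Canvas.{u}) (f : G.V → W) (a b : G.V) : Prop :=
  f a ≠ f b ∧ (G.IsOuter a b ∨ ∃ c, G.IsFace a b c ∧ f c ≠ f a ∧ f c ≠ f b)

theorem Survives.adj {a b : G.V} (h : Survives G f a b) : G.graph.Adj a b := by
  rcases h.2 with h | ⟨c, h, -⟩
  · exact adj_of_isOuter h
  · exact adj_of_isFace h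

variable (D : EdgeContr G W f u v p q)
include D

theorem map_eq : f u = f v := (D.eq_iff _ _).2 (Or.inr (Or.inl ⟨rfl, rfl⟩))

theorem ne_uv : u ≠ v := (isFace_ne D.face_left).1

theorem ne_pq : p ≠ q := opposite_ne D.face_left D.face_right

theorem ne_all : p ≠ u ∧ p ≠ v ∧ q ≠ u ∧ q ≠ v := by
  obtain ⟨-, h1, h2⟩ := isFace_ne D.face_left
  obtain ⟨-, h3, h4⟩ := isFace_ne D.face_right
  exact ⟨h2, h1.symm, h3.symm, h4⟩

theorem not_survives_of_face {a b c : G.V} (h : G.IsFace a b c) (hc : f c = f a ∨ f c = f b) :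
    ¬ Survives G f a b := by
  rintro ⟨-, h' | ⟨d, hd, h1, h2⟩⟩
  · exact not_isOuter_of_isFace h h'
  · rw [isFace_unique hd h] at h1 h2
    exact hc.elim h1 h2

/-- These darts lie on the two collapsing triangles. The edges `up` and `vp` become parallel, and of
the four darts on them exactly `u → p` and `p → v` remain, one in each direction; the same happens
at `q`. -/
theorem not_survives : ¬ Survives G f v p ∧ ¬ Survives G f p u ∧ ¬ Survives G f u q ∧
    ¬ Survives G f q v :=
  ⟨D.not_survives_of_face (isFace_rot D.face_left) (Or.inl D.map_eq),
    D.not_survives_of_face (isFace_rot (isFace_rot D.face_left)) (Or.inr D.map_eq.symm),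
    D.not_survives_of_face (isFace_rot D.face_right) (Or.inl D.map_eq.symm),
    D.not_survives_of_face (isFace_rot (isFace_rot D.face_right)) (Or.inr D.map_eq)⟩

theorem survives_of_forall {a b : G.V} (hab : G.graph.Adj a b) (hne : f a ≠ f b)
    (h : ∀ c, G.IsFace a b c → c ≠ u ∧ c ≠ v) : Survives G f a b := by
  refine ⟨hne, ?_⟩
  rcases isOuter_or_isFace hab with ho | ⟨c, hc⟩
  · exact Or.inl ho
  · obtain ⟨h1, h2⟩ := h c hc
    obtain ⟨-, d1, d2⟩ := isFace_ne hc
    refine Or.inr ⟨c, hc, ?_, ?_⟩ <;> rw [Ne, D.eq_iff] <;> grind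

theorem survives_or {a b : G.V} (hab : G.graph.Adj a b) : Survives G f a b ∨
    (a = u ∧ b = v) ∨ (a = v ∧ b = u) ∨ (a = v ∧ b = p) ∨ (a = p ∧ b = u) ∨ (a = u ∧ b = q) ∨
      (a = q ∧ b = v) := by
  by_cases hne : f a = f b
  · rw [D.eq_iff] at hne
    have := hab.ne
    tauto
  by_cases h : ∀ c, G.IsFace a b c → c ≠ u ∧ c ≠ v
  · exact Or.inl (D.survives_of_forall hab hne h)
  push Not at h
  obtain ⟨c, hc, h⟩ := h
  by_cases hs : f c = f a ∨ f c = f b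
  · rw [D.eq_iff, D.eq_iff] at hs
    obtain ⟨-, d1, d2⟩ := isFace_ne hc
    right
    have h1 := isFace_rot hc
    have h2 := isFace_rot h1
    have e1 := fun t (h : G.IsFace u v t) => isFace_unique h D.face_left
    have e2 := fun t (h : G.IsFace v u t) => isFace_unique h D.face_right
    rcases hs with (hs | ⟨rfl, rfl⟩ | ⟨rfl, rfl⟩) | (hs | ⟨rfl, rfl⟩ | ⟨rfl, rfl⟩)
    · exact absurd hs d2
    · have := e1 _ h2; tauto
    · have := e2 _ h2; tauto
    · exact absurd hs.symm d1
    · have := e2 _ h1; tauto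
    · have := e1 _ h1; tauto
  · push Not at hs
    exact Or.inl ⟨hne, Or.inr ⟨c, hc, hs⟩⟩

/-- A lost dart is replaced by its parallel twin: `v → p` by `u → p`, and so on. The twin would be
lost as well only if `p = q`, which `opposite_ne` forbids. -/
theorem exists_survives {a b : G.V} (hab : G.graph.Adj a b) (hne : f a ≠ f b) :
    ∃ a' b', Survives G f a' b' ∧ f a' = f a ∧ f b' = f b := by
  have huv := D.map_eq
  have hpq := D.ne_pq
  obtain ⟨n1, n2, n3, n4⟩ := D.ne_all
  have hu := D.ne_uv
  have e1 := fun t (h : G.IsFace u v t) => isFace_unique h D.face_left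
  have e2 := fun t (h : G.IsFace v u t) => isFace_unique h D.face_right
  have a1 := adj_of_isFace (isFace_rot D.face_left)
  have a2 := adj_of_isFace (isFace_rot (isFace_rot D.face_left))
  have a3 := adj_of_isFace (isFace_rot D.face_right)
  have a4 := adj_of_isFace (isFace_rot (isFace_rot D.face_right))
  rcases D.survives_or hab with h | ⟨rfl, rfl⟩ | ⟨rfl, rfl⟩ | ⟨rfl, rfl⟩ | ⟨rfl, rfl⟩ | ⟨rfl, rfl⟩ |
    ⟨rfl, rfl⟩
  · exact ⟨a, b, h, rfl, rfl⟩
  · exact absurd huv hne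
  · exact absurd huv.symm hne
  · refine ⟨u, b, D.survives_of_forall a2.symm (huv ▸ hne) fun c hc => ?_, huv, rfl⟩
    refine ⟨(isFace_ne hc).2.2, ?_⟩
    rintro rfl
    exact hpq (e2 _ (isFace_rot (isFace_rot hc)))
  · refine ⟨a, v, D.survives_of_forall a1.symm (huv ▸ hne) fun c hc => ?_, rfl, huv.symm⟩
    refine ⟨?_, (isFace_ne hc).2.1.symm⟩
    rintro rfl
    exact hpq (e2 _ (isFace_rot hc))
  · refine ⟨v, b, D.survives_of_forall a4.symm (huv ▸ hne) fun c hc => ?_, huv.symm, rfl⟩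
    refine ⟨?_, (isFace_ne hc).2.2⟩
    rintro rfl
    exact hpq.symm (e1 _ (isFace_rot (isFace_rot hc)))
  · refine ⟨a, u, D.survives_of_forall a3.symm (huv ▸ hne) fun c hc => ?_, rfl, huv⟩
    refine ⟨(isFace_ne hc).2.1.symm, ?_⟩
    rintro rfl
    exact hpq.symm (e1 _ (isFace_rot hc))

/-- Two different darts with the same image have their unmerged end at a common neighbor of `u` and
`v`. By `common` this end is `p` or `q`, where only one dart of each direction survives. -/
theorem survives_unique {a b a' b' : G.V} (h : Survives G f a b) (h' : Survives G f a' b')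
    (ha : f a = f a') (hb : f b = f b') : a = a' ∧ b = b' := by
  have hadj := h.adj
  have hadj' := h'.adj
  have hne := h.1
  have hne' := h'.1
  obtain ⟨s1, s2, s3, s4⟩ := D.not_survives
  have hcm := D.common
  rw [Ne, D.eq_iff] at hne hne'
  rw [D.eq_iff] at ha hb
  have := hadj.symm
  have := hadj'.symm
  grind

theorem not_external_of_eq {a b : G.V} (ha : G.External a) (hb : G.External b)
    (h : f a = f b) : a = b := by
  rw [D.eq_iff] at h
  have := D.internal
  rcases h with h | ⟨rfl, rfl⟩ | ⟨rfl, rfl⟩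
  · exact h
  · exact absurd hb this
  · exact absurd ha this

theorem map_ne_of_isOuter {a b : G.V} (h : G.IsOuter a b) : f a ≠ f b := fun he =>
  (adj_of_isOuter h).ne (D.not_external_of_eq ⟨_, h⟩ (external_of_isOuter_right h) he)

theorem dart_iff (x y : W) : (Outer G f x y ∨ ∃ z, Face G f x y z) ↔
    x ≠ y ∧ ∃ a b, G.graph.Adj a b ∧ f a = x ∧ f b = y := by
  constructor
  · rintro (⟨a, b, h, rfl, rfl⟩ | ⟨z, ⟨hn, a, b, c, h, rfl, rfl, rfl⟩⟩)
    · exact ⟨D.map_ne_of_isOuter h, a, b, adj_of_isOuter h, rfl, rfl⟩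
    · exact ⟨hn.1, a, b, adj_of_isFace h, rfl, rfl⟩
  · rintro ⟨hne, a, b, hab, rfl, rfl⟩
    obtain ⟨a', b', h, h1, h2⟩ := D.exists_survives hab hne
    rcases h.2 with ho | ⟨c, hc, h3, h4⟩
    · exact Or.inl ⟨a', b', ho, h1, h2⟩
    · refine Or.inr ⟨f c, ⟨hne, ?_, ?_⟩, a', b', c, hc, h1, h2, rfl⟩
      · rw [← h2]; exact h4.symm
      · rw [← h1]; exact h3

theorem survives_of_face {a b c : G.V} (h : G.IsFace a b c) (h1 : f a ≠ f b) (h2 : f b ≠ f c)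
    (h3 : f c ≠ f a) : Survives G f a b := ⟨h1, Or.inr ⟨c, h, h3, h2.symm⟩⟩

theorem survives_of_isOuter {a b : G.V} (h : G.IsOuter a b) : Survives G f a b :=
  ⟨D.map_ne_of_isOuter h, Or.inl h⟩

theorem step_iff (S : W → Prop) {x y z : G.V}
    (hS : ∀ s t, Face G f s (f x) t ∨ (Outer G f s (f x) ∧ Outer G f (f x) t) → (S s ↔ S t))
    (h : G.Step x y z) (hy : f y ≠ f x) (hz : f z ≠ f x) : S (f y) ↔ S (f z) := by
  by_cases hyz : f y = f z
  · rw [hyz]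
  apply hS
  rcases h with h | h
  · exact Or.inl ⟨⟨hy, hz.symm, fun h => hyz h.symm⟩, y, x, z, h, rfl, rfl, rfl⟩
  · exact Or.inr ⟨⟨y, x, h.1, rfl, rfl⟩, ⟨x, z, h.2, rfl, rfl⟩⟩

theorem link (x : W) (S : W → Prop)
    (hS : ∀ s t, Face G f s x t ∨ (Outer G f s x ∧ Outer G f x t) → (S s ↔ S t)) (s t : W)
    (hs : Outer G f x s ∨ ∃ c, Face G f x s c) (ht : Outer G f x t ∨ ∃ c, Face G f x t c)
    (h : S s) : S t := by
  obtain ⟨x, rfl⟩ := D.surjective x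
  obtain ⟨hne1, a, y, hay, ha, rfl⟩ := (D.dart_iff _ _).1 hs
  obtain ⟨hne2, b, z, hbz, hb, rfl⟩ := (D.dart_iff _ _).1 ht
  by_cases hx : x = u ∨ x = v
  · have hfx : f x = f u := by rcases hx with rfl | rfl; rfl; exact D.map_eq.symm
    have huv := D.map_eq
    have au := adj_of_isFace D.face_left
    obtain ⟨n1, n2, n3, n4⟩ := D.ne_all
    -- The link of the merged vertex consists of the turn around `u` without `v` and the turn around
    -- `v` without `u`. Both are connected, and `p` lies on both.
    have key : ∀ w e : G.V, (w = u ∧ e = v ∨ w = v ∧ e = u) → ∀ t, G.graph.Adj w t → t ≠ e →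
        (S (f t) ↔ S (f p)) := by
      intro w e hwe t ht hte
      have h1 : ∀ y, G.graph.Adj w y → y ≠ e → f y ≠ f x := by
        intro y hy hye
        have := hy.ne
        rw [hfx, Ne, D.eq_iff]
        rcases hwe with ⟨rfl, rfl⟩ | ⟨rfl, rfl⟩ <;> grind
      have hfw : f w = f x := by
        rcases hwe with ⟨rfl, rfl⟩ | ⟨rfl, rfl⟩
        · exact hfx.symm
        · rw [hfx, huv]
      refine nbr_induction_punctured (v := w) (e := e) (fun y => S (f y)) ?_ ?_ ht ?_ hte ?_
      · rcases hwe with ⟨rfl, rfl⟩ | ⟨rfl, rfl⟩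
        · exact au
        · exact au.symm
      · intro y z hy hz hst
        obtain ⟨h2, h3⟩ := step_adj hst
        refine D.step_iff S (by rw [hfw]; exact hS) hst ?_ ?_
        · rw [hfw]; exact h1 _ h2 hy
        · rw [hfw]; exact h1 _ h3 hz
      · rcases hwe with ⟨rfl, rfl⟩ | ⟨rfl, rfl⟩
        · exact (adj_of_isFace (isFace_rot (isFace_rot D.face_left))).symm
        · exact adj_of_isFace (isFace_rot D.face_left)
      · rcases hwe with ⟨rfl, rfl⟩ | ⟨rfl, rfl⟩
        · exact n2
        · exact n1
    have key2 : ∀ a y, G.graph.Adj a y → f a = f x → f x ≠ f y → (S (f y) ↔ S (f p)) := by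
      intro a y hay ha hne
      rw [hfx] at ha hne
      rcases (D.eq_iff _ _).1 ha with rfl | ⟨rfl, -⟩ | ⟨rfl, -⟩
      · exact key a v (Or.inl ⟨rfl, rfl⟩) y hay fun h => hne (h ▸ huv)
      · exact key a v (Or.inl ⟨rfl, rfl⟩) y hay fun h => hne (h ▸ huv)
      · exact key a u (Or.inr ⟨rfl, rfl⟩) y hay fun h => hne (h ▸ rfl)
    exact (key2 b z hbz hb hne2).2 ((key2 a y hay ha hne1).1 h)
  · have hfib : ∀ a, f a = f x → a = x := by
      intro a ha
      rw [D.eq_iff] at ha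
      tauto
    rw [hfib a ha] at hay
    rw [hfib b hb] at hbz
    refine nbr_induction (v := x) (fun y => S (f y)) hay h ?_ hbz
    intro y z hst hy
    obtain ⟨h2, h3⟩ := step_adj hst
    exact (D.step_iff S hS hst (fun h => h2.ne (hfib _ h).symm)
      (fun h => h3.ne (hfib _ h).symm)).1 hy

theorem outer_ncard : {x : W × W | Outer G f x.1 x.2}.ncard =
    {x : G.V × G.V | G.IsOuter x.1 x.2}.ncard := by
  have : {x : W × W | Outer G f x.1 x.2} =
      Prod.map f f '' {p : G.V × G.V | G.IsOuter p.1 p.2} := by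
    ext ⟨p, q⟩
    constructor
    · rintro ⟨a, b, h, rfl, rfl⟩
      exact ⟨(a, b), h, rfl⟩
    · rintro ⟨⟨a, b⟩, h, he⟩
      obtain ⟨rfl, rfl⟩ := Prod.mk.inj he
      exact ⟨a, b, h, rfl, rfl⟩
  rw [this, Set.InjOn.ncard_image]
  rintro ⟨a, b⟩ h ⟨a', b'⟩ h' he
  obtain ⟨h1, h2⟩ := Prod.mk.inj he
  exact Prod.ext (D.not_external_of_eq ⟨_, h⟩ ⟨_, h'⟩ h1)
    (D.not_external_of_eq (external_of_isOuter_right h) (external_of_isOuter_right h') h2)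

/-- Three edges disappear: `uv` and one of each parallel pair. The loss of six darts matches the
loss of one vertex in `count`. -/
theorem dart_ncard : {x : W × W | Outer G f x.1 x.2 ∨ ∃ c, Face G f x.1 x.2 c}.ncard + 6 =
    {x : G.V × G.V | G.graph.Adj x.1 x.2}.ncard := by
  have h1 : {x : W × W | Outer G f x.1 x.2 ∨ ∃ c, Face G f x.1 x.2 c} =
      Prod.map f f '' {x : G.V × G.V | Survives G f x.1 x.2} := by
    ext ⟨x, y⟩
    refine (D.dart_iff x y).trans ⟨?_, ?_⟩
    · rintro ⟨hne, a, b, hab, rfl, rfl⟩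
      obtain ⟨a', b', h, h1, h2⟩ := D.exists_survives hab hne
      exact ⟨(a', b'), h, Prod.ext h1 h2⟩
    · rintro ⟨⟨a, b⟩, h, he⟩
      obtain ⟨rfl, rfl⟩ := Prod.mk.inj he
      exact ⟨h.1, a, b, Survives.adj h, rfl, rfl⟩
  have h2 : {x : G.V × G.V | Survives G f x.1 x.2} = {x : G.V × G.V | G.graph.Adj x.1 x.2} \
      {(u, v), (v, u), (v, p), (p, u), (u, q), (q, v)} := by
    obtain ⟨s1, s2, s3, s4⟩ := D.not_survives
    have huv := D.map_eq
    ext ⟨a, b⟩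
    simp only [Set.mem_ofPred_eq, Set.mem_sdiff, Set.mem_insert_iff, Set.mem_singleton_iff,
      Prod.mk.injEq]
    constructor
    · intro h
      refine ⟨h.adj, ?_⟩
      have := h.1
      grind
    · rintro ⟨h, h'⟩
      exact (D.survives_or h).resolve_right h'
  have h3 : ({(u, v), (v, u), (v, p), (p, u), (u, q), (q, v)} : Set (G.V × G.V)).ncard = 6 := by
    obtain ⟨n1, n2, n3, n4⟩ := D.ne_all
    have n5 := D.ne_uv
    have n6 := D.ne_pq
    have e : ({(u, v), (v, u), (v, p), (p, u), (u, q), (q, v)} : Set (G.V × G.V)) =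
        ((↑) '' {x | x ∈ [(u, v), (v, u), (v, p), (p, u), (u, q), (q, v)]}) := by
      ext x; simp
    have h : [(u, v), (v, u), (v, p), (p, u), (u, q), (q, v)].Nodup := by
      simp only [List.nodup_cons, List.mem_cons, Prod.mk.injEq, List.not_mem_nil]
      grind
    classical
    have := List.toFinset_card_of_nodup h
    rw [← Set.ncard_coe_finset] at this
    simpa using this
  have h4 : ({(u, v), (v, u), (v, p), (p, u), (u, q), (q, v)} : Set (G.V × G.V)) ⊆
      {x : G.V × G.V | G.graph.Adj x.1 x.2} := by
    have a0 := adj_of_isFace D.face_left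
    have a1 := adj_of_isFace (isFace_rot D.face_left)
    have a2 := adj_of_isFace (isFace_rot (isFace_rot D.face_left))
    have a3 := adj_of_isFace (isFace_rot D.face_right)
    have a4 := adj_of_isFace (isFace_rot (isFace_rot D.face_right))
    rintro x (rfl | rfl | rfl | rfl | rfl | rfl)
    · exact a0
    · exact a0.symm
    · exact a1
    · exact a2
    · exact a3
    · exact a4
  rw [h1, Set.InjOn.ncard_image, h2, ← h3, Set.ncard_sdiff_add_ncard_of_subset h4]
  rintro ⟨a, b⟩ h ⟨a', b'⟩ h' he
  obtain ⟨h1, h2⟩ := Prod.mk.inj he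
  obtain ⟨h3, h4⟩ := D.survives_unique h h' h1 h2
  exact Prod.ext h3 h4

def diskData (hW : Nat.card W + 1 = Nat.card G.V) : DiskData W where
  finite := Finite.of_surjective _ D.surjective
  face := Face G f
  outer := Outer G f
  face_rot := by
    rintro _ _ _ ⟨⟨h1, h2, h3⟩, a, b, c, h, rfl, rfl, rfl⟩
    exact ⟨⟨h2, h3, h1⟩, b, c, a, isFace_rot h, rfl, rfl, rfl⟩
  face_unique := by
    rintro _ _ _ _ ⟨⟨h1, h2, h3⟩, a, b, c, h, rfl, rfl, rfl⟩
      ⟨⟨h1', h2', h3'⟩, a', b', c', h', ha, hb, rfl⟩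
    rw [← ha, ← hb] at h1'
    rw [← hb] at h2'
    rw [← ha] at h3'
    obtain ⟨rfl, rfl⟩ := D.survives_unique (D.survives_of_face h h1 h2 h3)
      (D.survives_of_face h' h1' h2' h3') ha.symm hb.symm
    rw [isFace_unique h h']
  face_ne h := h.1.1
  outer_ne := by
    rintro _ _ ⟨a, b, h, rfl, rfl⟩
    exact D.map_ne_of_isOuter h
  outer_right_unique := by
    rintro _ _ _ ⟨a, b, h, rfl, rfl⟩ ⟨a', b', h', ha, rfl⟩
    rw [D.not_external_of_eq ⟨_, h'⟩ ⟨_, h⟩ ha] at h'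
    rw [isOuter_right_unique h h']
  outer_left_unique := by
    rintro _ _ _ ⟨a, b, h, rfl, rfl⟩ ⟨a', b', h', rfl, hb⟩
    rw [D.not_external_of_eq (external_of_isOuter_right h') (external_of_isOuter_right h) hb] at h'
    rw [isOuter_left_unique h h']
  outer_succ := by
    rintro _ _ ⟨a, b, h, rfl, rfl⟩
    obtain ⟨c, hc⟩ := isOuter_succ h
    exact ⟨f c, b, c, hc, rfl, rfl⟩
  not_outer := by
    rintro _ _ _ ⟨⟨h1, h2, h3⟩, a, b, c, h, rfl, rfl, rfl⟩ ⟨a', b', h', ha, hb⟩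
    obtain ⟨rfl, rfl⟩ := D.survives_unique (D.survives_of_face h h1 h2 h3)
      (D.survives_of_isOuter h') ha.symm hb.symm
    exact not_isOuter_of_isFace h h'
  symm := by
    intro a b h
    rw [D.dart_iff] at h ⊢
    obtain ⟨hne, a, b, h, rfl, rfl⟩ := h
    exact ⟨hne.symm, b, a, h.symm, rfl, rfl⟩
  outer_induction := by
    rintro S _ _ ⟨a, b, h, rfl, rfl⟩ ha hS _ _ ⟨x, y, h', rfl, rfl⟩
    exact isOuter_induction (fun x => S (f x)) h ha
      (fun x y hxy => hS _ _ ⟨x, y, hxy, rfl, rfl⟩) h'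
  link := D.link
  nonempty := ⟨f u⟩
  connected := by
    intro S hS x y hx
    obtain ⟨x, rfl⟩ := D.surjective x
    obtain ⟨y, rfl⟩ := D.surjective y
    refine closed_eq_univ (fun x => S (f x)) hx ?_ y
    intro a b ha hab
    by_cases hne : f a = f b
    · rwa [← hne]
    · exact (hS _ _ ((D.dart_iff _ _).2 ⟨hne, a, b, hab, rfl, rfl⟩)).1 ha
  outer_length := by
    rw [D.outer_ncard, ← faceLength_outer_eq]
    exact G.outer_length
  count := by
    have h1 := D.outer_ncard
    have h2 := D.dart_ncard
    have h3 := G.count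
    rw [faceLength_outer_eq] at h3
    omega

theorem contr (hW : Nat.card W + 1 = Nat.card G.V) : Contr G (D.diskData hW).toCanvas f where
  surjective := D.surjective
  adj x y := ((D.diskData hW).toCanvas_adj x y).trans (D.dart_iff x y)
  face x y z := (D.diskData hW).toCanvas_isFace x y z
  face_inj := by
    intro a b c a' b' c' h h' h1 h2 h3 ha hb hc
    obtain ⟨rfl, rfl⟩ := D.survives_unique (D.survives_of_face h h1 h2 h3)
      (D.survives_of_face h' (by rwa [← ha, ← hb]) (by rwa [← hb, ← hc]) (by rwa [← ha, ← hc]))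
      ha hb
    exact ⟨rfl, rfl, isFace_unique h h'⟩
  outer x y := (D.diskData hW).toCanvas_isOuter x y
  ext_inj a b := D.not_external_of_eq

end EdgeContr

/-- An edge `uv` with `v` internal can be contracted when all triangles through it are facial. -/
theorem exists_contr_edge {u v : G.V} (huv : G.graph.Adj u v) (hv : G.Internal v)
    (h : ∀ t, G.graph.Adj t u → G.graph.Adj t v → {u, v, t} ∈ G.facial) :
    ∃ (H : Canvas.{u}) (f : G.V → H.V), Contr G H f ∧
      (∀ a b, f a = f b ↔ a = b ∨ (a = u ∧ b = v) ∨ (a = v ∧ b = u)) ∧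
      Nat.card H.V + 1 = Nat.card G.V := by
  classical
  obtain ⟨p, hp⟩ := isFace_of_internal huv (Or.inr hv)
  obtain ⟨q, hq⟩ := isFace_of_internal huv.symm (Or.inl hv)
  let W : Type u := {x : G.V // x ≠ v}
  let f : G.V → W := fun x => if hx : x = v then ⟨u, huv.ne⟩ else ⟨x, hx⟩
  have D : EdgeContr G W f u v p q := by
    refine ⟨hv, hp, hq, ?_, ?_, ?_⟩
    · intro t ht1 ht2
      rcases facial_iff.1 (h t ht1 ht2) with h | h
      · exact Or.inl (isFace_unique h hp)
      · exact Or.inr (isFace_unique h hq)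
    · rintro ⟨x, hx⟩
      exact ⟨x, by simp [f, hx]⟩
    · intro a b
      have := huv.ne
      by_cases ha : a = v <;> by_cases hb : b = v <;> simp [f, ha, hb] <;> grind
  have hW : Nat.card W + 1 = Nat.card G.V := by
    have h1 := Set.ncard_add_ncard_compl ({v} : Set G.V)
    have h2 : Nat.card W = ({v}ᶜ : Set G.V).ncard := rfl
    rw [Set.ncard_singleton] at h1
    omega
  exact ⟨(D.diskData hW).toCanvas, f, D.contr hW, D.eq_iff, hW⟩

end Canvas

namespace Canvas

variable {G : Canvas.{u}}

/-! ## Local structure of canvases in which every triangle is facial -/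

/-- Every triangle is facial. -/
def Tri (G : Canvas.{u}) : Prop :=
  ∀ a b c : G.V, G.graph.Adj a b → G.graph.Adj b c → G.graph.Adj c a → {a, b, c} ∈ G.facial

theorem IsCandidate.tri {ℓ : ℕ} (hG : G.IsCandidate ℓ) : G.Tri := hG.triangle_facial

/-- An edge with an internal end has a triangle on either side, and there is no other triangle
through it because all triangles are facial. -/
theorem exists_common (hT : G.Tri) {u v : G.V} (hv : G.Internal v) (huv : G.graph.Adj u v) :
    ∃ p q, p ≠ q ∧ ∀ t, (G.graph.Adj t u ∧ G.graph.Adj t v) ↔ (t = p ∨ t = q) := by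
  obtain ⟨p, hp⟩ := isFace_of_internal huv (Or.inr hv)
  obtain ⟨q, hq⟩ := isFace_of_internal huv.symm (Or.inl hv)
  refine ⟨p, q, opposite_ne hp hq, fun t => ⟨?_, ?_⟩⟩
  · rintro ⟨h1, h2⟩
    rcases facial_iff.1 (hT u v t huv h2.symm h1) with h | h
    · exact Or.inl (isFace_unique h hp)
    · exact Or.inr (isFace_unique h hq)
  · rintro (rfl | rfl)
    · exact ⟨adj_of_isFace (isFace_rot (isFace_rot hp)), (adj_of_isFace (isFace_rot hp)).symm⟩
    · exact ⟨(adj_of_isFace (isFace_rot hq)).symm, adj_of_isFace (isFace_rot (isFace_rot hq))⟩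

/-- If each element of a set of neighbors of `w` has two common neighbors with `w` in the set, then
the set contains all neighbors of `w`, and `w` is internal. -/
theorem nbr_closed (hT : G.Tri) {w : G.V} (S : G.V → Prop) {s₀ : G.V} (hs₀ : S s₀)
    (hS : ∀ s, S s → G.graph.Adj w s ∧ ∃ a b, S a ∧ S b ∧ a ≠ b ∧ G.graph.Adj s a ∧
      G.graph.Adj s b) : G.Internal w ∧ ∀ t, G.graph.Adj w t → S t := by
  -- On each side of `ws` there is at most one triangle, so the distinct common neighbors `a` and
  -- `b` lie on different sides. Hence the rotation at `w` leads from `s` to a vertex of `S`, and no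
  -- dart from `w` to `S` is outer.
  have key : ∀ s, S s → (∃ a, S a ∧ G.IsFace s w a) ∧ ∃ a, G.IsFace w s a := by
    intro s hs
    obtain ⟨h1, a, b, ha, hb, hab, h2, h3⟩ := hS s hs
    have ha' := (hS a ha).1
    have hb' := (hS b hb).1
    rcases facial_iff.1 (hT s w a h1.symm ha' h2.symm) with h | h <;>
      rcases facial_iff.1 (hT s w b h1.symm hb' h3.symm) with h' | h'
    · exact absurd (isFace_unique h h') hab
    · exact ⟨⟨a, ha, h⟩, b, h'⟩
    · exact ⟨⟨b, hb, h'⟩, a, h⟩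
    · exact absurd (isFace_unique h h') hab
  have hall : ∀ t, G.graph.Adj w t → S t := by
    intro t ht
    refine nbr_induction S (hS s₀ hs₀).1 hs₀ ?_ ht
    intro x y hxy hx
    obtain ⟨a, ha, h⟩ := (key x hx).1
    rw [step_unique hxy (Or.inl h)]
    exact ha
  refine ⟨?_, hall⟩
  rintro ⟨t, ht⟩
  obtain ⟨a, ha⟩ := (key t (hall t (adj_of_isOuter ht))).2
  exact not_isOuter_of_isFace ha ht

theorem length_le_deg {v : G.V} {L : List G.V} (hL : L.Nodup) (h : ∀ t ∈ L, G.graph.Adj v t) :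
    L.length ≤ G.deg v := by
  classical
  rw [← List.toFinset_card_of_nodup hL, ← Set.ncard_coe_finset]
  exact Set.ncard_le_ncard (fun t ht => h t (by simpa using ht)) (Set.toFinite _)

theorem deg_le_length {v : G.V} {L : List G.V} (h : ∀ t, G.graph.Adj v t → t ∈ L) :
    G.deg v ≤ L.length := by
  classical
  refine le_trans ?_ L.toFinset_card_le
  rw [← Set.ncard_coe_finset]
  exact Set.ncard_le_ncard (fun t ht => by simpa using h t ht) (Set.toFinite _)

theorem mem_of_deg_le {v : G.V} {L : List G.V} (hL : L.Nodup) (h : ∀ t ∈ L, G.graph.Adj v t)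
    (hd : G.deg v ≤ L.length) (t : G.V) (ht : G.graph.Adj v t) : t ∈ L := by
  by_contra hn
  have := length_le_deg (v := v) (List.nodup_cons.2 ⟨hn, hL⟩) (by
    intro s hs
    rcases List.mem_cons.1 hs with rfl | hs
    · exact ht
    · exact h s hs)
  rw [List.length_cons] at this
  omega

/-- By `nbr_closed`, the vertex `w` would be internal with only the four neighbors `a`, `b`, `c`,
`d`. This is the standard contradiction in the arguments about 4-cycles below. -/
theorem not_closed_four {ℓ : ℕ} (hG : G.IsCandidate ℓ) {w a b c d : G.V} (ha : G.graph.Adj w a)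
    (hb : G.graph.Adj w b) (hc : G.graph.Adj w c) (hd : G.graph.Adj w d) (hab : G.graph.Adj a b)
    (hbc : G.graph.Adj b c) (hcd : G.graph.Adj c d) (hda : G.graph.Adj d a) (hac : a ≠ c)
    (hbd : b ≠ d) : False := by
  obtain ⟨h1, h2⟩ := nbr_closed hG.tri (w := w) (fun t => t = a ∨ t = b ∨ t = c ∨ t = d)
    (Or.inl rfl) (by
      rintro s (rfl | rfl | rfl | rfl)
      · exact ⟨ha, b, d, by simp, by simp, hbd, hab, hda.symm⟩
      · exact ⟨hb, a, c, by simp, by simp, hac, hab.symm, hbc⟩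
      · exact ⟨hc, b, d, by simp, by simp, hbd, hbc.symm, hcd⟩
      · exact ⟨hd, a, c, by simp, by simp, hac, hda, hcd.symm⟩)
  have := deg_le_length (v := w) (L := [a, b, c, d]) (by simpa using h2)
  have := hG.five_le_deg w h1
  simp at *
  omega

/-- An internal vertex `v` of degree five and the cycle `abcde` through its neighbors. -/
structure W5 (G : Canvas.{u}) (v a b c d e : G.V) : Prop where
  internal : G.Internal v
  nbr : ∀ t, G.graph.Adj v t ↔ t = a ∨ t = b ∨ t = c ∨ t = d ∨ t = e
  nodup : [a, b, c, d, e].Nodup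
  ab : G.graph.Adj a b
  bc : G.graph.Adj b c
  cd : G.graph.Adj c d
  de : G.graph.Adj d e
  ea : G.graph.Adj e a
  ac : ¬ G.graph.Adj a c
  bd : ¬ G.graph.Adj b d
  ce : ¬ G.graph.Adj c e
  da : ¬ G.graph.Adj d a
  eb : ¬ G.graph.Adj e b

namespace W5

variable {v a b c d e : G.V}

theorem rot (h : G.W5 v a b c d e) : G.W5 v b c d e a where
  internal := h.internal
  nbr t := by rw [h.nbr]; tauto
  nodup := by have := h.nodup; simp at this ⊢; grind
  ab := h.bc
  bc := h.cd
  cd := h.de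
  de := h.ea
  ea := h.ab
  ac := h.bd
  bd := h.ce
  ce := h.da
  da := h.eb
  eb := h.ac

theorem refl (h : G.W5 v a b c d e) : G.W5 v a e d c b where
  internal := h.internal
  nbr t := by rw [h.nbr]; tauto
  nodup := by have := h.nodup; simp at this ⊢; grind
  ab := h.ea.symm
  bc := h.de.symm
  cd := h.cd.symm
  de := h.bc.symm
  ea := h.ab.symm
  ac h' := h.da h'.symm
  bd h' := h.ce h'.symm
  ce h' := h.bd h'.symm
  da h' := h.ac h'.symm
  eb h' := h.eb h'.symm

theorem adj (h : G.W5 v a b c d e) : G.graph.Adj v a ∧ G.graph.Adj v b ∧ G.graph.Adj v c ∧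
    G.graph.Adj v d ∧ G.graph.Adj v e := by
  simp [h.nbr]

theorem ne (h : G.W5 v a b c d e) : a ≠ b ∧ a ≠ c ∧ a ≠ d ∧ a ≠ e ∧ b ≠ c ∧ b ≠ d ∧ b ≠ e ∧
    c ≠ d ∧ c ≠ e ∧ d ≠ e := by
  have := h.nodup
  simp at this
  tauto

theorem ne_hub (h : G.W5 v a b c d e) : v ≠ a ∧ v ≠ b ∧ v ≠ c ∧ v ≠ d ∧ v ≠ e := by
  obtain ⟨h1, h2, h3, h4, h5⟩ := h.adj
  exact ⟨h1.ne, h2.ne, h3.ne, h4.ne, h5.ne⟩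

theorem internalFive (h : G.W5 v a b c d e) : G.InternalFive v := by
  refine ⟨h.internal, le_antisymm ?_ ?_⟩
  · exact deg_le_length (L := [a, b, c, d, e]) (by simp [h.nbr])
  · exact length_le_deg (L := [a, b, c, d, e]) h.nodup (by simp [h.nbr])

end W5

/-- From `a`, `b`, keep taking the second common neighbor with `v`. By `nbr_closed`, a return after
three or four steps would give `v` degree at most four, so the walk closes after exactly five steps.
A chord of the resulting cycle would be a third common neighbor of an edge at `v`. -/
theorem exists_W5 (hT : G.Tri) {v a b : G.V} (hv : G.InternalFive v) (ha : G.graph.Adj v a)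
    (hb : G.graph.Adj v b) (hab : G.graph.Adj a b) : ∃ c d e, G.W5 v a b c d e := by
  have hc : ∀ x y, G.graph.Adj v x → G.graph.Adj v y → G.graph.Adj x y → ∃ z, z ≠ y ∧
      ∀ t, (G.graph.Adj t x ∧ G.graph.Adj t v) ↔ (t = y ∨ t = z) := by
    intro x y hx hy hxy
    obtain ⟨p, q, hpq, h⟩ := exists_common hT hv.1 hx.symm
    rcases (h y).1 ⟨hxy.symm, hy.symm⟩ with rfl | rfl
    · exact ⟨q, hpq.symm, h⟩
    · exact ⟨p, hpq, fun t => (h t).trans or_comm⟩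
  obtain ⟨c, c1, c2⟩ := hc b a hb ha hab.symm
  obtain ⟨c3, c4⟩ := (c2 c).2 (Or.inr rfl)
  obtain ⟨d, d1, d2⟩ := hc c b c4.symm hb c3
  obtain ⟨d3, d4⟩ := (d2 d).2 (Or.inr rfl)
  obtain ⟨e, e1, e2⟩ := hc d c d4.symm c4.symm d3
  obtain ⟨e3, e4⟩ := (e2 e).2 (Or.inr rfl)
  have hdeg := hv.2
  have nd : d ≠ a := by
    rintro rfl
    obtain ⟨-, h⟩ := nbr_closed hT (w := v) (fun t => t = d ∨ t = b ∨ t = c) (Or.inl rfl) (by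
      rintro s (rfl | rfl | rfl)
      · exact ⟨ha, b, c, by simp, by simp, c3.ne.symm, hab, d3⟩
      · exact ⟨hb, d, c, by simp, by simp, c1.symm, hab.symm, c3.symm⟩
      · exact ⟨c4.symm, b, d, by simp, by simp, d1.symm, c3, d3.symm⟩)
    have := deg_le_length (v := v) (L := [d, b, c]) (by simpa using h)
    simp at this
    omega
  have nea : e ≠ a := by
    rintro rfl
    obtain ⟨-, h⟩ := nbr_closed hT (w := v) (fun t => t = e ∨ t = b ∨ t = c ∨ t = d)
      (Or.inl rfl) (by
      rintro s (rfl | rfl | rfl | rfl)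
      · exact ⟨ha, b, d, by simp, by simp, d1.symm, hab, e3⟩
      · exact ⟨hb, e, c, by simp, by simp, c1.symm, hab.symm, c3.symm⟩
      · exact ⟨c4.symm, b, d, by simp, by simp, d1.symm, c3, d3.symm⟩
      · exact ⟨d4.symm, c, e, by simp, by simp, c1, d3, e3.symm⟩)
    have := deg_le_length (v := v) (L := [e, b, c, d]) (by simpa using h)
    simp at this
    omega
  have neb : e ≠ b := by
    rintro rfl
    have := (c2 d).1 ⟨e3.symm, d4⟩
    rcases this with h | h
    · exact nd h
    · exact d3.ne h
  have hn : [a, b, c, d, e].Nodup := by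
    have := hab.ne
    have := c3.ne
    have := d3.ne
    have := e3.ne
    simp
    grind
  have hadj : ∀ t ∈ [a, b, c, d, e], G.graph.Adj v t := by
    have := c4.symm
    have := d4.symm
    have := e4.symm
    simp
    tauto
  have hmem := mem_of_deg_le hn hadj (by simp [hdeg])
  have hmem' : ∀ t, G.graph.Adj v t ↔ t = a ∨ t = b ∨ t = c ∨ t = d ∨ t = e := fun t =>
    ⟨fun h => by simpa using hmem t h, fun h => hadj t (by simpa using h)⟩
  obtain ⟨f, f1, f2⟩ := hc e d e4.symm d4.symm e3
  obtain ⟨f3, f4⟩ := (f2 f).2 (Or.inr rfl)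
  have hf := (hmem' f).1 f4.symm
  have hfa : f = a := by
    have := c2 e
    have := d2 e
    have := e2 e
    have := f3.ne
    have := f3.symm
    simp at hn
    rcases hf with h | h | h | h | h <;> subst h <;> grind
  subst hfa
  have ne := hn
  simp at ne
  refine ⟨c, d, e, hv.1, hmem', hn, hab, c3.symm, d3.symm, e3.symm, f3.symm, fun h => ?_, fun h => ?_,
    fun h => ?_, fun h => ?_, fun h => ?_⟩
  · have := (d2 f).1 ⟨h, ha.symm⟩
    tauto
  · have := (c2 d).1 ⟨h.symm, d4⟩
    tauto
  · have := (d2 e).1 ⟨h.symm, e4⟩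
    tauto
  · have := (e2 f).1 ⟨h.symm, ha.symm⟩
    tauto
  · have := (c2 e).1 ⟨h, e4⟩
    tauto

/-- The neighborhood of a neighbor `b` of degree five of a vertex `v` of degree five. -/
theorem W5.side (hT : G.Tri) {v a b c d e : G.V} (h : G.W5 v a b c d e) (hb : G.InternalFive b) :
    ∃ x y, G.W5 b v a x y c := by
  obtain ⟨h1, h2, h3, h4, h5⟩ := h.adj
  obtain ⟨x, y, z, hw⟩ := exists_W5 hT hb h2.symm h.ab.symm h1
  obtain ⟨w1, w2, w3, w4, w5⟩ := hw.adj
  have hz := (h.nbr z).1 hw.ea.symm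
  have := h.ne
  have := hw.ne
  have : z = c := by
    have := h.bd
    have := h.eb
    have := G.graph.adj_comm e b
    have := w5.ne
    rcases hz with h | h | h | h | h <;> subst h <;> first | rfl | grind
  subst this
  exact ⟨x, y, hw⟩

theorem IsCandidate.small_or_big {ℓ : ℕ} (hG : G.IsCandidate ℓ) (x : G.V) :
    G.InternalFive x ∨ (G.External x ∨ 6 ≤ G.deg x) := by
  by_cases hx : G.External x
  · exact Or.inr (Or.inl hx)
  · have := hG.five_le_deg x hx
    by_cases h : G.deg x = 5
    · exact Or.inl ⟨hx, h⟩
    · exact Or.inr (Or.inr (by omega))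

/-! ## Contractions in canvases in which every triangle is facial -/

namespace Contr

variable {H : Canvas.{u}} {f : G.V → H.V}

/-- The set `T` collects the neighbors that may be lost; the others must have distinct images. -/
theorem deg_le (hf : Contr G H f) {x : G.V} (hx : ∀ y, f y = f x → y = x) (T : Set G.V)
    (h : Set.InjOn f {y | G.graph.Adj x y ∧ y ∉ T}) : G.deg x ≤ H.deg (f x) + T.ncard := by
  have h1 : G.graph.neighborSet x ⊆ {y | G.graph.Adj x y ∧ y ∉ T} ∪ T := by
    intro y hy
    by_cases hyT : y ∈ T
    · exact Or.inr hyT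
    · exact Or.inl ⟨hy, hyT⟩
  have h2 : f '' {y | G.graph.Adj x y ∧ y ∉ T} ⊆ H.graph.neighborSet (f x) := by
    rintro _ ⟨y, ⟨hy, -⟩, rfl⟩
    exact hf.adj_of hy fun h => hy.ne (hx y h.symm).symm
  calc G.deg x ≤ ({y | G.graph.Adj x y ∧ y ∉ T} ∪ T).ncard :=
        Set.ncard_le_ncard h1 (Set.toFinite _)
    _ ≤ {y | G.graph.Adj x y ∧ y ∉ T}.ncard + T.ncard := Set.ncard_union_le _ _
    _ = (f '' {y | G.graph.Adj x y ∧ y ∉ T}).ncard + T.ncard := by rw [h.ncard_image]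
    _ ≤ _ := Nat.add_le_add_right (Set.ncard_le_ncard h2 (Set.toFinite _)) _

theorem internal_of (hf : Contr G H f) {a : G.V} (h : H.Internal (f a)) : G.Internal a :=
  fun h' => h (hf.external h')

theorem card_lt (hf : Contr G H f) {a b : G.V} (hab : a ≠ b) (h : f a = f b) :
    Nat.card H.V < Nat.card G.V := by
  have := Fintype.ofFinite G.V
  have := Fintype.ofFinite H.V
  rw [Nat.card_eq_fintype_card, Nat.card_eq_fintype_card]
  exact Fintype.card_lt_of_surjective_not_injective f hf.surjective fun hi => hab (hi h)

/-- After the contraction of a set `B`, all triangles are facial, provided that all cycles formed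
by an edge and a path through `B` have a shortcut. -/
theorem tri_of_set (hf : Contr G H f) (hT : G.Tri) (B : Set G.V)
    (hB : ∀ a b, f a = f b ↔ a = b ∨ (a ∈ B ∧ b ∈ B))
    (h : ∀ x y b b', x ∉ B → y ∉ B → b ∈ B → b' ∈ B → G.graph.Adj x b → G.graph.Adj y b' →
      G.graph.Adj x y → ∃ c ∈ B, G.graph.Adj x c ∧ G.graph.Adj y c) : H.Tri := by
  have key : ∀ b x y, b ∈ B → H.graph.Adj (f b) (f x) → H.graph.Adj (f b) (f y) →
      H.graph.Adj (f x) (f y) → {f b, f x, f y} ∈ H.facial := by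
    intro b x y hb h1 h2 h3
    have hx : x ∉ B := fun hx => h1.ne ((hB _ _).2 (Or.inr ⟨hb, hx⟩))
    have hy : y ∉ B := fun hy => h2.ne ((hB _ _).2 (Or.inr ⟨hb, hy⟩))
    obtain ⟨-, b1, x1, e1, e2, e3⟩ := (hf.adj _ _).1 h1
    obtain ⟨-, b2, y1, e4, e5, e6⟩ := (hf.adj _ _).1 h2
    obtain ⟨-, x2, y2, e7, e8, e9⟩ := (hf.adj _ _).1 h3
    have hx1 : x1 = x := ((hB _ _).1 e3).resolve_right fun h => hx h.2
    have hx2 : x2 = x := ((hB _ _).1 e8).resolve_right fun h => hx h.2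
    have hy1 : y1 = y := ((hB _ _).1 e6).resolve_right fun h => hy h.2
    have hy2 : y2 = y := ((hB _ _).1 e9).resolve_right fun h => hy h.2
    subst hx1 hy1 hx2 hy2
    have hb1 : b1 ∈ B := by rcases (hB _ _).1 e2 with rfl | h; exact hb; exact h.1
    have hb2 : b2 ∈ B := by rcases (hB _ _).1 e5 with rfl | h; exact hb; exact h.1
    obtain ⟨c, hc, h4, h5⟩ := h _ _ b1 b2 hx hy hb1 hb2 e1.symm e4.symm e7
    have hcb : f c = f b := (hB _ _).2 (Or.inr ⟨hc, hb⟩)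
    rw [← hcb] at h1 h2 ⊢
    exact hf.facial_of (hT _ _ _ h4.symm e7 h5) h1.ne h3.ne h2.ne.symm
  intro p q r hpq hqr hrp
  obtain ⟨a, rfl⟩ := hf.surjective p
  obtain ⟨b, rfl⟩ := hf.surjective q
  obtain ⟨c, rfl⟩ := hf.surjective r
  by_cases ha : a ∈ B
  · exact key a b c ha hpq hrp.symm hqr
  by_cases hb : b ∈ B
  · rw [Set.insert_comm]
    exact key b a c hb hpq.symm hqr hrp.symm
  by_cases hc : c ∈ B
  · have : ({f a, f b, f c} : Set H.V) = {f c, f a, f b} := by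
      rw [Set.insert_comm (f c), Set.pair_comm (f c)]
    rw [this]
    exact key c a b hc hrp hqr.symm hpq
  obtain ⟨-, a1, b1, e1, e2, e3⟩ := (hf.adj _ _).1 hpq
  obtain ⟨-, b2, c2, e4, e5, e6⟩ := (hf.adj _ _).1 hqr
  obtain ⟨-, c3, a3, e7, e8, e9⟩ := (hf.adj _ _).1 hrp
  rw [hB] at e2 e3 e5 e6 e8 e9
  have : a1 = a := e2.resolve_right fun h => ha h.2
  have : a3 = a := e9.resolve_right fun h => ha h.2
  have : b1 = b := e3.resolve_right fun h => hb h.2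
  have : b2 = b := e5.resolve_right fun h => hb h.2
  have : c2 = c := e6.resolve_right fun h => hc h.2
  have : c3 = c := e8.resolve_right fun h => hc h.2
  subst_vars
  exact hf.facial_of (hT _ _ _ e1 e4 e7) hpq.ne hqr.ne hrp.ne

theorem isContraction (hf : Contr G H f) {E : Set (Sym2 G.V)} (hE : E ⊆ G.graph.edgeSet)
    (h1 : ∀ a b, s(a, b) ∈ E → f a = f b)
    (h2 : ∀ a b, f a = f b → (SimpleGraph.fromEdgeSet E).Reachable a b) :
    IsContraction G H E f where
  edges := hE
  surjective := hf.surjective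
  fibers a b := by
    refine ⟨h2 a b, ?_⟩
    rintro ⟨p⟩
    induction p with
    | nil => rfl
    | cons h _ ih => exact (h1 _ _ ((SimpleGraph.fromEdgeSet_adj _).1 h).1).trans ih
  adj := hf.adj
  face := hf.face
  face_inj := hf.face_inj
  outer := hf.outer

theorem isCandidate (hf : Contr G H f) {ℓ : ℕ} (hG : G.sys.faceLength G.outer = ℓ) (hT : H.Tri)
    (hd : ∀ v, H.Internal v → 5 ≤ H.deg v) : H.IsCandidate ℓ :=
  ⟨hf.faceLength_outer.trans hG, hT, hd⟩

end Contr

theorem pair_eq_iff {u v a b : G.V} : (a = b ∨ a ∈ ({u, v} : Set G.V) ∧ b ∈ ({u, v} : Set G.V)) ↔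
    (a = b ∨ (a = u ∧ b = v) ∨ (a = v ∧ b = u)) := by
  simp only [Set.mem_insert_iff, Set.mem_singleton_iff]
  grind

/-- The contraction of an edge that is not in a chordless 4-cycle. -/
theorem exists_contr_edge_tri (hT : G.Tri) {u v : G.V} (huv : G.graph.Adj u v) (hv : G.Internal v)
    (h : ∀ a b, G.graph.Adj v a → G.graph.Adj a b → G.graph.Adj b u → a ≠ u → b ≠ v →
      G.graph.Adj v b ∨ G.graph.Adj u a) :
    ∃ (H : Canvas.{u}) (f : G.V → H.V), Contr G H f ∧
      (∀ a b, f a = f b ↔ a = b ∨ (a = u ∧ b = v) ∨ (a = v ∧ b = u)) ∧ H.Tri ∧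
      (∀ x, x ≠ u → x ≠ v → G.deg x ≤ H.deg (f x) + 1) ∧
      (∀ x, x ≠ u → x ≠ v → ¬ (G.graph.Adj x u ∧ G.graph.Adj x v) → G.deg x ≤ H.deg (f x)) ∧
      G.deg u + G.deg v ≤ H.deg (f u) + 4 := by
  obtain ⟨H, f, hf, hfib, -⟩ := exists_contr_edge huv hv fun t h1 h2 => hT _ _ _ huv h2.symm h1
  refine ⟨H, f, hf, hfib, ?_, ?_, ?_, ?_⟩
  · refine hf.tri_of_set hT {u, v} (fun a b => (hfib a b).trans pair_eq_iff.symm) ?_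
    intro x y b b' hx hy hb hb' h1 h2 h3
    simp only [Set.mem_insert_iff, Set.mem_singleton_iff, not_or] at hx hy hb hb'
    simp only [Set.mem_insert_iff, Set.mem_singleton_iff, exists_eq_or_imp, exists_eq_left]
    rcases hb with rfl | rfl <;> rcases hb' with rfl | rfl
    · exact Or.inl ⟨h1, h2⟩
    · rcases h y x h2.symm h3.symm h1 hy.1 hx.2 with h | h
      · exact Or.inr ⟨h.symm, h2⟩
      · exact Or.inl ⟨h1, h.symm⟩
    · rcases h x y h1.symm h3 h2 hx.1 hy.2 with h | h
      · exact Or.inr ⟨h1, h.symm⟩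
      · exact Or.inl ⟨h.symm, h2⟩
    · exact Or.inr ⟨h1, h2⟩
  · intro x hx hx'
    have := hf.deg_le (x := x) (fun y hy => by rw [hfib] at hy; tauto) {v} (by
      rintro y ⟨hy, hyv⟩ z ⟨hz, hzv⟩ hyz
      rw [hfib] at hyz
      rw [Set.mem_singleton_iff] at hyv hzv
      tauto)
    rwa [Set.ncard_singleton] at this
  · intro x hx hx' hn
    have := hf.deg_le (x := x) (fun y hy => by rw [hfib] at hy; tauto) ∅ (by
      rintro y ⟨hy, -⟩ z ⟨hz, -⟩ hyz
      rw [hfib] at hyz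
      rcases hyz with h | ⟨rfl, rfl⟩ | ⟨rfl, rfl⟩
      · exact h
      · exact absurd ⟨hy, hz⟩ hn
      · exact absurd ⟨hz, hy⟩ hn)
    rwa [Set.ncard_empty] at this
  -- The constant 4: the edge `uv` is counted at both of its ends, and each of the two common
  -- neighbors is counted twice.
  · obtain ⟨p, q, hpq, hc⟩ := exists_common hT hv huv
    have hfuv : f u = f v := (hfib _ _).2 (Or.inr (Or.inl ⟨rfl, rfl⟩))
    let A : Set G.V := G.graph.neighborSet u \ {v}
    let B : Set G.V := G.graph.neighborSet v \ {u}
    have h1 : f '' (A ∪ B) ⊆ H.graph.neighborSet (f u) := by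
      rintro _ ⟨y, hy | hy, rfl⟩
      · refine hf.adj_of hy.1 fun h => ?_
        have := SimpleGraph.Adj.ne hy.1
        have := hy.2
        rw [Set.mem_singleton_iff] at this
        rw [hfib] at h
        grind
      · change H.graph.Adj (f u) (f y)
        rw [hfuv]
        refine hf.adj_of hy.1 fun h => ?_
        have := SimpleGraph.Adj.ne hy.1
        have := hy.2
        rw [Set.mem_singleton_iff] at this
        rw [hfib] at h
        grind
    have h2 : Set.InjOn f (A ∪ B) := by
      intro y hy z hz hyz
      have n1 : ∀ y ∈ A ∪ B, y ≠ u ∧ y ≠ v := by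
        rintro y (hy | hy)
        · exact ⟨(SimpleGraph.Adj.ne hy.1).symm, hy.2⟩
        · exact ⟨hy.2, (SimpleGraph.Adj.ne hy.1).symm⟩
      have := n1 y hy
      have := n1 z hz
      rw [hfib] at hyz
      tauto
    have h3 : A ∩ B ⊆ {p, q} := by
      rintro t ⟨ht1, ht2⟩
      exact (hc t).1 ⟨ht1.1.symm, ht2.1.symm⟩
    have h4 := Set.ncard_union_add_ncard_inter A B
    have h5 : A.ncard + 1 = G.deg u := Set.ncard_sdiff_singleton_add_one huv
    have h6 : B.ncard + 1 = G.deg v := Set.ncard_sdiff_singleton_add_one huv.symm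
    have h7 : (A ∩ B).ncard ≤ 2 :=
      (Set.ncard_le_ncard h3 (Set.toFinite _)).trans (Set.ncard_pair hpq).le
    have h8 := Set.ncard_le_ncard h1 (Set.toFinite _)
    rw [h2.ncard_image] at h8
    change _ ≤ H.deg (f u) at h8
    omega

/-- The canvas `G` can be contracted to a smaller candidate. -/
def Reducible (G : Canvas.{u}) (ℓ : ℕ) : Prop :=
  ∃ H : Canvas.{u}, H.IsCandidate ℓ ∧ IsStarContraction G H ∧ Nat.card H.V < Nat.card G.V

theorem Contr.isOneContraction {H : Canvas.{u}} {f : G.V → H.V} (hf : Contr G H f) {u v : G.V}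
    (huv : G.graph.Adj u v) (hv : G.Internal v)
    (hfib : ∀ a b, f a = f b ↔ a = b ∨ (a = u ∧ b = v) ∨ (a = v ∧ b = u)) :
    IsOneContraction G H u v := by
  refine ⟨huv, hv, f, hf.isContraction ?_ ?_ ?_⟩
  · rintro e rfl
    exact huv
  · intro a b hab
    rw [Set.mem_singleton_iff, Sym2.eq_iff] at hab
    rw [hfib]
    exact Or.inr hab
  · intro a b hab
    have : (SimpleGraph.fromEdgeSet {s(u, v)}).Adj u v :=
      (SimpleGraph.fromEdgeSet_adj _).2 ⟨rfl, huv.ne⟩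
    rcases (hfib a b).1 hab with rfl | ⟨rfl, rfl⟩ | ⟨rfl, rfl⟩
    · exact SimpleGraph.Reachable.refl _
    · exact this.reachable
    · exact this.symm.reachable

/-- If internal, the merged vertex has degree at least 5 + 5 - 4. Only common neighbors of `u` and
`v` lose degree, one each, and those that are internal have degree at least six. The hypothesis on
4-cycles keeps all triangles facial. -/
theorem reducible_of_edge {ℓ : ℕ} (hG : G.IsCandidate ℓ) {u v : G.V} (huv : G.graph.Adj u v)
    (hv : G.Internal v)
    (h : ∀ a b, G.graph.Adj v a → G.graph.Adj a b → G.graph.Adj b u → a ≠ u → b ≠ v →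
      G.graph.Adj v b ∨ G.graph.Adj u a)
    (hbig : ∀ t, G.graph.Adj t u → G.graph.Adj t v → G.External t ∨ 6 ≤ G.deg t) :
    G.Reducible ℓ := by
  obtain ⟨H, f, hf, hfib, hT, h1, h2, h3⟩ := exists_contr_edge_tri hG.tri huv hv h
  have hfuv : f u = f v := (hfib _ _).2 (Or.inr (Or.inl ⟨rfl, rfl⟩))
  refine ⟨H, hf.isCandidate hG.1 hT ?_, Or.inl ⟨u, v, hf.isOneContraction huv hv hfib⟩,
    hf.card_lt huv.ne hfuv⟩
  intro p hp
  obtain ⟨x, rfl⟩ := hf.surjective p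
  have hx := hf.internal_of hp
  by_cases hxu : f x = f u
  · rw [hxu] at hp ⊢
    have := hG.five_le_deg u (hf.internal_of hp)
    have := hG.five_le_deg v hv
    omega
  · have n1 : x ≠ u := fun h => hxu (h ▸ rfl)
    have n2 : x ≠ v := fun h => hxu (h ▸ hfuv.symm)
    by_cases hc : G.graph.Adj x u ∧ G.graph.Adj x v
    · have := (hbig x hc.1 hc.2).resolve_left hx
      have := h1 x n1 n2
      omega
    · have := hG.five_le_deg x hx
      have := h2 x n1 n2 hc
      omega

/-- The set `B` can be contracted to a vertex. -/
def ContrSet (G : Canvas.{u}) (B : Set G.V) : Prop :=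
  ∃ (H : Canvas.{u}) (f : G.V → H.V), Contr G H f ∧
    ∀ a b, f a = f b ↔ a = b ∨ (a ∈ B ∧ b ∈ B)

theorem contrSet_singleton (b : G.V) : G.ContrSet {b} := by
  refine ⟨G, _, Contr.id G, fun x y => ?_⟩
  simp only [Set.mem_singleton_iff]
  grind

/-- A triangle through the edge from `b` to the contracted set has a third vertex `t` adjacent to
`b` and to some `β ∈ B`. The common neighbor `γ ∈ B` turns it into the image of the facial triangle
`bγt`, so the edge can be contracted. -/
theorem ContrSet.insert (hT : G.Tri) {B : Set G.V} (hB : G.ContrSet B) (b : G.V)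
    (hbB : b ∉ B) (hb : G.Internal b) (hadj : ∃ β ∈ B, G.graph.Adj b β)
    (h : ∀ t, G.graph.Adj b t → t ∉ B → ∀ β ∈ B, G.graph.Adj t β →
      ∃ γ ∈ B, G.graph.Adj b γ ∧ G.graph.Adj t γ) : G.ContrSet (Insert.insert b B) := by
  obtain ⟨H, f, hf, hfib⟩ := hB
  obtain ⟨β, hβ, hbβ⟩ := hadj
  have hne : f b ≠ f β := by
    rw [Ne, hfib]
    rintro (rfl | h)
    · exact hbB hβ
    · exact hbB h.1
  have hbi : H.Internal (f b) := by
    rw [PlaneGraph.Internal, hf.external_iff]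
    rintro ⟨a, ha, hab⟩
    rcases (hfib _ _).1 hab with rfl | h
    · exact hb ha
    · exact hbB h.2
  obtain ⟨K, g, hg, hgfib, -⟩ := exists_contr_edge (hf.adj_of hbβ hne).symm hbi (by
    intro t h1 h2
    obtain ⟨-, t1, β1, e1, rfl, e2⟩ := (hf.adj _ _).1 h1
    obtain ⟨-, t2, b2, e3, e4, e5⟩ := (hf.adj _ _).1 h2
    have hβ1 : β1 ∈ B := by rcases (hfib _ _).1 e2 with rfl | h; exact hβ; exact h.1
    have ht1 : t1 ∉ B := fun h => h1.ne ((hfib _ _).2 (Or.inr ⟨h, hβ⟩))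
    have e4 : t2 = t1 := ((hfib _ _).1 e4).resolve_right fun h => ht1 h.2
    have e5 : b2 = b := ((hfib _ _).1 e5).resolve_right fun h => hbB h.2
    subst e4 e5
    obtain ⟨γ, hγ, h3, h4⟩ := h _ e3.symm ht1 β1 hβ1 e1
    have hγβ : f γ = f β := (hfib _ _).2 (Or.inr ⟨hγ, hβ⟩)
    rw [← hγβ] at h1 hne ⊢
    exact hf.facial_of (hT _ _ _ h3.symm e3.symm h4) hne.symm h2.ne.symm h1.ne)
  refine ⟨K, _, hf.comp hg, fun x y => ?_⟩
  have hfb : ∀ x, f x = f b ↔ x = b := fun x => by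
    rw [hfib]
    exact or_iff_left fun h => hbB h.2
  have hfβ : ∀ x, f x = f β ↔ x ∈ B := fun x => by
    rw [hfib]
    refine ⟨?_, fun h => Or.inr ⟨h, hβ⟩⟩
    rintro (rfl | h)
    · exact hβ
    · exact h.1
  rw [Function.comp_apply, Function.comp_apply, hgfib, hfb, hfb, hfβ, hfβ, hfib]
  simp only [Set.mem_insert_iff]
  grind

end Canvas

namespace Canvas

/-! ## Replacing an internal vertex of degree five by a wheel -/

/-- A vertex `w` whose faces are the triangles `w kᵢ kᵢ₊₁`. -/
structure Hub (G : Canvas.{u}) (w : G.V) (k : Fin 5 → G.V) : Prop where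
  injective : Function.Injective k
  internal : G.Internal w
  nbr : ∀ t, G.graph.Adj w t ↔ ∃ i, t = k i
  face : ∀ i, G.IsFace w (k i) (k (i + 1))

namespace Hub

variable {G : Canvas.{u}}

section Faces

variable (G : Canvas.{u}) (w : G.V) (k : Fin 5 → G.V)

/-- The new vertex `inr i` is placed inside the old triangle `w kᵢ kᵢ₊₁`. In `Spoke`, the third
vertex of the face that traverses the directed rim edge from `i` to `j` is the hub for `j = i + 1`,
and `kᵢ` for the reverse direction. -/
def Rim (i : Fin 5) (b c : G.V) : Prop := b = k i ∧ c = k (i + 1)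

def Spoke (i j : Fin 5) (a : G.V) : Prop := (j = i + 1 ∧ a = w) ∨ (i = j + 1 ∧ a = k i)

def Face : G.V ⊕ Fin 5 → G.V ⊕ Fin 5 → G.V ⊕ Fin 5 → Prop
  | .inl a, .inl b, .inl c => G.IsFace a b c ∧ a ≠ w ∧ b ≠ w ∧ c ≠ w
  | .inr i, .inl b, .inl c => Rim G k i b c
  | .inl b, .inl c, .inr i => Rim G k i b c
  | .inl c, .inr i, .inl b => Rim G k i b c
  | .inr i, .inr j, .inl a => Spoke G w k i j a
  | .inr j, .inl a, .inr i => Spoke G w k i j a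
  | .inl a, .inr i, .inr j => Spoke G w k i j a
  | .inr _, .inr _, .inr _ => False

def Outer : G.V ⊕ Fin 5 → G.V ⊕ Fin 5 → Prop
  | .inl a, .inl b => G.IsOuter a b
  | _, _ => False

def Dart : G.V ⊕ Fin 5 → G.V ⊕ Fin 5 → Prop
  | .inl a, .inl b => G.graph.Adj a b ∧ a ≠ w ∧ b ≠ w
  | .inl a, .inr i => a = w ∨ a = k i ∨ a = k (i + 1)
  | .inr i, .inl a => a = w ∨ a = k i ∨ a = k (i + 1)
  | .inr i, .inr j => j = i + 1 ∨ i = j + 1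

end Faces

variable {w : G.V} {k : Fin 5 → G.V} (D : Hub G w k)
include D

theorem ne (i : Fin 5) : k i ≠ w := ((D.nbr _).2 ⟨i, rfl⟩).ne.symm

theorem eq_of_face {a b : G.V} (h : G.IsFace w a b) : ∃ i, a = k i ∧ b = k (i + 1) := by
  obtain ⟨i, rfl⟩ := (D.nbr a).1 (adj_of_isFace h)
  exact ⟨i, rfl, isFace_unique h (D.face i)⟩

theorem adj_succ (i : Fin 5) : G.graph.Adj (k i) (k (i + 1)) :=
  adj_of_isFace (isFace_rot (D.face i))

theorem dart_iff (x y : G.V ⊕ Fin 5) :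
    (Outer G x y ∨ ∃ z, Face G w k x y z) ↔ Dart G w k x y := by
  rcases x with a | i <;> rcases y with b | j
  · constructor
    · rintro (h | ⟨c | i, h⟩)
      · refine ⟨adj_of_isOuter h, ?_, ?_⟩
        · rintro rfl
          exact D.internal ⟨_, h⟩
        · rintro rfl
          exact D.internal (external_of_isOuter_right h)
      · exact ⟨adj_of_isFace h.1, h.2.1, h.2.2.1⟩
      · obtain ⟨rfl, rfl⟩ := h
        exact ⟨D.adj_succ i, D.ne _, D.ne _⟩
    · rintro ⟨h, ha, hb⟩
      rcases isOuter_or_isFace h with h | ⟨c, hc⟩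
      · exact Or.inl h
      · by_cases hcw : c = w
        · subst hcw
          obtain ⟨i, rfl, rfl⟩ := D.eq_of_face (isFace_rot (isFace_rot hc))
          exact Or.inr ⟨.inr i, rfl, rfl⟩
        · exact Or.inr ⟨.inl c, hc, ha, hb, hcw⟩
  · constructor
    · rintro (h | ⟨c | i, h⟩)
      · exact h.elim
      · exact Or.inr (Or.inr h.2)
      · rcases h with h | h
        · exact Or.inl h.2
        · exact Or.inr (Or.inl h.2)
    · rintro (rfl | rfl | rfl)
      · exact Or.inr ⟨.inr (j + 1), Or.inl ⟨rfl, rfl⟩⟩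
      · exact Or.inr ⟨.inr (j - 1), Or.inr ⟨by simp, rfl⟩⟩
      · exact Or.inr ⟨.inl (k j), rfl, rfl⟩
  · constructor
    · rintro (h | ⟨c | i', h⟩)
      · exact h.elim
      · exact Or.inr (Or.inl h.1)
      · rcases h with h | ⟨rfl, h⟩
        · exact Or.inl h.2
        · exact Or.inr (Or.inr h)
    · rintro (rfl | rfl | rfl)
      · exact Or.inr ⟨.inr (i - 1), Or.inl ⟨by simp, rfl⟩⟩
      · exact Or.inr ⟨.inl (k (i + 1)), rfl, rfl⟩
      · exact Or.inr ⟨.inr (i + 1), Or.inr ⟨rfl, rfl⟩⟩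
  · constructor
    · rintro (h | ⟨c | i', h⟩)
      · exact h.elim
      · rcases h with h | h
        · exact Or.inl h.1
        · exact Or.inr h.1
      · exact h.elim
    · rintro (rfl | rfl)
      · exact Or.inr ⟨.inl w, Or.inl ⟨rfl, rfl⟩⟩
      · exact Or.inr ⟨.inl (k (j + 1)), Or.inr ⟨rfl, rfl⟩⟩

theorem face_unique {a b c d : G.V ⊕ Fin 5} (h : Face G w k a b c) (h' : Face G w k a b d) :
    c = d := by
  have hk := D.injective
  have hw := D.ne
  have hf : ∀ i c, G.IsFace (k i) (k (i + 1)) c → c = w := fun i c h =>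
    isFace_unique h (isFace_rot (D.face i))
  have h5 : ∀ i : Fin 5, i + 1 ≠ i ∧ i + 1 + 1 ≠ i := by decide
  rcases a with a | a <;> rcases b with b | b <;> rcases c with c | c <;> rcases d with d | d <;>
    simp only [Face, Rim, Spoke] at h h'
  · rw [isFace_unique h.1 h'.1]
  · obtain ⟨rfl, rfl⟩ := h'
    exact absurd (hf _ _ h.1) h.2.2.2
  · obtain ⟨rfl, rfl⟩ := h
    exact absurd (hf _ _ h'.1) h'.2.2.2
  · rw [hk (h.1.symm.trans h'.1)]
  · rw [h.1, h'.1]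
  · obtain ⟨rfl, rfl⟩ := h
    rcases h' with h' | h'
    · exact absurd h'.2 (hw _)
    · exact absurd (hk h'.2) (h5 b).1
  · obtain ⟨rfl, rfl⟩ := h'
    rcases h with h | h
    · exact absurd h.2 (hw _)
    · exact absurd (hk h.2) (h5 b).1
  · rcases h with h | h <;> rcases h' with h' | h'
    · rw [h.1, h'.1]
    · exact absurd (h'.2.symm.trans h.2) (hw _)
    · exact absurd (h.2.symm.trans h'.2) (hw _)
    · rw [add_right_cancel (h.1.symm.trans h'.1)]
  · rw [h.2, h'.2]
  · obtain ⟨rfl, rfl⟩ := h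
    rcases h' with h' | ⟨rfl, h'⟩
    · exact absurd h'.2 (hw _)
    · exact absurd (hk h') (h5 a).1.symm
  · obtain ⟨rfl, rfl⟩ := h'
    rcases h with h | ⟨rfl, h⟩
    · exact absurd h.2 (hw _)
    · exact absurd (hk h) (h5 a).1.symm
  · rcases h with h | h <;> rcases h' with h' | h'
    · rw [add_right_cancel (h.1.symm.trans h'.1)]
    · exact absurd (h'.2.symm.trans h.2) (hw _)
    · exact absurd (h.2.symm.trans h'.2) (hw _)
    · rw [h.1, h'.1]
  · rcases h with h | h <;> rcases h' with h' | h'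
    · rw [h.2, h'.2]
    · have := h.1.symm ▸ h'.1
      exact absurd this.symm (h5 a).2
    · have := h'.1.symm ▸ h.1
      exact absurd this.symm (h5 a).2
    · rw [h.2, h'.2]

theorem link_inr (i : Fin 5) (S : G.V ⊕ Fin 5 → Prop)
    (hS : ∀ s t, Face G w k s (.inr i) t → (S s ↔ S t)) (s : G.V ⊕ Fin 5)
    (hs : Dart G w k (.inr i) s) : S s ↔ S (.inl w) := by
  have h1 := hS (.inl (k (i + 1))) (.inl (k i)) ⟨rfl, rfl⟩
  have h2 := hS (.inl w) (.inr (i + 1)) (Or.inl ⟨rfl, rfl⟩)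
  have h3 := hS (.inr (i - 1)) (.inl w) (Or.inl ⟨by simp, rfl⟩)
  have h4 := hS (.inl (k i)) (.inr (i - 1)) (Or.inr ⟨by simp, rfl⟩)
  rcases s with s | s
  · rcases hs with rfl | rfl | rfl
    · rfl
    · exact h4.trans h3
    · exact h1.trans (h4.trans h3)
  · rcases hs with rfl | rfl
    · exact h2.symm
    · simpa using h3

theorem link_hub (S : G.V ⊕ Fin 5 → Prop)
    (hS : ∀ s t, Face G w k s (.inl w) t → (S s ↔ S t)) (s : G.V ⊕ Fin 5)
    (hs : Dart G w k (.inl w) s) : S s ↔ S (.inr 0) := by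
  have h : ∀ i : Fin 5, S (.inr (i + 1)) ↔ S (.inr i) := fun i => hS _ _ (Or.inl ⟨rfl, rfl⟩)
  rcases s with s | i
  · exact absurd rfl hs.2.1
  · have h0 := h 0
    have h1 := h 1
    have h2 := h 2
    have h3 := h 3
    fin_cases i
    · rfl
    · exact h0
    · exact h1.trans h0
    · exact h2.trans (h1.trans h0)
    · exact h3.trans (h2.trans (h1.trans h0))

theorem link_old (x : G.V) (hx : x ≠ w) (S : G.V ⊕ Fin 5 → Prop)
    (hS : ∀ s t, Face G w k s (.inl x) t ∨ (Outer G s (.inl x) ∧ Outer G (.inl x) t) →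
      (S s ↔ S t)) (s t : G.V ⊕ Fin 5)
    (hs : Dart G w k (.inl x) s) (ht : Dart G w k (.inl x) t) (h : S s) : S t := by
  classical
  -- At the old vertex `x = kⱼ`, the single neighbor `w` is replaced by the two consecutive
  -- neighbors `inr (j - 1)` and `inr j`, on which `S` agrees. Giving `w` the value of `S` at `inr
  -- j` reduces the claim to the rotation at `x` in `G`.
  let S' : G.V → Prop := fun y => if y = w then ∃ j, x = k j ∧ S (.inr j) else S (.inl y)
  have hw : ∀ j, x = k j → (S' w ↔ S (.inr j)) := by
    rintro j rfl
    simp only [S', if_true]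
    refine ⟨?_, fun h => ⟨j, rfl, h⟩⟩
    rintro ⟨i, hi, h⟩
    rwa [D.injective hi]
  have ho : ∀ y, y ≠ w → (S' y ↔ S (.inl y)) := fun y hy => by simp only [S', if_neg hy]
  have hmid : ∀ i, x = k (i + 1) → (S (.inr i) ↔ S (.inr (i + 1))) := fun i hi =>
    hS _ _ (Or.inl (Or.inr ⟨rfl, hi⟩))
  have hstep : ∀ y z, G.Step x y z → (S' y ↔ S' z) := by
    intro y z hyz
    by_cases hy : y = w
    · subst hy
      rcases hyz with h | h
      · obtain ⟨i, rfl, rfl⟩ := D.eq_of_face h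
        rw [hw i rfl, ho _ (D.ne _)]
        exact hS _ _ (Or.inl ⟨rfl, rfl⟩)
      · exact absurd ⟨_, h.1⟩ D.internal
    by_cases hz : z = w
    · subst hz
      rcases hyz with h | h
      · obtain ⟨i, rfl, rfl⟩ := D.eq_of_face (isFace_rot (isFace_rot h))
        rw [hw _ rfl, ho _ (D.ne _), ← hmid i rfl]
        exact hS _ _ (Or.inl ⟨rfl, rfl⟩)
      · exact absurd (external_of_isOuter_right h.2) D.internal
    rw [ho y hy, ho z hz]
    apply hS
    rcases hyz with h | h
    · exact Or.inl ⟨h, hy, hx, hz⟩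
    · exact Or.inr h
  have key : ∀ s, Dart G w k (.inl x) s → ∃ y, G.graph.Adj x y ∧ (S s ↔ S' y) := by
    rintro (y | i) hs
    · exact ⟨y, hs.1, (ho y hs.2.2).symm⟩
    · rcases hs with rfl | rfl | rfl
      · exact absurd rfl hx
      · exact ⟨w, ((D.nbr _).2 ⟨i, rfl⟩).symm, (hw i rfl).symm⟩
      · exact ⟨w, ((D.nbr _).2 ⟨i + 1, rfl⟩).symm, (hmid i rfl).trans (hw _ rfl).symm⟩
  obtain ⟨y, hy, hy'⟩ := key s hs
  obtain ⟨z, hz, hz'⟩ := key t ht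
  exact hz'.2 (nbr_induction S' hy (hy'.1 h) (fun a b hab => (hstep a b hab).1) hz)

def newDart (w : G.V) (k : Fin 5 → G.V) : Fin 5 × Fin 8 → (G.V ⊕ Fin 5) × (G.V ⊕ Fin 5) :=
  fun p => ![(.inl w, .inr p.1), (.inr p.1, .inl w), (.inl (k p.1), .inr p.1),
    (.inr p.1, .inl (k p.1)), (.inl (k (p.1 + 1)), .inr p.1), (.inr p.1, .inl (k (p.1 + 1))),
    (.inr p.1, .inr (p.1 + 1)), (.inr (p.1 + 1), .inr p.1)] p.2

omit D in
theorem newDart_injective (hk : Function.Injective k) (hw : ∀ i, k i ≠ w) :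
    Function.Injective (newDart w k) := by
  have h5 : ∀ i : Fin 5, i + 1 ≠ i ∧ i + 1 + 1 ≠ i := by decide
  rintro ⟨i, m⟩ ⟨j, n⟩ h
  fin_cases m <;> fin_cases n <;> simp [newDart] at h ⊢ <;> grind

def oldDart (w : G.V) (k : Fin 5 → G.V) : Fin 5 × Fin 2 → G.V × G.V :=
  fun p => ![(w, k p.1), (k p.1, w)] p.2

omit D in
theorem oldDart_injective (hk : Function.Injective k) (hw : ∀ i, k i ≠ w) :
    Function.Injective (oldDart w k) := by
  rintro ⟨i, m⟩ ⟨j, n⟩ h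
  fin_cases m <;> fin_cases n <;> simp [oldDart] at h ⊢ <;> grind

/-- The ten darts at the old `w` go, and forty come: each index contributes four new edges. The
surplus is 30 = 6 · 5, as `count` requires for five new vertices. -/
theorem dart_ncard : {p : (G.V ⊕ Fin 5) × (G.V ⊕ Fin 5) | Dart G w k p.1 p.2}.ncard =
    {p : G.V × G.V | G.graph.Adj p.1 p.2}.ncard + 30 := by
  have h1 : {p : (G.V ⊕ Fin 5) × (G.V ⊕ Fin 5) | Dart G w k p.1 p.2} =
      Prod.map Sum.inl Sum.inl '' ({p : G.V × G.V | G.graph.Adj p.1 p.2} \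
        Set.range (oldDart w k)) ∪ Set.range (newDart w k) := by
    ext ⟨x, y⟩
    constructor
    · intro h
      rcases x with a | i <;> rcases y with b | j
      · refine Or.inl ⟨(a, b), ⟨h.1, ?_⟩, rfl⟩
        rintro ⟨⟨i, m⟩, hm⟩
        have := h.2
        fin_cases m <;> simp [oldDart] at hm <;> grind
      · right
        rcases h with rfl | rfl | rfl
        · exact ⟨(j, 0), rfl⟩
        · exact ⟨(j, 2), rfl⟩
        · exact ⟨(j, 4), rfl⟩
      · right
        rcases h with rfl | rfl | rfl
        · exact ⟨(i, 1), rfl⟩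
        · exact ⟨(i, 3), rfl⟩
        · exact ⟨(i, 5), rfl⟩
      · right
        rcases h with rfl | rfl
        · exact ⟨(i, 6), rfl⟩
        · exact ⟨(j, 7), rfl⟩
    · rintro (⟨⟨a, b⟩, ⟨h, h'⟩, he⟩ | ⟨⟨i, m⟩, hm⟩)
      · obtain ⟨rfl, rfl⟩ := Prod.mk.inj he
        refine ⟨h, ?_, ?_⟩
        · rintro rfl
          obtain ⟨i, rfl⟩ := (D.nbr _).1 h
          exact h' ⟨(i, 0), rfl⟩
        · rintro rfl
          obtain ⟨i, rfl⟩ := (D.nbr _).1 (SimpleGraph.Adj.symm h)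
          exact h' ⟨(i, 1), rfl⟩
      · fin_cases m <;> simp [newDart] at hm <;> obtain ⟨rfl, rfl⟩ := hm <;> simp [Dart]
  have h2 : Set.range (oldDart w k) ⊆ {p : G.V × G.V | G.graph.Adj p.1 p.2} := by
    rintro _ ⟨⟨i, m⟩, rfl⟩
    have := (D.nbr (k i)).2 ⟨i, rfl⟩
    fin_cases m
    · exact this
    · exact this.symm
  have h3 : (Set.range (oldDart w k)).ncard = 10 := by
    rw [← Set.image_univ,
      Set.ncard_image_of_injective _ (oldDart_injective D.injective D.ne), Set.ncard_univ]
    simp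
  have h4 : (Set.range (newDart w k)).ncard = 40 := by
    rw [← Set.image_univ,
      Set.ncard_image_of_injective _ (newDart_injective D.injective D.ne), Set.ncard_univ]
    simp
  have h5 := Set.ncard_sdiff_add_ncard_of_subset h2
  rw [h1, Set.ncard_union_eq ?_ (Set.toFinite _) (Set.toFinite _), h4,
    Set.ncard_image_of_injective _ (Sum.inl_injective.prodMap Sum.inl_injective)]
  · omega
  · rw [Set.disjoint_left]
    rintro _ ⟨⟨a, b⟩, -, rfl⟩ ⟨⟨i, m⟩, hm⟩
    fin_cases m <;> simp [newDart] at hm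

theorem outer_ncard : {p : (G.V ⊕ Fin 5) × (G.V ⊕ Fin 5) | Outer G p.1 p.2}.ncard =
    {p : G.V × G.V | G.IsOuter p.1 p.2}.ncard := by
  rw [← Set.ncard_image_of_injective {p : G.V × G.V | G.IsOuter p.1 p.2}
    (Sum.inl_injective (β := Fin 5).prodMap (Sum.inl_injective (β := Fin 5)))]
  congr 1
  ext ⟨x, y⟩
  constructor
  · intro h
    rcases x with a | i <;> rcases y with b | j
    · exact ⟨(a, b), h, rfl⟩
    · exact h.elim
    · exact h.elim
    · exact h.elim
  · rintro ⟨⟨a, b⟩, h, he⟩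
    obtain ⟨rfl, rfl⟩ := Prod.mk.inj he
    exact h

def diskData : DiskData (G.V ⊕ Fin 5) where
  finite := inferInstance
  face := Face G w k
  outer := Outer G
  face_rot := by
    rintro (a | a) (b | b) (c | c) h
    · exact ⟨isFace_rot h.1, h.2.2.1, h.2.2.2, h.2.1⟩
    all_goals exact h
  face_unique := D.face_unique
  face_ne := by
    rintro (a | a) (b | b) c h
    · have := (D.dart_iff _ _).1 (Or.inr ⟨c, h⟩)
      intro h'
      exact this.1.ne (Sum.inl_injective h')
    · exact Sum.inl_ne_inr
    · exact Sum.inr_ne_inl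
    · have h := (D.dart_iff _ _).1 (Or.inr ⟨c, h⟩)
      rintro h'
      rw [Sum.inr_injective h'] at h
      have h5 : ∀ i : Fin 5, ¬ (i = i + 1) := by decide
      rcases h with h | h
      · exact h5 b h
      · exact h5 b h
  outer_ne := by
    rintro (a | a) (b | b) h
    · exact fun h' => (adj_of_isOuter h).ne (Sum.inl_injective h')
    all_goals exact h.elim
  outer_right_unique := by
    rintro (a | a) (b | b) (c | c) h h'
    · exact congrArg _ (isOuter_right_unique h h')
    all_goals first | exact h.elim | exact h'.elim
  outer_left_unique := by
    rintro (a | a) (b | b) (c | c) h h'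
    · exact congrArg _ (isOuter_left_unique h h')
    all_goals first | exact h.elim | exact h'.elim
  outer_succ := by
    rintro (a | a) (b | b) h
    · obtain ⟨c, hc⟩ := isOuter_succ h
      exact ⟨.inl c, hc⟩
    all_goals exact h.elim
  not_outer := by
    rintro (a | a) (b | b) (c | c) h h'
    · exact not_isOuter_of_isFace h.1 h'
    · obtain ⟨rfl, rfl⟩ := h
      exact not_isOuter_of_isFace (isFace_rot (D.face c)) h'
    all_goals exact h'.elim
  symm := by
    intro a b h
    rw [D.dart_iff] at h ⊢
    rcases a with a | a <;> rcases b with b | b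
    · exact ⟨h.1.symm, h.2.2, h.2.1⟩
    · exact h
    · exact h
    · exact h.symm
  outer_induction := by
    rintro S (a | a) (b | b) h ha hS (x | x) (y | y) h'
    · exact isOuter_induction (fun x => S (.inl x)) h ha (fun x y hxy => hS (.inl x) (.inl y) hxy) h'
    all_goals first | exact h.elim | exact h'.elim
  link := by
    intro v S hS s t hs ht h
    rw [D.dart_iff] at hs ht
    rcases v with x | i
    · by_cases hx : x = w
      · subst hx
        have := D.link_hub S (fun s t h => hS s t (Or.inl h))
        exact (this t ht).2 ((this s hs).1 h)
      · exact D.link_old x hx S hS s t hs ht h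
    · have := D.link_inr i S (fun s t h => hS s t (Or.inl h))
      exact (this t ht).2 ((this s hs).1 h)
  nonempty := ⟨.inl w⟩
  connected := by
    intro S hS x y hx
    have hS : ∀ x y, Dart G w k x y → (S x ↔ S y) := fun x y h => hS x y ((D.dart_iff x y).2 h)
    have hr : ∀ i, S (.inr i) ↔ S (.inl w) := fun i => hS _ _ (Or.inl rfl)
    have hk : ∀ i, S (.inl (k i)) ↔ S (.inl w) := fun i =>
      (hS (.inl (k i)) (.inr i) (Or.inr (Or.inl rfl))).trans (hr i)
    have hadj : ∀ a b, G.graph.Adj a b → S (.inl a) → S (.inl b) := by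
      intro a b hab ha
      by_cases haw : a = w
      · subst haw
        obtain ⟨i, rfl⟩ := (D.nbr _).1 hab
        exact (hk i).2 ha
      by_cases hbw : b = w
      · subst hbw
        obtain ⟨i, rfl⟩ := (D.nbr _).1 hab.symm
        exact (hk i).1 ha
      exact (hS (.inl a) (.inl b) ⟨hab, haw, hbw⟩).1 ha
    have hx' : ∃ a, S (.inl a) := by
      rcases x with x | i
      · exact ⟨x, hx⟩
      · exact ⟨w, (hr i).1 hx⟩
    obtain ⟨a, ha⟩ := hx'
    have hall := closed_eq_univ (fun a => S (.inl a)) ha (fun x y hx hxy => hadj x y hxy hx)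
    rcases y with y | i
    · exact hall y
    · exact (hr i).2 (hall w)
  outer_length := by
    rw [D.outer_ncard, ← faceLength_outer_eq]
    exact G.outer_length
  count := by
    have h1 := D.outer_ncard
    have h2 := D.dart_ncard
    have h3 := G.count
    have h4 : {p : (G.V ⊕ Fin 5) × (G.V ⊕ Fin 5) | Outer G p.1 p.2 ∨
        ∃ c, Face G w k p.1 p.2 c} = {p | Dart G w k p.1 p.2} := by
      ext p
      exact D.dart_iff _ _
    rw [faceLength_outer_eq] at h3
    rw [h4, Nat.card_sum, Nat.card_eq_fintype_card (α := Fin 5), Fintype.card_fin]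
    omega

omit D in
/-- `H` is obtained from `G` by replacing the vertex `w` by a wheel. -/
structure IsExpansion (G : Canvas.{u}) (w : G.V) (k : Fin 5 → G.V) (H : Canvas.{u})
    (ι : G.V ⊕ Fin 5 ≃ H.V) : Prop where
  adj : ∀ x y, H.graph.Adj (ι x) (ι y) ↔ Dart G w k x y
  face : ∀ x y z, H.IsFace (ι x) (ι y) (ι z) ↔ Face G w k x y z
  outer : ∀ x y, H.IsOuter (ι x) (ι y) ↔ Outer G x y

theorem exists_expansion : ∃ (H : Canvas.{u}) (ι : G.V ⊕ Fin 5 ≃ H.V), IsExpansion G w k H ι :=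
  ⟨D.diskData.toCanvas, Equiv.refl _, fun x y => D.dart_iff x y, D.diskData.toCanvas_isFace,
    D.diskData.toCanvas_isOuter⟩

variable {H : Canvas.{u}} {ι : G.V ⊕ Fin 5 ≃ H.V} (E : IsExpansion G w k H ι)
include E

theorem expansion_external (x : G.V) : H.External (ι (.inl x)) ↔ G.External x := by
  constructor
  · rintro ⟨y, h⟩
    obtain ⟨y, rfl⟩ := ι.surjective y
    have h : Outer G (.inl x) y := (E.outer _ _).1 h
    rcases y with y | i
    · exact ⟨y, h⟩
    · exact h.elim
  · rintro ⟨y, h⟩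
    exact ⟨ι (.inl y), (E.outer _ _).2 h⟩

theorem expansion_faceLength_outer :
    H.sys.faceLength H.outer = G.sys.faceLength G.outer := by
  rw [faceLength_outer_eq, faceLength_outer_eq, ← D.outer_ncard,
    ← Set.ncard_image_of_injective _ (ι.injective.prodMap ι.injective)]
  congr 1
  ext ⟨x, y⟩
  obtain ⟨x, rfl⟩ := ι.surjective x
  obtain ⟨y, rfl⟩ := ι.surjective y
  refine (E.outer x y).trans ⟨fun h => ⟨(x, y), h, rfl⟩, ?_⟩
  rintro ⟨⟨a, b⟩, h, he⟩
  obtain ⟨h1, h2⟩ := Prod.mk.inj he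
  rwa [← ι.injective h1, ← ι.injective h2]

theorem ncard_le_deg (x : G.V ⊕ Fin 5) (S : Set (G.V ⊕ Fin 5)) (hS : ∀ y ∈ S, Dart G w k x y) :
    S.ncard ≤ H.deg (ι x) := by
  rw [← Set.ncard_image_of_injective _ ι.injective]
  refine Set.ncard_le_ncard ?_ (Set.toFinite _)
  rintro _ ⟨y, hy, rfl⟩
  exact (E.adj _ _).2 (hS y hy)

theorem expansion_deg_le (x : G.V) (hx : x ≠ w) (hxk : ∀ i, x ≠ k i) :
    G.deg x ≤ H.deg (ι (.inl x)) := by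
  refine le_trans (Set.ncard_image_of_injective _ (Sum.inl_injective (β := Fin 5))).ge
    (D.ncard_le_deg E _ _ ?_)
  rintro _ ⟨y, hy, rfl⟩
  refine ⟨hy, hx, ?_⟩
  rintro rfl
  obtain ⟨i, hi⟩ := (D.nbr _).1 (SimpleGraph.Adj.symm hy)
  exact hxk i hi

/-- A vertex `kᵢ` exchanges its neighbor `w` for the two new vertices `inr i` and `inr (i - 1)`. -/
theorem expansion_deg_rim (i : Fin 5) : G.deg (k i) + 1 ≤ H.deg (ι (.inl (k i))) := by
  have h2 := D.ncard_le_deg E (.inl (k i))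
    (Sum.inl '' (G.graph.neighborSet (k i) \ {w}) ∪ {.inr i, .inr (i - 1)}) (by
      rintro _ (⟨y, ⟨hy, hyw⟩, rfl⟩ | rfl | rfl)
      · exact ⟨hy, D.ne i, hyw⟩
      · exact Or.inr (Or.inl rfl)
      · exact Or.inr (Or.inr (by simp)))
  rw [Set.ncard_union_eq ?_ (Set.toFinite _) (Set.toFinite _),
    Set.ncard_image_of_injective _ Sum.inl_injective, Set.ncard_pair ?_] at h2
  · have := Set.ncard_sdiff_singleton_add_one
      (show w ∈ G.graph.neighborSet (k i) from ((D.nbr _).2 ⟨i, rfl⟩).symm)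
    change _ = G.deg (k i) at this
    omega
  · rw [Ne, Sum.inr.injEq]
    have : ∀ i : Fin 5, ¬ i = i - 1 := by decide
    exact this i
  · rw [Set.disjoint_left]
    rintro _ ⟨y, -, rfl⟩ h
    simp at h

theorem five_le_deg_inr (i : Fin 5) : 5 ≤ H.deg (ι (.inr i)) := by
  classical
  have h := D.ncard_le_deg E (.inr i)
    (([.inl w, .inl (k i), .inl (k (i + 1)), .inr (i + 1), .inr (i - 1)] :
      List (G.V ⊕ Fin 5)).toFinset : Set _) (by
    intro t ht
    simp only [List.coe_toFinset, Set.mem_ofPred_eq, List.mem_cons, List.not_mem_nil,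
      or_false] at ht
    rcases ht with rfl | rfl | rfl | rfl | rfl <;> simp [Dart])
  rw [Set.ncard_coe_finset, List.toFinset_card_of_nodup] at h
  · exact h
  · have h5 : ∀ i : Fin 5, i ≠ i + 1 ∧ i + 1 ≠ i - 1 := by decide
    have h1 := D.ne
    have h2 := fun h => (h5 i).1 (D.injective h)
    simp [(h5 i).2, (h1 _).symm]
    exact fun h => h2 h

theorem five_le_deg_hub : 5 ≤ H.deg (ι (.inl w)) := by
  classical
  have h := D.ncard_le_deg E (.inl w)
    (([.inr 0, .inr 1, .inr 2, .inr 3, .inr 4] : List (G.V ⊕ Fin 5)).toFinset : Set _) (by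
    intro t ht
    simp only [List.coe_toFinset, Set.mem_ofPred_eq, List.mem_cons, List.not_mem_nil,
      or_false] at ht
    rcases ht with rfl | rfl | rfl | rfl | rfl <;> simp [Dart])
  rw [Set.ncard_coe_finset, List.toFinset_card_of_nodup] at h
  · exact h
  · simp

omit E in
theorem face_of_triangle (hT : G.Tri) {x y z : G.V ⊕ Fin 5} (hxy : Dart G w k x y)
    (hyz : Dart G w k y z) (hzx : Dart G w k z x) : Face G w k x y z ∨ Face G w k y x z := by
  have hk := D.injective
  have h5 : ∀ i : Fin 5, i + 1 ≠ i ∧ i + 1 + 1 ≠ i ∧ i + 1 + 1 + 1 ≠ i := by decide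
  rcases x with a | a <;> rcases y with b | b <;> rcases z with c | c <;>
    simp only [Dart, Face, Rim, Spoke] at hxy hyz hzx ⊢
  · rcases facial_iff.1 (hT a b c hxy.1 hyz.1 hzx.1) with h | h
    · exact Or.inl ⟨h, hxy.2.1, hyz.2.1, hzx.2.1⟩
    · exact Or.inr ⟨h, hyz.2.1, hxy.2.1, hzx.2.1⟩
  · have := hxy.1.ne
    grind
  · have := hzx.1.ne
    grind
  · grind
  · have := hyz.1.ne
    grind
  · grind
  · grind
  · have h6 : ∀ i j l : Fin 5, (j = i + 1 ∨ i = j + 1) → (l = j + 1 ∨ j = l + 1) →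
        (i = l + 1 ∨ l = i + 1) → False := by decide
    exact (h6 _ _ _ hxy hyz hzx).elim

theorem expansion_tri (hT : G.Tri) : H.Tri := by
  intro x y z hxy hyz hzx
  obtain ⟨x, rfl⟩ := ι.surjective x
  obtain ⟨y, rfl⟩ := ι.surjective y
  obtain ⟨z, rfl⟩ := ι.surjective z
  rw [facial_iff, E.face, E.face]
  rw [E.adj] at hxy hyz hzx
  exact D.face_of_triangle hT hxy hyz hzx

/-- The facial triangles of the expansion. -/
theorem expansion_facial (T : Set H.V) : T ∈ H.facial ↔
    (∃ a b c, G.IsFace a b c ∧ a ≠ w ∧ b ≠ w ∧ c ≠ w ∧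
      T = {ι (.inl a), ι (.inl b), ι (.inl c)}) ∨
    T ∈ wheelTriangles (ι (.inl w)) (fun i => ι (.inr i)) (fun i => ι (.inl (k i))) := by
  constructor
  · rintro ⟨x, y, z, h, rfl⟩
    obtain ⟨x, rfl⟩ := ι.surjective x
    obtain ⟨y, rfl⟩ := ι.surjective y
    obtain ⟨z, rfl⟩ := ι.surjective z
    rw [E.face] at h
    have h3 : ∀ a b c : H.V, ({a, b, c} : Set H.V) = {b, c, a} := by
      intro a b c; ext; simp; tauto
    have h4 : ∀ a b c : H.V, ({a, b, c} : Set H.V) = {b, a, c} := fun a b c =>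
      Set.insert_comm _ _ _
    have hr : ∀ i b c, Rim G k i b c → {ι (.inr i), ι (.inl b), ι (.inl c)} ∈
        wheelTriangles (ι (.inl w)) (fun i => ι (.inr i)) (fun i => ι (.inl (k i))) := by
      rintro i _ _ ⟨rfl, rfl⟩
      exact ⟨i, Or.inr (Or.inr rfl)⟩
    have hs : ∀ i j a, Spoke G w k i j a → {ι (.inl a), ι (.inr i), ι (.inr j)} ∈
        wheelTriangles (ι (.inl w)) (fun i => ι (.inr i)) (fun i => ι (.inl (k i))) := by
      rintro i j _ (⟨rfl, rfl⟩ | ⟨rfl, rfl⟩)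
      · exact ⟨i, Or.inl rfl⟩
      · refine ⟨j, Or.inr (Or.inl ?_)⟩
        rw [h3, h4]
    rcases x with a | a <;> rcases y with b | b <;> rcases z with c | c
    · exact Or.inl ⟨a, b, c, h.1, h.2.1, h.2.2.1, h.2.2.2, rfl⟩
    · right; rw [← h3]; exact hr _ _ _ h
    · right; rw [h3]; exact hr _ _ _ h
    · exact Or.inr (hs _ _ _ h)
    · exact Or.inr (hr _ _ _ h)
    · right; rw [h3]; exact hs _ _ _ h
    · right; rw [← h3]; exact hs _ _ _ h
    · exact h.elim
  · rintro (⟨a, b, c, h, ha, hb, hc, rfl⟩ | ⟨i, rfl | rfl | rfl⟩)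
    · exact ⟨_, _, _, (E.face (.inl a) (.inl b) (.inl c)).2 ⟨h, ha, hb, hc⟩, rfl⟩
    · exact ⟨_, _, _, (E.face (.inl w) (.inr i) (.inr (i + 1))).2 (Or.inl ⟨rfl, rfl⟩), rfl⟩
    · refine facial_iff.2 (Or.inr ?_)
      exact (E.face (.inr (i + 1)) (.inr i) (.inl (k (i + 1)))).2 (Or.inr ⟨rfl, rfl⟩)
    · exact ⟨_, _, _, (E.face (.inr i) (.inl (k i)) (.inl (k (i + 1)))).2 ⟨rfl, rfl⟩, rfl⟩

end Hub

end Canvas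

namespace Canvas

variable {G : Canvas.{u}}

/-! ## The two sides of a cycle -/

section Homology

open scoped Matrix

variable (G)

noncomputable def edgeDart (e : G.graph.edgeSet) : G.graph.Dart :=
  (show ∃ d : G.graph.Dart, d.edge = e by
    obtain ⟨e, he⟩ := e
    induction e with
    | _ a b => exact ⟨⟨(a, b), he⟩, rfl⟩).choose

theorem edgeDart_edge (e : G.graph.edgeSet) : (G.edgeDart e).edge = e :=
  (show ∃ d : G.graph.Dart, d.edge = e by
    obtain ⟨e, he⟩ := e
    induction e with
    | _ a b => exact ⟨⟨(a, b), he⟩, rfl⟩).choose_spec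

theorem sum_edgeDart [Fintype G.graph.edgeSet] [Fintype G.graph.Dart]
    (g : G.graph.Dart → ZMod 2) :
    ∑ e, (g (G.edgeDart e) + g (G.edgeDart e).symm) = ∑ d, g d := by
  let φ : G.graph.edgeSet × Bool → G.graph.Dart := fun p =>
    if p.2 then G.edgeDart p.1 else (G.edgeDart p.1).symm
  have hφ : Function.Bijective φ := by
    constructor
    · rintro ⟨e, b⟩ ⟨e', b'⟩ h
      have he : e = e' := by
        apply Subtype.ext
        rw [← G.edgeDart_edge e, ← G.edgeDart_edge e']
        have := congrArg SimpleGraph.Dart.edge h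
        cases b <;> cases b' <;> simpa [φ] using this
      subst he
      cases b <;> cases b' <;> simp [φ] at h ⊢
      · exact (G.edgeDart e).symm_ne h
      · exact (G.edgeDart e).symm_ne h.symm
    · intro d
      have h := G.edgeDart_edge ⟨d.edge, d.edge_mem⟩
      rcases (SimpleGraph.dart_edge_eq_iff _ _).1 h with h | h
      · exact ⟨(⟨d.edge, d.edge_mem⟩, true), by simp [φ, h]⟩
      · exact ⟨(⟨d.edge, d.edge_mem⟩, false), by simp [φ, h]⟩
  rw [← hφ.sum_comp g, Fintype.sum_prod_type]
  refine Finset.sum_congr rfl fun e _ => ?_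
  simp [φ]

/-- This is connectedness of the dual graph. Consecutive faces around a vertex share an edge, so `φ`
is constant around each vertex, and the edges of `G` carry the value from vertex to vertex. -/
theorem eq_of_forall_symm {α : Type*} (φ : G.sys.Face → α)
    (h : ∀ d, φ (G.sys.leftFace d) = φ (G.sys.leftFace d.symm)) (F F' : G.sys.Face) :
    φ F = φ F' := by
  obtain ⟨d, rfl⟩ := G.sys.leftFace_surjective F
  obtain ⟨d', rfl⟩ := G.sys.leftFace_surjective F'
  have hrot : ∀ d e : G.graph.Dart, d.fst = e.fst → φ (G.sys.leftFace d) = φ (G.sys.leftFace e) := by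
    intro d e hde
    refine (G.sys.rot_cyclic d e hde).induction_on_set
      (fun e => φ (G.sys.leftFace d) = φ (G.sys.leftFace e)) rfl ?_
    intro z hz
    rw [G.sys.leftFace_rot, ← h, hz]
  refine closed_eq_univ (fun v => ∀ e : G.graph.Dart, e.fst = v →
    φ (G.sys.leftFace d) = φ (G.sys.leftFace e)) (s := d.fst) (fun e he => hrot d e he.symm) ?_
    d'.fst d' rfl
  intro x y hx hxy e he
  let b : G.graph.Dart := ⟨(x, y), hxy⟩
  rw [hx b rfl, h b]
  exact hrot _ _ he.symm

theorem eq_of_forall_adj {α : Type*} (f : G.V → α) (h : ∀ x y, G.graph.Adj x y → f x = f y)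
    (x y : G.V) : f x = f y :=
  closed_eq_univ (fun y => f x = f y) (s := x) rfl (fun a b ha hab => ha.trans (h a b hab)) y

theorem finrank_ker_le_one {X Y : Type*} [Fintype X]
    (γ : (X → ZMod 2) →ₗ[ZMod 2] (Y → ZMod 2))
    (h : ∀ f, γ f = 0 → ∀ x y, f x = f y) : Module.finrank (ZMod 2) (LinearMap.ker γ) ≤ 1 := by
  have h1 : LinearMap.ker γ ≤ Submodule.span (ZMod 2) {fun _ => 1} := by
    intro f hf
    rw [Submodule.mem_span_singleton]
    rcases isEmpty_or_nonempty X with hX | ⟨⟨x⟩⟩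
    · exact ⟨0, funext fun x => hX.elim x⟩
    · refine ⟨f x, funext fun y => ?_⟩
      simp [h f hf x y]
  refine (Submodule.finrank_mono h1).trans ?_
  refine (finrank_span_le_card _).trans ?_
  simp

/-- A set of edges that meets each vertex an even number of times separates the faces into two
classes. -/
theorem exists_side_of_even [Fintype G.graph.Dart] [DecidableEq G.V]
    (c : G.graph.Dart → ZMod 2) (hc : ∀ d, c d.symm = c d)
    (hv : ∀ v, ∑ d, (if d.fst = v then c d else 0) = 0) :
    ∃ φ : G.sys.Face → ZMod 2, ∀ d, φ (G.sys.leftFace d) + φ (G.sys.leftFace d.symm) = c d := by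
  classical
  have := Fintype.ofFinite G.V
  have := Fintype.ofFinite G.sys.Face
  have := Fintype.ofFinite G.graph.edgeSet
  -- Over the field with two elements, `M` is the boundary map from edges to vertices and `N` sends
  -- a set of faces to its boundary. The claim is exactness at the edges.
  let M : Matrix G.V G.graph.edgeSet (ZMod 2) := fun v e =>
    (if (G.edgeDart e).fst = v then 1 else 0) + (if (G.edgeDart e).snd = v then 1 else 0)
  let N : Matrix G.graph.edgeSet G.sys.Face (ZMod 2) := fun e F =>
    (if G.sys.leftFace (G.edgeDart e) = F then 1 else 0) +
      (if G.sys.leftFace (G.edgeDart e).symm = F then 1 else 0)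
  have hM : ∀ c : G.graph.Dart → ZMod 2, (∀ d, c d.symm = c d) → ∀ v,
      (M *ᵥ fun e => c (G.edgeDart e)) v = ∑ d, (if d.fst = v then c d else 0) := by
    intro c hc v
    rw [← G.sum_edgeDart, Matrix.mulVec, dotProduct]
    refine Finset.sum_congr rfl fun e _ => ?_
    rw [hc, show (G.edgeDart e).symm.fst = (G.edgeDart e).snd from rfl]
    simp only [M, add_mul, ite_mul, one_mul, zero_mul]
  have hN : ∀ φ e, (N *ᵥ φ) e = φ (G.sys.leftFace (G.edgeDart e)) +
      φ (G.sys.leftFace (G.edgeDart e).symm) := by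
    intro φ e
    simp [N, Matrix.mulVec, dotProduct, add_mul, Finset.sum_add_distrib]
  have hMT : ∀ f e, (Mᵀ *ᵥ f) e = f (G.edgeDart e).fst + f (G.edgeDart e).snd := by
    intro f e
    change ∑ v, ((if (G.edgeDart e).fst = v then 1 else 0) +
      (if (G.edgeDart e).snd = v then 1 else 0)) * f v = _
    simp [add_mul, Finset.sum_add_distrib]
  have hself : ∀ x : ZMod 2, x + x = 0 := by decide
  have heq : ∀ x y : ZMod 2, x + y = 0 → x = y := by decide
  have hMN : LinearMap.range N.mulVecLin ≤ LinearMap.ker M.mulVecLin := by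
    rintro _ ⟨φ, rfl⟩
    rw [LinearMap.mem_ker, Matrix.mulVecLin_apply, Matrix.mulVecLin_apply]
    funext v
    have h1 := hM (fun d => φ (G.sys.leftFace d) + φ (G.sys.leftFace d.symm))
      (fun d => by rw [SimpleGraph.Dart.symm_symm, add_comm]) v
    have h2 : N *ᵥ φ = fun e => φ (G.sys.leftFace (G.edgeDart e)) +
        φ (G.sys.leftFace (G.edgeDart e).symm) := funext (hN φ)
    rw [h2, h1, Pi.zero_apply]
    have h3 : ∀ d : G.graph.Dart, (if d.fst = v then φ (G.sys.leftFace d) +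
        φ (G.sys.leftFace d.symm) else 0) = (if d.fst = v then φ (G.sys.leftFace d) else 0) +
        (if (G.sys.rot d).fst = v then φ (G.sys.leftFace (G.sys.rot d)) else 0) := by
      intro d
      rw [G.sys.rot_fst, G.sys.leftFace_rot]
      split_ifs <;> simp
    rw [Finset.sum_congr rfl fun d _ => h3 d, Finset.sum_add_distrib,
      Equiv.sum_comp G.sys.rot (fun d => if d.fst = v then φ (G.sys.leftFace d) else 0), hself]
  have k1 : Module.finrank (ZMod 2) (LinearMap.ker N.mulVecLin) ≤ 1 := by
    refine finrank_ker_le_one _ fun φ hφ => G.eq_of_forall_symm φ fun d => ?_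
    have key : ∀ e, φ (G.sys.leftFace (G.edgeDart e)) = φ (G.sys.leftFace (G.edgeDart e).symm) :=
      fun e => heq _ _ (by rw [← hN]; exact congrFun hφ e)
    rcases (SimpleGraph.dart_edge_eq_iff _ _).1 (G.edgeDart_edge ⟨d.edge, d.edge_mem⟩) with h | h
    · rw [← h]; exact key _
    · have := key ⟨d.edge, d.edge_mem⟩
      rw [h, SimpleGraph.Dart.symm_symm] at this
      exact this.symm
  have k2 : Module.finrank (ZMod 2) (LinearMap.ker Mᵀ.mulVecLin) ≤ 1 := by
    refine finrank_ker_le_one _ fun f hf => G.eq_of_forall_adj f fun x y hxy => ?_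
    have key : ∀ e, f (G.edgeDart e).fst = f (G.edgeDart e).snd :=
      fun e => heq _ _ (by rw [← hMT]; exact congrFun hf e)
    let d : G.graph.Dart := ⟨(x, y), hxy⟩
    have := key ⟨d.edge, d.edge_mem⟩
    rcases (SimpleGraph.dart_edge_eq_iff _ _).1 (G.edgeDart_edge ⟨d.edge, d.edge_mem⟩) with h | h
    · rw [h] at this; exact this
    · rw [h] at this; exact this.symm
  have r1 := LinearMap.finrank_range_add_finrank_ker N.mulVecLin
  have r2 := LinearMap.finrank_range_add_finrank_ker Mᵀ.mulVecLin
  have r3 := LinearMap.finrank_range_add_finrank_ker M.mulVecLin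
  have r4 : Module.finrank (ZMod 2) (LinearMap.range Mᵀ.mulVecLin) =
    Module.finrank (ZMod 2) (LinearMap.range M.mulVecLin) := Matrix.rank_transpose M
  have r5 := G.euler
  have r6 : G.graph.edgeSet.ncard = Fintype.card G.graph.edgeSet := by
    rw [← Nat.card_coe_set_eq, Nat.card_eq_fintype_card]
  rw [Nat.card_eq_fintype_card, Nat.card_eq_fintype_card] at r5
  simp only [Module.finrank_fintype_fun_eq_card] at r1 r2 r3
  -- As `N` and the transpose of `M` have kernels of dimension at most one, the rank of `N` is at
  -- least `F - 1`, and `ker M` has dimension at most `E - V + 1`. By Euler's formula these bounds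
  -- coincide.
  have hle : LinearMap.range N.mulVecLin = LinearMap.ker M.mulVecLin :=
    Submodule.eq_of_le_of_finrank_le hMN (by omega)
  have hcmem : (fun e => c (G.edgeDart e)) ∈ LinearMap.ker M.mulVecLin := by
    rw [LinearMap.mem_ker, Matrix.mulVecLin_apply]
    funext v
    rw [hM c hc, hv, Pi.zero_apply]
  rw [← hle] at hcmem
  obtain ⟨φ, hφ⟩ := hcmem
  refine ⟨φ, fun d => ?_⟩
  have key := congrFun hφ ⟨d.edge, d.edge_mem⟩
  rw [Matrix.mulVecLin_apply, hN] at key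
  rcases (SimpleGraph.dart_edge_eq_iff _ _).1 (G.edgeDart_edge ⟨d.edge, d.edge_mem⟩) with h | h
  · rw [h] at key; exact key
  · rw [h, SimpleGraph.Dart.symm_symm, hc] at key
    rw [add_comm]; exact key

end Homology

/-- The cycle `abcd`. -/
structure Quad (G : Canvas.{u}) (a b c d : G.V) : Prop where
  ab : G.graph.Adj a b
  bc : G.graph.Adj b c
  cd : G.graph.Adj c d
  da : G.graph.Adj d a
  ac : a ≠ c
  bd : b ≠ d

theorem Quad.rot {a b c d : G.V} (h : G.Quad a b c d) : G.Quad b c d a :=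
  ⟨h.bc, h.cd, h.da, h.ab, h.bd, h.ac.symm⟩

/-- The vertices `x` and `y` are consecutive on the cycle `abcd`. -/
def OnQuad {V : Type*} (a b c d x y : V) : Prop :=
  s(x, y) = s(a, b) ∨ s(x, y) = s(b, c) ∨ s(x, y) = s(c, d) ∨ s(x, y) = s(d, a)

theorem OnQuad.symm {V : Type*} {a b c d x y : V} (h : OnQuad a b c d x y) :
    OnQuad a b c d y x := by
  unfold OnQuad at *
  rwa [Sym2.eq_swap]

theorem OnQuad.rot {V : Type*} {a b c d x y : V} (h : OnQuad a b c d x y) :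
    OnQuad b c d a x y := by
  unfold OnQuad at *
  tauto

theorem OnQuad.mem {V : Type*} {a b c d x y : V} (h : OnQuad a b c d x y) :
    (x = a ∨ x = b ∨ x = c ∨ x = d) ∧ (y = a ∨ y = b ∨ y = c ∨ y = d) := by
  simp only [OnQuad, Sym2.eq_iff] at h
  tauto

/-- `S x y` says that the face to the left of `(x, y)` is inside the closed curve formed by the
edges in `Q`. -/
structure Side (G : Canvas.{u}) (Q : G.V → G.V → Prop) (S : G.V → G.V → Prop) : Prop where
  adj : ∀ x y, S x y → G.graph.Adj x y
  face : ∀ x y z, G.IsFace x y z → (S x y ↔ S y z)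
  outer : ∀ x y, G.IsOuter x y → ¬ S x y
  on : ∀ x y, G.graph.Adj x y → Q x y → (S x y ↔ ¬ S y x)
  off : ∀ x y, G.graph.Adj x y → ¬ Q x y → (S x y ↔ S y x)

theorem exists_side {a b c d : G.V} (h : G.Quad a b c d) : ∃ S, G.Side (OnQuad a b c d) S := by
  classical
  have := Fintype.ofFinite G.graph.Dart
  let f : G.graph.Dart → ZMod 2 := fun e => if OnQuad a b c d e.fst e.snd then 1 else 0
  have hf : ∀ e, f e.symm = f e := by
    intro e
    have : OnQuad a b c d e.symm.fst e.symm.snd ↔ OnQuad a b c d e.fst e.snd :=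
      ⟨fun h => h.symm, fun h => h.symm⟩
    simp only [f, this]
  have hsum : ∀ v, ∑ e : G.graph.Dart, (if e.fst = v then f e else 0) = 0 := by
    intro v
    have key : ∀ a b c d : G.V, G.Quad a b c d → ∑ e : G.graph.Dart,
        (if e.fst = a then (if OnQuad a b c d e.fst e.snd then (1 : ZMod 2) else 0) else 0) = 0 := by
      intro a b c d h
      let d₁ : G.graph.Dart := ⟨(a, b), h.ab⟩
      let d₂ : G.graph.Dart := ⟨(a, d), h.da.symm⟩
      have hd : d₁ ≠ d₂ := fun he => h.bd (congrArg (fun d : G.graph.Dart => d.snd) he)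
      have : ∀ e : G.graph.Dart, (if e.fst = a then (if OnQuad a b c d e.fst e.snd then (1 : ZMod 2)
          else 0) else 0) = (if e = d₁ then 1 else 0) + (if e = d₂ then 1 else 0) := by
        intro e
        by_cases he : e.fst = a
        · have h1 : e = d₁ ↔ e.snd = b :=
            ⟨fun h => h ▸ rfl, fun h => dart_ext he h⟩
          have h2 : e = d₂ ↔ e.snd = d :=
            ⟨fun h => h ▸ rfl, fun h => dart_ext he h⟩
          have h3 : OnQuad a b c d e.fst e.snd ↔ e.snd = b ∨ e.snd = d := by
            have := h.ab.ne
            have := h.da.ne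
            have := h.ac
            simp only [OnQuad, Sym2.eq_iff]
            grind
          have := h.bd
          rw [if_pos he]
          simp only [h1, h2, h3]
          by_cases hb : e.snd = b <;> by_cases hd : e.snd = d <;> simp [hb, hd] <;> grind
        · have h1 : e ≠ d₁ := fun h => he (h ▸ rfl)
          have h2 : e ≠ d₂ := fun h => he (h ▸ rfl)
          simp [he, h1, h2]
      rw [Finset.sum_congr rfl fun e _ => this e, Finset.sum_add_distrib]
      simp
      decide
    by_cases hva : v = a
    · subst hva; exact key _ _ _ _ h
    have hr : ∀ a b c d x y : G.V, OnQuad b c d a x y ↔ OnQuad a b c d x y := fun a b c d x y =>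
      ⟨fun h => h.rot.rot.rot, fun h => h.rot⟩
    by_cases hvb : v = b
    · subst hvb
      have := key _ _ _ _ h.rot
      simpa only [hr] using this
    by_cases hvc : v = c
    · subst hvc
      have := key _ _ _ _ h.rot.rot
      simpa only [hr] using this
    by_cases hvd : v = d
    · subst hvd
      have := key _ _ _ _ h.rot.rot.rot
      simpa only [hr] using this
    refine Finset.sum_eq_zero fun e _ => ?_
    split_ifs with he
    · have : ¬ OnQuad a b c d e.fst e.snd := fun h => by
        have := h.mem.1
        grind
      simp [f, this]
    · rfl
  obtain ⟨φ, hφ⟩ := G.exists_side_of_even f hf hsum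
  -- The class of the outer face counts as the exterior. This choice makes outer darts never satisfy
  -- `S`.
  let S : G.V → G.V → Prop := fun x y => ∃ e : G.graph.Dart, e.fst = x ∧ e.snd = y ∧
    φ (G.sys.leftFace e) ≠ φ G.outer
  have hS : ∀ e : G.graph.Dart, S e.fst e.snd ↔ φ (G.sys.leftFace e) ≠ φ G.outer := by
    intro e
    refine ⟨?_, fun h => ⟨e, rfl, rfl, h⟩⟩
    rintro ⟨e', h1, h2, h3⟩
    rwa [dart_ext h1 h2] at h3
  have z1 : ∀ x y z : ZMod 2, x + y = 1 → (x ≠ z ↔ ¬ y ≠ z) := by decide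
  have z0 : ∀ x y z : ZMod 2, x + y = 0 → (x ≠ z ↔ y ≠ z) := by decide
  refine ⟨S, ?_, ?_, ?_, ?_, ?_⟩
  · rintro _ _ ⟨e, rfl, rfl, -⟩
    exact e.adj
  · rintro _ _ _ ⟨e, he, rfl, rfl, rfl⟩
    have := hS (G.sys.next e)
    rw [G.sys.leftFace_next, ← hS e, G.sys.next_fst] at this
    exact this.symm
  · rintro _ _ ⟨e, he, rfl, rfl⟩
    rw [hS, he]
    exact fun h => h rfl
  · intro x y hxy hq
    let e : G.graph.Dart := ⟨(x, y), hxy⟩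
    refine (hS e).trans (Iff.trans ?_ (not_congr (hS e.symm)).symm)
    refine z1 _ _ _ ((hφ e).trans ?_)
    exact if_pos hq
  · intro x y hxy hq
    let e : G.graph.Dart := ⟨(x, y), hxy⟩
    refine (hS e).trans (Iff.trans ?_ (hS e.symm).symm)
    refine z0 _ _ _ ((hφ e).trans ?_)
    exact if_neg hq

namespace Side

variable {Q : G.V → G.V → Prop} {S : G.V → G.V → Prop}

theorem step (hS : G.Side Q S) {v s t : G.V} (h : G.Step v s t) : S s v ↔ S v t := by
  rcases h with h | h
  · exact hS.face _ _ _ h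
  · exact iff_of_false (hS.outer _ _ h.1) (hS.outer _ _ h.2)

theorem const (hS : G.Side Q S) {v s t : G.V} (hv : ∀ x, ¬ Q v x) (hs : S v s)
    (ht : G.graph.Adj v t) : S v t := by
  refine nbr_induction (S v) (hS.adj _ _ hs) hs ?_ ht
  intro x y hxy hx
  exact (hS.step hxy).1 ((hS.off _ _ (hS.adj _ _ hx) (hv x)).1 hx)

/-- A union of faces with empty boundary is empty. -/
theorem eq_empty (hS : G.Side (fun _ _ => False) S) (x y : G.V) : ¬ S x y := by
  intro hxy
  obtain ⟨a, b, hab⟩ := G.exists_external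
  have := closed_eq_univ (fun v => ∀ t, G.graph.Adj v t → S v t) (s := x)
    (fun t ht => hS.const (fun _ h => h) hxy ht) (by
      intro v w hv hvw t ht
      exact hS.const (fun _ h => h) ((hS.off _ _ hvw (fun h => h)).1 (hv w hvw)) ht) a
  exact hS.outer _ _ hab (this b (adj_of_isOuter hab))

end Side

/-- A set of faces whose boundary contains at most one edge at `v` contains none. -/
theorem boundary_parity (S : G.V → G.V → Prop) {v p : G.V}
    (hstep : ∀ s t, G.Step v s t → (S s v ↔ S v t)) (hp : G.graph.Adj v p)
    (h : ∀ s, G.graph.Adj v s → s ≠ p → (S v s ↔ S s v)) : S v p ↔ S p v := by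
  obtain ⟨e, he⟩ := exists_step hp
  refine nbr_induction (v := v) (fun s => S v s ↔ S p v) (step_adj he).2 (hstep _ _ he).symm ?_ hp
  intro x y hxy hx
  by_cases hxp : x = p
  · subst hxp
    exact (hstep _ _ hxy).symm
  · rw [← hstep _ _ hxy, ← h x (step_adj hxy).1 hxp, hx]

/-- If the boundary of a set of faces at `v` consists of two edges `vp` and `vs`, where `p, q, r, s`
are consecutive neighbors of `v`, then the remaining neighbors of `v` are on the other side. -/
theorem fan_separation (hT : G.Tri) (S : G.V → G.V → Prop) {v p q r s t : G.V}
    (hstep : ∀ s t, G.Step v s t → (S s v ↔ S v t)) (vp : G.graph.Adj v p) (vq : G.graph.Adj v q)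
    (vr : G.graph.Adj v r) (vs : G.graph.Adj v s) (pq : G.graph.Adj p q) (qr : G.graph.Adj q r)
    (rs : G.graph.Adj r s) (hpr : p ≠ r) (hqs : q ≠ s)
    (hoff : ∀ x, G.graph.Adj v x → x ≠ p → x ≠ s → (S v x ↔ S x v)) (hp : S v p ↔ ¬ S p v)
    (hs : S v s ↔ ¬ S s v) (vt : G.graph.Adj v t) (tq : t ≠ q) (tr : t ≠ r) (tp : t ≠ p)
    (ts : t ≠ s) : S v t ↔ ¬ S v q := by
  have turn : ∀ x y, G.graph.Adj v x → G.graph.Adj v y → G.graph.Adj x y →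
      G.Step v x y ∨ G.Step v y x := by
    intro x y hx hy hxy
    rcases facial_iff.1 (hT x v y hx.symm hy hxy.symm) with h | h
    · exact Or.inl (Or.inl h)
    · exact Or.inr (Or.inl (isFace_rot (isFace_rot h)))
  have key : ∀ p q r s : G.V, G.Step v p q → G.Step v q r → G.Step v r s →
      (∀ x, G.graph.Adj v x → x ≠ p → x ≠ s → (S v x ↔ S x v)) → (S v p ↔ ¬ S p v) →
      (S v s ↔ ¬ S s v) → q ≠ p → q ≠ s → r ≠ p → r ≠ s →
      (S v r ↔ S v q) ∧ ∀ t, G.graph.Adj v t → t ≠ q → t ≠ r → t ≠ p →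
      t ≠ s → (S v t ↔ ¬ S v q) := by
    intro p q r s spq sqr srs hoff hp hs hqp hqs hrp hrs
    have e1 := hstep _ _ spq
    have e2 := hstep _ _ sqr
    have e3 := hstep _ _ srs
    have e4 := hoff q (step_adj spq).2 hqp hqs
    have e5 := hoff r (step_adj sqr).2 hrp hrs
    refine ⟨by rw [← e2, ← e4], fun t vt tq tr tp ts => ?_⟩
    have := nbr_induction (v := v) (fun t => t = q ∨ t = r ∨ t = s ∨ (S v t ↔ ¬ S v q))
      (step_adj srs).2 (Or.inr (Or.inr (Or.inl rfl))) (by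
        rintro x y hxy hx
        by_cases hxp : x = p
        · subst hxp
          exact Or.inl (step_unique hxy spq)
        rcases hx with rfl | rfl | rfl | hx
        · exact Or.inr (Or.inl (step_unique hxy sqr))
        · exact Or.inr (Or.inr (Or.inl (step_unique hxy srs)))
        · refine Or.inr (Or.inr (Or.inr ?_))
          rw [← hstep _ _ hxy, e4, e2, e5, e3, hs, not_not]
        · refine Or.inr (Or.inr (Or.inr ?_))
          by_cases hxs : x = s
          · subst hxs
            rw [← hstep _ _ hxy, e4, e2, e5, e3, hs, not_not]
          rw [← hstep _ _ hxy, ← hoff x (step_adj hxy).1 hxp hxs, hx]) vt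
    exact ((this.resolve_left tq).resolve_left tr).resolve_left ts
  -- The argument in `key` runs in the direction of rotation; if the fan is traversed the other way,
  -- `key` is applied to `s, r, q, p`.
  have hqp := pq.ne'
  have hrs := rs.ne
  rcases turn p q vp vq pq with h1 | h1
  · have h2 : G.Step v q r := (turn q r vq vr qr).resolve_right fun h => hpr (step_right_unique h1 h)
    have h3 : G.Step v r s := (turn r s vr vs rs).resolve_right fun h => hqs (step_right_unique h2 h)
    exact (key p q r s h1 h2 h3 hoff hp hs hqp hqs hpr.symm hrs).2 t vt tq tr tp ts
  · have h2 : G.Step v r q := (turn q r vq vr qr).resolve_left fun h => hpr (step_unique h1 h)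
    have h3 : G.Step v s r := (turn r s vr vs rs).resolve_left fun h => hqs (step_unique h2 h)
    obtain ⟨h4, h5⟩ := key s r q p h3 h2 h1 (fun x hx h h' => hoff x hx h' h) hs hp hrs hpr.symm
      hqs hqp
    rw [h4]
    exact (h5 t vt tr tq ts tp)

/-! ## A region in which every 4-cycle has a chord -/

/-- The chordless cycle `abcd`. -/
structure Hole (G : Canvas.{u}) (a b c d : G.V) : Prop extends G.Quad a b c d where
  chord₁ : ¬ G.graph.Adj a c
  chord₂ : ¬ G.graph.Adj b d

theorem Hole.rot {a b c d : G.V} (h : G.Hole a b c d) : G.Hole b c d a :=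
  ⟨h.toQuad.rot, h.chord₂, fun h' => h.chord₁ h'.symm⟩

theorem Hole.onQuad {a b c d x y : G.V} (h : G.Hole a b c d) (hxy : G.graph.Adj x y)
    (hx : x = a ∨ x = b ∨ x = c ∨ x = d) (hy : y = a ∨ y = b ∨ y = c ∨ y = d) :
    OnQuad a b c d x y := by
  have h1 := h.chord₁
  have h2 := h.chord₂
  have h3 := hxy.symm
  simp only [OnQuad, Sym2.eq_iff]
  rcases hx with rfl | rfl | rfl | rfl <;> rcases hy with rfl | rfl | rfl | rfl <;> simp_all

theorem Hole.third {a b c d x y z : G.V} (h : G.Hole a b c d) (hq : OnQuad a b c d x y)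
    (hx : G.graph.Adj z x) (hy : G.graph.Adj z y) : ¬ (z = a ∨ z = b ∨ z = c ∨ z = d) := by
  intro hz
  have h1 := h.onQuad hx hz hq.mem.1
  have h2 := h.onQuad hy hz hq.mem.2
  have := h.ac
  have := h.bd
  have := h.ab.ne
  have := h.bc.ne
  have := h.cd.ne
  have := h.da.ne
  simp only [OnQuad, Sym2.eq_iff] at hq h1 h2
  grind

theorem Hole.adj_of_onQuad {a b c d x y : G.V} (h : G.Hole a b c d) (hq : OnQuad a b c d x y) :
    G.graph.Adj x y := by
  simp only [OnQuad, Sym2.eq_iff] at hq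
  rcases hq with (⟨rfl, rfl⟩ | ⟨rfl, rfl⟩) | (⟨rfl, rfl⟩ | ⟨rfl, rfl⟩) |
    (⟨rfl, rfl⟩ | ⟨rfl, rfl⟩) | (⟨rfl, rfl⟩ | ⟨rfl, rfl⟩)
  exacts [h.ab, h.ab.symm, h.bc, h.bc.symm, h.cd, h.cd.symm, h.da, h.da.symm]

/-- The vertices inside the closed curve `abcd`. -/
def Inside (S : G.V → G.V → Prop) (a b c d v : G.V) : Prop :=
  ¬ (v = a ∨ v = b ∨ v = c ∨ v = d) ∧ ∃ s, S v s

section Inside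

variable {S : G.V → G.V → Prop} {a b c d v t : G.V}

theorem Inside.side (hS : G.Side (OnQuad a b c d) S) (hv : Inside S a b c d v)
    (ht : G.graph.Adj v t) : S v t ∧ S t v := by
  obtain ⟨hv, s, hs⟩ := hv
  have hn : ∀ x, ¬ OnQuad a b c d v x := fun x h => hv h.mem.1
  have := hS.const hn hs ht
  exact ⟨this, (hS.off _ _ ht (hn t)).1 this⟩

theorem Inside.internal (hS : G.Side (OnQuad a b c d) S) (hv : Inside S a b c d v) :
    G.Internal v := by
  rintro ⟨t, ht⟩
  exact hS.outer _ _ ht (hv.side hS (adj_of_isOuter ht)).1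

theorem Inside.nbr (hS : G.Side (OnQuad a b c d) S) (hv : Inside S a b c d v)
    (ht : G.graph.Adj v t) (hn : ¬ (t = a ∨ t = b ∨ t = c ∨ t = d)) : Inside S a b c d t :=
  ⟨hn, v, (hv.side hS ht).2⟩

theorem or_iff_or_of_flip {a b c d : Prop} (h : ¬ (a ∧ ¬ b ↔ c ∧ ¬ d)) (h' : b ↔ ¬ d) :
    a ∨ b ↔ c ∨ d := by
  tauto

theorem or_iff_or_of_no_flip {a b c d : Prop} (h : a ∧ ¬ b ↔ c ∧ ¬ d) (h' : b ↔ d) :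
    a ∨ b ↔ c ∨ d := by
  tauto

/-- The hole is inside the region enclosed by another one. -/
theorem Hole.nest (h : G.Hole a b c d) (hS : G.Side (OnQuad a b c d) S) {k₀ k₁ k₂ k₃ : G.V}
    {T : G.V → G.V → Prop} (hT : G.Side (OnQuad k₀ k₁ k₂ k₃) T)
    (hk : ∀ x, x = k₀ ∨ x = k₁ ∨ x = k₂ ∨ x = k₃ →
      Inside S a b c d x ∨ (x = a ∨ x = b ∨ x = c ∨ x = d)) (x y : G.V) (hxy : T x y) :
    S x y := by
  -- The part `T ∖ S` changes only across edges of `abcd`: an edge of the other hole that is not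
  -- inside `S` has both ends among the corners, and a chordless cycle has no further edges between
  -- its corners.
  have hoff : ∀ x y, G.graph.Adj x y → ¬ OnQuad a b c d x y →
      (T x y ∧ ¬ S x y ↔ T y x ∧ ¬ S y x) := by
    intro x y hxy hq
    have h1 := hS.off x y hxy hq
    by_cases hs : S x y
    · tauto
    by_cases hK : OnQuad k₀ k₁ k₂ k₃ x y
    · exfalso
      rcases hk x hK.mem.1 with h2 | h2
      · exact hs (h2.side hS hxy).1
      rcases hk y hK.mem.2 with h3 | h3
      · exact hs (h3.side hS hxy.symm).2
      exact hq (h.onQuad hxy h2 h3)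
    · have := hT.off x y hxy hK
      tauto
  have hface : ∀ x y z, G.IsFace x y z → (T x y ∧ ¬ S x y ↔ T y z ∧ ¬ S y z) := by
    intro x y z hf
    rw [hT.face _ _ _ hf, hS.face _ _ _ hf]
  have hstep : ∀ v s t, G.Step v s t → (T s v ∧ ¬ S s v ↔ T v t ∧ ¬ S v t) := by
    intro v s t hs
    rw [hT.step hs, hS.step hs]
  let X : G.V → G.V → Prop := fun x y => T x y ∧ ¬ S x y
  -- By parity at a corner, `T ∖ S` changes across both or neither of the two cycle edges there.
  -- Hence its boundary is empty or the whole cycle `abcd`.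
  have spread : ∀ a b c d : G.V, G.Hole a b c d → (∀ x y, G.graph.Adj x y →
      ¬ OnQuad a b c d x y → (X x y ↔ X y x)) → (X a b ↔ X b a) → (X b c ↔ X c b) := by
    intro a b c d h hoff hab
    refine boundary_parity X (hstep b) h.bc fun s hs hsc => ?_
    by_cases hsa : s = a
    · rw [hsa]; exact hab.symm
    · refine hoff b s hs ?_
      have := h.ab.ne
      have := h.bc.ne
      have := h.bd
      simp only [OnQuad, Sym2.eq_iff]
      grind
  have hr : ∀ a b c d x y : G.V, OnQuad b c d a x y ↔ OnQuad a b c d x y := fun a b c d x y =>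
    ⟨fun h => h.rot.rot.rot, fun h => h.rot⟩
  have s1 := spread a b c d h hoff
  have s2 := spread b c d a h.rot (by simpa only [hr] using hoff)
  have s3 := spread c d a b h.rot.rot (by simpa only [hr] using hoff)
  have s4 := spread d a b c h.rot.rot.rot (by simpa only [hr] using hoff)
  by_cases hX : X a b ↔ X b a
  · have hX1 := s1 hX
    have hX2 := s2 hX1
    have hX3 := s3 hX2
    have hall : ∀ x y, OnQuad a b c d x y → (X x y ↔ X y x) := by
      intro x y hq
      simp only [OnQuad, Sym2.eq_iff] at hq
      rcases hq with (⟨rfl, rfl⟩ | ⟨rfl, rfl⟩) | (⟨rfl, rfl⟩ | ⟨rfl, rfl⟩) |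
        (⟨rfl, rfl⟩ | ⟨rfl, rfl⟩) | (⟨rfl, rfl⟩ | ⟨rfl, rfl⟩)
      exacts [hX, hX.symm, hX1, hX1.symm, hX2, hX2.symm, hX3, hX3.symm]
    have hX0 : G.Side (fun _ _ => False) X :=
      ⟨fun x y h => hT.adj _ _ h.1, hface, fun x y ho h => hT.outer _ _ ho h.1,
        fun _ _ _ h => h.elim, fun x y hxy _ => by
          by_cases hq : OnQuad a b c d x y
          · exact hall x y hq
          · exact hoff x y hxy hq⟩
    by_contra hs
    exact hX0.eq_empty x y ⟨hxy, hs⟩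
  · exfalso
    have hnone : ∀ x y, OnQuad a b c d x y → ¬ (X x y ↔ X y x) := by
      intro x y hq
      simp only [OnQuad, Sym2.eq_iff] at hq
      rcases hq with (⟨rfl, rfl⟩ | ⟨rfl, rfl⟩) | (⟨rfl, rfl⟩ | ⟨rfl, rfl⟩) |
        (⟨rfl, rfl⟩ | ⟨rfl, rfl⟩) | (⟨rfl, rfl⟩ | ⟨rfl, rfl⟩)
      exacts [hX, fun h => hX h.symm, fun h => hX (s4 (s3 (s2 h))),
        fun h => hX (s4 (s3 (s2 h.symm))), fun h => hX (s4 (s3 h)), fun h => hX (s4 (s3 h.symm)),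
        fun h => hX (s4 h), fun h => hX (s4 h.symm)]
    -- If `T ∖ S` has the boundary of `S`, then it lies just outside of `S` along the whole cycle.
    -- So `T ∪ S` has no boundary, although it is nonempty and misses the outer face.
    have hX0 : G.Side (fun _ _ => False) (fun x y => T x y ∨ S x y) := by
      refine ⟨fun x y h => h.elim (hT.adj _ _) (hS.adj _ _), fun x y z hf => by
        rw [hT.face _ _ _ hf, hS.face _ _ _ hf], fun x y ho h => h.elim (hT.outer _ _ ho)
        (hS.outer _ _ ho), fun _ _ _ h => h.elim, fun x y hxy _ => ?_⟩
      by_cases hq : OnQuad a b c d x y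
      · have h1 := hnone x y hq
        have h2 := hS.on x y hxy hq
        exact or_iff_or_of_flip h1 h2
      · exact or_iff_or_of_no_flip (hoff x y hxy hq) (hS.off x y hxy hq)
    have := hS.on a b h.ab (Or.inl rfl)
    by_cases hs : S a b
    · exact hX0.eq_empty a b (Or.inr hs)
    · exact hX0.eq_empty b a (Or.inr (not_not.1 fun h => hs (this.2 h)))

end Inside

/-- All the edges leaving `I` lead to the hole `abcd`, which is the boundary of `I`. -/
structure Frame (G : Canvas.{u}) (I : G.V → Prop) (a b c d : G.V) : Prop
    extends G.Hole a b c d where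
  not_mem : ∀ x, x = a ∨ x = b ∨ x = c ∨ x = d → ¬ I x
  nbr : ∀ v t, I v → G.graph.Adj v t → ¬ I t → t = a ∨ t = b ∨ t = c ∨ t = d
  inner : ∀ x y, OnQuad a b c d x y → ∃ z, I z ∧ G.graph.Adj z x ∧ G.graph.Adj z y
  opposite : ∀ x y, OnQuad a b c d x y → G.Internal x → ∃ z, ¬ I z ∧
    ¬ (z = a ∨ z = b ∨ z = c ∨ z = d) ∧ G.graph.Adj z x ∧ G.graph.Adj z y

theorem Frame.rot {I : G.V → Prop} {a b c d : G.V} (h : G.Frame I a b c d) :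
    G.Frame I b c d a where
  toHole := h.toHole.rot
  not_mem x hx := h.not_mem x (by tauto)
  nbr v t hv ht hn := by have := h.nbr v t hv ht hn; tauto
  inner x y hq := h.inner x y hq.rot.rot.rot
  opposite x y hq hx := by
    obtain ⟨z, h1, h2, h3⟩ := h.opposite x y hq.rot.rot.rot hx
    exact ⟨z, h1, by tauto, h3⟩

/-- A set of internal vertices such that each 4-cycle through one of them has a chord. -/
structure Region (G : Canvas.{u}) (I : G.V → Prop) : Prop where
  nonempty : ∃ v, I v
  internal : ∀ v, I v → G.Internal v
  chord : ∀ u v a b, I u → G.Quad u v a b → G.graph.Adj u a ∨ G.graph.Adj v b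
  boundary : (∀ v t, I v → G.graph.Adj v t → ¬ I t → G.External t) ∨
    ∃ a b c d, G.Frame I a b c d

/-- Among all chordless 4-cycles with their inner sides, choose one whose side contains the fewest
darts. A chordless 4-cycle through an inner vertex that stays in the closed disk would have a
smaller side, and one that leaves the disk must do so through two opposite corners, which is
excluded separately. -/
theorem exists_region {ℓ : ℕ} (hG : G.IsCandidate ℓ) (hint : ∃ v, G.Internal v) :
    ∃ I, G.Region I := by
  classical
  have := G.finite
  by_cases hex : ∃ n, ∃ a b c d S, G.Hole a b c d ∧ G.Side (OnQuad a b c d) S ∧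
      {p : G.V × G.V | S p.1 p.2}.ncard = n
  swap
  · refine ⟨G.Internal, hint, fun v h => h, ?_, Or.inl fun v t _ _ h => not_not.1 h⟩
    intro u v a b _ hq
    by_contra hn
    rw [not_or] at hn
    obtain ⟨S, hS⟩ := exists_side hq
    exact hex ⟨_, _, _, _, _, S, ⟨hq, hn.1, hn.2⟩, hS, rfl⟩
  obtain ⟨a, b, c, d, S, hC, hS, hn⟩ := Nat.find_spec hex
  have hmin : ∀ a' b' c' d' T, G.Hole a' b' c' d' → G.Side (OnQuad a' b' c' d') T →
      {p : G.V × G.V | S p.1 p.2}.ncard ≤ {p : G.V × G.V | T p.1 p.2}.ncard := by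
    intro a' b' c' d' T h1 h2
    rw [hn]
    exact Nat.find_min' hex ⟨a', b', c', d', T, h1, h2, rfl⟩
  have hnest : ∀ u v p q, Inside S a b c d u → G.Hole u v p q →
      (∀ x, x = v ∨ x = p ∨ x = q →
        Inside S a b c d x ∨ (x = a ∨ x = b ∨ x = c ∨ x = d)) → False := by
    intro u v p q hu hK hall
    obtain ⟨T, hT⟩ := exists_side hK.toQuad
    have hsub := hC.nest hS hT (by
      rintro x (rfl | hx)
      · exact Or.inl hu
      · exact hall x hx)
    -- The inclusion is strict: both darts of the edge `uv` at the inner vertex `u` lie in `S`, but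
    -- only one of them lies in `T`, because `uv` is on the other hole.
    have hlt : {p : G.V × G.V | T p.1 p.2}.ncard < {p : G.V × G.V | S p.1 p.2}.ncard := by
      refine Set.ncard_lt_ncard ⟨fun p hp => hsub _ _ hp, fun hsub' => ?_⟩ (Set.toFinite _)
      obtain ⟨h1, h2⟩ := hu.side hS hK.ab
      have h3 : T u v := hsub' (a := (u, v)) h1
      have h4 : T v u := hsub' (a := (v, u)) h2
      exact (hT.on u v hK.ab (Or.inl rfl)).1 h3 h4
    have := hmin u v p q T hK hT
    omega
  have hedge : ∀ x y, OnQuad a b c d x y → G.graph.Adj x y := fun x y => hC.adj_of_onQuad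
  have hthird : ∀ x y z, OnQuad a b c d x y → G.graph.Adj z x → G.graph.Adj z y →
      ¬ (z = a ∨ z = b ∨ z = c ∨ z = d) := fun x y z => hC.third
  have hinner : ∀ x y, OnQuad a b c d x y →
      ∃ z, Inside S a b c d z ∧ G.graph.Adj z x ∧ G.graph.Adj z y := by
    have key : ∀ x y, OnQuad a b c d x y → S x y →
      ∃ z, Inside S a b c d z ∧ G.graph.Adj z x ∧ G.graph.Adj z y := by
      intro x y hq hs
      rcases (isOuter_or_isFace (hedge x y hq)).symm with ⟨z, hz⟩ | hz
      · have h1 : G.graph.Adj z x := adj_of_isFace (isFace_rot (isFace_rot hz))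
        have h2 : G.graph.Adj z y := (adj_of_isFace (isFace_rot hz)).symm
        have hn := hthird x y z hq h1 h2
        have h3 := (hS.face _ _ _ hz).1 hs
        exact ⟨z, ⟨hn, y, (hS.off _ _ h2.symm fun h => hn h.mem.2).1 h3⟩, h1, h2⟩
      · exact absurd hs (hS.outer _ _ hz)
    intro x y hq
    by_cases hs : S x y
    · exact key x y hq hs
    · obtain ⟨z, h1, h2, h3⟩ := key y x hq.symm
        (by have := hS.on x y (hedge x y hq) hq; tauto)
      exact ⟨z, h1, h3, h2⟩
  have hframe : G.Frame (Inside S a b c d) a b c d := by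
    refine ⟨hC, fun x hx h => h.1 hx, fun v t hv ht hn => ?_, hinner, ?_⟩
    · by_contra h
      exact hn (hv.nbr hS ht h)
    · intro x y hq hx
      have hxy := hedge x y hq
      have key : ∃ z, G.graph.Adj z x ∧ G.graph.Adj z y ∧ ¬ S z x := by
        by_cases hs : S x y
        · obtain ⟨z, hz⟩ := isFace_of_internal hxy.symm (Or.inr hx)
          refine ⟨z, (adj_of_isFace (isFace_rot hz)).symm,
            adj_of_isFace (isFace_rot (isFace_rot hz)), ?_⟩
          have hn := hthird x y z hq (adj_of_isFace (isFace_rot hz)).symm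
            (adj_of_isFace (isFace_rot (isFace_rot hz)))
          have h1 := hS.on x y hxy hq
          have h2 := hS.face _ _ _ hz
          have h3 := hS.off _ _ (adj_of_isFace (isFace_rot hz)) fun h => hn h.mem.2
          tauto
        · obtain ⟨z, hz⟩ := isFace_of_internal hxy (Or.inl hx)
          refine ⟨z, adj_of_isFace (isFace_rot (isFace_rot hz)),
            (adj_of_isFace (isFace_rot hz)).symm, ?_⟩
          have h2 := hS.face _ _ _ (isFace_rot (isFace_rot hz))
          tauto
      obtain ⟨z, h1, h2, h3⟩ := key
      exact ⟨z, fun h => h3 (h.side hS h1).1, hthird x y z hq h1 h2, h1, h2⟩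
  obtain ⟨z₀, hz₀, -⟩ := hinner a b (Or.inl rfl)
  refine ⟨Inside S a b c d, ⟨z₀, hz₀⟩, fun v hv => hv.internal hS, ?_,
    Or.inr ⟨a, b, c, d, hframe⟩⟩
  intro u v p q hu hq
  by_contra hn
  rw [not_or] at hn
  have hv : Inside S a b c d v ∨ (v = a ∨ v = b ∨ v = c ∨ v = d) :=
    or_iff_not_imp_left.2 (hframe.nbr u v hu hq.ab)
  have hq' : Inside S a b c d q ∨ (q = a ∨ q = b ∨ q = c ∨ q = d) :=
    or_iff_not_imp_left.2 (hframe.nbr u q hu hq.da.symm)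
  by_cases hp : Inside S a b c d p ∨ (p = a ∨ p = b ∨ p = c ∨ p = d)
  · refine hnest u v p q hu ⟨hq, hn.1, hn.2⟩ ?_
    rintro x (rfl | rfl | rfl) <;> assumption
  have hv' := hv.resolve_left fun h => hp (or_iff_not_imp_left.2 (hframe.nbr v p h hq.bc))
  have hq'' := hq'.resolve_left fun h => hp (or_iff_not_imp_left.2 (hframe.nbr q p h hq.cd.symm))
  -- Here `u` is adjacent to opposite corners `v` and `q`. The 4-cycles `uveq` and `uvfq` stay in
  -- the closed disk, so they have chords; thus `u` is adjacent to all four corners and would have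
  -- degree four.
  have key : ∀ v e q f : G.V, G.Hole v e q f → (∀ x, x = v ∨ x = e ∨ x = q ∨ x = f →
      (x = a ∨ x = b ∨ x = c ∨ x = d)) → G.graph.Adj u v → G.graph.Adj u q → False := by
    intro v e q f h hall huv huq
    have hne : ∀ x, x = v ∨ x = e ∨ x = q ∨ x = f → u ≠ x := by
      rintro x hx rfl
      exact hu.1 (hall u hx)
    have h1 : G.graph.Adj u e := by
      by_contra h1
      refine hnest u v e q hu ⟨⟨huv, h.ab, h.bc, huq.symm, hne e (by simp), h.ac⟩, h1, h.chord₁⟩ ?_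
      rintro x (rfl | rfl | rfl) <;> exact Or.inr (hall _ (by simp))
    have h2 : G.graph.Adj u f := by
      by_contra h2
      refine hnest u v f q hu
        ⟨⟨huv, h.da.symm, h.cd.symm, huq.symm, hne f (by simp), h.ac⟩, h2, h.chord₁⟩ ?_
      rintro x (rfl | rfl | rfl) <;> exact Or.inr (hall _ (by simp))
    exact not_closed_four hG huv h1 huq h2 h.ab h.bc h.cd h.da h.ac h.bd
  have hvq : ¬ OnQuad a b c d v q := fun h => hn.2 (hedge _ _ h)
  have hbd := hq.bd
  rcases hv' with rfl | rfl | rfl | rfl <;> rcases hq'' with rfl | rfl | rfl | rfl <;>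
    first
    | exact absurd rfl hbd
    | (refine key _ _ _ _ hC ?_ hq.ab hq.da.symm; grind)
    | (refine key _ _ _ _ hC.rot ?_ hq.ab hq.da.symm; grind)
    | (refine key _ _ _ _ hC.rot.rot ?_ hq.ab hq.da.symm; grind)
    | (refine key _ _ _ _ hC.rot.rot.rot ?_ hq.ab hq.da.symm; grind)
    | exact hvq (by simp [OnQuad])

end Canvas

namespace Canvas

variable {G : Canvas.{u}}

/-! ## Vertices of degree five in a region -/

def Big (G : Canvas.{u}) (v : G.V) : Prop := G.External v ∨ 6 ≤ G.deg v

theorem InternalFive.not_big {v : G.V} (h : G.InternalFive v) : ¬ G.Big v := by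
  rintro (h' | h')
  · exact h.1 h'
  · have := h.2
    omega

theorem Frame.refl {I : G.V → Prop} {a b c d : G.V} (h : G.Frame I a b c d) :
    G.Frame I a d c b := by
  have hq : ∀ x y, OnQuad a d c b x y → OnQuad a b c d x y := by
    intro x y h
    simp only [OnQuad, Sym2.eq_iff] at h ⊢
    tauto
  exact
  { ab := h.da.symm
    bc := h.cd.symm
    cd := h.bc.symm
    da := h.ab.symm
    ac := h.ac
    bd := h.bd.symm
    chord₁ := h.chord₁
    chord₂ := fun h' => h.chord₂ h'.symm
    not_mem := fun x hx => h.not_mem x (by tauto)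
    nbr := fun v t hv ht hn => by have := h.nbr v t hv ht hn; tauto
    inner := fun x y hxy => h.inner x y (hq x y hxy)
    opposite := fun x y hxy hx => by
      obtain ⟨z, h1, h2, h3⟩ := h.opposite x y (hq x y hxy) hx
      exact ⟨z, h1, by tauto, h3⟩ }

section Region

variable {ℓ : ℕ} (hG : G.IsCandidate ℓ) {I : G.V → Prop} (hI : G.Region I)
include hI

theorem Region.exists_frame {s v : G.V} (hs : G.Internal s) (hsI : ¬ I s) (hv : I v)
    (h : G.graph.Adj v s) : ∃ b c d, G.Frame I s b c d := by
  rcases hI.boundary with hb | ⟨a, b, c, d, hF⟩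
  · exact absurd (hb v s hv h hsI) hs
  · rcases hF.nbr v s hv h hsI with rfl | rfl | rfl | rfl
    · exact ⟨_, _, _, hF⟩
    · exact ⟨_, _, _, hF.rot⟩
    · exact ⟨_, _, _, hF.rot.rot⟩
    · exact ⟨_, _, _, hF.rot.rot.rot⟩

/-- Besides its neighbors in `I`, such an `s` is a corner of the frame with two neighbors on the
frame and, being internal, one more outside. A third neighbor in `I` would make the degree six. -/
theorem Region.not_three {s p q r : G.V} (hs : G.InternalFive s) (hsI : ¬ I s) (hp : I p)
    (hq : I q) (hr : I r) (hpq : p ≠ q) (hpr : p ≠ r) (hqr : q ≠ r) (sp : G.graph.Adj s p)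
    (sq : G.graph.Adj s q) (sr : G.graph.Adj s r) : False := by
  obtain ⟨b, c, d, hF⟩ := hI.exists_frame hs.1 hsI hp sp.symm
  obtain ⟨z, hz, hzC, zs, zb⟩ := hF.opposite s b (Or.inl rfl) hs.1
  have hb := hF.not_mem b (by simp)
  have hd := hF.not_mem d (by simp)
  have hbd := hF.bd
  have h6 := length_le_deg (v := s) (L := [p, q, r, b, d, z]) (by simp; grind) (by
    simp only [List.mem_cons, List.not_mem_nil, or_false]
    rintro t (rfl | rfl | rfl | rfl | rfl | rfl)
    exacts [sp, sq, sr, hF.ab, hF.da.symm, zs.symm])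
  have := hs.2
  simp at h6
  omega

include hG

/-- Through each of the other two corners there is a 4-cycle containing `v`. As the frame is
chordless, the chord must join `v` to that corner, so `v` is adjacent to all four. -/
theorem Region.not_opposite {a b c d v : G.V} (hF : G.Frame I a b c d) (hv : I v)
    (ha : G.graph.Adj v a) (hc : G.graph.Adj v c) : False := by
  have key : ∀ e, G.graph.Adj a e → G.graph.Adj e c → ¬ I e → G.graph.Adj v e := by
    intro e hae hec he
    refine (hI.chord v a e c hv ⟨ha, hae, hec, hc.symm, ?_, hF.ac⟩).resolve_right hF.chord₁
    rintro rfl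
    exact he hv
  exact not_closed_four hG ha (key b hF.ab hF.bc (hF.not_mem b (by simp))) hc
    (key d hF.da.symm hF.cd.symm (hF.not_mem d (by simp))) hF.ab hF.bc hF.cd hF.da hF.ac hF.bd

theorem Region.adj_outside {v s t : G.V} (hv : I v) (hs : G.Internal s) (hsI : ¬ I s)
    (htI : ¬ I t) (hst : s ≠ t) (vs : G.graph.Adj v s) (vt : G.graph.Adj v t) :
    G.graph.Adj s t := by
  obtain ⟨b, c, d, hF⟩ := hI.exists_frame hs hsI hv vs
  rcases hF.nbr v t hv vt htI with rfl | rfl | rfl | rfl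
  · exact absurd rfl hst
  · exact hF.ab
  · exact (hI.not_opposite hG hF hv vs vt).elim
  · exact hF.da.symm

/-- The two vertices would be consecutive corners, with common neighbors `i` inside and `z` outside.
Degree five forces each of the other corners to be adjacent to `i` or to `z`. The chord condition
makes `i` adjacent to both of them or to neither, so `i` or `z` is adjacent to all four corners. -/
theorem Region.not_adj_outside {u u' s t : G.V} (hu : I u) (hu' : I u') (hs : G.InternalFive s)
    (ht : G.InternalFive t) (hsI : ¬ I s) (htI : ¬ I t) (us : G.graph.Adj u s)
    (ut : G.graph.Adj u' t) : ¬ G.graph.Adj s t := by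
  intro hst
  obtain ⟨b, c, d, hF⟩ := hI.exists_frame hs.1 hsI hu us
  have key : ∀ s t c d z i : G.V, G.Frame I s t c d → G.InternalFive s → I i →
      G.graph.Adj i s → G.graph.Adj i t → ¬ I z → z ≠ d → G.graph.Adj z s → G.graph.Adj z t →
      G.graph.Adj i d ∨ G.graph.Adj z d := by
    intro s t c d z i hF hs hi is it hz hzd zs zt
    obtain ⟨i', p, q, hW⟩ := exists_W5 hG.tri hs zs.symm hF.ab zt
    have hd := hF.not_mem d (by simp)
    obtain ⟨x, y, hxy, h⟩ := exists_common hG.tri hs.1 hF.ab.symm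
    obtain rfl : i' = i := by
      have h1 := (h i').1 ⟨hW.bc.symm, hW.adj.2.2.1.symm⟩
      have h2 := (h i).1 ⟨it, is⟩
      have h3 := (h z).1 ⟨zt, zs⟩
      have := hW.ne
      grind
    rcases (hW.nbr d).1 hF.da.symm with rfl | rfl | rfl | rfl | rfl
    · exact absurd rfl hzd
    · exact absurd rfl hF.bd
    · exact absurd hi hd
    · exact Or.inl hW.cd
    · exact Or.inr hW.ea.symm
  have main : ∀ b c d, G.Frame I s b c d → t = b → False := by
    rintro b c d hF rfl
    obtain ⟨i, hi, is, it⟩ := hF.inner s t (Or.inl rfl)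
    obtain ⟨z, hz, hzC, zs, zt⟩ := hF.opposite s t (Or.inl rfl) hs.1
    simp only [not_or] at hzC
    have h1 := key s t c d z i hF hs hi is it hz hzC.2.2.2 zs zt
    have h2 := key t s d c z i hF.rot.refl ht hi it is hz hzC.2.2.1 zt zs
    have hid : ∀ x, ¬ I x → i ≠ x := by rintro _ hx rfl; exact hx hi
    have hc := hid c (hF.not_mem c (by simp))
    have hd := hid d (hF.not_mem d (by simp))
    have h3 : G.graph.Adj i d → G.graph.Adj i c := fun h =>
      (hI.chord i t c d hi ⟨it, hF.bc, hF.cd, h.symm, hc, hF.bd⟩).resolve_right hF.chord₂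
    have h4 : G.graph.Adj i c → G.graph.Adj i d := fun h =>
      (hI.chord i s d c hi ⟨is, hF.da.symm, hF.cd.symm, h.symm, hd, hF.ac⟩).resolve_right hF.chord₁
    by_cases h5 : G.graph.Adj i c
    · exact not_closed_four hG is it h5 (h4 h5) hF.ab hF.bc hF.cd hF.da hF.ac hF.bd
    · exact not_closed_four hG zs zt (h2.resolve_left h5)
        (h1.resolve_left fun h => h5 (h3 h)) hF.ab hF.bc hF.cd hF.da hF.ac hF.bd
  rcases hF.nbr u' t hu' ut htI with rfl | h | rfl | h
  · exact hst.ne rfl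
  · exact main _ _ _ hF h
  · exact hF.chord₁ hst
  · exact main _ _ _ hF.refl h

/-- Two outside neighbors of `v` would be adjacent corners of the frame, which cannot both be small.
-/
theorem Region.eq_outside {v s t : G.V} (hv : I v) (hs : G.InternalFive s)
    (ht : G.InternalFive t) (hsI : ¬ I s) (htI : ¬ I t) (vs : G.graph.Adj v s)
    (vt : G.graph.Adj v t) : s = t := by
  by_contra hst
  exact hI.not_adj_outside hG hv hv hs ht hsI htI vs vt
    (hI.adj_outside hG hv hs.1 hsI htI hst vs vt)

end Region

end Canvas

/-! ### The 2-contraction and the existence of a full hub -/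

namespace Canvas

variable {G : Canvas.{u}}

theorem Contr.internal_of_unique {H : Canvas.{u}} {f : G.V → H.V} (hf : Contr G H f) {a : G.V}
    (ha : G.Internal a) (h : ∀ b, f b = f a → b = a) : H.Internal (f a) := by
  intro h'
  obtain ⟨b, hb, hba⟩ := (hf.external_iff _).1 h'
  rw [h b hba] at hb
  exact ha hb

theorem Contr.adj_of_unique {H : Canvas.{u}} {f : G.V → H.V} (hf : Contr G H f) {a b : G.V}
    (h : H.graph.Adj (f a) (f b)) (ha : ∀ x, f x = f a → x = a) (hb : ∀ x, f x = f b → x = b) :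
    G.graph.Adj a b := by
  obtain ⟨-, x, y, hxy, h1, h2⟩ := (hf.adj _ _).1 h
  rwa [ha x h1, hb y h2] at hxy

theorem Big.six_le {v : G.V} (h : G.Big v) (hv : G.Internal v) : 6 ≤ G.deg v :=
  h.resolve_left hv

section Region

variable {ℓ : ℕ} (hG : G.IsCandidate ℓ) {I : G.V → Prop} (hI : G.Region I)
include hI hG

/-- The 2-contraction. -/
theorem Region.reducible_of_two {v m₀ m₁ m₂ m₃ m₄ x y : G.V} (hW : G.W5 v m₀ m₁ m₂ m₃ m₄)
    (hW' : G.W5 m₂ v m₁ x y m₃) (hv : I v) (h2 : I m₂) (s1 : G.InternalFive m₁)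
    (s3 : G.InternalFive m₃) (h0 : G.Big m₀) (hy : G.Big y) : G.Reducible ℓ := by
  have s0 := hW.internalFive
  have s2 := hW'.internalFive
  obtain ⟨n0, n1, n2, n3, n4⟩ := hW.adj
  obtain ⟨k1, k2, k3, k4, k5⟩ := hW.ne_hub
  have hne := hW.ne
  have hne' := hW'.ne
  obtain ⟨H₁, f, hf, hfib, hT₁, d1, d2, d3⟩ := exists_contr_edge_tri hG.tri n1.symm s0.1
    (fun a b va ab bu hau hbv =>
      (hI.chord v a b m₁ hv ⟨va, ab, bu, n1.symm, hbv.symm, hau⟩).imp_right fun h => h.symm)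
  have hfvm : f m₁ = f v := (hfib _ _).2 (Or.inr (Or.inl ⟨rfl, rfl⟩))
  have huniq : ∀ a, a ≠ v → a ≠ m₁ → ∀ b, f b = f a → b = a := by
    intro a h1 h2 b hb
    rw [hfib] at hb
    tauto
  have hne2 : f m₂ ≠ f v := fun h => k3 (huniq m₂ k3.symm (by grind) v h.symm)
  have hne3 : f m₃ ≠ f v := fun h => k4 (huniq m₃ k4.symm (by grind) v h.symm)
  have hne23 : f m₂ ≠ f m₃ := fun h => hW.cd.ne (huniq m₃ k4.symm (by grind) m₂ h)
  have u2 := huniq m₂ k3.symm (by grind)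
  have u3 := huniq m₃ k4.symm (by grind)
  -- In the intermediate canvas, a 4-cycle along the second edge either passes through the merged
  -- vertex, which is adjacent to both ends of that edge, or lifts to a 4-cycle of `G` through `m₂ ∈
  -- I`. In both cases it has a chord.
  obtain ⟨H₂, g, hg, hgib, hT₂, e1, e2, e3⟩ := exists_contr_edge_tri hT₁ (hf.adj_of hW.cd hne23)
    (hf.internal_of_unique s3.1 u3) (by
      intro a b h1 h2' h3 ha hb
      obtain ⟨a, rfl⟩ := hf.surjective a
      obtain ⟨b, rfl⟩ := hf.surjective b
      by_cases hav : f a = f v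
      · right; rw [hav]; exact hf.adj_of n2.symm hne2
      by_cases hbv : f b = f v
      · left; rw [hbv]; exact hf.adj_of n3.symm hne3
      have ua := huniq a (by rintro rfl; exact hav rfl) (by rintro rfl; exact hav hfvm)
      have ub := huniq b (by rintro rfl; exact hbv rfl) (by rintro rfl; exact hbv hfvm)
      have h1' := hf.adj_of_unique h1 u3 ua
      have h2'' := hf.adj_of_unique h2' ua ub
      have h3' := hf.adj_of_unique h3 ub u2
      rcases hI.chord m₂ m₃ a b h2 ⟨hW.cd, h1', h2'', h3', by rintro rfl; exact ha rfl,
        by rintro rfl; exact hb rfl⟩ with h | h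
      · right; exact hf.adj_of h ha.symm
      · left; exact hf.adj_of h hb.symm)
  have hgf : g (f m₂) = g (f m₃) := (hgib _ _).2 (Or.inr (Or.inl ⟨rfl, rfl⟩))
  refine ⟨H₂, (hf.comp hg).isCandidate hG.1 hT₂ ?_, Or.inr (Or.inl ⟨v, m₁, m₂, m₃, ?_, Or.inl
    ⟨hG.tri _ _ _ n1 hW.bc n2.symm, hG.tri _ _ _ n2 hW.cd n3.symm⟩, ⟨s0, s1, s2, s3⟩, _,
    (hf.comp hg).isContraction ?_ ?_ ?_⟩), (hf.comp hg).card_lt n1.ne (congrArg g hfvm.symm)⟩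
  -- The first contraction gives a vertex of degree at least 5 + 5 - 4 and leaves at least 4 at
  -- `m₂`. The second gives 4 + 5 - 4 and takes one from the first merged vertex. Apart from these,
  -- only the big vertices `m₀` and `y` lose degree, one each.
  · intro p hp
    obtain ⟨p, rfl⟩ := hg.surjective p
    obtain ⟨p, rfl⟩ := hf.surjective p
    have hp' := hf.internal_of (hg.internal_of hp)
    have q2 := d1 m₂ (by grind) (by grind)
    have q3 := d2 m₃ (by grind) (by grind) (fun h => hW.bd h.1.symm)
    have := s0.2
    have := s1.2
    have := s2.2
    have := s3.2
    by_cases hp2 : f p = f m₂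
    · rw [hp2]; omega
    by_cases hp3 : f p = f m₃
    · rw [hp3, ← hgf]; omega
    by_cases hpv : f p = f v
    · have := e1 (f p) hp2 hp3
      rw [hpv, ← hfvm] at this ⊢
      omega
    have npv : p ≠ v := by rintro rfl; exact hpv rfl
    have npm : p ≠ m₁ := by rintro rfl; exact hpv hfvm
    have up := huniq p npv npm
    have := e1 (f p) hp2 hp3
    by_cases h0p : p = m₀
    · subst h0p
      have := d1 p npm npv
      have := e2 (f p) hp2 hp3 (fun h => hW.ac (hf.adj_of_unique h.1 up u2))
      have := h0.six_le hp'
      omega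
    have := d2 p npm npv (by
      rintro ⟨hp1, hpv'⟩
      rcases (hW.nbr p).1 hpv'.symm with rfl | rfl | rfl | rfl | rfl
      · exact h0p rfl
      · exact npm rfl
      · exact hp2 rfl
      · exact hp3 rfl
      · exact hW.eb hp1)
    by_cases hpy : p = y
    · subst hpy
      have := hy.six_le hp'
      omega
    have := e2 (f p) hp2 hp3 (by
      rintro ⟨h1, h2⟩
      have h1 := hf.adj_of_unique h1 up u2
      have h2 := hf.adj_of_unique h2 up u3
      rcases (hW'.nbr p).1 h1.symm with rfl | rfl | rfl | rfl | rfl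
      · exact npv rfl
      · exact npm rfl
      · exact hW'.ce h2
      · exact hpy rfl
      · exact hp3 rfl)
    have := hG.five_le_deg p hp'
    omega
  · simp
    grind
  · rintro e (rfl | rfl)
    · exact n1
    · exact hW.cd
  · rintro a b (h | h) <;> rcases Sym2.eq_iff.1 h with ⟨rfl, rfl⟩ | ⟨rfl, rfl⟩
    · exact congrArg g hfvm.symm
    · exact congrArg g hfvm
    · exact hgf
    · exact hgf.symm
  · have r1 : (SimpleGraph.fromEdgeSet {s(v, m₁), s(m₂, m₃)}).Reachable v m₁ :=
      SimpleGraph.Adj.reachable (by simp [k2])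
    have r2 : (SimpleGraph.fromEdgeSet {s(v, m₁), s(m₂, m₃)}).Reachable m₂ m₃ :=
      SimpleGraph.Adj.reachable (by simp [hW.cd.ne])
    intro a b hab
    have hab := (hgib _ _).1 hab
    rcases hab with hab | ⟨ha, hb⟩ | ⟨ha, hb⟩
    · rcases (hfib _ _).1 hab with rfl | ⟨rfl, rfl⟩ | ⟨rfl, rfl⟩
      exacts [SimpleGraph.Reachable.refl _, r1.symm, r1]
    · rw [u2 a ha, u3 b hb]; exact r2
    · rw [u3 a ha, u2 b hb]; exact r2.symm

variable (hR : ¬ G.Reducible ℓ)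
include hR

/-- In a region no 4-cycle obstructs the 1-contraction of `uv`, so only a small common neighbor can.
-/
theorem Region.exists_small_common {u v : G.V} (hv : I v) (huv : G.graph.Adj u v) :
    ∃ t, G.graph.Adj t u ∧ G.graph.Adj t v ∧ G.InternalFive t := by
  by_contra h
  push Not at h
  refine hR (reducible_of_edge hG huv (hI.internal v hv) (fun a b va ab bu hau hbv =>
    (hI.chord v a b u hv ⟨va, ab, bu, huv, hbv.symm, hau⟩).imp_right fun h => h.symm)
    fun t h1 h2 => (hG.small_or_big t).resolve_left (h t h1 h2))

/-- The vertices `a` and `c` are the common neighbors of the edge `vb`. So two neighbors of `v` at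
distance two on its link are never both big. -/
theorem Region.small_or_small {v a b c d e : G.V} (hv : I v) (hW : G.W5 v a b c d e) :
    G.InternalFive a ∨ G.InternalFive c := by
  obtain ⟨t, ht, htv, hs⟩ := hI.exists_small_common hG hR hv hW.adj.2.1.symm
  rcases (hW.nbr t).1 htv.symm with rfl | rfl | rfl | rfl | rfl
  · exact Or.inl hs
  · exact (ht.ne rfl).elim
  · exact Or.inr hs
  · exact (hW.bd ht.symm).elim
  · exact (hW.eb ht).elim

/-- A vertex of degree five all of whose neighbors have degree five. -/
def FullHub (I : G.V → Prop) (h : G.V) : Prop :=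
  I h ∧ G.InternalFive h ∧ ∀ t, G.graph.Adj h t → I t ∧ G.InternalFive t

/-- If the small common neighbor `t` of an edge at `v` is outside `I`, then the small common
neighbor of `t` and `v` is a second vertex next to `v`; it cannot be outside as well. -/
theorem Region.exists_small : ∃ v, I v ∧ G.InternalFive v := by
  obtain ⟨v, hv⟩ := hI.nonempty
  obtain ⟨u, hu⟩ : ∃ u, G.graph.Adj v u := by
    by_contra h
    push Not at h
    have := deg_le_length (v := v) (L := []) (by simpa using h)
    have := hG.five_le_deg v (hI.internal v hv)
    simp at *
    omega
  obtain ⟨t, -, htv, ht⟩ := hI.exists_small_common hG hR hv hu.symm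
  by_cases htI : I t
  · exact ⟨t, htI, ht⟩
  obtain ⟨s, hst, hsv, hs⟩ := hI.exists_small_common hG hR hv htv
  by_cases hsI : I s
  · exact ⟨s, hsI, hs⟩
  exact (hst.ne (hI.eq_outside hG hv hs ht hsI htI hsv.symm htv.symm)).elim

/-- The remaining neighbors `c`, `d`, `e` are small, and the hub is the middle one, `d`. If one of
its two far neighbors were big, a 2-contraction that pairs it with `a` or `b` would work. -/
theorem Region.fullHub_of_big_pair {v a b c d e : G.V} (hv : I v) (hW : G.W5 v a b c d e)
    (ha : G.Big a) (hb : G.Big b) : ∃ h, FullHub I h := by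
  have small : ∀ {x y : G.V}, G.Big x → G.InternalFive x ∨ G.InternalFive y → G.InternalFive y :=
    fun hx h => h.resolve_left fun h' => h'.not_big hx
  have hc : G.InternalFive c := small ha (hI.small_or_small hG hR hv hW)
  have hd : G.InternalFive d := small hb (hI.small_or_small hG hR hv hW.rot)
  have he : G.InternalFive e := small hb (hI.small_or_small hG hR hv hW.rot.refl)
  have hne := hW.ne
  obtain ⟨n0, n1, n2, n3, n4⟩ := hW.adj
  obtain ⟨x, y, hD⟩ := W5.side hG.tri hW.rot.rot hd
  obtain ⟨k0, k1, k2, k3, k4⟩ := hD.adj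
  have hne' := hD.ne
  have dI : I d := by
    by_contra dI
    have cI : I c := by
      by_contra cI
      exact hI.not_adj_outside hG hv hv hc hd cI dI n2 n3 hW.cd
    have eI : I e := by
      by_contra eI
      exact hI.not_adj_outside hG hv hv he hd eI dI n4 n3 hW.de.symm
    exact hI.not_three hd dI hv cI eI (by grind) (by grind) (by grind) k0 k1 k4
  have sx : G.InternalFive x := by
    by_contra hx
    exact hR (hI.reducible_of_two hG hW.refl hD.refl hv dI he hc ha
      ((hG.small_or_big x).resolve_left hx))
  have sy : G.InternalFive y := by
    by_contra hy
    exact hR (hI.reducible_of_two hG hW.rot hD hv dI hc he hb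
      ((hG.small_or_big y).resolve_left hy))
  -- A small `s` outside `I` has at most two neighbors in `I`; a third small neighbor `r` would have
  -- to be outside too, and then `s` and `r` are adjacent small outside vertices.
  have pick : ∀ {s p q r : G.V}, G.InternalFive s → G.InternalFive r → I p → I q → p ≠ q →
      p ≠ r → q ≠ r → G.graph.Adj p r → G.graph.Adj s p → G.graph.Adj s q → G.graph.Adj s r →
      I s := by
    intro s p q r hs hr hp hq hpq hpr hqr pr sp sq sr
    by_contra hsI
    have hrI : I r := by
      by_contra hrI
      exact hI.not_adj_outside hG hp hp hs hr hsI hrI sp.symm pr sr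
    exact hI.not_three hs hsI hp hq hrI hpq hpr hqr sp sq sr
  have cI : I c := pick hc sx dI hv k0.ne k2.ne hne'.2.1 k2 hW.cd n2.symm hD.bc
  have eI : I e := pick he sy dI hv k0.ne k3.ne hne'.2.2.1 k3 hW.de.symm n4.symm hD.de.symm
  have xI : I x := pick sx sy dI cI hW.cd.ne' k3.ne (by tauto) k3 k2.symm hD.bc.symm hD.cd
  have yI : I y := pick sy sx dI eI hW.de.ne k2.ne (by tauto) k2 k3.symm hD.de hD.cd.symm
  refine ⟨d, dI, hd, fun t ht => ?_⟩
  rcases (hD.nbr t).1 ht with rfl | rfl | rfl | rfl | rfl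
  exacts [⟨hv, hW.internalFive⟩, ⟨cI, hc⟩, ⟨xI, sx⟩, ⟨yI, sy⟩, ⟨eI, he⟩]

/-- One of the two common neighbors of `v` and `a` is outside `I`, since `a` has at most two
neighbors in `I`. It is big because `v` sees only one small outside vertex. This one big vertex `e`
forces small vertices around `c` until `c` is a full hub, unless `d` is big and the previous lemma
applies to `d`, `e`. -/
theorem Region.fullHub_of_outside {v a : G.V} (hv : I v) (hs : G.InternalFive v)
    (ha : G.InternalFive a) (haI : ¬ I a) (va : G.graph.Adj v a) : ∃ h, FullHub I h := by
  have key : ∀ b c d e, G.W5 v a b c d e → ¬ I e → ∃ h, FullHub I h := by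
    intro b c d e hW heI
    obtain ⟨n0, n1, n2, n3, n4⟩ := hW.adj
    have hne := hW.ne
    have out : ∀ {t}, G.InternalFive t → G.graph.Adj v t → t ≠ a → I t := by
      intro t ht vt hta
      by_contra htI
      exact hta (hI.eq_outside hG hv ht ha htI haI vt va)
    have hin : ∀ {t}, G.graph.Adj v t → t ≠ a → ¬ G.graph.Adj a t → I t := by
      intro t vt hta hat
      by_contra htI
      exact hat (hI.adj_outside hG hv ha.1 haI htI hta.symm va vt)
    have hse : ¬ G.InternalFive e := fun h => heI (out h n4 (by grind))
    have hbe := (hG.small_or_big e).resolve_left hse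
    have sb : G.InternalFive b :=
      (hI.small_or_small hG hR hv hW.rot.rot.rot.rot).resolve_left hse
    have sc : G.InternalFive c :=
      (hI.small_or_small hG hR hv hW.rot.rot).resolve_right hse
    by_cases sd : G.InternalFive d
    swap
    · exact hI.fullHub_of_big_pair hG hR hv hW.rot.rot.rot ((hG.small_or_big d).resolve_left sd) hbe
    have bI : I b := out sb n1 (by grind)
    have cI : I c := out sc n2 (by grind)
    have dI : I d := out sd n3 (by grind)
    obtain ⟨x, y, hC⟩ := W5.side hG.tri hW.rot sc
    obtain ⟨p, q, hD⟩ := W5.side hG.tri hW.rot.rot sd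
    -- If `x` were big, the 2-contraction of `vd` and `cb` would work, since `e` is big.
    have sx : G.InternalFive x := by
      by_contra hx
      exact hR (hI.reducible_of_two hG hW.refl.rot hC.refl hv cI sd sb hbe
        ((hG.small_or_big x).resolve_left hx))
    have hneC := hC.ne
    have hneD := hD.ne
    obtain ⟨c0, c1, c2, c3, c4⟩ := hC.adj
    obtain ⟨d0, d1, d2, d3, d4⟩ := hD.adj
    have xI : I x := by
      by_contra xI
      have := hI.eq_outside hG bI sx ha xI haI hC.bc hW.ab.symm
      subst this
      exact hW.ac c2.symm
    obtain rfl : p = y := by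
      rcases (hC.nbr p).1 hD.bc with h | h | h | h | h
      · exact absurd h.symm (by grind)
      · subst h; exact absurd d2.symm hW.bd
      · subst h; exact absurd d2.symm hC.ce
      · exact h
      · exact absurd h d2.ne'
    have sy : G.InternalFive p := (hI.small_or_small hG hR dI hD.rot.rot).resolve_right hse
    have yI : I p := by
      by_contra yI
      exact hI.not_three sy yI cI dI xI hW.cd.ne c2.ne (by grind) hC.adj.2.2.2.1.symm d2.symm
        hC.cd.symm
    refine ⟨c, cI, sc, fun t ht => ?_⟩
    rcases (hC.nbr t).1 ht with rfl | rfl | rfl | rfl | rfl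
    exacts [⟨hv, hs⟩, ⟨bI, sb⟩, ⟨xI, sx⟩, ⟨yI, sy⟩, ⟨dI, sd⟩]
  obtain ⟨p, q, hpq, hc⟩ := exists_common hG.tri hs.1 va.symm
  have hp := (hc p).2 (Or.inl rfl)
  obtain ⟨c, d, e, hW⟩ := exists_W5 hG.tri hs va hp.2.symm hp.1.symm
  by_cases heI : I e
  · have hbI : ¬ I p := fun hpI => hI.not_three ha haI hv hpI heI hp.2.ne' hW.adj.2.2.2.2.ne
      (by have := hW.ne; tauto) va.symm hW.ab hW.ea.symm
    exact key _ _ _ _ hW.refl hbI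
  · exact key _ _ _ _ hW heI

theorem Region.exists_fullHub : ∃ h, FullHub I h := by
  by_contra hno
  have hZ : ∀ v, I v → G.InternalFive v → ∀ a b c d e, G.W5 v a b c d e → G.Big a →
      ∀ t, G.graph.Adj v t → t ≠ a → I t ∧ G.InternalFive t := by
    -- Without a full hub, two big neighbors of a small `v ∈ I` are impossible, both at distance one
    -- and at distance two on the link, and no small neighbor is outside `I`.
    intro v hv hs a b c d e hW ha
    have sI : ∀ t, G.graph.Adj v t → G.InternalFive t → I t := by
      intro t vt st
      by_contra htI
      exact hno (hI.fullHub_of_outside hG hR hv hs st htI vt)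
    have nb : ∀ {x y z p q : G.V}, G.W5 v x y z p q → G.Big x → G.InternalFive y := by
      intro x y z p q hW hx
      by_contra hy
      exact hno (hI.fullHub_of_big_pair hG hR hv hW hx ((hG.small_or_big y).resolve_left hy))
    have nc : ∀ {x y z p q : G.V}, G.W5 v x y z p q → G.Big x → G.InternalFive z :=
      fun hW hx => (hI.small_or_small hG hR hv hW).resolve_left fun h => h.not_big hx
    intro t ht hta
    refine (fun h => ⟨sI t ht h, h⟩) ?_
    rcases (hW.nbr t).1 ht with rfl | rfl | rfl | rfl | rfl
    exacts [(hta rfl).elim, nb hW ha, nc hW ha, nc hW.refl ha, nb hW.refl ha]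
  have hone : ∀ v, I v → G.InternalFive v → ∃ a b c d e, G.W5 v a b c d e ∧ G.Big a := by
    intro v hv hs
    by_contra h
    push Not at h
    refine hno ⟨v, hv, hs, fun t ht => ?_⟩
    have hst : G.InternalFive t := by
      by_contra hst
      obtain ⟨p, q, -, hc⟩ := exists_common hG.tri hs.1 ht.symm
      have hp := (hc p).2 (Or.inl rfl)
      obtain ⟨c, d, e, hW⟩ := exists_W5 hG.tri hs ht hp.2.symm hp.1.symm
      exact h _ _ _ _ _ hW ((hG.small_or_big t).resolve_left hst)
    refine ⟨?_, hst⟩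
    by_contra htI
    exact hno (hI.fullHub_of_outside hG hR hv hs hst htI ht)
  have hbig : ∀ v w, I v → G.InternalFive v → G.graph.Adj v w → ¬ (I w ∧ G.InternalFive w) →
      G.Internal w ∧ ∀ t, G.graph.Adj w t → I t ∧ G.InternalFive t := by
    intro v w hv hs vw hw
    -- The exceptional vertex `w` is the unique big neighbor of each small `s ∈ I` next to it. The
    -- two vertices flanking `w` on the link of `s` are again small and in `I`, so by `nbr_closed`
    -- this holds all around `w`.
    have hW : ∀ s, I s → G.InternalFive s → G.graph.Adj s w →
        ∃ b c d e, G.W5 s w b c d e ∧ (I b ∧ G.InternalFive b) ∧ (I e ∧ G.InternalFive e) := by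
      intro s hsI hs sw
      obtain ⟨a, b, c, d, e, hW, ha⟩ := hone s hsI hs
      obtain rfl : w = a := by
        by_contra hwa
        exact hw (hZ s hsI hs a b c d e hW ha w sw hwa)
      have := hW.ne
      exact ⟨b, c, d, e, hW, hZ s hsI hs _ _ _ _ _ hW ha b hW.adj.2.1 (by grind),
        hZ s hsI hs _ _ _ _ _ hW ha e hW.adj.2.2.2.2 (by grind)⟩
    obtain ⟨h1, h2⟩ := nbr_closed hG.tri (w := w)
      (fun t => (I t ∧ G.InternalFive t) ∧ G.graph.Adj t w) (s₀ := v) ⟨⟨hv, hs⟩, vw⟩ (by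
        rintro s ⟨⟨hsI, hs⟩, sw⟩
        obtain ⟨b, c, d, e, hW, hb, he⟩ := hW s hsI hs sw
        exact ⟨sw.symm, b, e, ⟨hb, hW.ab.symm⟩, ⟨he, hW.ea⟩, by have := hW.ne; grind,
          hW.adj.2.1, hW.adj.2.2.2.2⟩)
    exact ⟨h1, fun t ht => (h2 t ht).1⟩
  obtain ⟨v, hv, hs⟩ := hI.exists_small hG hR
  obtain ⟨a, b, hab⟩ := G.exists_external
  -- Small vertices of `I` and their neighbors form a set closed under adjacency, yet none of them
  -- is external.
  have := closed_eq_univ (fun w => (I w ∧ G.InternalFive w) ∨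
    ∃ v, I v ∧ G.InternalFive v ∧ G.graph.Adj v w) (s := v) (Or.inl ⟨hv, hs⟩) (by
      intro x y hx hxy
      by_cases hx' : I x ∧ G.InternalFive x
      · exact Or.inr ⟨x, hx'.1, hx'.2, hxy⟩
      · obtain ⟨v, hv, hs, vx⟩ := hx.resolve_left hx'
        exact Or.inl ((hbig v x hv hs vx hx').2 y hxy)) a
  by_cases ha : I a ∧ G.InternalFive a
  · exact ha.2.1 ⟨b, hab⟩
  · obtain ⟨v, hv, hs, va⟩ := this.resolve_left ha
    exact (hbig v a hv hs va ha).1 ⟨b, hab⟩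

end Region

end Canvas

namespace Canvas

variable {G : Canvas.{u}}

/-! ## Configurations -/

/-- The vertices `p i` are distinct, their adjacencies are given by the lists `nb i`, and the first
`m` of them are internal and have all their neighbors among them. -/
structure Config {n : ℕ} (G : Canvas.{u}) (nb : Fin n → List (Fin n)) (m : ℕ) (p : Fin n → G.V) :
    Prop where
  injective : Function.Injective p
  adj : ∀ i j, G.graph.Adj (p i) (p j) ↔ j ∈ nb i
  closed : ∀ i, i.val < m → ∀ t, G.graph.Adj (p i) t → ∃ j, t = p j
  internal : ∀ i, i.val < m → G.Internal (p i)

/-- The images of the elements of a list. -/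
def Img {n : ℕ} {α : Type*} (p : Fin n → α) (B : List (Fin n)) : Set α := p '' {i | i ∈ B}

namespace Config

variable {n : ℕ} {nb : Fin n → List (Fin n)} {m : ℕ} {p : Fin n → G.V}

theorem of_nbr (hp : Function.Injective p) (hsymm : ∀ i j, j ∈ nb i ↔ i ∈ nb j)
    (hnb : ∀ i : Fin n, i.val < m → G.Internal (p i) ∧
      ∀ t, G.graph.Adj (p i) t ↔ ∃ j ∈ nb i, t = p j)
    (hrest : ∀ i j : Fin n, m ≤ i.val → m ≤ j.val → (G.graph.Adj (p i) (p j) ↔ j ∈ nb i)) :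
    G.Config nb m p := by
  have h1 : ∀ i j : Fin n, i.val < m → (G.graph.Adj (p i) (p j) ↔ j ∈ nb i) := by
    intro i j hi
    rw [(hnb i hi).2]
    constructor
    · rintro ⟨k, hk, h⟩
      rwa [hp h]
    · intro h
      exact ⟨j, h, rfl⟩
  refine ⟨hp, fun i j => ?_, fun i hi t ht => ?_, fun i hi => (hnb i hi).1⟩
  · by_cases hi : i.val < m
    · exact h1 i j hi
    by_cases hj : j.val < m
    · rw [SimpleGraph.adj_comm, h1 j i hj, hsymm]
    · exact hrest i j (not_lt.1 hi) (not_lt.1 hj)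
  · obtain ⟨j, -, h⟩ := ((hnb i hi).2 t).1 ht
    exact ⟨j, h⟩

variable (C : G.Config nb m p)
include C

theorem mem_img {B : List (Fin n)} {i : Fin n} : p i ∈ Img p B ↔ i ∈ B :=
  C.injective.mem_set_image

theorem perm (σ : Fin n → Fin n) (hσ : Function.Injective σ)
    (hnb : ∀ i j, σ j ∈ nb (σ i) ↔ j ∈ nb i) (hm : ∀ i, i.val < m → (σ i).val < m) :
    G.Config nb m (p ∘ σ) where
  injective := C.injective.comp hσ
  adj i j := (C.adj _ _).trans (hnb i j)
  closed i hi t ht := by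
    obtain ⟨j, rfl⟩ := C.closed _ (hm i hi) t ht
    obtain ⟨k, rfl⟩ := (Finite.injective_iff_surjective.1 hσ) j
    exact ⟨k, rfl⟩
  internal i hi := C.internal _ (hm i hi)

theorem exists_nbr {i : Fin n} (hi : i.val < m) {t : G.V} (ht : G.graph.Adj (p i) t) :
    ∃ j ∈ nb i, t = p j := by
  obtain ⟨j, rfl⟩ := C.closed i hi t ht
  exact ⟨j, (C.adj _ _).1 ht, rfl⟩

theorem deg_eq {i : Fin n} (hi : i.val < m) (h : (nb i).Nodup) : G.deg (p i) = (nb i).length := by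
  rw [← List.length_map (as := nb i) p]
  refine le_antisymm (deg_le_length fun t ht => ?_)
    (length_le_deg (h.map C.injective) fun t ht => ?_)
  · obtain ⟨j, hj, rfl⟩ := C.exists_nbr hi ht
    exact List.mem_map_of_mem hj
  · obtain ⟨j, hj, rfl⟩ := List.mem_map.1 ht
    exact (C.adj _ _).2 hj

theorem internalFive {i : Fin n} (hi : i.val < m) (h : (nb i).Nodup ∧ (nb i).length = 5) :
    G.InternalFive (p i) :=
  ⟨C.internal i hi, (C.deg_eq hi h.1).trans h.2⟩

theorem facial (hT : G.Tri) (i j k : Fin n) (h : j ∈ nb i ∧ k ∈ nb j ∧ i ∈ nb k) :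
    {p i, p j, p k} ∈ G.facial :=
  hT _ _ _ ((C.adj _ _).2 h.1) ((C.adj _ _).2 h.2.1) ((C.adj _ _).2 h.2.2)

theorem contrSet_singleton (i : Fin n) : G.ContrSet (Img p [i]) := by
  have : Img p [i] = {p i} := by simp [Img]
  rw [this]
  exact Canvas.contrSet_singleton _

/-- All conditions of `ContrSet.insert` become statements about the lists `nb`, so each step of a
contraction can be decided by computation. The order of absorption matters: at each stage the
enlarged set must meet the condition on triangles. -/
theorem absorb (hT : G.Tri) (b : Fin n) {B : List (Fin n)} (hB : G.ContrSet (Img p B))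
    (h : b.val < m ∧ b ∉ B ∧ (∃ β ∈ B, β ∈ nb b) ∧ ∀ t ∈ nb b, t ∉ B → ∀ β ∈ B, β ∈ nb t →
      ∃ γ ∈ B, γ ∈ nb b ∧ γ ∈ nb t) : G.ContrSet (Img p (b :: B)) := by
  have : Img p (b :: B) = Insert.insert (p b) (Img p B) := by
    ext t
    simp [Img, eq_comm]
  rw [this]
  obtain ⟨h1, h2, ⟨β, hβ, h3⟩, h4⟩ := h
  refine hB.insert hT _ (by rwa [C.mem_img]) (C.internal b h1)
    ⟨p β, C.mem_img.2 hβ, (C.adj _ _).2 h3⟩ ?_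
  rintro t ht htB _ ⟨β, hβ, rfl⟩ htβ
  obtain ⟨t, htb, rfl⟩ := C.exists_nbr h1 ht
  rw [C.mem_img] at htB
  obtain ⟨γ, hγ, h5, h6⟩ := h4 t htb htB β hβ ((C.adj _ _).1 htβ)
  exact ⟨p γ, C.mem_img.2 hγ, (C.adj _ _).2 h5, (C.adj _ _).2 h6⟩

section Contraction

variable {H : Canvas.{u}} {f : G.V → H.V} (hf : Contr G H f) {B : List (Fin n)}
  (hfib : ∀ a b, f a = f b ↔ a = b ∨ (a ∈ Img p B ∧ b ∈ Img p B))
include hf hfib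

/-- The list `L` names the redundant neighbors in `B`: outside of `L`, the vertex `p j` has at most
one neighbor in the contracted set. -/
theorem deg_le {j : Fin n} (L : List (Fin n)) (hj : j ∉ B)
    (h : ∀ a ∈ B, ∀ b ∈ B, a ∈ nb j → b ∈ nb j → a ∉ L → b ∉ L → a = b) :
    G.deg (p j) ≤ H.deg (f (p j)) + L.length := by
  classical
  refine (hf.deg_le (x := p j) ?_ (Img p L) ?_).trans (Nat.add_le_add_left ?_ _)
  · intro y hy
    rcases (hfib _ _).1 hy with h | h
    · exact h
    · exact absurd (C.mem_img.1 h.2) hj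
  · rintro y ⟨hy, hyL⟩ z ⟨hz, hzL⟩ hyz
    rcases (hfib _ _).1 hyz with h | ⟨⟨a, ha, rfl⟩, b, hb, rfl⟩
    · exact h
    · rw [h a ha b hb ((C.adj _ _).1 hy) ((C.adj _ _).1 hz) (fun h => hyL (C.mem_img.2 h))
        (fun h => hzL (C.mem_img.2 h))]
  · refine (Set.ncard_image_le (Set.toFinite _)).trans ?_
    refine le_trans ?_ L.toFinset_card_le
    rw [← Set.ncard_coe_finset]
    exact Set.ncard_le_ncard (fun t ht => by simpa using ht) (Set.toFinite _)

/-- A vertex that is not in the configuration sees only its unclosed vertices, those with index at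
least `m`. If `B` has at most one of these, no neighbors of the vertex are merged. -/
theorem deg_le_outside {x : G.V} (hx : ∀ i, x ≠ p i)
    (hB : ∀ a ∈ B, ∀ b ∈ B, m ≤ a.val → m ≤ b.val → a = b) : G.deg x ≤ H.deg (f x) := by
  have := hf.deg_le (x := x) ?_ ∅ ?_
  · rwa [Set.ncard_empty] at this
  · intro y hy
    rcases (hfib _ _).1 hy with h | ⟨-, i, -, h⟩
    · exact h
    · exact absurd h.symm (hx i)
  · rintro y ⟨hy, -⟩ z ⟨hz, -⟩ hyz
    rcases (hfib _ _).1 hyz with h | ⟨⟨a, ha, rfl⟩, b, hb, rfl⟩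
    · exact h
    · have key : ∀ a, G.graph.Adj x (p a) → m ≤ a.val := by
        intro a ha
        by_contra hn
        obtain ⟨j, h⟩ := C.closed a (not_le.1 hn) x ha.symm
        exact hx j h
      rw [hB a ha b hb (key a hy) (key b hz)]

/-- The merged vertex keeps the neighbors of `p i` outside `B` and gains those listed in `L`, which
come from other members of `B`. -/
theorem deg_merge {i : Fin n} (hi : i ∈ B) (L : List (Fin n)) (hL : L.Nodup)
    (h : ∀ j ∈ L, j ∉ B ∧ j ∉ nb i ∧ ∃ b ∈ B, j ∈ nb b) :
    G.deg (p i) + L.length ≤ H.deg (f (p i)) + ((nb i).filter (· ∈ B)).length := by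
  classical
  set K := (nb i).filter (· ∈ B) with hK
  let A : Set G.V := G.graph.neighborSet (p i) \ Img p B
  have hlen : ∀ M : List (Fin n), (Img p M).ncard ≤ M.length := by
    intro M
    refine (Set.ncard_image_le (Set.toFinite _)).trans ?_
    refine le_trans ?_ M.toFinset_card_le
    rw [← Set.ncard_coe_finset]
    exact Set.ncard_le_ncard (fun t ht => by simpa using ht) (Set.toFinite _)
  have h1 : G.deg (p i) ≤ A.ncard + K.length := by
    refine le_trans ?_ (Nat.add_le_add_left (hlen K) _)
    refine le_trans (Set.ncard_le_ncard ?_ (Set.toFinite _)) (Set.ncard_union_le _ _)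
    intro t ht
    by_cases hB : t ∈ Img p B
    · obtain ⟨b, hb, rfl⟩ := hB
      exact Or.inr (C.mem_img.2 (by
        rw [hK, List.mem_filter]
        exact ⟨(C.adj _ _).1 ht, by simpa using hb⟩))
    · exact Or.inl ⟨ht, hB⟩
  have h2 : (Img p L).ncard = L.length := by
    rw [Img, Set.ncard_image_of_injective _ C.injective, ← List.toFinset_card_of_nodup hL,
      ← Set.ncard_coe_finset]
    congr 1
    ext t
    simp
  have h3 : Disjoint A (Img p L) := by
    rw [Set.disjoint_left]
    rintro _ ht ⟨j, hj, rfl⟩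
    exact (h j hj).2.1 ((C.adj _ _).1 ht.1)
  have hout : ∀ t ∈ A ∪ Img p L, t ∉ Img p B := by
    rintro t (ht | ⟨j, hj, rfl⟩)
    · exact ht.2
    · rw [C.mem_img]
      exact (h j hj).1
  have h4 : Set.InjOn f (A ∪ Img p L) := by
    intro y hy z hz hyz
    rcases (hfib _ _).1 hyz with h | h
    · exact h
    · exact absurd h.1 (hout y hy)
  have hne : ∀ t ∈ A ∪ Img p L, f (p i) ≠ f t := by
    intro t ht he
    rcases (hfib _ _).1 he with h | h
    · exact hout t ht (h ▸ C.mem_img.2 hi)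
    · exact hout t ht h.2
  have h5 : f '' (A ∪ Img p L) ⊆ H.graph.neighborSet (f (p i)) := by
    rintro _ ⟨t, ht, rfl⟩
    have hnet := hne t ht
    rcases ht with ht | ⟨j, hj, rfl⟩
    · exact hf.adj_of ht.1 hnet
    · obtain ⟨b, hb, hbj⟩ := (h j hj).2.2
      have hib : f (p i) = f (p b) := (hfib _ _).2 (Or.inr ⟨C.mem_img.2 hi, C.mem_img.2 hb⟩)
      change H.graph.Adj _ _
      rw [hib] at hnet ⊢
      exact hf.adj_of ((C.adj _ _).2 hbj) hnet
  have h6 := Set.ncard_le_ncard h5 (Set.toFinite _)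
  rw [h4.ncard_image, Set.ncard_union_eq h3 (Set.toFinite _) (Set.toFinite _), h2] at h6
  change _ ≤ H.deg _ at h6
  omega

/-- At most one vertex `i₀` of `B` is visible from outside the configuration. Hence `hin` handles
the edges inside it by computation, and `hout` leaves only triangles that pass through `i₀` and an
outside vertex. -/
theorem tri (hT : G.Tri) (i₀ : Fin n) (hB : ∀ b ∈ B, m ≤ b.val → b = i₀)
    (hin : ∀ x, x ∉ B → ∀ y ∈ nb x, y ∉ B → ∀ b ∈ B, b ∈ nb x → ∀ b' ∈ B, b' ∈ nb y →
      ∃ c ∈ B, c ∈ nb x ∧ c ∈ nb y)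
    (hout : ∀ x j, (∀ i, x ≠ p i) → j ∉ B → G.graph.Adj x (p i₀) → G.graph.Adj x (p j) →
      i₀ ∈ nb j) : H.Tri := by
  have hge : ∀ x a, (∀ i, x ≠ p i) → G.graph.Adj x (p a) → m ≤ a.val := by
    intro x a hx ha
    by_contra hn
    obtain ⟨j, h⟩ := C.closed a (not_le.1 hn) x ha.symm
    exact hx j h
  refine hf.tri_of_set hT (Img p B) hfib ?_
  have mixed : ∀ x y b b', (∀ i, x ≠ p i) → y ∉ Img p B → b ∈ Img p B → b' ∈ Img p B →
      G.graph.Adj x b → G.graph.Adj y b' → G.graph.Adj x y →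
      ∃ c ∈ Img p B, G.graph.Adj x c ∧ G.graph.Adj y c := by
    rintro x y _ _ hx hy ⟨b, hb, rfl⟩ ⟨b', hb', rfl⟩ xb yb xy
    have e1 := hB b hb (hge x b hx xb)
    by_cases hy' : ∀ i, y ≠ p i
    · have e2 := hB b' hb' (hge y b' hy' yb)
      exact ⟨p b, C.mem_img.2 hb, xb, by rw [e1, ← e2]; exact yb⟩
    · push Not at hy'
      obtain ⟨j, rfl⟩ := hy'
      rw [e1] at xb hb
      exact ⟨p i₀, C.mem_img.2 hb, xb, (C.adj _ _).2 (hout x j hx (fun h => hy (C.mem_img.2 h))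
        xb xy)⟩
  intro x y b b' hxB hyB hb hb' xb yb xy
  by_cases hx : ∀ i, x ≠ p i
  · exact mixed x y b b' hx hyB hb hb' xb yb xy
  by_cases hy : ∀ i, y ≠ p i
  · obtain ⟨c, hc, h1, h2⟩ := mixed y x b' b hy hxB hb' hb yb xb xy.symm
    exact ⟨c, hc, h2, h1⟩
  push Not at hx hy
  obtain ⟨x, rfl⟩ := hx
  obtain ⟨y, rfl⟩ := hy
  obtain ⟨b, hb, rfl⟩ := hb
  obtain ⟨b', hb', rfl⟩ := hb'
  rw [C.mem_img] at hxB hyB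
  obtain ⟨c, hc, h1, h2⟩ := hin x hxB y ((C.adj _ _).1 xy) hyB b hb
    ((C.adj _ _).1 xb) b' hb' ((C.adj _ _).1 yb)
  exact ⟨p c, C.mem_img.2 hc, (C.adj _ _).2 h1, (C.adj _ _).2 h2⟩

end Contraction

end Config

end Canvas

namespace Canvas

variable {G : Canvas.{u}}

/-! ## The two innermost layers around a vertex of degree five -/

theorem W5.common {v a b c d e t : G.V} (h : G.W5 v a b c d e) (hv : G.graph.Adj v t)
    (hb : G.graph.Adj t b) : t = a ∨ t = c := by
  rcases (h.nbr t).1 hv with rfl | rfl | rfl | rfl | rfl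
  · exact Or.inl rfl
  · exact (hb.ne rfl).elim
  · exact Or.inr rfl
  · exact (h.bd hb.symm).elim
  · exact (h.eb hb).elim

/-- A vertex `0` of degree five with its neighbors `1, ..., 5` of degree five and the second
common neighbors `6, ..., 10` of consecutive neighbors. -/
def flowerNb : Fin 11 → List (Fin 11) :=
  ![[1, 2, 3, 4, 5], [0, 5, 10, 6, 2], [0, 1, 6, 7, 3], [0, 2, 7, 8, 4], [0, 3, 8, 9, 5],
    [0, 4, 9, 10, 1], [1, 2, 7, 10], [2, 3, 6, 8], [3, 4, 7, 9], [4, 5, 8, 10], [5, 1, 9, 6]]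

/-- Two adjacent vertices of degree five in the second layer, together with the first two layers,
inside a 4-cycle. -/
def diamondNb : Fin 12 → List (Fin 12) :=
  ![[1, 2, 3, 4, 5], [0, 5, 7, 8, 2], [0, 1, 8, 9, 3], [0, 2, 9, 10, 4], [0, 3, 10, 6, 5],
    [0, 4, 6, 7, 1], [4, 5, 7, 11, 10], [5, 1, 8, 11, 6], [1, 2, 7, 9, 11], [2, 3, 8, 10],
    [3, 4, 9, 6, 11], [6, 7, 8, 10]]

theorem Config.flower_rotate {p : Fin 11 → G.V} (C : G.Config flowerNb 6 p) :
    G.Config flowerNb 6 (p ∘ ![0, 2, 3, 4, 5, 1, 7, 8, 9, 10, 6]) :=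
  C.perm _ (by decide) (by decide) (by decide)

section Region

variable {ℓ : ℕ} (hG : G.IsCandidate ℓ) {I : G.V → Prop} (hI : G.Region I)
include hI hG

/-- The links of consecutive neighbors of the hub share an edge, so they close up to a second layer
of five vertices. Coincidences and chords in this layer are excluded by the chord condition at the
vertices next to the hub. -/
theorem Region.exists_flower {h : G.V} (hh : FullHub I h) :
    ∃ p, G.Config flowerNb 6 p ∧ ∀ i : Fin 11, i.val < 6 → I (p i) := by
  obtain ⟨hhI, hs, hall⟩ := hh
  obtain ⟨t, ht⟩ : ∃ t, G.graph.Adj h t := by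
    by_contra hn
    push Not at hn
    have h0 := deg_le_length (v := h) (L := []) (by simpa using hn)
    rw [hs.2] at h0
    simp at h0
  obtain ⟨q, q', -, hc⟩ := exists_common hG.tri hs.1 ht.symm
  have hq := (hc q).2 (Or.inl rfl)
  obtain ⟨c, d, e, hW⟩ := exists_W5 hG.tri hs ht hq.2.symm hq.1.symm
  have side : ∀ a b c d e, G.W5 h a b c d e → ∃ x y, G.W5 b h a x y c := fun a b c d e hW =>
    W5.side hG.tri hW (hall b hW.adj.2.1).2
  have glue : ∀ b c a d x y x' y', G.W5 b h a x y c → G.W5 c h b x' y' d → x' = y := by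
    intro b c a d x y x' y' h1 h2
    rcases h1.rot.rot.rot.common h2.bc.symm.symm (h2.adj.2.2.1.symm) with h | h
    · exact h
    · exact (h2.ne.2.1 h.symm).elim
  -- If `x` and `z` were adjacent, then `bczx` would be a 4-cycle through `b ∈ I`, and both of its
  -- diagonals are excluded by the links of `c` and `b`.
  have sep : ∀ b c a d x y z, G.W5 b h a x y c → G.W5 c h b y z d → I b → x ≠ z ∧
      ¬ G.graph.Adj x z := by
    intro b c a d x y z h1 h2 hb
    have hcx : ¬ G.graph.Adj x c := h1.ce
    have hbz : ¬ G.graph.Adj b z := h2.bd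
    have hxz : x ≠ z := by
      rintro rfl
      exact hbz h1.adj.2.2.1
    refine ⟨hxz, fun hxz' => ?_⟩
    have hbz' : b ≠ z := h2.ne.2.2.2.2.2.1
    have hcx' : c ≠ x := h1.ne.2.2.2.2.2.2.2.2.1.symm
    rcases hI.chord b c z x hb ⟨h1.adj.2.2.2.2, h2.adj.2.2.2.1, hxz'.symm, h1.adj.2.2.1.symm, hbz',
      hcx'⟩ with h | h
    · exact hbz h
    · exact hcx h.symm
  obtain ⟨s0, s1, w1⟩ := side _ _ _ _ _ hW
  obtain ⟨s1', s2, w2⟩ := side _ _ _ _ _ hW.rot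
  obtain ⟨s2', s3, w3⟩ := side _ _ _ _ _ hW.rot.rot
  obtain ⟨s3', s4, w4⟩ := side _ _ _ _ _ hW.rot.rot.rot
  obtain ⟨s4', s0', w0⟩ := side _ _ _ _ _ hW.rot.rot.rot.rot
  obtain rfl := glue _ _ _ _ _ _ _ _ w1 w2
  obtain rfl := glue _ _ _ _ _ _ _ _ w2 w3
  obtain rfl := glue _ _ _ _ _ _ _ _ w3 w4
  obtain rfl := glue _ _ _ _ _ _ _ _ w4 w0
  obtain rfl := glue _ _ _ _ _ _ _ _ w0 w1
  obtain ⟨h1, h2, h3, h4, h5⟩ := hW.adj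
  have d0 := sep _ _ _ _ _ _ _ w0 w1 (hall _ h1).1
  have d1 := sep _ _ _ _ _ _ _ w1 w2 (hall _ h2).1
  have d2 := sep _ _ _ _ _ _ _ w2 w3 (hall _ h3).1
  have d3 := sep _ _ _ _ _ _ _ w3 w4 (hall _ h4).1
  have d4 := sep _ _ _ _ _ _ _ w4 w0 (hall _ h5).1
  have n0 := w0.ne
  have n1 := w1.ne
  have n2 := w2.ne
  have n3 := w3.ne
  have n4 := w4.ne
  have nh := hW.ne
  have nhh := hW.ne_hub
  have hs0 := w1.ac
  have hs1 := w1.da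
  have hs2 := w2.da
  have hs3 := w3.da
  have hs4 := w4.da
  have e1 := w0.cd
  have e2 := w1.cd
  have e3 := w2.cd
  have e4 := w3.cd
  have e5 := w4.cd
  have hr : ∀ x, ¬ G.graph.Adj h x → x ≠ t ∧ x ≠ q ∧ x ≠ c ∧ x ≠ d ∧ x ≠ e := by
    intro x hx
    rw [hW.nbr] at hx
    tauto
  have hr0 := hr _ hs0
  have hr1 := hr _ fun h' => hs1 h'.symm
  have hr2 := hr _ fun h' => hs2 h'.symm
  have hr3 := hr _ fun h' => hs3 h'.symm
  have hr4 := hr _ fun h' => hs4 h'.symm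
  clear side glue sep hc hq hr
  refine ⟨![h, t, q, c, d, e, s0, s1', s2', s3', s4'], Config.of_nbr ?_ (by decide) ?_ ?_, ?_⟩
  · rw [← List.nodup_ofFn]
    simp [List.ofFn_succ]
    clear * - n0 n1 n2 n3 n4 nh nhh hr0 hr1 hr2 hr3 hr4 d0 d1 d2 d3 d4
    grind
  · intro i hi
    fin_cases i <;> first | (exfalso; revert hi; decide) | skip
    all_goals simp [flowerNb]
    · exact ⟨hW.internal, hW.nbr⟩
    · exact ⟨w0.internal, w0.nbr⟩
    · exact ⟨w1.internal, w1.nbr⟩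
    · exact ⟨w2.internal, w2.nbr⟩
    · exact ⟨w3.internal, w3.nbr⟩
    · exact ⟨w4.internal, w4.nbr⟩
  · have d0' : ¬ G.graph.Adj s1' s4' := fun h => d0.2 h.symm
    have d1' : ¬ G.graph.Adj s2' s0 := fun h => d1.2 h.symm
    have d2' : ¬ G.graph.Adj s3' s1' := fun h => d2.2 h.symm
    have d3' : ¬ G.graph.Adj s4' s2' := fun h => d3.2 h.symm
    have d4' : ¬ G.graph.Adj s0 s3' := fun h => d4.2 h.symm
    intro i j hi hj
    fin_cases i <;> first | (exfalso; revert hi; decide) | skip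
    all_goals fin_cases j <;> first | (exfalso; revert hj; decide) | skip
    all_goals simp [flowerNb, d0.2, d1.2, d2.2, d3.2, d4.2, d0', d1', d2', d3', d4', e1, e2, e3,
      e4, e5, e1.symm, e2.symm, e3.symm, e4.symm, e5.symm]
  · intro i hi
    fin_cases i <;> first | (exfalso; revert hi; decide) | skip
    exacts [hhI, (hall _ h1).1, (hall _ h2).1, (hall _ h3).1, (hall _ h4).1, (hall _ h5).1]

end Region

end Canvas

/-! ### The 5-contraction and the extended 5-contraction -/

namespace Canvas

variable {G : Canvas.{u}}

theorem mem_low_iff : ∀ j : Fin 11, j ∈ ([5, 4, 3, 2, 1, 0] : List (Fin 11)) ↔ j.val < 6 := by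
  decide

theorem eq_of_six_le : ∀ j : Fin 11, 6 ≤ j.val → j = 6 ∨ j = 7 ∨ j = 10 ∨ j = 8 ∨ j = 9 := by
  decide

set_option synthInstance.maxSize 1000 in
set_option synthInstance.maxHeartbeats 200000 in
theorem Config.flower_contr {p : Fin 11 → G.V} (C : G.Config flowerNb 6 p) (hT : G.Tri) :
    ∃ (H : Canvas.{u}) (f : G.V → H.V), Contr G H f ∧
      (∀ a b, f a = f b ↔ a = b ∨ (a ∈ Img p [5, 4, 3, 2, 1, 0] ∧ b ∈ Img p [5, 4, 3, 2, 1, 0])) ∧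
      H.Tri ∧ IsFiveContraction G H (p 0) f := by
  have h0 := C.contrSet_singleton 0
  have h1 := C.absorb hT 1 h0 (by decide)
  have h2 := C.absorb hT 2 h1 (by decide)
  have h3 := C.absorb hT 3 h2 (by decide)
  have h4 := C.absorb hT 4 h3 (by decide)
  obtain ⟨H, f, hf, hfib⟩ := C.absorb hT 5 h4 (by decide)
  have hs : ∀ i : Fin 11, i.val < 6 → G.InternalFive (p i) := fun i hi =>
    C.internalFive hi (by revert i; decide)
  have hmem : ∀ j ∈ flowerNb 0, j ∈ ([5, 4, 3, 2, 1, 0] : List (Fin 11)) := by decide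
  refine ⟨H, f, hf, hfib, ?_, hs 0 (by decide), ?_, hf.isContraction ?_ ?_ ?_⟩
  · refine C.tri hf hfib hT 0 (by decide) (by decide) ?_
    intro x j hx _ h0 _
    obtain ⟨i, hi⟩ := C.closed 0 (by decide) x h0.symm
    exact absurd hi (hx i)
  · intro w hw
    obtain ⟨j, hj, rfl⟩ := C.exists_nbr (i := 0) (by decide) hw
    exact hs j ((mem_low_iff j).1 (hmem j hj))
  · exact SimpleGraph.incidenceSet_subset _ _
  · intro a b hab
    have key : ∀ b, G.graph.Adj (p 0) b → f (p 0) = f b := by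
      intro b hb
      obtain ⟨j, hj, rfl⟩ := C.exists_nbr (i := 0) (by decide) hb
      exact (hfib _ _).2 (Or.inr ⟨C.mem_img.2 (by decide), C.mem_img.2 (hmem j hj)⟩)
    obtain ⟨hadj, hmem⟩ := hab
    rw [SimpleGraph.mem_edgeSet] at hadj
    rcases Sym2.mem_iff.1 hmem with h | h
    · rw [← h] at hadj ⊢
      exact key b hadj
    · rw [← h] at hadj ⊢
      exact (key a hadj.symm).symm
  · have key : ∀ a ∈ Img p [5, 4, 3, 2, 1, 0],
        (SimpleGraph.fromEdgeSet (G.graph.incidenceSet (p 0))).Reachable (p 0) a := by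
      rintro _ ⟨j, hj, rfl⟩
      by_cases hj0 : j = 0
      · rw [hj0]
      have hadj : G.graph.Adj (p 0) (p j) := (C.adj _ _).2 (by
        have : ∀ j ∈ ([5, 4, 3, 2, 1, 0] : List (Fin 11)), j ≠ 0 → j ∈ flowerNb 0 := by decide
        exact this j hj hj0)
      refine SimpleGraph.Adj.reachable ?_
      rw [SimpleGraph.fromEdgeSet_adj]
      exact ⟨⟨hadj, Sym2.mem_mk_left _ _⟩, hadj.ne⟩
    intro a b hab
    rcases (hfib _ _).1 hab with rfl | ⟨ha, hb⟩
    · exact SimpleGraph.Reachable.refl _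
    · exact (key a ha).symm.trans (key b hb)

section Red

variable {ℓ : ℕ} (hG : G.IsCandidate ℓ) {p : Fin 11 → G.V} (C : G.Config flowerNb 6 p)
include hG C

/-- The 5-contraction. -/
theorem Config.reducible_of_five (hbig : ∀ j : Fin 11, 6 ≤ j.val → G.Big (p j)) :
    G.Reducible ℓ := by
  obtain ⟨H, f, hf, hfib, hT, hfive⟩ := C.flower_contr hG.tri
  refine ⟨H, hf.isCandidate hG.1 hT ?_, Or.inr (Or.inr (Or.inl ⟨_, f, hfive⟩)),
    hf.card_lt (a := p 0) (b := p 1) (C.injective.ne (by decide))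
    ((hfib _ _).2 (Or.inr ⟨C.mem_img.2 (by decide), C.mem_img.2 (by decide)⟩))⟩
  intro q hq
  obtain ⟨x, rfl⟩ := hf.surjective q
  have hx := hf.internal_of hq
  by_cases hxp : ∀ i, x ≠ p i
  · exact (hG.five_le_deg x hx).trans (C.deg_le_outside hf hfib hxp (by decide))
  push Not at hxp
  obtain ⟨j, rfl⟩ := hxp
  by_cases hj : 6 ≤ j.val
  -- A second-layer vertex loses one degree, since its two neighbors in the first layer are merged;
  -- the vector names one of these two as redundant.
  · have h6 := (hbig j hj).six_le hx
    have := C.deg_le hf hfib (j := j)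
      [(![0, 0, 0, 0, 0, 0, 1, 2, 3, 4, 5] : Fin 11 → Fin 11) j]
      (fun h => absurd ((mem_low_iff j).1 h) (not_lt.2 hj)) (by clear h6 hx hq; revert j; decide)
    simp at this
    omega
  · have h0 : f (p j) = f (p 0) := (hfib _ _).2 (Or.inr ⟨C.mem_img.2
      ((mem_low_iff j).2 (not_le.1 hj)), C.mem_img.2 (by decide)⟩)
    have := C.deg_merge hf hfib (i := 0) (by decide) [6, 7, 8, 9, 10] (by decide) (by decide)
    have h5 := (C.internalFive (i := 0) (by decide) (by decide)).2
    rw [h0]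
    have h6 : ((flowerNb 0).filter (· ∈ ([5, 4, 3, 2, 1, 0] : List (Fin 11)))).length = 5 := by
      decide
    rw [h6, h5] at this
    simpa using this

/-- The extended 5-contraction. -/
theorem Config.reducible_of_extended (h6 : G.InternalFive (p 6))
    (h7 : G.Internal (p 7) → 7 ≤ G.deg (p 7)) (h8 : G.Big (p 8)) (h9 : G.Big (p 9))
    (h10 : G.Internal (p 10) → 7 ≤ G.deg (p 10))
    (hcross : ∀ b, G.graph.Adj b (p 6) → (G.graph.Adj b (p 8) ∨ G.graph.Adj b (p 9)) →
      b = p 1 ∨ b = p 2 ∨ b = p 7 ∨ b = p 10) : G.Reducible ℓ := by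
  obtain ⟨H, f, hf, hfib, hT, hfive⟩ := C.flower_contr hG.tri
  have hB : ∀ {i j}, i ∈ ([5, 4, 3, 2, 1, 0] : List (Fin 11)) →
      j ∈ ([5, 4, 3, 2, 1, 0] : List (Fin 11)) → f (p i) = f (p j) := fun hi hj =>
    (hfib _ _).2 (Or.inr ⟨C.mem_img.2 hi, C.mem_img.2 hj⟩)
  have huniq : ∀ x, f x ≠ f (p 0) → ∀ y, f y = f x → y = x := by
    intro x hx y hy
    rcases (hfib _ _).1 hy with h | h
    · exact h
    · exact absurd ((hfib _ _).2 (Or.inr ⟨h.2, C.mem_img.2 (by decide)⟩)) hx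
  have hne : ∀ j : Fin 11, 6 ≤ j.val → f (p j) ≠ f (p 0) := by
    intro j hj h
    rcases (hfib _ _).1 h with h | h
    · rw [C.injective h] at hj
      exact absurd hj (by decide)
    · exact absurd ((mem_low_iff j).1 (C.mem_img.1 h.1)) (not_lt.2 hj)
  have hadj : ∀ x, H.graph.Adj (f x) (f (p 0)) → ∃ j : Fin 11, 6 ≤ j.val ∧ x = p j := by
    intro x hx
    obtain ⟨hn, a, b, hab, h1, h2⟩ := (hf.adj _ _).1 hx
    obtain rfl := huniq x hn a h1
    have hb : b ∈ Img p [5, 4, 3, 2, 1, 0] := by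
      rcases (hfib _ _).1 h2 with rfl | h
      · exact C.mem_img.2 (by decide)
      · exact h.1
    obtain ⟨i, hi, rfl⟩ := hb
    obtain ⟨j, rfl⟩ := C.closed i ((mem_low_iff i).1 hi) a hab.symm
    refine ⟨j, ?_, rfl⟩
    by_contra hj
    exact hn (hB ((mem_low_iff j).2 (not_le.1 hj)) (by decide))
  have hadj' : ∀ j : Fin 11, 6 ≤ j.val → H.graph.Adj (f (p j)) (f (p 0)) := by
    intro j hj
    obtain ⟨i, hi, hij⟩ : ∃ i ∈ ([5, 4, 3, 2, 1, 0] : List (Fin 11)), i ∈ flowerNb j := by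
      revert j; decide
    rw [hB (i := 0) (j := i) (by decide) hi]
    refine hf.adj_of ((C.adj _ _).2 hij) ?_
    rw [hB (i := i) (j := 0) hi (by decide)]
    exact hne j hj
  have hlift : ∀ x y, H.graph.Adj (f x) (f y) → f x ≠ f (p 0) → f y ≠ f (p 0) →
      G.graph.Adj x y := fun x y h hx hy => hf.adj_of_unique h (huniq x hx) (huniq y hy)
  have hint : H.Internal (f (p 0)) := by
    intro h
    obtain ⟨a, ha, h0⟩ := (hf.external_iff _).1 h
    rcases (hfib _ _).1 h0 with rfl | ⟨⟨i, hi, rfl⟩, -⟩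
    · exact C.internal 0 (by decide) ha
    · exact C.internal i ((mem_low_iff i).1 hi) ha
  -- A 4-cycle along the second contracted edge leaves the merged vertex through a second-layer
  -- vertex. If that vertex is `p 7` or `p 10`, it is adjacent to `p 6`; if it is `p 8` or `p 9`,
  -- then `hcross` supplies the chord.
  obtain ⟨K, g, hg, hgib, hK, e1, e2, e3⟩ := exists_contr_edge_tri hT
    (hadj' 6 (by decide)) hint (by
      intro a b h1 h2 h3 ha hb
      obtain ⟨x, rfl⟩ := hf.surjective a
      obtain ⟨y, rfl⟩ := hf.surjective b
      obtain ⟨j, hj, rfl⟩ := hadj x h1.symm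
      have hyx := hlift _ _ h2 h1.ne' hb
      have hy6 := hlift _ _ h3 hb (hne 6 (by decide))
      have hcases := (eq_of_six_le j hj).resolve_left fun h => ha (by rw [h])
      have hfin : G.graph.Adj y (p 8) ∨ G.graph.Adj y (p 9) → H.graph.Adj (f (p 0)) (f y) := by
        intro h
        rcases hcross y hy6 h with rfl | rfl | rfl | rfl
        · exact absurd (hB (by decide) (by decide)) hb
        · exact absurd (hB (by decide) (by decide)) hb
        · exact (hadj' 7 (by decide)).symm
        · exact (hadj' 10 (by decide)).symm
      rcases hcases with rfl | rfl | rfl | rfl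
      · exact Or.inr (hf.adj_of ((C.adj _ _).2 (by decide)) ha.symm)
      · exact Or.inr (hf.adj_of ((C.adj _ _).2 (by decide)) ha.symm)
      · exact Or.inl (hfin (Or.inl hyx.symm))
      · exact Or.inl (hfin (Or.inr hyx.symm)))
  have hgf : g (f (p 6)) = g (f (p 0)) := (hgib _ _).2 (Or.inr (Or.inl ⟨rfl, rfl⟩))
  refine ⟨K, (hf.comp hg).isCandidate hG.1 hK ?_, Or.inr (Or.inr (Or.inr (Or.inl
    ⟨p 0, p 1, p 2, p 6, (C.adj _ _).2 (by decide), (C.adj _ _).2 (by decide),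
      (C.adj _ _).2 (by decide), C.injective.ne (by decide), (C.adj _ _).2 (by decide),
      (C.adj _ _).2 (by decide), H, f, hfive, hg.isOneContraction (hadj' 6 (by decide)) hint
      hgib⟩))), (hf.comp hg).card_lt (C.injective.ne (show (6 : Fin 11) ≠ 0 by decide)) hgf⟩
  have hd : ∀ j : Fin 11, 6 ≤ j.val → G.deg (p j) ≤ H.deg (f (p j)) + 1 := by
    intro j hj
    exact C.deg_le hf hfib (j := j)
      [(![0, 0, 0, 0, 0, 0, 1, 2, 3, 4, 5] : Fin 11 → Fin 11) j] (by revert j; decide)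
      (by revert j; decide)
  intro q hq
  obtain ⟨y, rfl⟩ := hg.surjective q
  obtain ⟨x, rfl⟩ := hf.surjective y
  have hx := hf.internal_of (hg.internal_of hq)
  -- The merged hub has degree at least 5 and `p 6` keeps at least 4 after the first stage; 5 + 4 -
  -- 4 = 5.
  have hm : 5 ≤ K.deg (g (f (p 0))) := by
    have := C.deg_merge hf hfib (i := 0) (by decide) [6, 7, 8, 9, 10] (by decide) (by decide)
    have h5 := (C.internalFive (i := 0) (by decide) (by decide)).2
    have h5' : ((flowerNb 0).filter (· ∈ ([5, 4, 3, 2, 1, 0] : List (Fin 11)))).length = 5 := by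
      decide
    rw [h5', h5] at this
    have := hd 6 (by decide)
    have := h6.2
    rw [hgf] at e3
    simp at *
    omega
  by_cases h0 : f x = f (p 0)
  · rw [h0]
    exact hm
  by_cases hf6 : f x = f (p 6)
  · rw [hf6, hgf]
    exact hm
  have k1 := e1 (f x) hf6 h0
  have k2 := e2 (f x) hf6 h0
  by_cases hadjx : H.graph.Adj (f x) (f (p 0))
  · obtain ⟨j, hj, rfl⟩ := hadj x hadjx
    have hdj := hd j hj
    have hcases := (eq_of_six_le j hj).resolve_left fun h => hf6 (by rw [h])
    -- The vertices `p 7` and `p 10` can lose one degree at each of the two stages, hence the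
    -- hypothesis of degree seven; `p 8` and `p 9` are not adjacent to `p 6`, so they lose at most
    -- one in all.
    have k3 : j = 8 ∨ j = 9 → H.deg (f (p j)) ≤ K.deg (g (f (p j))) := by
      intro h
      refine k2 fun h' => ?_
      have := (C.adj _ _).1 (hlift _ _ h'.1 h0 (hne 6 (by decide)))
      rcases h with rfl | rfl <;> revert this <;> decide
    rcases hcases with rfl | rfl | rfl | rfl
    · have := h7 hx
      omega
    · have := h10 hx
      omega
    · have := h8.six_le hx
      have := k3 (by decide)
      omega
    · have := h9.six_le hx
      have := k3 (by decide)
      omega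
  · have hxp : ∀ i, x ≠ p i := by
      rintro i rfl
      by_cases hi : 6 ≤ i.val
      · exact hadjx (hadj' i hi)
      · exact h0 (hB ((mem_low_iff i).2 (not_le.1 hi)) (by decide))
    have := hG.five_le_deg x hx
    have := C.deg_le_outside hf hfib hxp (by decide)
    have := k2 fun h => hadjx h.2
    omega

end Red

end Canvas

namespace Canvas

variable {G : Canvas.{u}}

/-! ## Finding the 8-diamond -/

theorem Config.nbr {n : ℕ} {nb : Fin n → List (Fin n)} {m : ℕ} {p : Fin n → G.V}
    (C : G.Config nb m p) {i : Fin n} (hi : i.val < m) (t : G.V) :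
    G.graph.Adj (p i) t ↔ ∃ j ∈ nb i, t = p j :=
  ⟨fun h => C.exists_nbr hi h, by rintro ⟨j, hj, rfl⟩; exact (C.adj _ _).2 hj⟩

theorem nbr_of_closed_five (hT : G.Tri) {w a b c d e : G.V}
    (ha : G.graph.Adj w a) (hb : G.graph.Adj w b) (hc : G.graph.Adj w c) (hd : G.graph.Adj w d)
    (he : G.graph.Adj w e) (hab : G.graph.Adj a b) (hbc : G.graph.Adj b c) (hcd : G.graph.Adj c d)
    (hde : G.graph.Adj d e) (hea : G.graph.Adj e a) (hac : a ≠ c) (hbd : b ≠ d) (hce : c ≠ e)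
    (hda : d ≠ a) (heb : e ≠ b) : G.Internal w ∧
      ∀ t, G.graph.Adj w t → t = a ∨ t = b ∨ t = c ∨ t = d ∨ t = e :=
  nbr_closed hT (w := w) (fun t => t = a ∨ t = b ∨ t = c ∨ t = d ∨ t = e)
    (Or.inl rfl) (by
      rintro s (rfl | rfl | rfl | rfl | rfl)
      · exact ⟨ha, b, e, by simp, by simp, heb.symm, hab, hea.symm⟩
      · exact ⟨hb, a, c, by simp, by simp, hac, hab.symm, hbc⟩
      · exact ⟨hc, b, d, by simp, by simp, hbd, hbc.symm, hcd⟩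
      · exact ⟨hd, c, e, by simp, by simp, hce, hcd.symm, hde⟩
      · exact ⟨he, d, a, by simp, by simp, hda, hde.symm, hea⟩)

/-- The links of the adjacent small vertices `p 9` and `p 10` share a further vertex, which becomes
the corner `p 11` of the diamond. It remains to see that this vertex is new and not adjacent to `p
7`. -/
theorem Config.exists_diamond {p : Fin 11 → G.V} (C : G.Config flowerNb 6 p) (hT : G.Tri)
    (h9 : G.InternalFive (p 9)) (h10 : G.InternalFive (p 10)) :
    ∃ q, G.Config diamondNb 8 q := by
  have A : ∀ i j : Fin 11, j ∈ flowerNb i → G.graph.Adj (p i) (p j) := fun i j h => (C.adj _ _).2 h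
  have N : ∀ i j : Fin 11, j ∉ flowerNb i → ¬ G.graph.Adj (p i) (p j) := fun i j h h' =>
    h ((C.adj _ _).1 h')
  have D : ∀ i j : Fin 11, i ≠ j → p i ≠ p j := fun i j h => C.injective.ne h
  obtain ⟨c, z, e, w9⟩ := exists_W5 hT h9 (A 9 4 (by decide)) (A 9 5 (by decide))
    (A 4 5 (by decide))
  obtain rfl : p 10 = c := (w9.common (A 9 10 (by decide)) (A 10 5 (by decide))).resolve_left
    (D _ _ (by decide))
  obtain rfl : p 8 = e := (w9.rot.rot.rot.rot.common (A 9 8 (by decide))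
    (A 8 4 (by decide))).resolve_right (D _ _ (by decide))
  obtain ⟨c, z', e, w10⟩ := exists_W5 hT h10 (A 10 5 (by decide)) (A 10 1 (by decide))
    (A 5 1 (by decide))
  obtain rfl : p 6 = c := (w10.common (A 10 6 (by decide)) (A 6 1 (by decide))).resolve_left
    (D _ _ (by decide))
  obtain rfl : p 9 = e := (w10.rot.rot.rot.rot.common (A 10 9 (by decide))
    (A 9 5 (by decide))).resolve_right (D _ _ (by decide))
  obtain rfl : z' = z := (w9.rot.common w10.de.symm w10.adj.2.2.2.1.symm).resolve_left
    w10.ne.2.2.1.symm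
  have z9 := w10.de
  have z10 := w10.adj.2.2.2.1.symm
  have z8 := w9.de
  have z6 := w10.cd.symm
  have hz : ∀ i, p i ≠ z' := by
    have h4 := w9.ne.2.2.1
    have h5 := w9.ne.2.2.2.2.2.1
    have h10' := z10.ne'
    have h8' := z8.ne'
    intro i hi
    have h1 := (C.adj 9 i).1 (hi ▸ z9.symm)
    have : ∀ i ∈ flowerNb 9, i = 4 ∨ i = 5 ∨ i = 8 ∨ i = 10 := by decide
    rcases this i h1 with rfl | rfl | rfl | rfl
    exacts [h4 hi, h5 hi, h8' hi, h10' hi]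
  -- With this edge, all links close up and the twelve vertices form an icosahedron. It would be the
  -- whole graph, with no vertex on the outer face.
  have hz7 : ¬ G.graph.Adj z' (p 7) := by
    intro z7
    obtain ⟨c1, c2⟩ := nbr_of_closed_five hT (A 6 10 (by decide)) (A 6 1 (by decide))
      (A 6 2 (by decide)) (A 6 7 (by decide)) z6.symm (A 10 1 (by decide)) (A 1 2 (by decide))
      (A 2 7 (by decide)) z7.symm z10 (D _ _ (by decide)) (D _ _ (by decide)) (hz 2)
      (D _ _ (by decide)) (hz 1).symm
    obtain ⟨c3, c4⟩ := nbr_of_closed_five hT (A 8 9 (by decide)) (A 8 4 (by decide))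
      (A 8 3 (by decide)) (A 8 7 (by decide)) z8.symm (A 9 4 (by decide)) (A 4 3 (by decide))
      (A 3 7 (by decide)) z7.symm z9 (D _ _ (by decide)) (D _ _ (by decide)) (hz 3)
      (D _ _ (by decide)) (hz 4).symm
    obtain ⟨c5, c6⟩ := nbr_of_closed_five hT z6 z10 z9 z8 z7 (A 6 10 (by decide))
      (A 10 9 (by decide)) (A 9 8 (by decide)) (A 8 7 (by decide)) (A 7 6 (by decide))
      (D _ _ (by decide)) (D _ _ (by decide)) (D _ _ (by decide)) (D _ _ (by decide))
      (D _ _ (by decide))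
    obtain ⟨c7, c8⟩ := nbr_of_closed_five hT (A 7 6 (by decide)) (A 7 2 (by decide))
      (A 7 3 (by decide)) (A 7 8 (by decide)) z7.symm (A 6 2 (by decide)) (A 2 3 (by decide))
      (A 3 8 (by decide)) z8.symm z6 (D _ _ (by decide)) (D _ _ (by decide)) (hz 3)
      (D _ _ (by decide)) (hz 2).symm
    have key : ∀ x, (x = z' ∨ ∃ i, x = p i) → G.Internal x ∧
        ∀ y, G.graph.Adj x y → y = z' ∨ ∃ i, y = p i := by
      rintro x (rfl | ⟨i, rfl⟩)
      · refine ⟨c5, fun y hy => Or.inr ?_⟩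
        rcases c6 y hy with h | h | h | h | h <;> exact ⟨_, h⟩
      · by_cases hi : i.val < 6
        · exact ⟨C.internal i hi, fun y hy => Or.inr (C.closed i hi y hy)⟩
        rcases eq_of_six_le i (not_lt.1 hi) with rfl | rfl | rfl | rfl | rfl
        · refine ⟨c1, fun y hy => ?_⟩
          rcases c2 y hy with h | h | h | h | h <;>
            first | exact Or.inl h | exact Or.inr ⟨_, h⟩
        · refine ⟨c7, fun y hy => ?_⟩
          rcases c8 y hy with h | h | h | h | h <;>
            first | exact Or.inl h | exact Or.inr ⟨_, h⟩
        · refine ⟨w10.internal, fun y hy => ?_⟩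
          rcases (w10.nbr y).1 hy with h | h | h | h | h <;>
            first | exact Or.inl h | exact Or.inr ⟨_, h⟩
        · refine ⟨c3, fun y hy => ?_⟩
          rcases c4 y hy with h | h | h | h | h <;>
            first | exact Or.inl h | exact Or.inr ⟨_, h⟩
        · refine ⟨w9.internal, fun y hy => ?_⟩
          rcases (w9.nbr y).1 hy with h | h | h | h | h <;>
            first | exact Or.inl h | exact Or.inr ⟨_, h⟩
    obtain ⟨a, b, hab⟩ := G.exists_external
    have := closed_eq_univ (fun x => x = z' ∨ ∃ i, x = p i) (s := z') (Or.inl rfl)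
      (fun x y hx hxy => (key x hx).2 y hxy) a
    exact (key a this).1 ⟨b, hab⟩
  refine ⟨![p 0, p 1, p 2, p 3, p 4, p 5, p 9, p 10, p 6, p 7, p 8, z'],
    Config.of_nbr ?_ (by decide) ?_ ?_⟩
  · rw [← List.nodup_ofFn]
    simp [List.ofFn_succ, C.injective.eq_iff, hz]
  · intro i hi
    fin_cases i <;> first | (exfalso; revert hi; decide) | skip
    · exact ⟨C.internal 0 (by decide), fun t =>
        (C.nbr (i := 0) (by decide) t).trans (by simp [flowerNb, diamondNb])⟩
    · exact ⟨C.internal 1 (by decide), fun t =>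
        (C.nbr (i := 1) (by decide) t).trans (by simp [flowerNb, diamondNb])⟩
    · exact ⟨C.internal 2 (by decide), fun t =>
        (C.nbr (i := 2) (by decide) t).trans (by simp [flowerNb, diamondNb])⟩
    · exact ⟨C.internal 3 (by decide), fun t =>
        (C.nbr (i := 3) (by decide) t).trans (by simp [flowerNb, diamondNb])⟩
    · exact ⟨C.internal 4 (by decide), fun t =>
        (C.nbr (i := 4) (by decide) t).trans (by simp [flowerNb, diamondNb])⟩
    · exact ⟨C.internal 5 (by decide), fun t =>
        (C.nbr (i := 5) (by decide) t).trans (by simp [flowerNb, diamondNb])⟩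
    · exact ⟨w9.internal, fun t => (w9.nbr t).trans (by simp [diamondNb])⟩
    · exact ⟨w10.internal, fun t => (w10.nbr t).trans (by simp [diamondNb])⟩
  · have hz7' : ¬ G.graph.Adj (p 7) z' := fun h => hz7 h.symm
    intro i j hi hj
    fin_cases i <;> first | (exfalso; revert hi; decide) | skip
    all_goals fin_cases j <;> first | (exfalso; revert hj; decide) | skip
    all_goals simp [diamondNb, C.adj, flowerNb, hz7, hz7', z6, z6.symm, z8, z8.symm]

theorem Config.flower_rotate_to {p : Fin 11 → G.V} (C : G.Config flowerNb 6 p) {j : Fin 11}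
    (hj : 6 ≤ j.val) : ∃ σ : Fin 11 → Fin 11, (∀ i, i.val < 6 → (σ i).val < 6) ∧
      (∀ i, 6 ≤ i.val → 6 ≤ (σ i).val) ∧ σ 6 = j ∧ G.Config flowerNb 6 (p ∘ σ) := by
  rcases eq_of_six_le j hj with rfl | rfl | rfl | rfl | rfl
  · exact ⟨id, by decide, by decide, rfl, C⟩
  · exact ⟨![0, 2, 3, 4, 5, 1, 7, 8, 9, 10, 6], by decide, by decide, rfl,
      C.perm _ (by decide) (by decide) (by decide)⟩
  · exact ⟨![0, 5, 1, 2, 3, 4, 10, 6, 7, 8, 9], by decide, by decide, rfl,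
      C.perm _ (by decide) (by decide) (by decide)⟩
  · exact ⟨![0, 3, 4, 5, 1, 2, 8, 9, 10, 6, 7], by decide, by decide, rfl,
      C.perm _ (by decide) (by decide) (by decide)⟩
  · exact ⟨![0, 4, 5, 1, 2, 3, 9, 10, 6, 7, 8], by decide, by decide, rfl,
      C.perm _ (by decide) (by decide) (by decide)⟩

/-- Since `s` has degree five, its only neighbor outside `I` and the frame is one vertex `y`, a
common neighbor of `s` with both `t` and `w`. The outer common neighbor `x` of `t` and `u` differs
from `y`, for otherwise it would be adjacent to all four corners. So `t` sees `a`, `b`, `c`, `s`,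
`u`, `x`, `y`. -/
theorem Region.seven_le {ℓ : ℕ} (hG : G.IsCandidate ℓ) {I : G.V → Prop} {s t u w p q a b c : G.V}
    (hF : G.Frame I s t u w) (hs : G.InternalFive s) (hp : I p) (hq : I q) (hpq : p ≠ q)
    (sp : G.graph.Adj s p) (sq : G.graph.Adj s q) (ha : I a) (hb : I b) (hc : I c) (hab : a ≠ b)
    (hac : a ≠ c) (hbc : b ≠ c) (ta : G.graph.Adj t a) (tb : G.graph.Adj t b)
    (tc : G.graph.Adj t c) (ht : G.Internal t) : 7 ≤ G.deg t := by
  have hI : ∀ x y, I x → ¬ I y → x ≠ y := by rintro x _ hx hy rfl; exact hy hx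
  have hsI := hF.not_mem s (by simp)
  have htI := hF.not_mem t (by simp)
  have huI := hF.not_mem u (by simp)
  have hwI := hF.not_mem w (by simp)
  obtain ⟨z, hz, hzC, zs, zt⟩ := hF.opposite s t (Or.inl rfl) hs.1
  obtain ⟨y, hy, hyC, ys, yw⟩ := hF.opposite s w (by simp [OnQuad]) hs.1
  obtain ⟨x, hx, hxC, xt, xu⟩ := hF.opposite t u (by simp [OnQuad]) ht
  simp only [not_or] at hzC hyC hxC
  have hzy : y = z := by
    have hm := mem_of_deg_le (v := s) (L := [p, q, t, w, z])
      (by have := hF.bd; have := hI p _ hp htI; have := hI p _ hp hwI; have := hI p _ hp hz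
          have := hI q _ hq htI; have := hI q _ hq hwI; have := hI q _ hq hz
          simp; grind)
      (by simp only [List.mem_cons, List.not_mem_nil, or_false]
          rintro r (rfl | rfl | rfl | rfl | rfl)
          exacts [sp, sq, hF.ab, hF.da.symm, zs.symm]) (by simp [hs.2]) y ys.symm
    have := hI p y hp hy
    have := hI q y hq hy
    simp at hm
    grind
  subst hzy
  have hxy : x ≠ y := by
    rintro rfl
    exact not_closed_four hG zs xt xu yw hF.ab hF.bc hF.cd hF.da hF.ac hF.bd
  refine length_le_deg (v := t) (L := [a, b, c, s, u, x, y]) ?_ ?_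
  · have := hF.ac
    have n1 := hI a _ ha hsI
    have n2 := hI a _ ha huI
    have n3 := hI a _ ha hx
    have n4 := hI a _ ha hy
    have n5 := hI b _ hb hsI
    have n6 := hI b _ hb huI
    have n7 := hI b _ hb hx
    have n8 := hI b _ hb hy
    have n9 := hI c _ hc hsI
    have n10 := hI c _ hc huI
    have n11 := hI c _ hc hx
    have n12 := hI c _ hc hy
    simp
    grind
  · simp only [List.mem_cons, List.not_mem_nil, or_false]
    rintro r (rfl | rfl | rfl | rfl | rfl | rfl | rfl)
    exacts [ta, tb, tc, hF.ab.symm, hF.bc, xt.symm, zt.symm]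

section Region

variable {ℓ : ℕ} (hG : G.IsCandidate ℓ) {I : G.V → Prop} (hI : G.Region I)
include hI hG

/-- The edge from `p 6` to its remaining neighbor outside the flower has the common neighbors `p 7`
and `p 10`; one of them must be small. -/
theorem Region.diamond_of_small {p : Fin 11 → G.V} (C : G.Config flowerNb 6 p)
    (hR : ¬ G.Reducible ℓ) (h6 : G.InternalFive (p 6))
    (h6I : I (p 6)) : ∃ q, G.Config diamondNb 8 q := by
  have A : ∀ i j : Fin 11, j ∈ flowerNb i → G.graph.Adj (p i) (p j) := fun i j h => (C.adj _ _).2 h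
  have D : ∀ i j : Fin 11, i ≠ j → p i ≠ p j := fun i j h => C.injective.ne h
  obtain ⟨c, d, e, w6⟩ := exists_W5 hG.tri h6 (A 6 1 (by decide)) (A 6 2 (by decide))
    (A 1 2 (by decide))
  obtain rfl : p 7 = c := (w6.common (A 6 7 (by decide)) (A 7 2 (by decide))).resolve_left
    (D _ _ (by decide))
  obtain rfl : p 10 = e := (w6.rot.rot.rot.rot.common (A 6 10 (by decide))
    (A 10 1 (by decide))).resolve_right (D _ _ (by decide))
  rcases hI.small_or_small hG hR h6I w6.rot.rot with h7 | h10
  · exact C.flower_rotate.flower_rotate.exists_diamond hG.tri h6 h7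
  · exact C.flower_rotate.exists_diamond hG.tri h10 h6

/-- As `p 6` already has the neighbors `p 1` and `p 2` in `I`, the vertices `p 7` and `p 10` are its
neighbors on the frame, and `p 8`, `p 9` are inside and therefore big. The degree condition for `p
7` and `p 10` is `Region.seven_le`. A common neighbor of `p 6` with `p 8` or `p 9` is in `I` or on
the frame, and so is one of the four allowed. -/
theorem Region.reducible_of_outside {p : Fin 11 → G.V} (C : G.Config flowerNb 6 p)
    (hpI : ∀ i : Fin 11, i.val < 6 → I (p i)) (hno : ∀ j, 6 ≤ j.val → I (p j) →
      ¬ G.InternalFive (p j)) (h6 : G.InternalFive (p 6)) : G.Reducible ℓ := by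
  have A : ∀ i j : Fin 11, j ∈ flowerNb i → G.graph.Adj (p i) (p j) := fun i j h => (C.adj _ _).2 h
  have N : ∀ i j : Fin 11, j ∉ flowerNb i → ¬ G.graph.Adj (p i) (p j) := fun i j h h' =>
    h ((C.adj _ _).1 h')
  have D : ∀ i j : Fin 11, i ≠ j → p i ≠ p j := fun i j h => C.injective.ne h
  have h6I : ¬ I (p 6) := fun h => hno 6 (by decide) h h6
  have three : ∀ b, I b → G.graph.Adj b (p 6) → b = p 1 ∨ b = p 2 := by
    intro b hb hb6
    by_contra h
    rw [not_or] at h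
    exact hI.not_three h6 h6I (hpI 1 (by decide)) (hpI 2 (by decide)) hb (D _ _ (by decide))
      (Ne.symm h.1) (Ne.symm h.2) (A 6 1 (by decide)) (A 6 2 (by decide)) hb6.symm
  have h7I : ¬ I (p 7) := fun h => (three _ h (A 7 6 (by decide))).elim (D _ _ (by decide))
    (D _ _ (by decide))
  have h10I : ¬ I (p 10) := fun h => (three _ h (A 10 6 (by decide))).elim (D _ _ (by decide))
    (D _ _ (by decide))
  obtain ⟨u, hF⟩ : ∃ u, G.Frame I (p 6) (p 7) u (p 10) := by
    obtain ⟨b, c, d, hF⟩ := hI.exists_frame h6.1 h6I (hpI 1 (by decide)) (A 1 6 (by decide))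
    rcases hF.nbr _ _ (hpI 2 (by decide)) (A 2 7 (by decide)) h7I with h | h | h | h
    · exact absurd h (D _ _ (by decide))
    · subst h
      rcases hF.nbr _ _ (hpI 1 (by decide)) (A 1 10 (by decide)) h10I with h | h | h | h
      · exact absurd h (D _ _ (by decide))
      · exact absurd h (D _ _ (by decide))
      · exact absurd (h ▸ A 6 10 (by decide)) hF.chord₁
      · subst h
        exact ⟨c, hF⟩
    · exact absurd (h ▸ A 6 7 (by decide)) hF.chord₁
    · subst h
      rcases hF.nbr _ _ (hpI 1 (by decide)) (A 1 10 (by decide)) h10I with h | h | h | h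
      · exact absurd h (D _ _ (by decide))
      · subst h
        exact ⟨c, hF.refl⟩
      · exact absurd (h ▸ A 6 10 (by decide)) hF.chord₁
      · exact absurd h (D _ _ (by decide))
  have h8I : I (p 8) := by
    by_contra h8I
    rcases hF.nbr _ _ (hpI 3 (by decide)) (A 3 8 (by decide)) h8I with h | h | h | h
    · exact D _ _ (by decide) h
    · exact D _ _ (by decide) h
    · exact N 8 10 (by decide) (h ▸ hF.cd)
    · exact D _ _ (by decide) h
  have h9I : I (p 9) := by
    by_contra h9I
    rcases hF.nbr _ _ (hpI 4 (by decide)) (A 4 9 (by decide)) h9I with h | h | h | h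
    · exact D _ _ (by decide) h
    · exact D _ _ (by decide) h
    · exact N 7 9 (by decide) (h ▸ hF.bc)
    · exact D _ _ (by decide) h
  refine C.reducible_of_extended hG h6 (fun h7 => ?_)
    ((hG.small_or_big _).resolve_left (hno 8 (by decide) h8I))
    ((hG.small_or_big _).resolve_left (hno 9 (by decide) h9I)) (fun h10 => ?_) ?_
  · exact Region.seven_le hG hF h6 (hpI 1 (by decide)) (hpI 2 (by decide)) (D _ _ (by decide))
      (A 6 1 (by decide)) (A 6 2 (by decide)) (hpI 2 (by decide)) (hpI 3 (by decide)) h8I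
      (D _ _ (by decide)) (D _ _ (by decide)) (D _ _ (by decide)) (A 7 2 (by decide))
      (A 7 3 (by decide)) (A 7 8 (by decide)) h7
  · exact Region.seven_le hG hF.refl h6 (hpI 1 (by decide)) (hpI 2 (by decide)) (D _ _ (by decide))
      (A 6 1 (by decide)) (A 6 2 (by decide)) (hpI 1 (by decide)) (hpI 5 (by decide)) h9I
      (D _ _ (by decide)) (D _ _ (by decide)) (D _ _ (by decide)) (A 10 1 (by decide))
      (A 10 5 (by decide)) (A 10 9 (by decide)) h10
  · intro b hb6 hb
    by_cases hbI : I b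
    · have := three b hbI hb6
      tauto
    have hC : b = p 6 ∨ b = p 7 ∨ b = u ∨ b = p 10 := by
      rcases hb with hb | hb
      · exact hF.nbr _ _ h8I hb.symm hbI
      · exact hF.nbr _ _ h9I hb.symm hbI
    rcases hC with h | h | h | h
    · exact absurd (h ▸ hb6) (G.graph.loopless.irrefl _)
    · exact Or.inr (Or.inr (Or.inl h))
    · exact absurd (h ▸ hb6.symm) hF.chord₁
    · exact Or.inr (Or.inr (Or.inr h))

theorem Region.exists_diamond (hR : ¬ G.Reducible ℓ) : ∃ q, G.Config diamondNb 8 q := by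
  obtain ⟨h, hh⟩ := hI.exists_fullHub hG hR
  obtain ⟨p, C, hpI⟩ := hI.exists_flower hG hh
  by_cases h1 : ∃ j : Fin 11, 6 ≤ j.val ∧ I (p j) ∧ G.InternalFive (p j)
  · obtain ⟨j, hj, hjI, hjs⟩ := h1
    obtain ⟨σ, -, -, rfl, hσ⟩ := C.flower_rotate_to hj
    exact hI.diamond_of_small hG hσ hR hjs hjI
  push Not at h1
  by_cases h2 : ∃ j : Fin 11, 6 ≤ j.val ∧ G.InternalFive (p j)
  · obtain ⟨j, hj, hjs⟩ := h2
    obtain ⟨σ, h3, h4, rfl, hσ⟩ := C.flower_rotate_to hj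
    exact absurd (hI.reducible_of_outside hG hσ (fun i hi => hpI _ (h3 i hi))
      (fun i hi => h1 _ (h4 i hi)) hjs) hR
  push Not at h2
  exact absurd (C.reducible_of_five hG fun j hj =>
    (hG.small_or_big _).resolve_left (h2 j hj)) hR

end Region

end Canvas

namespace Canvas

variable {G : Canvas.{u}}

/-! ## Disks bounded by chordless 4-cycles -/

/-- The internal vertices in `D` fill a disk bounded by the hole `abcd`. -/
structure Disk (G : Canvas.{u}) (D : G.V → Prop) (a b c d : G.V) : Prop
    extends G.Hole a b c d where
  not_mem : ∀ x, x = a ∨ x = b ∨ x = c ∨ x = d → ¬ D x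
  internal : ∀ x, D x → G.Internal x
  closed : ∀ x y, D x → G.graph.Adj x y → D y ∨ (y = a ∨ y = b ∨ y = c ∨ y = d)
  inner : ∀ x y, OnQuad a b c d x y → ∃ z, D z ∧ G.graph.Adj z x ∧ G.graph.Adj z y
  unique : ∀ x y z z', OnQuad a b c d x y → D z → D z' → G.graph.Adj z x → G.graph.Adj z y →
    G.graph.Adj z' x → G.graph.Adj z' y → z = z'
  two : ∀ x, x = a ∨ x = b ∨ x = c ∨ x = d → ∃ s t, s ≠ t ∧ D s ∧ D t ∧ G.graph.Adj x s ∧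
    G.graph.Adj x t

/-- The vertices outside the disk. -/
def Outside {V : Type*} (D : V → Prop) (a b c d w : V) : Prop :=
  ¬ D w ∧ ¬ (w = a ∨ w = b ∨ w = c ∨ w = d)

namespace Disk

variable {D : G.V → Prop} {a b c d w : G.V}

theorem rot (h : G.Disk D a b c d) : G.Disk D b c d a where
  toHole := h.toHole.rot
  not_mem x hx := h.not_mem x (by tauto)
  internal := h.internal
  closed x y hx hy := by have := h.closed x y hx hy; tauto
  inner x y hq := h.inner x y hq.rot.rot.rot
  unique x y z z' hq := h.unique x y z z' hq.rot.rot.rot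
  two x hx := h.two x (by tauto)

theorem refl (h : G.Disk D a b c d) : G.Disk D a d c b := by
  have hq : ∀ x y, OnQuad a d c b x y → OnQuad a b c d x y := by
    intro x y h
    simp only [OnQuad, Sym2.eq_iff] at h ⊢
    tauto
  exact
  { ab := h.da.symm
    bc := h.cd.symm
    cd := h.bc.symm
    da := h.ab.symm
    ac := h.ac
    bd := h.bd.symm
    chord₁ := h.chord₁
    chord₂ := fun h' => h.chord₂ h'.symm
    not_mem := fun x hx => h.not_mem x (by tauto)
    internal := h.internal
    closed := fun x y hx hy => by have := h.closed x y hx hy; tauto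
    inner := fun x y hxy => h.inner x y (hq x y hxy)
    unique := fun x y z z' hxy => h.unique x y z z' (hq x y hxy)
    two := fun x hx => h.two x (by tauto) }

theorem outside_rot (hw : Outside D a b c d w) : Outside D b c d a w := ⟨hw.1, by
  have := hw.2
  tauto⟩

theorem outside_refl (hw : Outside D a b c d w) : Outside D a d c b w := ⟨hw.1, by
  have := hw.2
  tauto⟩

theorem not_adj (h : G.Disk D a b c d) (hw : Outside D a b c d w) {x : G.V} (hx : D x) :
    ¬ G.graph.Adj x w := fun h' => (h.closed x w hx h').elim hw.1 hw.2

variable {ℓ : ℕ} (hG : G.IsCandidate ℓ)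
include hG

/-- Of the two common neighbors of an edge of the boundary with an internal end, only one can be
inside, by `unique`. -/
theorem exists_outside (h : G.Disk D a b c d) {x y : G.V} (hq : OnQuad a b c d x y)
    (hx : G.Internal x) :
    ∃ w, Outside D a b c d w ∧ G.graph.Adj w x ∧ G.graph.Adj w y := by
  obtain ⟨p, q, hpq, hc⟩ := exists_common hG.tri hx (h.adj_of_onQuad hq).symm
  obtain ⟨z, hz, zx, zy⟩ := h.inner x y hq
  have key : ∃ w, w ≠ z ∧ G.graph.Adj w y ∧ G.graph.Adj w x := by
    rcases (hc z).1 ⟨zy, zx⟩ with rfl | rfl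
    · exact ⟨q, hpq.symm, (hc q).2 (Or.inr rfl)⟩
    · exact ⟨p, hpq, (hc p).2 (Or.inl rfl)⟩
  obtain ⟨w, hwz, wy, wx⟩ := key
  exact ⟨w, ⟨fun hw => hwz (h.unique x y w z hq hw hz wx wy zx zy), h.third hq wx wy⟩, wx, wy⟩

/-- An internal `b` has two neighbors inside, the two adjacent corners, `w`, and the outer common
neighbor with `c`. The last is not `w`, as otherwise `w` would be adjacent to all four corners. -/
theorem big (h : G.Disk D a b c d) (hw : Outside D a b c d w) (wa : G.graph.Adj w a)
    (wb : G.graph.Adj w b) (wd : G.graph.Adj w d) : G.Big b := by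
  by_cases hb : G.External b
  · exact Or.inl hb
  right
  obtain ⟨z, hz, zb, zc⟩ := h.exists_outside hG (show OnQuad a b c d b c by simp [OnQuad]) hb
  obtain ⟨s, t, hst, hs, ht, bs, bt⟩ := h.two b (by simp)
  have hzw : z ≠ w := by
    rintro rfl
    exact not_closed_four hG wa wb zc wd h.ab h.bc h.cd h.da h.ac h.bd
  have hD : ∀ x y, D x → ¬ D y → x ≠ y := by rintro x _ hx hy rfl; exact hy hx
  have e1 := hD s _ hs (h.not_mem a (by simp))
  have e2 := hD s _ hs (h.not_mem c (by simp))
  have e3 := hD s _ hs hw.1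
  have e4 := hD s _ hs hz.1
  have e5 := hD t _ ht (h.not_mem a (by simp))
  have e6 := hD t _ ht (h.not_mem c (by simp))
  have e7 := hD t _ ht hw.1
  have e8 := hD t _ ht hz.1
  have e9 := hw.2
  have e10 := hz.2
  have e11 := h.ac
  refine length_le_deg (v := b) (L := [s, t, a, c, w, z]) (by simp; grind) ?_
  simp only [List.mem_cons, List.not_mem_nil, or_false]
  rintro r (rfl | rfl | rfl | rfl | rfl | rfl)
  exacts [bs, bt, h.ab.symm, h.bc, wb.symm, zb.symm]

/-- No vertex outside the disk is adjacent to three consecutive vertices of its boundary. -/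
theorem reducible_of_three (h : G.Disk D a b c d) (hw : Outside D a b c d w)
    (wd : G.graph.Adj w d) (wa : G.graph.Adj w a) (wb : G.graph.Adj w b) : G.Reducible ℓ := by
  obtain ⟨i, hi, ia, ib⟩ := h.inner a b (by simp [OnQuad])
  obtain ⟨j, hj, ja, jd⟩ := h.inner a d (by simp [OnQuad])
  have hiw : i ≠ w := by rintro rfl; exact hw.1 hi
  have hjw : j ≠ w := by rintro rfl; exact hw.1 hj
  -- The corner `a` is enclosed by the disk and `w`, so all its neighbors are known. Then the edge
  -- `wa` can be contracted: its common neighbors are `b` and `d`, which are big.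
  obtain ⟨h1, h2⟩ := nbr_closed hG.tri (w := a)
    (fun t => (D t ∧ G.graph.Adj a t) ∨ t = b ∨ t = d ∨ t = w) (s₀ := b) (by simp) (by
      rintro s (⟨hs, as⟩ | rfl | rfl | rfl)
      · obtain ⟨p, q, hpq, hc⟩ := exists_common hG.tri (h.internal s hs) as
        have key : ∀ x, x = p ∨ x = q →
            ((D x ∧ G.graph.Adj a x) ∨ x = b ∨ x = d ∨ x = w) ∧ G.graph.Adj s x := by
          intro x hx
          obtain ⟨xa, xs⟩ := (hc x).2 hx
          refine ⟨?_, xs.symm⟩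
          rcases h.closed s x hs xs.symm with hx | rfl | rfl | rfl | rfl
          · exact Or.inl ⟨hx, xa.symm⟩
          · exact (xa.ne rfl).elim
          · simp
          · exact (h.chord₁ xa.symm).elim
          · simp
        have kp := key p (Or.inl rfl)
        have kq := key q (Or.inr rfl)
        exact ⟨as, p, q, kp.1, kq.1, hpq, kp.2, kq.2⟩
      · exact ⟨h.ab, i, w, Or.inl ⟨hi, ia.symm⟩, by simp, hiw, ib.symm, wb.symm⟩
      · exact ⟨h.da.symm, j, w, Or.inl ⟨hj, ja.symm⟩, by simp, hjw, jd.symm, wd.symm⟩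
      · exact ⟨wa.symm, b, d, by simp, by simp, h.bd, wb, wd⟩)
  refine reducible_of_edge hG wa h1 ?_ ?_
  · intro x y ax xy yw hxw hya
    rcases h2 x ax with ⟨hx, -⟩ | rfl | rfl | rfl
    · rcases h.closed x y hx xy with hy | rfl | rfl | rfl | rfl
      · exact (h.not_adj hw hy yw).elim
      · exact (hya rfl).elim
      · exact Or.inl h.ab
      · exact (not_closed_four hG wa wb yw.symm wd h.ab h.bc h.cd h.da h.ac h.bd).elim
      · exact Or.inl h.da.symm
    · exact Or.inr wb
    · exact Or.inr wd
    · exact (hxw rfl).elim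
  · intro t tw ta
    rcases h2 t ta.symm with ⟨ht, -⟩ | rfl | rfl | rfl
    · exact (h.not_adj hw ht tw).elim
    · exact h.big hG hw wa wb wd
    · exact h.refl.big hG (outside_refl hw) wa wd wb
    · exact (tw.ne rfl).elim

variable (hR : ¬ G.Reducible ℓ)
include hR

theorem exists_pair (h : G.Disk D a b c d) (ha : G.Internal a) : ∃ w w', w ≠ w' ∧
    Outside D a b c d w ∧ Outside D a b c d w' ∧ G.graph.Adj w a ∧ G.graph.Adj w b ∧
    G.graph.Adj w' a ∧ G.graph.Adj w' d := by
  obtain ⟨w, hw, wa, wb⟩ := h.exists_outside hG (show OnQuad a b c d a b by simp [OnQuad]) ha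
  obtain ⟨w', hw', wa', wd'⟩ := h.exists_outside hG (show OnQuad a b c d a d by simp [OnQuad]) ha
  refine ⟨w, w', ?_, hw, hw', wa, wb, wa', wd'⟩
  rintro rfl
  exact hR (h.reducible_of_three hG hw wd' wa wb)

theorem exists_pair_list (h : G.Disk D a b c d) (ha : G.Internal a) {L : List G.V}
    (hL : L.Nodup) (hLD : ∀ x ∈ L, D x ∧ G.graph.Adj a x) :
    ∃ w w', Outside D a b c d w ∧ Outside D a b c d w' ∧ G.graph.Adj w b ∧ G.graph.Adj w' d ∧
      (L ++ [b, d, w, w']).Nodup ∧ ∀ t ∈ L ++ [b, d, w, w'], G.graph.Adj a t := by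
  obtain ⟨w, w', hww, hw, hw', wa, wb, wa', wd'⟩ := h.exists_pair hG hR ha
  have hn : ∀ x ∈ L, ∀ y, ¬ D y → x ≠ y := by rintro x hx _ hy rfl; exact hy (hLD x hx).1
  refine ⟨w, w', hw, hw', wb, wd', ?_, ?_⟩
  · rw [List.nodup_append]
    refine ⟨hL, ?_, ?_⟩
    · have := h.bd
      have := hw.2
      have := hw'.2
      simp
      grind
    · intro x hx y hy
      simp only [List.mem_cons, List.not_mem_nil, or_false] at hy
      rcases hy with rfl | rfl | rfl | rfl
      exacts [hn x hx _ (h.not_mem _ (by simp)), hn x hx _ (h.not_mem _ (by simp)), hn x hx _ hw.1,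
        hn x hx _ hw'.1]
  · intro x hx
    rcases List.mem_append.1 hx with hx | hx
    · exact (hLD x hx).2
    · simp only [List.mem_cons, List.not_mem_nil, or_false] at hx
      rcases hx with rfl | rfl | rfl | rfl
      exacts [h.ab, h.da.symm, wa.symm, wa'.symm]

/-- Besides the listed neighbors inside, an internal corner sees its two adjacent corners and an
outer common neighbor with each of them. These two are distinct by `reducible_of_three`. -/
theorem deg_ge (h : G.Disk D a b c d) (ha : G.Internal a) {L : List G.V} (hL : L.Nodup)
    (hLD : ∀ x ∈ L, D x ∧ G.graph.Adj a x) : L.length + 4 ≤ G.deg a := by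
  obtain ⟨w, w', -, -, -, -, h1, h2⟩ := h.exists_pair_list hG hR ha hL hLD
  simpa using length_le_deg h1 h2

theorem exists_pair_of_deg (h : G.Disk D a b c d) (ha : G.Internal a) {L : List G.V}
    (hL : L.Nodup) (hLD : ∀ x ∈ L, D x ∧ G.graph.Adj a x) (hd : G.deg a ≤ L.length + 4) :
    ∃ w w', w ≠ w' ∧ Outside D a b c d w ∧ Outside D a b c d w' ∧ G.graph.Adj w a ∧
      G.graph.Adj w b ∧ G.graph.Adj w' a ∧ G.graph.Adj w' d ∧
      ∀ t, G.graph.Adj a t → t ∈ L ∨ t = b ∨ t = d ∨ t = w ∨ t = w' := by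
  obtain ⟨w, w', hw, hw', wb, wd, h1, h2⟩ := h.exists_pair_list hG hR ha hL hLD
  refine ⟨w, w', ?_, hw, hw', (h2 w (by simp)).symm, wb, (h2 w' (by simp)).symm, wd,
    fun t ht => by simpa using mem_of_deg_le h1 h2 (by simpa using hd) t ht⟩
  have := (List.nodup_append.1 h1).2.1
  simp at this
  tauto

/-- If `a` has the least possible degree, each of its outside neighbors is also adjacent to `b` or
to `d`. Adjacency to `c` would then give three consecutive corners. -/
theorem not_opposite (h : G.Disk D a b c d) (ha : G.Internal a) {L : List G.V} (hL : L.Nodup)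
    (hLD : ∀ x ∈ L, D x ∧ G.graph.Adj a x) (hd : G.deg a ≤ L.length + 4)
    (hw : Outside D a b c d w) (wa : G.graph.Adj w a) : ¬ G.graph.Adj w c := by
  intro wc
  obtain ⟨y, y', -, -, -, -, yb, -, yd, hall⟩ := h.exists_pair_of_deg hG hR ha hL hLD hd
  rcases hall w wa.symm with hwL | rfl | rfl | rfl | rfl
  · exact hw.1 (hLD w hwL).1
  · exact hw.2 (by simp)
  · exact hw.2 (by simp)
  · exact hR (h.rot.reducible_of_three hG (outside_rot hw) wa yb wc)
  · exact hR (h.rot.rot.rot.reducible_of_three hG (outside_rot (outside_rot (outside_rot hw)))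
      wc yd wa)

end Disk

end Canvas

namespace Canvas

variable {G : Canvas.{u}}

/-! ## The 8-contraction -/

theorem Side.pass {a b c d x y z : G.V} {S : G.V → G.V → Prop} (hS : G.Side (OnQuad a b c d) S)
    (hx : ¬ (x = a ∨ x = b ∨ x = c ∨ x = d)) (hy : G.graph.Adj y x) (hz : G.graph.Adj x z) :
    S y x ↔ S x z := by
  have hn : ∀ t, ¬ OnQuad a b c d x t := fun t h => hx h.mem.1
  rw [hS.off y x hy fun h => hn y h.symm]
  exact ⟨fun h => hS.const hn h hz, fun h => hS.const hn h hy.symm⟩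

section Diamond

variable {p : Fin 12 → G.V} (C : G.Config diamondNb 8 p)
include C

theorem Config.diamond_hole : G.Hole (p 8) (p 9) (p 10) (p 11) where
  ab := (C.adj _ _).2 (by decide)
  bc := (C.adj _ _).2 (by decide)
  cd := (C.adj _ _).2 (by decide)
  da := (C.adj _ _).2 (by decide)
  ac := C.injective.ne (by decide)
  bd := C.injective.ne (by decide)
  chord₁ := by rw [C.adj]; decide
  chord₂ := by rw [C.adj]; decide

theorem Config.diamond_disk :
    G.Disk (fun t => ∃ i : Fin 12, i.val < 8 ∧ t = p i) (p 8) (p 9) (p 10) (p 11) := by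
  have hcase : ∀ {P : Fin 12 → Fin 12 → Prop}, (∀ i j, P i j → P j i) → P 8 9 → P 9 10 →
      P 10 11 → P 11 8 → ∀ x y, OnQuad (p 8) (p 9) (p 10) (p 11) x y →
      ∃ i j, x = p i ∧ y = p j ∧ P i j := by
    intro P hs h1 h2 h3 h4 x y hq
    simp only [OnQuad, Sym2.eq_iff] at hq
    rcases hq with (⟨rfl, rfl⟩ | ⟨rfl, rfl⟩) | (⟨rfl, rfl⟩ | ⟨rfl, rfl⟩) |
      (⟨rfl, rfl⟩ | ⟨rfl, rfl⟩) | (⟨rfl, rfl⟩ | ⟨rfl, rfl⟩)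
    exacts [⟨8, 9, rfl, rfl, h1⟩, ⟨9, 8, rfl, rfl, hs _ _ h1⟩, ⟨9, 10, rfl, rfl, h2⟩,
      ⟨10, 9, rfl, rfl, hs _ _ h2⟩, ⟨10, 11, rfl, rfl, h3⟩, ⟨11, 10, rfl, rfl, hs _ _ h3⟩,
      ⟨11, 8, rfl, rfl, h4⟩, ⟨8, 11, rfl, rfl, hs _ _ h4⟩]
  refine ⟨C.diamond_hole, ?_, ?_, ?_, ?_, ?_, ?_⟩
  · rintro x hx ⟨i, hi, rfl⟩
    simp only [C.injective.eq_iff] at hx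
    revert hi hx
    revert i
    decide
  · rintro x ⟨i, hi, rfl⟩
    exact C.internal i hi
  · rintro x y ⟨i, hi, rfl⟩ hxy
    obtain ⟨j, rfl⟩ := C.closed i hi y hxy
    by_cases hj : j.val < 8
    · exact Or.inl ⟨j, hj, rfl⟩
    · have : ∀ j : Fin 12, ¬ j.val < 8 → j = 8 ∨ j = 9 ∨ j = 10 ∨ j = 11 := by decide
      rcases this j hj with rfl | rfl | rfl | rfl <;> simp
  · intro x y hq
    obtain ⟨i, j, rfl, rfl, k, hk, h1, h2⟩ := hcase (P := fun i j => ∃ k : Fin 12, k.val < 8 ∧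
      i ∈ diamondNb k ∧ j ∈ diamondNb k) (fun i j ⟨k, h1, h2, h3⟩ => ⟨k, h1, h3, h2⟩)
      (by decide) (by decide) (by decide) (by decide) x y hq
    exact ⟨p k, ⟨k, hk, rfl⟩, (C.adj _ _).2 h1, (C.adj _ _).2 h2⟩
  · rintro x y _ _ hq ⟨k, hk, rfl⟩ ⟨k', hk', rfl⟩ h1 h2 h3 h4
    obtain ⟨i, j, rfl, rfl, h⟩ := hcase (P := fun i j => ∀ k k' : Fin 12, k.val < 8 → k'.val < 8 →
      i ∈ diamondNb k → j ∈ diamondNb k → i ∈ diamondNb k' → j ∈ diamondNb k' → k = k')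
      (fun i j h k k' hk hk' h1 h2 h3 h4 => h k k' hk hk' h2 h1 h4 h3)
      (by decide) (by decide) (by decide) (by decide) x y hq
    rw [C.adj] at h1 h2 h3 h4
    rw [h k k' hk hk' h1 h2 h3 h4]
  · have key : ∀ i j k : Fin 12, j.val < 8 → k.val < 8 → j ≠ k → j ∈ diamondNb i →
        k ∈ diamondNb i → ∃ s t, s ≠ t ∧ (∃ i : Fin 12, i.val < 8 ∧ s = p i) ∧
        (∃ i : Fin 12, i.val < 8 ∧ t = p i) ∧ G.graph.Adj (p i) s ∧ G.graph.Adj (p i) t :=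
      fun i j k hj hk hjk h1 h2 => ⟨p j, p k, C.injective.ne hjk, ⟨j, hj, rfl⟩, ⟨k, hk, rfl⟩,
        (C.adj _ _).2 h1, (C.adj _ _).2 h2⟩
    rintro x (rfl | rfl | rfl | rfl)
    · exact key 8 1 2 (by decide) (by decide) (by decide) (by decide) (by decide)
    · exact key 9 2 3 (by decide) (by decide) (by decide) (by decide) (by decide)
    · exact key 10 3 4 (by decide) (by decide) (by decide) (by decide) (by decide)
    · exact key 11 6 7 (by decide) (by decide) (by decide) (by decide) (by decide)

theorem Config.diamond_outside {w : G.V} (hw : ∀ i, w ≠ p i) :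
    Outside (fun t => ∃ i : Fin 12, i.val < 8 ∧ t = p i) (p 8) (p 9) (p 10) (p 11) w :=
  ⟨fun ⟨i, _, h⟩ => hw i h, by
    rintro (h | h | h | h) <;> exact hw _ h⟩

theorem Config.outside_of {w : G.V}
    (hw : Outside (fun t => ∃ i : Fin 12, i.val < 8 ∧ t = p i) (p 8) (p 9) (p 10) (p 11) w)
    (i : Fin 12) : w ≠ p i := by
  rintro rfl
  by_cases hi : i.val < 8
  · exact hw.1 ⟨i, hi, rfl⟩
  · have : ∀ j : Fin 12, ¬ j.val < 8 → j = 8 ∨ j = 9 ∨ j = 10 ∨ j = 11 := by decide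
    refine hw.2 ?_
    rcases this i hi with rfl | rfl | rfl | rfl <;> simp

/-- Opposite vertices of the boundary cannot both have common neighbors outside. -/
theorem Config.diamond_cross {ℓ : ℕ} (hG : G.IsCandidate ℓ) {s t : G.V} (hs : ∀ i, s ≠ p i)
    (ht : ∀ i, t ≠ p i) (s8 : G.graph.Adj s (p 8)) (s10 : G.graph.Adj s (p 10))
    (t9 : G.graph.Adj t (p 9)) : ¬ G.graph.Adj t (p 11) := by
  intro t11
  have A : ∀ i j : Fin 12, j ∈ diamondNb i → G.graph.Adj (p i) (p j) := fun i j h =>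
    (C.adj _ _).2 h
  have D : ∀ i j : Fin 12, i ≠ j → p i ≠ p j := fun i j h => C.injective.ne h
  have hst : t ≠ s := by
    rintro rfl
    exact not_closed_four hG s8 t9 s10 t11 (A 8 9 (by decide)) (A 9 10 (by decide))
      (A 10 11 (by decide)) (A 11 8 (by decide)) (D _ _ (by decide)) (D _ _ (by decide))
  obtain ⟨S, hS⟩ := exists_side (a := p 8) (b := p 9) (c := p 10) (d := s)
    ⟨A 8 9 (by decide), A 9 10 (by decide), s10.symm, s8, D _ _ (by decide), (hs 9).symm⟩
  have out : ∀ i : Fin 12, i ≠ 8 → i ≠ 9 → i ≠ 10 →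
      ¬ (p i = p 8 ∨ p i = p 9 ∨ p i = p 10 ∨ p i = s) := by
    intro i h8 h9 h10
    simp [C.injective.eq_iff, h8, h9, h10, (hs i).symm]
  -- At `p 9`, the 4-cycle through `p 8`, `p 9`, `p 10` and `s` separates the inner neighbors `p 2`,
  -- `p 3` from `t`. The passages below follow a closed walk from `p 2` through the diamond and `p
  -- 11` to `t` without touching this cycle, which is the contradiction.
  have hfan := fan_separation hG.tri S (fun _ _ h => hS.step h) (A 9 8 (by decide))
    (A 9 2 (by decide)) (A 9 3 (by decide)) (A 9 10 (by decide)) (A 8 2 (by decide))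
    (A 2 3 (by decide)) (A 3 10 (by decide)) (D _ _ (by decide)) (D _ _ (by decide)) (by
      intro x hx h8 h10
      refine hS.off _ _ hx fun hq => ?_
      have h1 := hq.mem
      have := hx.ne
      simp only [OnQuad, Sym2.eq_iff] at hq
      have := hs 9
      have := D 9 8 (by decide)
      have := D 9 10 (by decide)
      grind) (hS.on _ _ (A 9 8 (by decide)) (by simp [OnQuad]))
    (hS.on _ _ (A 9 10 (by decide)) (by simp [OnQuad])) t9.symm (ht 2) (ht 3) (ht 8) (ht 10)
  have hoff : ∀ x, G.graph.Adj (p 9) x → ¬ (x = p 8 ∨ x = p 9 ∨ x = p 10 ∨ x = s) →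
      (S (p 9) x ↔ S x (p 9)) := fun x hx hn => hS.off _ _ hx fun hq => hn hq.mem.2
  have hout : ¬ (t = p 8 ∨ t = p 9 ∨ t = p 10 ∨ t = s) := by simp [ht, hst]
  have k1 := hoff t t9.symm hout
  have k2 := hS.pass (out 2 (by decide) (by decide) (by decide)) (A 9 2 (by decide))
    (A 2 0 (by decide))
  have k3 := hS.pass (out 0 (by decide) (by decide) (by decide)) (A 2 0 (by decide))
    (A 0 5 (by decide))
  have k4 := hS.pass (out 5 (by decide) (by decide) (by decide)) (A 0 5 (by decide))
    (A 5 6 (by decide))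
  have k5 := hS.pass (out 6 (by decide) (by decide) (by decide)) (A 5 6 (by decide))
    (A 6 11 (by decide))
  have k6 := hS.pass (out 11 (by decide) (by decide) (by decide)) (A 6 11 (by decide)) t11.symm
  have k7 := hS.pass hout t11.symm t9
  rw [k1, ← k7, ← k6, ← k5, ← k4, ← k3, ← k2] at hfan
  exact iff_not_self hfan

theorem Config.isEightDiamond (hT : G.Tri) : IsEightDiamond G (p 0) ![p 1, p 2, p 3, p 4, p 5]
    ![p 8, p 9, p 10, p 6, p 7] (p 11) where
  nodup := by simp [C.injective.eq_iff]
  hub i := by fin_cases i <;> exact C.facial hT _ _ _ (by decide)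
  middle i := by fin_cases i <;> exact C.facial hT _ _ _ (by decide)
  rim i := by fin_cases i <;> exact C.facial hT _ _ _ (by decide)
  top₁ := C.facial hT _ _ _ (by decide)
  top₂ := C.facial hT _ _ _ (by decide)
  top₃ := C.facial hT _ _ _ (by decide)
  internalFive := by
    have key : ∀ i : Fin 12, i.val < 8 → G.InternalFive (p i) := fun i hi =>
      C.internalFive hi (by revert i; decide)
    intro u hu
    simp only [List.mem_cons, List.not_mem_nil, or_false] at hu
    rcases hu with rfl | rfl | rfl | rfl | rfl | rfl | rfl | rfl <;> exact key _ (by decide)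

theorem Config.mem_eightInterior {t : G.V} : t ∈ eightInterior (p 0) ![p 1, p 2, p 3, p 4, p 5]
    ![p 8, p 9, p 10, p 6, p 7] ↔ ∃ i : Fin 12, i.val < 8 ∧ t = p i := by
  simp only [eightInterior, Set.mem_insert_iff, Set.mem_singleton_iff]
  constructor
  · rintro (h | h | h | h | h | h | h | h)
    exacts [⟨0, by decide, h⟩, ⟨1, by decide, h⟩, ⟨2, by decide, h⟩, ⟨3, by decide, h⟩,
      ⟨4, by decide, h⟩, ⟨5, by decide, h⟩, ⟨6, by decide, h⟩, ⟨7, by decide, h⟩]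
  · rintro ⟨i, hi, rfl⟩
    have : ∀ i : Fin 12, i.val < 8 → i = 0 ∨ i = 1 ∨ i = 2 ∨ i = 3 ∨ i = 4 ∨ i = 5 ∨ i = 6 ∨
      i = 7 := by decide
    rcases this i hi with rfl | rfl | rfl | rfl | rfl | rfl | rfl | rfl <;> simp

end Diamond

end Canvas

namespace Canvas

variable {G : Canvas.{u}}

theorem diamond_low : ∀ j : Fin 12, j.val < 8 ∨ j = 8 ∨ j = 9 ∨ j = 10 ∨ j = 11 := by decide

section Diamond

variable {p : Fin 12 → G.V} (C : G.Config diamondNb 8 p)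
include C

/-- Deleting the interior and joining the corner `i₀` to the opposite corner `k` has the same result
as contracting the interior into `i₀`. So no new construction of canvases is needed; `j` and `l` are
the other two corners. -/
theorem Config.diamond_replacement (hT : G.Tri) {H : Canvas.{u}} {f : G.V → H.V}
    (hf : Contr G H f) {B : List (Fin 12)}
    (hfib : ∀ a b, f a = f b ↔ a = b ∨ (a ∈ Img p B ∧ b ∈ Img p B)) (i₀ j k l : Fin 12)
    (hB : ∀ i, i ∈ B ↔ i.val < 8 ∨ i = i₀) (h8 : 8 ≤ i₀.val)
    (hc : ∀ c : Fin 12, c.val < 8 → ∀ a ∈ diamondNb c, ∀ b ∈ diamondNb c, b ∈ diamondNb a →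
      a ∉ B → b ∉ B →
      (a = j ∧ b = k) ∨ (a = k ∧ b = j) ∨ (a = k ∧ b = l) ∨ (a = l ∧ b = k))
    (hjk : ∃ c : Fin 12, c.val < 8 ∧ j ∈ diamondNb c ∧ k ∈ diamondNb j ∧ c ∈ diamondNb k)
    (hkl : ∃ c : Fin 12, c.val < 8 ∧ k ∈ diamondNb c ∧ l ∈ diamondNb k ∧ c ∈ diamondNb l)
    (hjkl : j ∉ B ∧ k ∉ B ∧ l ∉ B) :
    IsReplacement G H (eightInterior (p 0) ![p 1, p 2, p 3, p 4, p 5]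
      ![p 8, p 9, p 10, p 6, p 7]) ∅
      {{f (p i₀), f (p j), f (p k)}, {f (p i₀), f (p k), f (p l)}} f := by
  have hi₀ : p i₀ ∈ Img p B := C.mem_img.2 ((hB _).2 (Or.inr rfl))
  have hlow : ∀ c : Fin 12, c.val < 8 → f (p c) = f (p i₀) := fun c hc =>
    (hfib _ _).2 (Or.inr ⟨C.mem_img.2 ((hB c).2 (Or.inl hc)), hi₀⟩)
  have hinj : ∀ a b, (¬ ∃ i : Fin 12, i.val < 8 ∧ a = p i) →
      (¬ ∃ i : Fin 12, i.val < 8 ∧ b = p i) → f a = f b → a = b := by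
    intro a b ha hb hab
    have key : ∀ a, (¬ ∃ i : Fin 12, i.val < 8 ∧ a = p i) → a ∈ Img p B → a = p i₀ := by
      rintro _ ha ⟨i, hi, rfl⟩
      rcases (hB i).1 hi with h | rfl
      · exact absurd ⟨i, h, rfl⟩ ha
      · rfl
    rcases (hfib _ _).1 hab with h | h
    · exact h
    · rw [key a ha h.1, key b hb h.2]
  have hne : ∀ a b : Fin 12, a ≠ b → b ∉ B → f (p a) ≠ f (p b) := by
    intro a b hab hb h
    rcases (hfib _ _).1 h with h | h
    · exact hab (C.injective h)
    · exact hb (C.mem_img.1 h.2)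
  have hneB : ∀ a b : Fin 12, a ∈ B → b ∉ B → f (p a) ≠ f (p b) := fun a b ha hb =>
    hne a b (fun h => hb (h ▸ ha)) hb
  have hadd : ∀ c a b, (∃ i : Fin 12, i.val < 8 ∧ c = p i) → {c, a, b} ∈ G.facial →
      f c ≠ f a → f b ≠ f c → ({f c, f a, f b} : Set H.V) = {f (p i₀), f (p j), f (p k)} ∨
        ({f c, f a, f b} : Set H.V) = {f (p i₀), f (p k), f (p l)} := by
    rintro _ a b ⟨c, h, rfl⟩ hface h1 h2
    obtain ⟨e1, e2, e3⟩ := facial_adj hface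
    obtain ⟨a, ha, rfl⟩ := C.exists_nbr h e1
    obtain ⟨b, hb, rfl⟩ := C.exists_nbr h e3.symm
    have hnot : ∀ a, f (p c) ≠ f (p a) → a ∉ B := fun a h1 ha =>
      h1 ((hlow c h).trans ((hfib _ _).2 (Or.inr ⟨hi₀, C.mem_img.2 ha⟩)))
    rw [hlow c h]
    rcases hc c h a ha b hb ((C.adj _ _).1 e2) (hnot a h1) (hnot b h2.symm) with
      ⟨rfl, rfl⟩ | ⟨rfl, rfl⟩ | ⟨rfl, rfl⟩ | ⟨rfl, rfl⟩
    · exact Or.inl rfl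
    · exact Or.inl (by rw [Set.pair_comm (f (p a))])
    · exact Or.inr rfl
    · exact Or.inr (by rw [Set.pair_comm (f (p a))])
  refine ⟨?_, ?_, ?_, ?_, hf.outer⟩
  · intro a ha b hb hab
    exact hinj a b (fun h => ha (C.mem_eightInterior.2 h)) (fun h => hb (C.mem_eightInterior.2 h))
      hab
  · rw [Set.compl_empty, Set.eq_univ_iff_forall]
    intro q
    obtain ⟨x, rfl⟩ := hf.surjective q
    by_cases hx : ∃ i : Fin 12, i.val < 8 ∧ x = p i
    · obtain ⟨i, hi, rfl⟩ := hx
      refine ⟨p i₀, fun h => ?_, (hlow i hi).symm⟩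
      obtain ⟨i', hi', h⟩ := C.mem_eightInterior.1 h
      rw [C.injective h] at h8
      exact absurd hi' (not_lt.2 h8)
    · exact ⟨x, fun h => hx (C.mem_eightInterior.1 h), rfl⟩
  · intro a b c ha hb hc h
    rw [C.mem_eightInterior] at ha hb hc
    obtain ⟨n1, n2, n3⟩ := isFace_ne h
    exact (hf.face _ _ _).2 ⟨⟨fun h => n1 (hinj _ _ ha hb h), fun h => n2 (hinj _ _ hb hc h),
      fun h => n3 (hinj _ _ hc ha h)⟩, a, b, c, h, rfl, rfl, rfl⟩
  · ext T
    constructor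
    · rintro ⟨_, _, _, h, rfl⟩
      obtain ⟨⟨n1, n2, n3⟩, a, b, c, hface, rfl, rfl, rfl⟩ := (hf.face _ _ _).1 h
      have hface' := facial_iff.2 (Or.inl hface)
      have hface₁ := facial_iff.2 (Or.inl (isFace_rot hface))
      have hface₂ := facial_iff.2 (Or.inl (isFace_rot (isFace_rot hface)))
      by_cases ha : ∃ i : Fin 12, i.val < 8 ∧ a = p i
      · exact Or.inr (hadd a b c ha hface' n1 n3)
      by_cases hb : ∃ i : Fin 12, i.val < 8 ∧ b = p i
      · right
        have := hadd b c a hb hface₁ n2 n1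
        rwa [Set.pair_comm, Set.insert_comm] at this
      by_cases hc : ∃ i : Fin 12, i.val < 8 ∧ c = p i
      · right
        have := hadd c a b hc hface₂ n3 n2
        rwa [Set.insert_comm, Set.pair_comm (f c)] at this
      left
      refine ⟨{a, b, c}, ⟨hface', ?_⟩, by simp [Set.image_insert_eq]⟩
      rw [Set.disjoint_left]
      rintro x (rfl | rfl | rfl) hx <;> have hx := C.mem_eightInterior.1 hx <;> contradiction
    · have hnew : ∀ a b : Fin 12, a ∉ B → b ∉ B → (∃ c : Fin 12, c.val < 8 ∧ a ∈ diamondNb c ∧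
          b ∈ diamondNb a ∧ c ∈ diamondNb b) → {f (p i₀), f (p a), f (p b)} ∈ H.facial := by
        rintro a b ha hb ⟨c, h, hc⟩
        have hcB := (hB c).2 (Or.inl h)
        have hab : p a ≠ p b := ((C.adj _ _).2 hc.2.1).ne
        rw [← hlow c h]
        exact hf.facial_of (C.facial hT _ _ _ hc) (hneB _ _ hcB ha)
          (hne _ _ (fun h => hab (h ▸ rfl)) hb) (hneB _ _ hcB hb).symm
      rintro (⟨_, ⟨⟨a, b, c, hface, rfl⟩, hdisj⟩, rfl⟩ | rfl | rfl)
      · obtain ⟨n1, n2, n3⟩ := isFace_ne hface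
        have hout : ∀ x ∈ ({a, b, c} : Set G.V), ¬ ∃ i : Fin 12, i.val < 8 ∧ x = p i :=
          fun x hx h => Set.disjoint_left.1 hdisj hx (C.mem_eightInterior.2 h)
        have ha := hout a (by simp)
        have hb := hout b (by simp)
        have hc := hout c (by simp)
        have himg : f '' {a, b, c} = {f a, f b, f c} := by simp [Set.image_insert_eq]
        change f '' {a, b, c} ∈ H.facial
        rw [himg]
        exact hf.facial_of (facial_iff.2 (Or.inl hface)) (fun h => n1 (hinj _ _ ha hb h))
          (fun h => n2 (hinj _ _ hb hc h)) (fun h => n3 (hinj _ _ hc ha h))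
      · exact hnew j k hjkl.1 hjkl.2.1 hjk
      · exact hnew k l hjkl.2.1 hjkl.2.2 hkl

variable {ℓ : ℕ} (hG : G.IsCandidate ℓ)
include hG

set_option synthInstance.maxSize 1000 in
set_option synthInstance.maxHeartbeats 200000 in
/-- The 8-contraction that adds the edge between `p 8` and `p 10`. -/
theorem Config.reducible_of_eight (h8 : G.Internal (p 8) → 7 ≤ G.deg (p 8))
    (h9 : G.Internal (p 9) → 7 ≤ G.deg (p 9)) (h10 : G.Internal (p 10) → 7 ≤ G.deg (p 10))
    (h11 : G.Internal (p 11) → 7 ≤ G.deg (p 11))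
    (hcross : ∀ x, (∀ i, x ≠ p i) → G.graph.Adj x (p 8) → ¬ G.graph.Adj x (p 10)) :
    G.Reducible ℓ := by
  have a0 := C.contrSet_singleton 8
  have a1 := C.absorb hG.tri 1 a0 (by decide)
  have a2 := C.absorb hG.tri 2 a1 (by decide)
  have a3 := C.absorb hG.tri 7 a2 (by decide)
  have a4 := C.absorb hG.tri 0 a3 (by decide)
  have a5 := C.absorb hG.tri 5 a4 (by decide)
  have a6 := C.absorb hG.tri 3 a5 (by decide)
  have a7 := C.absorb hG.tri 4 a6 (by decide)
  obtain ⟨H, f, hf, hfib⟩ := C.absorb hG.tri 6 a7 (by decide)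
  have hrep := C.diamond_replacement hG.tri hf hfib 8 9 10 11 (by decide) (by decide) (by decide)
    (by decide) (by decide) (by decide)
  have hT : H.Tri := by
    refine C.tri hf hfib hG.tri 8 (by decide) (by decide) ?_
    intro x j hx hj x8 xj
    rcases diamond_low j with h | rfl | rfl | rfl | rfl
    · obtain ⟨i, hi⟩ := C.closed j h x xj.symm
      exact absurd hi (hx i)
    · exact absurd (by decide) hj
    · decide
    · exact absurd xj (hcross x hx x8)
    · decide
  refine ⟨H, hf.isCandidate hG.1 hT ?_, Or.inr (Or.inr (Or.inr (Or.inr (Or.inl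
    ⟨_, _, _, _, C.isEightDiamond hG.tri, f, Or.inl ⟨?_, hrep⟩⟩)))),
    hf.card_lt (a := p 0) (b := p 1) (C.injective.ne (by decide))
    ((hfib _ _).2 (Or.inr ⟨C.mem_img.2 (by decide), C.mem_img.2 (by decide)⟩))⟩
  · intro q hq
    obtain ⟨x, rfl⟩ := hf.surjective q
    have hm : G.Internal (p 8) → 5 ≤ H.deg (f (p 8)) := by
      intro hi
      -- The corner `p 8` loses three inner neighbors and gains `p 10`: 7 - 3 + 1 = 5. Each other
      -- corner loses two; for `p 10`, the three lost inner neighbors are offset by the new edge.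
      have := C.deg_merge hf hfib (i := 8) (by decide) [10] (by decide) (by decide)
      have h6 : ((diamondNb 8).filter (· ∈ ([6, 4, 3, 5, 0, 7, 2, 1, 8] : List (Fin 12)))).length
        = 3 := by decide
      rw [h6] at this
      have := h8 hi
      simp at *
      omega
    have hx := hf.internal_of hq
    by_cases hxp : ∀ i, x ≠ p i
    · exact (hG.five_le_deg x hx).trans (C.deg_le_outside hf hfib hxp (by decide))
    push Not at hxp
    obtain ⟨j, rfl⟩ := hxp
    rcases diamond_low j with h | rfl | rfl | rfl | rfl
    · have h0 : f (p j) = f (p 8) := (hfib _ _).2 (Or.inr ⟨C.mem_img.2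
        (by clear hx hq; revert j; decide), C.mem_img.2 (by decide)⟩)
      rw [h0] at hq ⊢
      exact hm (hf.internal_of hq)
    · exact hm hx
    · have := C.deg_le hf hfib (j := 9) [2, 3] (by decide) (by decide)
      have := h9 hx
      simp at *
      omega
    · have := C.deg_le hf hfib (j := 10) [3, 4] (by decide) (by decide)
      have := h10 hx
      simp at *
      omega
    · have := C.deg_le hf hfib (j := 11) [6, 7] (by decide) (by decide)
      have := h11 hx
      simp at *
      omega
  · exact fun h => absurd ((C.adj 8 10).1 h) (by decide)

set_option synthInstance.maxSize 1000 in
set_option synthInstance.maxHeartbeats 200000 in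
/-- The 8-contraction that adds the edge between `p 9` and `p 11`. -/
theorem Config.reducible_of_eight' (h8 : G.Internal (p 8) → 8 ≤ G.deg (p 8))
    (h9 : G.Internal (p 9) → 6 ≤ G.deg (p 9)) (h10 : G.Internal (p 10) → 8 ≤ G.deg (p 10))
    (h11 : G.Internal (p 11) → 6 ≤ G.deg (p 11))
    (hcross : ∀ x, (∀ i, x ≠ p i) → G.graph.Adj x (p 9) → ¬ G.graph.Adj x (p 11)) :
    G.Reducible ℓ := by
  have a0 := C.contrSet_singleton 9
  have a1 := C.absorb hG.tri 2 a0 (by decide)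
  have a2 := C.absorb hG.tri 3 a1 (by decide)
  have a3 := C.absorb hG.tri 0 a2 (by decide)
  have a4 := C.absorb hG.tri 1 a3 (by decide)
  have a5 := C.absorb hG.tri 4 a4 (by decide)
  have a6 := C.absorb hG.tri 5 a5 (by decide)
  have a7 := C.absorb hG.tri 6 a6 (by decide)
  obtain ⟨H, f, hf, hfib⟩ := C.absorb hG.tri 7 a7 (by decide)
  have hrep := C.diamond_replacement hG.tri hf hfib 9 8 11 10 (by decide) (by decide) (by decide)
    (by decide) (by decide) (by decide)
  rw [Set.pair_comm (f (p 8))] at hrep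
  have hT : H.Tri := by
    refine C.tri hf hfib hG.tri 9 (by decide) (by decide) ?_
    intro x j hx hj x9 xj
    rcases diamond_low j with h | rfl | rfl | rfl | rfl
    · obtain ⟨i, hi⟩ := C.closed j h x xj.symm
      exact absurd hi (hx i)
    · decide
    · exact absurd (by decide) hj
    · decide
    · exact absurd xj (hcross x hx x9)
  refine ⟨H, hf.isCandidate hG.1 hT ?_, Or.inr (Or.inr (Or.inr (Or.inr (Or.inl
    ⟨_, _, _, _, C.isEightDiamond hG.tri, f, Or.inr ⟨?_, hrep⟩⟩)))),
    hf.card_lt (a := p 0) (b := p 1) (C.injective.ne (by decide))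
    ((hfib _ _).2 (Or.inr ⟨C.mem_img.2 (by decide), C.mem_img.2 (by decide)⟩))⟩
  · intro q hq
    obtain ⟨x, rfl⟩ := hf.surjective q
    have hm : G.Internal (p 9) → 5 ≤ H.deg (f (p 9)) := by
      intro hi
      -- The ends of the new edge lose two inner neighbors and gain one neighbor, so six suffices
      -- for `p 9` and `p 11`. The corners `p 8` and `p 10` lose three, so they need eight.
      have := C.deg_merge hf hfib (i := 9) (by decide) [11] (by decide) (by decide)
      have h6 : ((diamondNb 9).filter (· ∈ ([7, 6, 5, 4, 1, 0, 3, 2, 9] : List (Fin 12)))).length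
        = 2 := by decide
      rw [h6] at this
      have := h9 hi
      simp at *
      omega
    have hx := hf.internal_of hq
    by_cases hxp : ∀ i, x ≠ p i
    · exact (hG.five_le_deg x hx).trans (C.deg_le_outside hf hfib hxp (by decide))
    push Not at hxp
    obtain ⟨j, rfl⟩ := hxp
    rcases diamond_low j with h | rfl | rfl | rfl | rfl
    · have h0 : f (p j) = f (p 9) := (hfib _ _).2 (Or.inr ⟨C.mem_img.2
        (by clear hx hq; revert j; decide), C.mem_img.2 (by decide)⟩)
      rw [h0] at hq ⊢
      exact hm (hf.internal_of hq)
    · have := C.deg_le hf hfib (j := 8) [1, 2, 7] (by decide) (by decide)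
      have := h8 hx
      simp at *
      omega
    · exact hm hx
    · have := C.deg_le hf hfib (j := 10) [3, 4, 6] (by decide) (by decide)
      have := h10 hx
      simp at *
      omega
    · have := C.deg_le hf hfib (j := 11) [6] (by decide) (by decide)
      have := h11 hx
      simp at *
      omega
  · exact fun h => absurd ((C.adj 9 11).1 h) (by decide)

end Diamond

end Canvas

namespace Canvas

variable {G : Canvas.{u}}

/-! ## The 10-contraction -/

/-- The list of neighbors is cyclic but may run against the rotation. The direction of one face at
`w` determines that of all others, because a face of the opposite direction next to it would violate
`opposite_ne`. -/
theorem hub_or_reverse {w : G.V} {k : Fin 5 → G.V} (hk : Function.Injective k) (hw : G.Internal w)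
    (hnbr : ∀ t, G.graph.Adj w t ↔ ∃ i, t = k i)
    (hadj : ∀ i j, G.graph.Adj (k i) (k j) → j = i + 1 ∨ j = i - 1) :
    Hub G w k ∨ Hub G w (fun i => k (-i)) := by
  have hor : ∀ i, G.IsFace w (k i) (k (i + 1)) ∨ G.IsFace w (k i) (k (i - 1)) := by
    intro i
    obtain ⟨c, hc⟩ := isFace_of_internal ((hnbr _).2 ⟨i, rfl⟩) (Or.inl hw)
    obtain ⟨j, rfl⟩ := (hnbr c).1 (adj_of_isFace (isFace_rot (isFace_rot hc))).symm
    rcases hadj i j (adj_of_isFace (isFace_rot hc)) with rfl | rfl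
    · exact Or.inl hc
    · exact Or.inr hc
  have hnot : ∀ i j, G.IsFace w (k i) (k j) → ¬ G.IsFace w (k j) (k i) := fun i j h h' =>
    opposite_ne (isFace_rot h) (isFace_rot h') rfl
  have hup : ∀ i, G.IsFace w (k i) (k (i + 1)) → G.IsFace w (k (i + 1)) (k (i + 1 + 1)) := by
    intro i h
    refine (hor (i + 1)).resolve_right fun h' => hnot _ _ h ?_
    rwa [add_sub_cancel_right] at h'
  have hdown : ∀ i, G.IsFace w (k i) (k (i - 1)) → G.IsFace w (k (i - 1)) (k (i - 1 - 1)) := by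
    intro i h
    refine (hor (i - 1)).resolve_left fun h' => hnot _ _ h ?_
    rwa [sub_add_cancel] at h'
  rcases hor 0 with h | h
  · left
    refine ⟨hk, hw, hnbr, fun i => ?_⟩
    have h1 := hup _ h
    have h2 := hup _ h1
    have h3 := hup _ h2
    have h4 := hup _ h3
    fin_cases i
    exacts [h, h1, h2, h3, h4]
  · right
    refine ⟨hk.comp neg_injective, hw, fun t => (hnbr t).trans ?_, fun i => ?_⟩
    · exact ⟨fun ⟨i, h⟩ => ⟨-i, by rwa [neg_neg]⟩, fun ⟨i, h⟩ => ⟨-i, h⟩⟩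
    · have h1 := hdown _ h
      have h2 := hdown _ h1
      have h3 := hdown _ h2
      have h4 := hdown _ h3
      fin_cases i
      exacts [h, h1, h2, h3, h4]

/-- When the rim is reversed by `i ↦ -i`, the vertex `bᵢ` between `kᵢ` and `kᵢ₊₁` gets the index `-i
- 1`. -/
theorem wheelTriangles_reverse {V : Type u} (w : V) (b k : Fin 5 → V) :
    wheelTriangles w (fun i => b (-i - 1)) (fun i => k (-i)) = wheelTriangles w b k := by
  have h5 : ∀ i : Fin 5, -(i + 1) - 1 + 1 = -i - 1 ∧ -(i + 1) = -i - 1 ∧ -i - 1 + 1 = -i ∧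
      -(-i - 1) - 1 = i := by decide
  have key : ∀ (b k : Fin 5 → V),
      wheelTriangles w (fun i => b (-i - 1)) (fun i => k (-i)) ⊆ wheelTriangles w b k := by
    rintro b k _ ⟨i, rfl | rfl | rfl⟩ <;> obtain ⟨h1, h2, h3, -⟩ := h5 i
    · exact ⟨-(i + 1) - 1, Or.inl (by rw [h1, Set.pair_comm])⟩
    · exact ⟨-(i + 1) - 1, Or.inr (Or.inl (by dsimp only; rw [h1, h2, Set.insert_comm]))⟩
    · exact ⟨-i - 1, Or.inr (Or.inr (by dsimp only; rw [h3, h2, Set.pair_comm]))⟩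
  refine Set.Subset.antisymm (key b k) ?_
  have := key (fun i => b (-i - 1)) (fun i => k (-i))
  simpa [fun i => (h5 i).2.2.2] using this

section Expansion

variable {H K : Canvas.{u}} {f : G.V → H.V} (hf : Contr G H f) {D : Set G.V}
  (hfib : ∀ a b, f a = f b ↔ a = b ∨ (a ∈ D ∧ b ∈ D)) {d : G.V} (hd : d ∈ D) {k : Fin 5 → H.V}
  (hH : Hub H (f d) k) {ι : H.V ⊕ Fin 5 ≃ K.V} (E : Hub.IsExpansion H (f d) k K ι)
include hf hfib hd hH E

theorem Contr.replacement : IsReplacement G K D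
    {ι (.inl (f d)), ι (.inr 0), ι (.inr 1), ι (.inr 2), ι (.inr 3), ι (.inr 4)}
    (wheelTriangles (ι (.inl (f d))) (fun i => ι (.inr i)) (fun i => ι (.inl (k i))))
    (fun x => ι (.inl (f x))) := by
  have hmem : ∀ x, f x = f d ↔ x ∈ D := fun x => (hfib x d).trans
    ⟨fun h => h.elim (fun h => h ▸ hd) fun h => h.1, fun h => Or.inr ⟨h, hd⟩⟩
  have hW : ∀ i : Fin 5, ι (.inr i) ∈ ({ι (.inl (f d)), ι (.inr 0), ι (.inr 1), ι (.inr 2),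
      ι (.inr 3), ι (.inr 4)} : Set K.V) := by
    intro i
    fin_cases i <;> simp
  refine ⟨?_, ?_, ?_, ?_, ?_⟩
  · intro a ha b hb hab
    exact ((hfib a b).1 (Sum.inl_injective (ι.injective hab))).resolve_right fun h => ha h.1
  · ext q
    obtain ⟨q, rfl⟩ := ι.surjective q
    constructor
    · rintro ⟨x, hx, hxq⟩
      rw [← ι.injective hxq]
      have : f x ≠ f d := fun h => hx ((hmem x).1 h)
      simp [this]
    · intro hq
      rcases q with q | i
      · obtain ⟨x, rfl⟩ := hf.surjective q
        refine ⟨x, fun hx => hq ?_, rfl⟩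
        rw [(hmem x).2 hx]
        exact Or.inl rfl
      · exact absurd (hW i) hq
  · intro a b c ha hb hc h
    obtain ⟨n1, n2, n3⟩ := isFace_ne h
    refine (E.face _ _ _).2 ⟨(hf.face _ _ _).2 ⟨⟨fun h => ?_, fun h => ?_, fun h => ?_⟩,
      a, b, c, h, rfl, rfl, rfl⟩, mt (hmem a).1 ha, mt (hmem b).1 hb, mt (hmem c).1 hc⟩
    · exact ((hfib _ _).1 h).elim n1 fun h => ha h.1
    · exact ((hfib _ _).1 h).elim n2 fun h => hb h.1
    · exact ((hfib _ _).1 h).elim n3 fun h => hc h.1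
  · ext T
    rw [hH.expansion_facial E]
    refine or_congr_left ⟨?_, ?_⟩
    · rintro ⟨_, _, _, h, ha, hb, hc, rfl⟩
      obtain ⟨-, a, b, c, h', rfl, rfl, rfl⟩ := (hf.face _ _ _).1 h
      rw [Ne, hmem] at ha hb hc
      refine ⟨{a, b, c}, ⟨⟨a, b, c, h', rfl⟩, ?_⟩, by simp [Set.image_insert_eq]⟩
      rw [Set.disjoint_left]
      rintro x (rfl | rfl | rfl) <;> assumption
    · rintro ⟨_, ⟨⟨a, b, c, h, rfl⟩, hdisj⟩, rfl⟩
      have hout : ∀ x ∈ ({a, b, c} : Set G.V), x ∉ D := fun x hx => Set.disjoint_left.1 hdisj hx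
      have ha := hout a (by simp)
      have hb := hout b (by simp)
      have hc := hout c (by simp)
      obtain ⟨n1, n2, n3⟩ := isFace_ne h
      refine ⟨f a, f b, f c, (hf.face _ _ _).2 ⟨⟨fun h => ?_, fun h => ?_, fun h => ?_⟩,
        a, b, c, h, rfl, rfl, rfl⟩, mt (hmem a).1 ha, mt (hmem b).1 hb, mt (hmem c).1 hc, ?_⟩
      · exact ((hfib _ _).1 h).elim n1 fun h => ha h.1
      · exact ((hfib _ _).1 h).elim n2 fun h => hb h.1
      · exact ((hfib _ _).1 h).elim n3 fun h => hc h.1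
      · simp [Set.image_insert_eq]
  · intro p q
    obtain ⟨p, rfl⟩ := ι.surjective p
    obtain ⟨q, rfl⟩ := ι.surjective q
    rw [E.outer]
    constructor
    · intro h
      rcases p with p | i
      · rcases q with q | i
        · obtain ⟨a, b, hab, rfl, rfl⟩ := (hf.outer _ _).1 h
          exact ⟨a, b, hab, rfl, rfl⟩
        · exact h.elim
      · exact h.elim
    · rintro ⟨a, b, hab, ha, hb⟩
      rw [← ι.injective ha, ← ι.injective hb]
      exact (hf.outer _ _).2 ⟨a, b, hab, rfl, rfl⟩

end Expansion

theorem IsReplacement.card_lt {H : Canvas.{u}} {D : Set G.V} {W : Set H.V} {N : Set (Set H.V)}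
    {g : G.V → H.V} (h : IsReplacement G H D W N g) (hDW : W.ncard < D.ncard) :
    Nat.card H.V < Nat.card G.V := by
  have h1 := Set.ncard_add_ncard_compl W
  have h2 := Set.ncard_add_ncard_compl D
  have h3 := h.injOn.ncard_image
  rw [h.image] at h3
  omega

/-- The 10-diamond. -/
def tenNb : Fin 15 → List (Fin 15) :=
  ![[1, 2, 3, 4, 5], [0, 5, 7, 8, 2], [0, 1, 8, 9, 3], [0, 2, 9, 14, 4], [0, 3, 14, 6, 5],
    [0, 4, 6, 7, 1], [4, 5, 7, 10, 14], [5, 1, 8, 10, 6], [1, 2, 7, 9, 10, 11, 12],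
    [2, 3, 8, 14, 12, 13], [6, 7, 8, 14, 11], [8, 10, 12], [8, 9, 11, 13], [9, 12, 14],
    [3, 4, 6, 9, 10, 13]]

section Ten

theorem tenNb_low : ∀ i : Fin 15, i ∈ ([6, 7, 5, 4, 1, 0, 3, 2, 9, 8] : List (Fin 15)) ↔
    i.val < 10 := by decide

theorem tenNb_cycle : ∀ i : Fin 15, i.val < 10 ∨ ∃ j : Fin 5, i = ![10, 11, 12, 13, 14] j := by
  decide

variable {q : Fin 15 → G.V} (C : G.Config tenNb 10 q)
include C

theorem Config.diamond_of_ten :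
    G.Config diamondNb 8 (q ∘ ![0, 1, 2, 3, 4, 5, 6, 7, 8, 9, 14, 10]) where
  injective := C.injective.comp (by decide)
  adj i j := (C.adj _ _).trans (by revert i j; decide)
  closed i hi t ht := by
    have hlt : ∀ i : Fin 12, i.val < 8 → ((![0, 1, 2, 3, 4, 5, 6, 7, 8, 9, 14, 10] :
      Fin 12 → Fin 15) i).val < 10 := by decide
    obtain ⟨j, hj, rfl⟩ := C.exists_nbr (hlt i hi) ht
    have : ∀ i : Fin 12, i.val < 8 → ∀ j ∈ tenNb ((![0, 1, 2, 3, 4, 5, 6, 7, 8, 9, 14, 10] :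
      Fin 12 → Fin 15) i), ∃ k : Fin 12, j = (![0, 1, 2, 3, 4, 5, 6, 7, 8, 9, 14, 10] :
      Fin 12 → Fin 15) k := by decide
    obtain ⟨k, rfl⟩ := this i hi j hj
    exact ⟨k, rfl⟩
  internal i hi := C.internal _ (by revert i; decide)

theorem Config.mem_tenInterior {t : G.V} : t ∈ eightInterior (q 0) ![q 1, q 2, q 3, q 4, q 5]
    ![q 8, q 9, q 14, q 6, q 7] ∪ {q 8, q 9} ↔
      t ∈ Img q [6, 7, 5, 4, 1, 0, 3, 2, 9, 8] := by
  simp only [eightInterior, Img, Set.mem_union, Set.mem_insert_iff, Set.mem_singleton_iff,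
    Set.mem_image, Set.mem_ofPred_eq, List.mem_cons, List.not_mem_nil, or_false,
    exists_eq_or_imp, exists_eq_left, Matrix.cons_val, eq_comm (a := t)]
  tauto

theorem Config.isTenDiamond (hT : G.Tri) : IsTenDiamond G (q 0) ![q 1, q 2, q 3, q 4, q 5]
    ![q 8, q 9, q 14, q 6, q 7] (q 10) ![q 11, q 12, q 13] where
  toIsEightDiamond := C.diamond_of_ten.isEightDiamond hT
  nodup_ten := by simp [C.injective.eq_iff]
  side₁ := C.facial hT _ _ _ (by decide)
  side₂ := C.facial hT _ _ _ (by decide)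
  side₃ := C.facial hT _ _ _ (by decide)
  side₄ := C.facial hT _ _ _ (by decide)
  side₅ := C.facial hT _ _ _ (by decide)
  internal₀ := C.internal 8 (by decide)
  deg₀ := C.deg_eq (by decide) (by decide)
  internal₁ := C.internal 9 (by decide)
  deg₁ := C.deg_eq (by decide) (by decide)

set_option synthInstance.maxSize 1000 in
set_option synthInstance.maxHeartbeats 200000 in
theorem Config.ten_contr (hT : G.Tri) :
    ∃ (H : Canvas.{u}) (f : G.V → H.V), Contr G H f ∧
      (∀ a b, f a = f b ↔ a = b ∨ (a ∈ Img q [6, 7, 5, 4, 1, 0, 3, 2, 9, 8] ∧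
        b ∈ Img q [6, 7, 5, 4, 1, 0, 3, 2, 9, 8])) ∧ H.Tri := by
  have a0 := C.contrSet_singleton 8
  have a1 := C.absorb hT 9 a0 (by decide)
  have a2 := C.absorb hT 2 a1 (by decide)
  have a3 := C.absorb hT 3 a2 (by decide)
  have a4 := C.absorb hT 0 a3 (by decide)
  have a5 := C.absorb hT 1 a4 (by decide)
  have a6 := C.absorb hT 4 a5 (by decide)
  have a7 := C.absorb hT 5 a6 (by decide)
  have a8 := C.absorb hT 7 a7 (by decide)
  obtain ⟨H, f, hf, hfib⟩ := C.absorb hT 6 a8 (by decide)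
  refine ⟨H, f, hf, hfib, C.tri hf hfib hT 0 (by decide) (by decide) ?_⟩
  intro x j hx _ h0 _
  obtain ⟨i, hi⟩ := C.closed 0 (by decide) x h0.symm
  exact absurd hi (hx i)

end Ten

end Canvas

namespace Canvas

variable {G : Canvas.{u}}

section Ten

variable {q : Fin 15 → G.V} (C : G.Config tenNb 10 q) {ℓ : ℕ} (hG : G.IsCandidate ℓ)
include C hG

/-- The 10-contraction. -/
theorem Config.reducible_of_ten (h10 : G.Internal (q 10) → 6 ≤ G.deg (q 10))
    (h14 : G.Internal (q 14) → 7 ≤ G.deg (q 14)) : G.Reducible ℓ := by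
  obtain ⟨H, f, hf, hfib, hT⟩ := C.ten_contr hG.tri
  set B : List (Fin 15) := [6, 7, 5, 4, 1, 0, 3, 2, 9, 8] with hB
  have h0 : (0 : Fin 15) ∈ B := by decide
  have hmem : ∀ x, f x = f (q 0) ↔ x ∈ Img q B := fun x => (hfib x (q 0)).trans
    ⟨fun h => h.elim (fun h => h ▸ C.mem_img.2 h0) fun h => h.1,
      fun h => Or.inr ⟨h, C.mem_img.2 h0⟩⟩
  let r : Fin 5 → Fin 15 := ![10, 11, 12, 13, 14]
  have hr : ∀ j, r j ∉ B := by decide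
  have hrinj : Function.Injective r := by decide
  have huniq : ∀ j y, f y = f (q (r j)) → y = q (r j) := by
    intro j y h
    exact ((hfib _ _).1 h).resolve_right fun h => hr j (C.mem_img.1 h.2)
  have hk : Function.Injective fun j => f (q (r j)) := fun i j h =>
    hrinj (C.injective (huniq j _ h))
  have hint : H.Internal (f (q 0)) := by
    intro h
    obtain ⟨a, ha, h⟩ := (hf.external_iff _).1 h
    obtain ⟨i, hi, rfl⟩ := (hmem a).1 h
    exact C.internal i ((tenNb_low i).1 hi) ha
  have hnbr : ∀ t, H.graph.Adj (f (q 0)) t ↔ ∃ j, t = f (q (r j)) := by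
    intro t
    constructor
    · intro h
      obtain ⟨hne, a, b, hab, ha, rfl⟩ := (hf.adj _ _).1 h
      obtain ⟨i, hi, rfl⟩ := (hmem a).1 ha
      obtain ⟨j, rfl⟩ := C.closed i ((tenNb_low i).1 hi) b hab
      rcases tenNb_cycle j with hj | ⟨k, rfl⟩
      · exact absurd ((hmem _).2 (C.mem_img.2 ((tenNb_low j).2 hj))).symm hne
      · exact ⟨k, rfl⟩
    · rintro ⟨j, rfl⟩
      obtain ⟨i, hi, hij⟩ : ∃ i ∈ B, r j ∈ tenNb i := by
        have : ∀ j, ∃ i ∈ B, r j ∈ tenNb i := by decide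
        exact this j
      rw [← (hmem _).2 (C.mem_img.2 hi)]
      refine hf.adj_of ((C.adj _ _).2 hij) fun h => hr j ?_
      rw [(hmem _).2 (C.mem_img.2 hi)] at h
      exact C.mem_img.1 ((hmem _).1 h.symm)
  have hadj : ∀ i j, H.graph.Adj (f (q (r i))) (f (q (r j))) → j = i + 1 ∨ j = i - 1 := by
    intro i j h
    have : ∀ i j, r j ∈ tenNb (r i) → j = i + 1 ∨ j = i - 1 := by decide
    exact this i j ((C.adj _ _).1 (hf.adj_of_unique h (huniq i) (huniq j)))
  -- Degree four suffices here, since the wheel gives one back to each vertex of the 5-cycle. The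
  -- lists name the redundant inner neighbors: two at `q 10`, one at `q 12`, three at `q 14`.
  have hdeg : ∀ j, G.Internal (q (r j)) → 4 ≤ H.deg (f (q (r j))) := by
    intro j hj
    have h5 := hG.five_le_deg _ hj
    have := C.deg_le hf hfib (j := r j) ((![[6, 7], [], [8], [], [3, 4, 6]] :
      Fin 5 → List (Fin 15)) j) (hr j) (by clear h5 hj; revert j; decide)
    fin_cases j
    · have := h10 hj
      simp [r] at *
      omega
    · simp [r] at *
      omega
    · simp [r] at *
      omega
    · simp [r] at *
      omega
    · have := h14 hj
      simp [r] at *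
      omega
  have hmain : ∀ k, Hub H (f (q 0)) k → (∀ i, ∃ j, k i = f (q (r j))) →
      ∃ (K : Canvas.{u}) (ι : H.V ⊕ Fin 5 ≃ K.V), Hub.IsExpansion H (f (q 0)) k K ι ∧
        K.IsCandidate ℓ := by
    intro k hH hkr
    obtain ⟨K, ι, E⟩ := hH.exists_expansion
    refine ⟨K, ι, E, ?_, hH.expansion_tri E hT, ?_⟩
    · rw [hH.expansion_faceLength_outer E, hf.faceLength_outer]
      exact hG.1
    · intro v hv
      obtain ⟨y | i, rfl⟩ := ι.surjective v
      · have hy : H.Internal y := fun h => hv ((hH.expansion_external E y).2 h)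
        by_cases hyw : y = f (q 0)
        · rw [hyw]
          exact hH.five_le_deg_hub E
        by_cases hyk : ∃ i, y = k i
        · obtain ⟨i, rfl⟩ := hyk
          refine le_trans ?_ (hH.expansion_deg_rim E i)
          obtain ⟨j, hj⟩ := hkr i
          rw [hj] at hy ⊢
          exact Nat.succ_le_succ (hdeg j (hf.internal_of hy))
        · push Not at hyk
          refine le_trans ?_ (hH.expansion_deg_le E y hyw hyk)
          obtain ⟨x, rfl⟩ := hf.surjective y
          refine (hG.five_le_deg x (hf.internal_of hy)).trans
            (C.deg_le_outside hf hfib (fun i hi => ?_) (by decide))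
          subst hi
          rcases tenNb_cycle i with hi | ⟨j, rfl⟩
          · exact hyw ((hmem _).2 (C.mem_img.2 ((tenNb_low i).2 hi)))
          · obtain ⟨l, hl⟩ := (hH.nbr _).1 ((hnbr _).2 ⟨j, rfl⟩)
            exact hyk l hl
      · exact hH.five_le_deg_inr E i
  have hfin : ∀ (K : Canvas.{u}) (g : G.V → K.V) (w : K.V) (b : Fin 5 → K.V),
      [w, b 0, b 1, b 2, b 3, b 4].Nodup → K.IsCandidate ℓ →
      IsReplacement G K (Img q B) {w, b 0, b 1, b 2, b 3, b 4}
        (wheelTriangles w b (fun j => g (q (r j)))) g → G.Reducible ℓ := by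
    intro K g w b hb hK hrep
    refine ⟨K, hK, Or.inr (Or.inr (Or.inr (Or.inr (Or.inr ⟨_, _, _, _, _,
      C.isTenDiamond hG.tri, g, w, b, hb, ?_⟩)))), hrep.card_lt ?_⟩
    · have e1 : eightInterior (q 0) ![q 1, q 2, q 3, q 4, q 5] ![q 8, q 9, q 14, q 6, q 7] ∪
          {q 8, q 9} = Img q B := Set.ext fun t => C.mem_tenInterior
      have e2 : (fun j => g (q (r j))) = ![g (q 10), g (q 11), g (q 12), g (q 13), g (q 14)] := by
        funext j
        fin_cases j <;> rfl
      rw [e2, ← e1] at hrep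
      exact hrep
    · have h1 : ({w, b 0, b 1, b 2, b 3, b 4} : Set K.V).ncard ≤ 6 := by
        refine (Set.ncard_insert_le _ _).trans (Nat.succ_le_succ ?_)
        refine (Set.ncard_insert_le _ _).trans (Nat.succ_le_succ ?_)
        refine (Set.ncard_insert_le _ _).trans (Nat.succ_le_succ ?_)
        refine (Set.ncard_insert_le _ _).trans (Nat.succ_le_succ ?_)
        refine (Set.ncard_insert_le _ _).trans (Nat.succ_le_succ ?_)
        exact (Set.ncard_singleton _).le
      have h2 : (Img q B).ncard = 10 := by
        classical
        rw [Img, Set.ncard_image_of_injective _ C.injective]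
        have : {i | i ∈ B} = ((B.toFinset : Finset (Fin 15)) : Set (Fin 15)) := by
          ext i
          simp
        rw [this, Set.ncard_coe_finset]
        decide
      omega
  have hnodup : ∀ (K : Canvas.{u}) (ι : H.V ⊕ Fin 5 ≃ K.V) (σ : Fin 5 → Fin 5),
      Function.Injective σ → [ι (.inl (f (q 0))), ι (.inr (σ 0)), ι (.inr (σ 1)), ι (.inr (σ 2)),
        ι (.inr (σ 3)), ι (.inr (σ 4))].Nodup := by
    intro K ι σ hσ
    simp [hσ.eq_iff]
  rcases hub_or_reverse hk hint hnbr hadj with hH | hH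
  · obtain ⟨K, ι, E, hK⟩ := hmain _ hH fun i => ⟨i, rfl⟩
    exact hfin K (fun x => ι (.inl (f x))) _ (fun i => ι (.inr i))
      (hnodup K ι id Function.injective_id) hK
      (hf.replacement hfib (C.mem_img.2 h0) hH E)
  · obtain ⟨K, ι, E, hK⟩ := hmain _ hH fun i => ⟨-i, rfl⟩
    refine hfin K (fun x => ι (.inl (f x))) (ι (.inl (f (q 0)))) (fun i => ι (.inr (-i - 1)))
      (hnodup K ι (fun i => -i - 1) (by decide)) hK ?_
    have hrep := hf.replacement hfib (C.mem_img.2 h0) hH E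
    have e := wheelTriangles_reverse (ι (.inl (f (q 0)))) (fun i => ι (.inr (-i - 1)))
      (fun j => ι (.inl (f (q (r j)))))
    have e5 : ∀ i : Fin 5, -(-i - 1) - 1 = i := by decide
    simp only [e5] at e
    rw [e] at hrep
    convert hrep using 1
    ext t
    have : (0 : Fin 5) - 1 = 4 ∧ -(1 : Fin 5) - 1 = 3 ∧ -(2 : Fin 5) - 1 = 2 ∧
      -(3 : Fin 5) - 1 = 1 ∧ -(4 : Fin 5) - 1 = 0 ∧ -(0 : Fin 5) - 1 = 4 := by decide
    simp only [this, Set.mem_insert_iff, Set.mem_singleton_iff]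
    tauto

end Ten

end Canvas

/-! ### Excluding the 8-diamond -/

namespace Canvas

variable {G : Canvas.{u}}

section Diamond

variable {p : Fin 12 → G.V} (C : G.Config diamondNb 8 p)

include C in
/-- The reflection of the 8-diamond in the diagonal from `p 9` to `p 11`. -/
theorem Config.diamond_reflect :
    G.Config diamondNb 8 (p ∘ ![0, 4, 3, 2, 1, 5, 7, 6, 10, 9, 8, 11]) :=
  C.perm _ (by decide) (by decide) (by decide)

include C in
/-- The reflection of the 8-diamond in the diagonal from `p 8` to `p 10`. -/
theorem Config.diamond_reflect' :
    G.Config diamondNb 8 (p ∘ ![5, 1, 7, 6, 4, 0, 3, 2, 8, 11, 10, 9]) :=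
  C.perm _ (by decide) (by decide) (by decide)

variable {ℓ : ℕ} (hG : G.IsCandidate ℓ) (hR : ¬ G.Reducible ℓ)
include C hG hR

theorem Config.diamond_fan {L : List (Fin 12)} (i : Fin 12) (hL : L.Nodup)
    (h : ∀ j ∈ L, j.val < 8 ∧ j ∈ diamondNb i) :
    (L.map p).Nodup ∧ ∀ x ∈ L.map p, (∃ i : Fin 12, i.val < 8 ∧ x = p i) ∧ G.graph.Adj (p i) x := by
  refine ⟨hL.map C.injective, fun x hx => ?_⟩
  obtain ⟨j, hj, rfl⟩ := List.mem_map.1 hx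
  exact ⟨⟨j, (h j hj).1, rfl⟩, (C.adj _ _).2 (h j hj).2⟩

theorem Config.diamond_deg :
    (G.Internal (p 8) → 7 ≤ G.deg (p 8)) ∧ (G.Internal (p 9) → 6 ≤ G.deg (p 9)) ∧
    (G.Internal (p 10) → 7 ≤ G.deg (p 10)) ∧ (G.Internal (p 11) → 6 ≤ G.deg (p 11)) := by
  have h := C.diamond_disk
  obtain ⟨l1, m1⟩ := C.diamond_fan hG hR (L := [1, 2, 7]) 8 (by decide) (by decide)
  obtain ⟨l2, m2⟩ := C.diamond_fan hG hR (L := [2, 3]) 9 (by decide) (by decide)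
  obtain ⟨l3, m3⟩ := C.diamond_fan hG hR (L := [3, 4, 6]) 10 (by decide) (by decide)
  obtain ⟨l4, m4⟩ := C.diamond_fan hG hR (L := [6, 7]) 11 (by decide) (by decide)
  exact ⟨fun hi => h.deg_ge hG hR hi l1 m1, fun hi => h.rot.deg_ge hG hR hi l2 m2,
    fun hi => h.rot.rot.deg_ge hG hR hi l3 m3, fun hi => h.rot.rot.rot.deg_ge hG hR hi l4 m4⟩

/-- The least degrees at `p 8` and `p 9` leave no room for further neighbors, so all outside
neighbors are outer common neighbors of boundary edges. They form the path `a b' c` that completes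
the 10-diamond. -/
theorem Config.exists_ten (h8 : G.Internal (p 8)) (d8 : G.deg (p 8) ≤ 7) (h9 : G.Internal (p 9))
    (d9 : G.deg (p 9) ≤ 6) : ∃ q, G.Config tenNb 10 q ∧ q 10 = p 11 ∧ q 14 = p 10 := by
  have h := C.diamond_disk
  obtain ⟨l1, m1⟩ := C.diamond_fan hG hR (L := [1, 2, 7]) 8 (by decide) (by decide)
  obtain ⟨l2, m2⟩ := C.diamond_fan hG hR (L := [2, 3]) 9 (by decide) (by decide)
  obtain ⟨b, a, hab, hb, ha, b8, b9, a8, a11, all8⟩ := h.exists_pair_of_deg hG hR h8 l1 m1 d8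
  obtain ⟨c, b', hcb, hc, hb', c9, c10, b'9, b'8, all9⟩ :=
    h.rot.exists_pair_of_deg hG hR h9 l2 m2 d9
  have hc := Disk.outside_rot (Disk.outside_rot (Disk.outside_rot hc))
  have hb' := Disk.outside_rot (Disk.outside_rot (Disk.outside_rot hb'))
  have oa := C.outside_of ha
  have ob := C.outside_of hb
  have oc := C.outside_of hc
  have ob' := C.outside_of hb'
  have A : ∀ i j : Fin 12, j ∈ diamondNb i → G.graph.Adj (p i) (p j) := fun i j h =>
    (C.adj _ _).2 h
  have far : ∀ x, (∀ i, x ≠ p i) → ∀ i : Fin 12, i.val < 8 → ¬ G.graph.Adj (p i) x := by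
    intro x hx i hi hadj
    obtain ⟨j, hj⟩ := C.closed i hi x hadj
    exact hx j hj
  have three1 : ∀ x, (∀ i, x ≠ p i) → G.graph.Adj x (p 11) → G.graph.Adj x (p 8) →
      ¬ G.graph.Adj x (p 9) := fun x hx h1 h2 h3 =>
    hR (h.reducible_of_three hG (C.diamond_outside hx) h1 h2 h3)
  have three2 : ∀ x, (∀ i, x ≠ p i) → G.graph.Adj x (p 8) → G.graph.Adj x (p 9) →
      ¬ G.graph.Adj x (p 10) := fun x hx h1 h2 h3 =>
    hR (h.rot.reducible_of_three hG (Disk.outside_rot (C.diamond_outside hx)) h1 h2 h3)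
  have three3 : ∀ x, (∀ i, x ≠ p i) → G.graph.Adj x (p 9) → G.graph.Adj x (p 10) →
      ¬ G.graph.Adj x (p 11) := fun x hx h1 h2 h3 =>
    hR (h.rot.rot.reducible_of_three hG (Disk.outside_rot (Disk.outside_rot (C.diamond_outside hx))) h1 h2 h3)
  have three4 : ∀ x, (∀ i, x ≠ p i) → G.graph.Adj x (p 10) → G.graph.Adj x (p 11) →
      ¬ G.graph.Adj x (p 8) := fun x hx h1 h2 h3 =>
    hR (h.rot.rot.rot.reducible_of_three hG
      (Disk.outside_rot (Disk.outside_rot (Disk.outside_rot (C.diamond_outside hx)))) h1 h2 h3)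
  -- The edge between `p 8` and `p 9` has only two common neighbors, and `p 2` is one of them.
  have hbb : b' = b := by
    obtain ⟨x, y, -, hxy⟩ := exists_common hG.tri h8 (A 9 8 (by decide))
    have e1 := (hxy _).1 ⟨b9, b8⟩
    have e2 := (hxy _).1 ⟨b'9, b'8⟩
    have e3 := (hxy _).1 ⟨A 2 9 (by decide), A 2 8 (by decide)⟩
    have := ob 2
    have := ob' 2
    clear all8 all9
    grind
  subst hbb
  have hac : a ≠ c := by
    rintro rfl
    exact three1 a oa a11 a8 c9
  have hnbr : ∀ x y s : G.V, G.Internal x → G.graph.Adj y x → G.graph.Adj s x → G.graph.Adj s y →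
      ∃ t, t ≠ s ∧ G.graph.Adj t x ∧ G.graph.Adj t y := by
    intro x y s hx hxy h1 h2
    obtain ⟨u, v, huv, h⟩ := exists_common hG.tri hx hxy
    have hu := (h u).2 (Or.inl rfl)
    have hv := (h v).2 (Or.inr rfl)
    rcases (h s).1 ⟨h2, h1⟩ with rfl | rfl
    · exact ⟨v, huv.symm, hv.2, hv.1⟩
    · exact ⟨u, huv, hu.2, hu.1⟩
  -- The edge from `b'` to `p 8` has a second common neighbor besides `p 9`. Among the known
  -- neighbors of `p 8`, only `a` is possible.
  have hba : G.graph.Adj b' a := by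
    obtain ⟨t, ht, t8, tb⟩ := hnbr (p 8) b' (p 9) h8 b8 (A 9 8 (by decide)) b9.symm
    rcases all8 t t8.symm with hL | rfl | rfl | rfl | rfl
    · simp only [List.mem_map, List.mem_cons, List.not_mem_nil, or_false] at hL
      obtain ⟨i, rfl | rfl | rfl, rfl⟩ := hL <;> exact absurd tb (far _ ob _ (by decide))
    · exact absurd rfl ht
    · exact absurd b9 (three1 _ ob tb.symm b8)
    · exact absurd tb (SimpleGraph.irrefl _)
    · exact tb.symm
  have hbc : G.graph.Adj b' c := by
    obtain ⟨t, ht, t9, tb⟩ := hnbr (p 9) b' (p 8) h9 b9 (A 8 9 (by decide)) b8.symm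
    rcases all9 t t9.symm with hL | rfl | rfl | rfl | rfl
    · simp only [List.mem_map, List.mem_cons, List.not_mem_nil, or_false] at hL
      obtain ⟨i, rfl | rfl, rfl⟩ := hL <;> exact absurd tb (far _ ob _ (by decide))
    · exact absurd tb.symm (three2 _ ob b8 b9)
    · exact absurd rfl ht
    · exact tb.symm
    · exact absurd tb (SimpleGraph.irrefl _)
  have na10 : ¬ G.graph.Adj a (p 10) := fun h => three4 _ oa h a11 a8
  have nb10 := three2 _ ob b8 b9
  have nb11 : ¬ G.graph.Adj b' (p 11) := fun h => three1 _ ob h b8 b9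
  have nc11 := three3 _ oc c9 c10
  -- An edge `ac` would close the 4-cycle `a`, `p 8`, `p 9`, `c` around `b'`.
  have nac : ¬ G.graph.Adj a c := fun h =>
    not_closed_four hG hba b8 b9 hbc a8 (A 8 9 (by decide)) c9.symm h.symm (oa 9) (oc 8).symm
  refine ⟨![p 0, p 1, p 2, p 3, p 4, p 5, p 6, p 7, p 8, p 9, p 11, a, b', c, p 10], ?_, rfl, rfl⟩
  set q : Fin 15 → G.V :=
    ![p 0, p 1, p 2, p 3, p 4, p 5, p 6, p 7, p 8, p 9, p 11, a, b', c, p 10] with hq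
  let r : Fin 12 → Fin 15 := ![0, 1, 2, 3, 4, 5, 6, 7, 8, 9, 14, 10]
  have hqr : ∀ j, p j = q (r j) := by
    intro j
    fin_cases j <;> rfl
  refine Config.of_nbr ?_ (by decide) ?_ ?_
  · rw [← List.nodup_ofFn]
    have oa' := fun i => (oa i).symm
    have ob' := fun i => (ob i).symm
    have oc' := fun i => (oc i).symm
    simp [hq, C.injective.eq_iff, oa, ob, oc, oa', ob', oc', hab.symm, hcb.symm, hac]
  · have hlow : ∀ i : Fin 15, i.val < 10 → i = 8 ∨ i = 9 ∨ ∃ k : Fin 12, k.val < 8 ∧ i = r k := by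
      decide
    have h1 : ∀ i : Fin 12, i.val < 8 → ∀ j ∈ diamondNb i, r j ∈ tenNb (r i) := by decide
    have h2 : ∀ i : Fin 12, i.val < 8 → ∀ j ∈ tenNb (r i), ∃ k ∈ diamondNb i, j = r k := by decide
    intro i hi
    rcases hlow i hi with rfl | rfl | ⟨i, hi', rfl⟩
    · refine ⟨h8, fun t => ⟨fun ht => ?_, ?_⟩⟩
      · rcases all8 t ht with hL | rfl | rfl | rfl | rfl
        · simp only [List.mem_map, List.mem_cons, List.not_mem_nil, or_false] at hL
          obtain ⟨i, rfl | rfl | rfl, rfl⟩ := hL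
          exacts [⟨1, by decide, rfl⟩, ⟨2, by decide, rfl⟩, ⟨7, by decide, rfl⟩]
        exacts [⟨9, by decide, rfl⟩, ⟨10, by decide, rfl⟩, ⟨12, by decide, rfl⟩,
          ⟨11, by decide, rfl⟩]
      · rintro ⟨j, hj, rfl⟩
        have : ∀ j ∈ tenNb 8, j = 11 ∨ j = 12 ∨ ∃ k ∈ diamondNb 8, j = r k := by decide
        rcases this j hj with rfl | rfl | ⟨k, hk, rfl⟩
        · exact a8.symm
        · exact b8.symm
        · rw [← hqr]
          exact A 8 k hk
    · refine ⟨h9, fun t => ⟨fun ht => ?_, ?_⟩⟩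
      · rcases all9 t ht with hL | rfl | rfl | rfl | rfl
        · simp only [List.mem_map, List.mem_cons, List.not_mem_nil, or_false] at hL
          obtain ⟨i, rfl | rfl, rfl⟩ := hL
          exacts [⟨2, by decide, rfl⟩, ⟨3, by decide, rfl⟩]
        exacts [⟨14, by decide, rfl⟩, ⟨8, by decide, rfl⟩, ⟨13, by decide, rfl⟩,
          ⟨12, by decide, rfl⟩]
      · rintro ⟨j, hj, rfl⟩
        have : ∀ j ∈ tenNb 9, j = 12 ∨ j = 13 ∨ ∃ k ∈ diamondNb 9, j = r k := by decide
        rcases this j hj with rfl | rfl | ⟨k, hk, rfl⟩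
        · exact b9.symm
        · exact c9.symm
        · rw [← hqr]
          exact A 9 k hk
    · rw [← hqr]
      refine ⟨C.internal i hi', fun t => ⟨fun ht => ?_, ?_⟩⟩
      · obtain ⟨j, hj, rfl⟩ := C.exists_nbr hi' ht
        exact ⟨r j, h1 i hi' j hj, hqr j⟩
      · rintro ⟨j, hj, rfl⟩
        obtain ⟨j, hj', rfl⟩ := h2 i hi' j hj
        rw [← hqr]
        exact A i j hj'
  · have key : ∀ x y : Fin 15, (G.graph.Adj (q x) (q y) ↔ y ∈ tenNb x) →
        (G.graph.Adj (q y) (q x) ↔ x ∈ tenNb y) := by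
      intro x y h
      have : ∀ x y : Fin 15, y ∈ tenNb x ↔ x ∈ tenNb y := by decide
      rw [SimpleGraph.adj_comm, h, this]
    have pos : ∀ x y : Fin 15, G.graph.Adj (q x) (q y) → y ∈ tenNb x →
        (G.graph.Adj (q x) (q y) ↔ y ∈ tenNb x) := fun x y h h' => iff_of_true h h'
    have neg : ∀ x y : Fin 15, ¬ G.graph.Adj (q x) (q y) → y ∉ tenNb x →
        (G.graph.Adj (q x) (q y) ↔ y ∈ tenNb x) := fun x y h h' => iff_of_false h h'
    have loop : ∀ x : Fin 15, G.graph.Adj (q x) (q x) ↔ x ∈ tenNb x := fun x =>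
      neg x x (SimpleGraph.irrefl _) (by revert x; decide)
    have e1 := pos 11 10 a11 (by decide)
    have e2 := neg 12 10 nb11 (by decide)
    have e3 := neg 13 10 nc11 (by decide)
    have e4 := pos 10 14 (A 11 10 (by decide)) (by decide)
    have e5 := pos 12 11 hba (by decide)
    have e6 := neg 11 13 nac (by decide)
    have e7 := neg 11 14 na10 (by decide)
    have e8 := pos 12 13 hbc (by decide)
    have e9 := neg 12 14 nb10 (by decide)
    have e10 := pos 13 14 c10 (by decide)
    have high : ∀ i : Fin 15, 10 ≤ i.val → i = 10 ∨ i = 11 ∨ i = 12 ∨ i = 13 ∨ i = 14 := by decide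
    intro i j hi hj
    rcases high i hi with rfl | rfl | rfl | rfl | rfl <;>
      rcases high j hj with rfl | rfl | rfl | rfl | rfl <;>
      first
      | exact loop _
      | assumption
      | (apply key; assumption)

theorem Config.reducible_of_seven_six (h8 : G.Internal (p 8)) (d8 : G.deg (p 8) ≤ 7)
    (h9 : G.Internal (p 9)) (d9 : G.deg (p 9) ≤ 6) : False := by
  obtain ⟨q, hq, h10, h14⟩ := C.exists_ten hG hR h8 d8 h9 d9
  obtain ⟨-, -, k10, k11⟩ := C.diamond_deg hG hR
  exact hR (hq.reducible_of_ten hG (h10 ▸ k11) (h14 ▸ k10))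

theorem Config.not_diamond : False := by
  have h := C.diamond_disk
  obtain ⟨l1, m1⟩ := C.diamond_fan hG hR (L := [1, 2, 7]) 8 (by decide) (by decide)
  obtain ⟨l2, m2⟩ := C.diamond_fan hG hR (L := [2, 3]) 9 (by decide) (by decide)
  obtain ⟨l3, m3⟩ := C.diamond_fan hG hR (L := [3, 4, 6]) 10 (by decide) (by decide)
  obtain ⟨l4, m4⟩ := C.diamond_fan hG hR (L := [6, 7]) 11 (by decide) (by decide)
  obtain ⟨k8, k9, k10, k11⟩ := C.diamond_deg hG hR
  -- If `p 9` or `p 11` attains degree six, an internal neighbor of degree seven on the boundary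
  -- would give a 10-contraction. So the edge between `p 9` and `p 11` can be added, and the least
  -- degree excludes an outside common neighbor.
  by_cases hsmall : (G.Internal (p 9) ∧ G.deg (p 9) ≤ 6) ∨ (G.Internal (p 11) ∧ G.deg (p 11) ≤ 6)
  · refine hR (C.reducible_of_eight' hG (fun hi => ?_) k9 (fun hi => ?_) k11 fun x hx x9 x11 => ?_)
    · by_contra hd
      rcases hsmall with hs | hs
      · exact C.reducible_of_seven_six hG hR hi (by omega) hs.1 hs.2
      · exact C.diamond_reflect'.reducible_of_seven_six hG hR hi
          (show G.deg (p 8) ≤ 7 by omega) hs.1 hs.2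
    · by_contra hd
      rcases hsmall with hs | hs
      · exact C.diamond_reflect.reducible_of_seven_six hG hR hi
          (show G.deg (p 10) ≤ 7 by omega) hs.1 hs.2
      · exact C.diamond_reflect'.diamond_reflect.reducible_of_seven_six hG hR hi
          (show G.deg (p 10) ≤ 7 by omega) hs.1 hs.2
    · rcases hsmall with hs | hs
      · exact h.rot.not_opposite hG hR hs.1 l2 m2 hs.2
          (Disk.outside_rot (C.diamond_outside hx)) x9 x11
      · exact h.rot.rot.rot.not_opposite hG hR hs.1 l4 m4 hs.2
          (Disk.outside_rot (Disk.outside_rot (Disk.outside_rot (C.diamond_outside hx)))) x11 x9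
  · have k9' : G.Internal (p 9) → 7 ≤ G.deg (p 9) := fun hi => by
      by_contra hd
      exact hsmall (Or.inl ⟨hi, by omega⟩)
    have k11' : G.Internal (p 11) → 7 ≤ G.deg (p 11) := fun hi => by
      by_contra hd
      exact hsmall (Or.inr ⟨hi, by omega⟩)
    refine hR (C.reducible_of_eight hG k8 k9' k10 k11' fun x hx x8 x10 => ?_)
    -- The only obstruction left is an outside common neighbor `x` of `p 8` and `p 10`. It forces
    -- degree at least eight at these two when they are internal, and by planarity `p 9` and `p 11`
    -- have no outside common neighbor, so the other edge can be added.
    refine hR (C.reducible_of_eight' hG (fun hi => ?_) k9 (fun hi => ?_) k11 fun y hy y9 =>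
      C.diamond_cross hG hx hy x8 x10 y9)
    · by_contra hd
      exact h.not_opposite hG hR hi l1 m1 (show G.deg (p 8) ≤ 7 by omega) (C.diamond_outside hx)
        x8 x10
    · by_contra hd
      exact h.rot.rot.not_opposite hG hR hi l3 m3 (show G.deg (p 10) ≤ 7 by omega)
        (Disk.outside_rot (Disk.outside_rot (C.diamond_outside hx))) x10 x8

end Diamond

/-! ### The induction on the number of vertices -/

theorem IsCandidate.reducible {ℓ : ℕ} (hG : G.IsCandidate ℓ) (hv : ∃ v, G.Internal v) :
    G.Reducible ℓ := by
  by_contra hR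
  obtain ⟨I, hI⟩ := exists_region hG hv
  obtain ⟨q, C⟩ := hI.exists_diamond hG hR
  exact C.not_diamond hG hR

end Canvas

theorem mainTheorem7 (ℓ : ℕ) (G : Canvas.{u}) (hG : G.IsCandidate ℓ) :
    ∃ G' : Canvas.{u}, G'.IsCandidate ℓ ∧ (∀ v, ¬ G'.Internal v) ∧
      Relation.ReflTransGen
        (fun H K : Canvas.{u} =>
          H.IsCandidate ℓ ∧ K.IsCandidate ℓ ∧ Canvas.IsStarContraction K H) G' G := by
  induction hn : Nat.card G.V using Nat.strong_induction_on generalizing G with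
  | _ n ih =>
    by_cases hv : ∃ v, G.Internal v
    · obtain ⟨H, hH, hstar, hcard⟩ := hG.reducible hv
      obtain ⟨G', h1, h2, h3⟩ := ih _ (hn ▸ hcard) H hH rfl
      exact ⟨G', h1, h2, h3.tail ⟨hH, hG, hstar⟩⟩
    · push Not at hv
      exact ⟨G, hG, hv, Relation.ReflTransGen.refl⟩
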